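/- **Conventions.** A *closed oriented surface* $\Sigma'$ (possibly singular) is a compact Hausdorff space with a countable base in which every point $v$ has a neighbourhood homeomorphic to a wedge of $m_v\ge 1$ open disks centered at $v$, together with a function $v\mapsto g_v\in\mathbb Z_{\ge0}$ (the local genus) that is non-zero at only finitely many points and an orientation of its normalization (the nonsingular surface obtained by separating the disks of each wedge). Put $\mu_v=2g_v+m_v-1$. Points with $\mu_v>0$ are *singular*; the surface is *nonsingular* if there are none. Homeomorphisms of surfaces respect the local genera. A *branched covering* $f:\Sigma'\to S^2$ is a map whose composition with the projection of the normalization is an orientation preserving branched covering on each component of the normalization, and such that each singular point $v$ with $m_v=1$ is a ramification point of $f$. *Critical points* of $f$ are its ramification points and the singular points of $\Sigma'$; *critical values* are their images. Coverings $f_1:\Sigma_1\to S^2$ and $f_2:\Sigma_2\to S^2$ are *isomorphic* if $f_2\circ\alpha=f_1$ for some homeomorphism $\alpha:\Sigma_1\to\Sigma_2$; $[f]$ denotes the isomorphism class. A *perturbation domain* of $f_0:\Sigma_0\to S^2$ is a union $V=\bigcup_w \bar U_w$ of pairwise disjoint closed topological disks, one for each critical value $w$ of $f_0$, with $w$ an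 inner point of $\bar U_w$. For a critical point $v$ with $f_0(v)=w$ let $U_v$ be the connected component of $f_0^{-1}(\bar U_w)$ containing $v$. A *perturbation* of $f_0$ with perturbation domain $V$ is a branched covering $f_1:\Sigma_1\to S^2$ obtained as follows: for each $v$ in some (possibly empty) set $A$ of critical points of $f_0$ one replaces $U_v$ by a compact connected oriented (maybe singular) surface $\tilde U_v$, glued to $\Sigma_0\setminus\bigcup_{v\in A}\mathrm{Int}\,U_v$ along $\partial\tilde U_v=\partial U_v$, with $$b_1(\tilde U_v)+\sum_{x\in\tilde U_v}\mu_x=\mu_v,\qquad b_2(\tilde U_v)=0,$$ where $b_i$ are the Betti numbers, in such a way that $f_1=f_0$ outside the replaced pieces and $f_1(\tilde U_v)\subset\bar U_{f_0(v)}$ for $v\in A$. In this case $f_0$ is a *degeneration* of $f_1$. **Proposition.** Let $\Sigma$ be a nonsingular closed oriented surface and $n\ge 0$ an integer. Let $X_{\Sigma,n}$ be the set of isomorphism classes of $n$-sheeted branched coverings $\Sigma\to S^2$, and $\bar X_{\Sigma,n}$ the set of isomorphism classes of all degenerations of such coverings. For $[f]\in\bar X_{\Sigma,n}$ and a perturbation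 domain $V$ of $f$, let $U_{[f],V}\subset\bar X_{\Sigma,n}$ be the set of those classes in $\bar X_{\Sigma,n}$ that contain a perturbation, with perturbation domain $V$, of a covering in $[f]$. Then $X_{\Sigma,n}\subset\bar X_{\Sigma,n}$, the family $$\{U_{[f],V}\mid [f]\in\bar X_{\Sigma,n},\ V\text{ a perturbation domain of } f\}$$ is a base of a topology on $\bar X_{\Sigma,n}$, and $X_{\Sigma,n}$ is dense in $\bar X_{\Sigma,n}$ endowed with this topology. -/

import Mathlib

open Set Filter Topology

noncomputable section

/-! ### Singular surfaces -/

/-- The wedge of `m` open unit disks, realised as the union of the coordinate disks in `ℂ^m`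
(at most one coordinate is non-zero); its center is the origin. -/
def Wedge (m : ℕ) : Type :=
  {p : Fin m → ℂ // (∀ i, ‖p i‖ < 1) ∧ ∀ i j, i ≠ j → p i = 0 ∨ p j = 0}

instance (m : ℕ) : TopologicalSpace (Wedge m) :=
  inferInstanceAs (TopologicalSpace
    {p : Fin m → ℂ // (∀ i, ‖p i‖ < 1) ∧ ∀ i j, i ≠ j → p i = 0 ∨ p j = 0})

/-- `e` is an admissible chart at `x`: a homeomorphism of an open neighbourhood of `x` onto the
wedge of `m` open disks that takes `x` to the center. -/
def IsAdmissibleChart {X : Type} [TopologicalSpace X] {m : ℕ}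
    (e : OpenPartialHomeomorph X (Wedge m)) (x : X) : Prop :=
  x ∈ e.source ∧ e.target = univ ∧ ∀ i, (e x).1 i = 0

/-- `h` has local degree `d` at `z`: on every sufficiently small circle around `z` it avoids the
value `h z`, and its winding number around `h z` along the circle (computed through a continuous
choice `θ` of the argument, in full turns) is `d`. -/
def HasLocalDegree (h : ℂ → ℂ) (z : ℂ) (d : ℤ) : Prop :=
  ∀ᶠ r : ℝ in 𝓝[>] 0, ∃ θ : ℝ → ℝ, Continuous θ ∧ θ 1 = θ 0 + d ∧
    ∀ t ∈ Icc (0 : ℝ) 1,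
      h (z + r * Complex.exp (2 * Real.pi * Complex.I * t)) ≠ h z ∧
      h (z + r * Complex.exp (2 * Real.pi * Complex.I * t)) - h z =
        ‖h (z + r * Complex.exp (2 * Real.pi * Complex.I * t)) - h z‖ *
          Complex.exp (2 * Real.pi * Complex.I * θ t)

/-- A closed oriented, possibly singular, surface: a compact Hausdorff space with a countable base
in which every point `x` has a neighbourhood homeomorphic to a wedge of `branches x ≥ 1` open disks
centered at `x`, together with a local genus function of finite support and an orientation.
The number `branches x` is determined by the topology. An orientation of the normalization is the
same as an orientation of the two-dimensional manifold formed by the points with one branch, since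
the latter extends uniquely over the center of each branch; it is given by an oriented atlas. -/
structure ClosedSurface where
  carrier : Type
  [top : TopologicalSpace carrier]
  [t2 : T2Space carrier]
  [secondCountable : SecondCountableTopology carrier]
  [compact : CompactSpace carrier]
  /-- the number of branches -/
  branches : carrier → ℕ
  branches_pos : ∀ x, 1 ≤ branches x
  exists_chart : ∀ x, ∃ e : OpenPartialHomeomorph carrier (Wedge (branches x)),
    IsAdmissibleChart e x
  /-- the local genus -/
  genus : carrier → ℕ
  genus_finite : {x | genus x ≠ 0}.Finite
  /-- the oriented atlas on the set of points with one branch -/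
  posCharts : Set (OpenPartialHomeomorph carrier ℂ)
  posCharts_cover : ∀ x, branches x = 1 → ∃ e ∈ posCharts, x ∈ e.source
  posCharts_compat : ∀ e ∈ posCharts, ∀ e' ∈ posCharts, ∀ x ∈ e.source ∩ e'.source,
    HasLocalDegree (fun z => e' (e.symm z)) (e x) 1

instance : CoeSort ClosedSurface Type := ⟨ClosedSurface.carrier⟩

attribute [instance] ClosedSurface.top ClosedSurface.t2 ClosedSurface.secondCountable
  ClosedSurface.compact

/-- The Milnor number `2 g + m - 1` of a point. -/
def ClosedSurface.milnor (S : ClosedSurface) (x : S) : ℕ :=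
  2 * S.genus x + (S.branches x - 1)

/-- A surface is nonsingular if it has no singular points, i.e. all Milnor numbers vanish. -/
def ClosedSurface.Nonsingular (S : ClosedSurface) : Prop :=
  ∀ x, S.milnor x = 0

/-! ### Branched coverings of the sphere -/

/-- The two-dimensional sphere. -/
abbrev Sphere2 : Type := OnePoint ℂ

/-- The standard complex coordinate of the sphere near the point `w`: it is `z` if `w ≠ ∞` and
`1 / z` if `w = ∞` (only its values near `w` matter). These coordinates orient the sphere. -/
def sphereCoord (w : Sphere2) : Sphere2 → ℂ :=
  w.elim (fun y => y.elim 0 (fun z => z⁻¹)) (fun _ y => y.elim 0 (fun z => z))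

/-- `f` is ramified at `x` if it is not injective in any neighbourhood of `x`. -/
def IsRamified {X : Type} [TopologicalSpace X] (f : X → Sphere2) (x : X) : Prop :=
  ¬ ∃ N ∈ 𝓝 x, InjOn f N

/-- Orientation preserving branched coverings of the sphere by a closed singular surface. -/
structure IsBranchedCovering (S : ClosedSurface) (f : S → Sphere2) : Prop where
  /-- On every branch at `x`, the map is `z ↦ z ^ k` in suitable coordinates. Since the
  normalization is compact, this says that each of its components is a branched covering. -/
  normal_form : ∀ x : S, ∃ (e : OpenPartialHomeomorph S (Wedge (S.branches x)))
    (ψ : OpenPartialHomeomorph Sphere2 ℂ) (k : Fin (S.branches x) → ℕ),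
    IsAdmissibleChart e x ∧ (∀ i, 0 < k i) ∧
    ∀ y ∈ e.source, f y ∈ ψ.source ∧ ψ (f y) = ∑ i, (e y).1 i ^ k i
  /-- The map preserves orientation. -/
  orientation : ∀ e ∈ S.posCharts, ∀ x ∈ e.source,
    ∃ d : ℤ, 0 < d ∧ HasLocalDegree (fun z => sphereCoord (f x) (f (e.symm z))) (e x) d
  /-- Singular points with one branch are ramification points. -/
  ramified : ∀ x : S, 0 < S.milnor x → S.branches x = 1 → IsRamified f x

/-- A branched covering of the sphere by a closed oriented singular surface. -/
structure Covering where
  surf : ClosedSurface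
  map : surf → Sphere2
  isBranched : IsBranchedCovering surf map

namespace Covering

/-- Critical points: ramification points and singular points. -/
def critPoints (c : Covering) : Set c.surf :=
  {x | IsRamified c.map x ∨ 0 < c.surf.milnor x}

/-- Critical values. -/
def critValues (c : Covering) : Set Sphere2 := c.map '' c.critPoints

/-- `c` is `n`-sheeted: every non-critical value has exactly `n` preimages. -/
def IsSheeted (c : Covering) (n : ℕ) : Prop :=
  ∀ y ∉ c.critValues, (c.map ⁻¹' {y}).encard = n

/-- Isomorphism of coverings: a homeomorphism of the surfaces (which, as a map of surfaces,
respects the local genera) commuting with the maps to the sphere. It automatically preserves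
orientation, because both coverings do. -/
def Iso (c₁ c₂ : Covering) : Prop :=
  ∃ α : c₁.surf ≃ₜ c₂.surf,
    (∀ x, c₂.surf.genus (α x) = c₁.surf.genus x) ∧ ∀ x, c₂.map (α x) = c₁.map x

instance isoSetoid : Setoid Covering where
  r := Iso
  iseqv :=
    { refl := fun c => ⟨Homeomorph.refl _, fun _ => rfl, fun _ => rfl⟩
      symm := by
        rintro c₁ c₂ ⟨α, hg, hf⟩
        refine ⟨α.symm, fun x => ?_, fun x => ?_⟩
        · rw [← hg, α.apply_symm_apply]
        · rw [← hf, α.apply_symm_apply]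
      trans := by
        rintro c₁ c₂ c₃ ⟨α, hg, hf⟩ ⟨β, hg', hf'⟩
        exact ⟨α.trans β, fun x => (hg' _).trans (hg x), fun x => (hf' _).trans (hf x)⟩ }

/-! ### Perturbations of coverings -/

end Covering

/-- A closed topological disk in the sphere. -/
def IsClosedDisk (D : Set Sphere2) : Prop :=
  Nonempty (Metric.closedBall (0 : ℂ) 1 ≃ₜ D)

/-- The `i`-th Betti number: the rank of the `i`-th singular homology with rational
coefficients. -/
def betti (i : ℕ) (X : Type) [TopologicalSpace X] : Cardinal :=
  Module.rank ℚ (((AlgebraicTopology.singularHomologyFunctor (ModuleCat.{0} ℚ) i).obj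
    (ModuleCat.of ℚ ℚ)).obj (TopCat.of X))

namespace Covering

/-- `D` picks for every critical value `w` a closed disk `D w` that contains `w` as an inner point,
so that these disks are pairwise disjoint. -/
def IsDiskFamily (c : Covering) (D : Sphere2 → Set Sphere2) : Prop :=
  (∀ w ∈ c.critValues, IsClosedDisk (D w) ∧ w ∈ interior (D w)) ∧
  c.critValues.PairwiseDisjoint D

/-- `V` is a perturbation domain of `c`: the union of disks as above. -/
def IsPerturbationDomain (c : Covering) (V : Set Sphere2) : Prop :=
  ∃ D, c.IsDiskFamily D ∧ V = ⋃ w ∈ c.critValues, D w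

/-- The closed admissible neighbourhood `U_v` of `v`: the connected component of the preimage of the
disk around the value of `v`. -/
def nbhd (c : Covering) (D : Sphere2 → Set Sphere2) (v : c.surf) : Set c.surf :=
  connectedComponentIn (c.map ⁻¹' D (c.map v)) v

/-- `c₁` is obtained from `c₀` by local perturbations at the points of a set `A` of critical points
of `c₀`, with the disks `D` (for a one-point set `A` this is a local perturbation). That is, the
surface of `c₁` is the union of two parts glued along their common boundary:
* the image, under an embedding `j`, of the surface of `c₀` without the interiors of the
  neighbourhoods `U_v`, `v ∈ A`; on this part the local genera and the maps to the sphere coincide;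
* disjoint compact connected surfaces `T v`, `v ∈ A`, such that the boundary of `T v` is that
  of `U_v`, the first Betti number of `T v` plus the sum of the Milnor numbers of its points is the
  Milnor number of `v`, the second Betti number vanishes, and `T v` is mapped to the disk. -/
structure IsPerturbationAt (c₀ c₁ : Covering) (D : Sphere2 → Set Sphere2) (A : Set c₀.surf)
    (j : ↥((⋃ v ∈ A, interior (c₀.nbhd D v))ᶜ) → c₁.surf) (T : c₀.surf → Set c₁.surf) : Prop where
  critical : A ⊆ c₀.critPoints
  embedding : IsEmbedding j
  map_eq : ∀ x, c₁.map (j x) = c₀.map x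
  genus_eq : ∀ x, c₁.surf.genus (j x) = c₀.surf.genus x
  closed : ∀ v ∈ A, IsClosed (T v)
  connected : ∀ v ∈ A, IsConnected (T v)
  disjoint : A.PairwiseDisjoint T
  cover : range j ∪ ⋃ v ∈ A, T v = univ
  boundary : ∀ v ∈ A, T v ∩ range j = j '' {x | (x : c₀.surf) ∈ frontier (c₀.nbhd D v)}
  mapsTo : ∀ v ∈ A, MapsTo c₁.map (T v) (D (c₀.map v))
  betti_one : ∀ v ∈ A,
    betti 1 (T v) + ((∑ᶠ x ∈ T v, c₁.surf.milnor x : ℕ) : Cardinal) = (c₀.surf.milnor v : Cardinal)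
  betti_two : ∀ v ∈ A, betti 2 (T v) = 0

/-- `c₁` is a perturbation of `c₀` with perturbation domain `V` (and `c₀` is a degeneration of
`c₁`): it is obtained by composing local perturbations at some of the critical points of `c₀`,
whose disks are the components of `V`. -/
def IsPerturbation (V : Set Sphere2) (c₀ c₁ : Covering) : Prop :=
  ∃ D, c₀.IsDiskFamily D ∧ V = (⋃ w ∈ c₀.critValues, D w) ∧
    ∃ A j T, IsPerturbationAt c₀ c₁ D A j T

end Covering

/-! ### The set of isomorphism classes and its completion -/

/-- Isomorphism classes of branched coverings of the sphere by closed singular surfaces. -/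
abbrev CoveringClass : Type 1 := Quotient Covering.isoSetoid

/-- The set of isomorphism classes of `n`-sheeted branched coverings `S → S²`. -/
def coveringClasses (S : ClosedSurface) (n : ℕ) : Set CoveringClass :=
  {q | ∃ (f : S → Sphere2) (hf : IsBranchedCovering S f),
    Covering.IsSheeted ⟨S, f, hf⟩ n ∧ q = ⟦⟨S, f, hf⟩⟧}

/-- The set of isomorphism classes of all degenerations of `n`-sheeted branched coverings
`S → S²`. -/
def completedClasses (S : ClosedSurface) (n : ℕ) : Set CoveringClass :=
  {q | ∃ (c₀ c₁ : Covering) (V : Set Sphere2), q = ⟦c₀⟧ ∧ ⟦c₁⟧ ∈ coveringClasses S n ∧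
    Covering.IsPerturbation V c₀ c₁}

/-- The set `U_{[f], V}` of isomorphism classes of all perturbations, with perturbation domain `V`,
of the coverings in the class `p` of `f`. -/
def basicNbhd (S : ClosedSurface) (n : ℕ) (p : CoveringClass) (V : Set Sphere2) :
    Set (completedClasses S n) :=
  {q | ∃ c₀ c₁ : Covering, ⟦c₀⟧ = p ∧ ⟦c₁⟧ = q.1 ∧ Covering.IsPerturbation V c₀ c₁}

/-- The family of all sets `U_{[f], V}`, where `[f]` runs over the completion and `V` over the
perturbation domains of `f`. -/
def basicNbhds (S : ClosedSurface) (n : ℕ) : Set (Set (completedClasses S n)) :=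
  {U | ∃ (c : Covering) (V : Set Sphere2), ⟦c⟧ ∈ completedClasses S n ∧
    c.IsPerturbationDomain V ∧ U = basicNbhd S n ⟦c⟧ V}

end

/-! A perturbation `c₁` of `c₀` is encoded by a continuous map π from the surface of `c₁` to that of
`c₀` (`Collapse`). It is bijective over the non-critical points, compatible with the coverings
outside the neighbourhoods U_v, and has over each U_v a connected preimage P with b₁(P) + Σμ = μ_v
and b₂(P) = 0. The translation goes both ways: `IsPerturbationAt.exists_collapse` builds π, and
`Collapse.isPerturbationAt` cuts the surface along it. In this form perturbations compose.
`Collapse.trans` shows that a perturbation of a perturbation, performed in disks inside the old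
ones, is a perturbation of the original covering. The only real issue is the Betti numbers:
collapsing pieces onto contractible neighbourhoods must add their first Betti numbers. This is
`betti_collapse`, an excision argument with singular chains and barycentric subdivision, giving 0 →
H₁(pieces) → H₁(X) → H₁(Y) → 0. For the base property, a class q in two basic sets has its critical
values in the interiors of disks of both domains (`Collapse.exists_mem_interior`). A perturbation
domain of q with disks inside these interiors gives, by composition, a basic set in the intersection
(`basicNbhd_subset`). It contains q by the trivial perturbation `Collapse.refl`, whose numerical
conditions hold because each U_v is contractible (`exists_flow`). For density, a degeneration of f :
Σ → S² with some domain must be shown to be a degeneration of such a covering with an arbitrarily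
prescribed domain. Composing f with radial homeomorphisms of the disks moves its critical values as
close to the centers as desired (`Collapse.exists_small`). This keeps Σ and the number of sheets,
and preserves orientation because the homeomorphism is the end of an isotopy (`orientation_push`).
Then the pieces can be collapsed to tiny concentric disks (`Gluing.exists_collapse`), and the
prescribed disks contain these. The map π on a piece is built from covering theory. Over the annulus
between the critical values and the boundary circle, `c₁` is an unramified covering, so radial paths
lift. They identify the outer part of the piece with the punctured U_v, and the core is sent to v.
-/

noncomputable section

/-! ### Singular chains with rational coefficients -/

/-- The standard topological simplex. -/
abbrev Simp (n : ℕ) : Type := stdSimplex ℝ (Fin (n + 1))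

/-- Singular chains with rational coefficients. -/
abbrev Chain (n : ℕ) (X : Type) [TopologicalSpace X] : Type := C(Simp n, X) →₀ ℚ

/-- The inclusion of the `i`-th face of the standard simplex. -/
def faceMap {n : ℕ} (i : Fin (n + 2)) : C(Simp n, Simp (n + 1)) :=
  ⟨stdSimplex.map i.succAbove, stdSimplex.continuous_map _⟩

section

variable {X Y Z : Type} [TopologicalSpace X] [TopologicalSpace Y] [TopologicalSpace Z]

/-- The boundary operator. -/
def bd (n : ℕ) (X : Type) [TopologicalSpace X] : Chain (n + 1) X →ₗ[ℚ] Chain n X :=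
  Finsupp.linearCombination ℚ
    (fun σ => ∑ i : Fin (n + 2), Finsupp.single (σ.comp (faceMap i)) ((-1 : ℚ) ^ (i : ℕ)))

/-- The chain map induced by a continuous map. -/
def push (n : ℕ) (f : C(X, Y)) : Chain n X →ₗ[ℚ] Chain n Y :=
  Finsupp.lmapDomain ℚ ℚ (fun σ => f.comp σ)

@[simp] lemma push_single (n : ℕ) (f : C(X, Y)) (σ : C(Simp n, X)) (a : ℚ) :
    push n f (Finsupp.single σ a) = Finsupp.single (f.comp σ) a := by
  simp [push]

lemma bd_single (n : ℕ) (σ : C(Simp (n + 1), X)) (a : ℚ) :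
    bd n X (Finsupp.single σ a) =
      ∑ i : Fin (n + 2), Finsupp.single (σ.comp (faceMap i)) (a * (-1 : ℚ) ^ (i : ℕ)) := by
  rw [bd, Finsupp.linearCombination_single, Finset.smul_sum]
  exact Finset.sum_congr rfl fun i _ => by rw [Finsupp.smul_single, smul_eq_mul]

lemma push_bd (n : ℕ) (f : C(X, Y)) (c : Chain (n + 1) X) :
    push n f (bd n X c) = bd n Y (push (n + 1) f c) := by
  induction c using Finsupp.induction_linear with
  | zero => simp
  | add c d hc hd => simp only [map_add, hc, hd]
  | single σ a => 
    rw [push_single, bd_single, bd_single, map_sum]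
    exact Finset.sum_congr rfl fun i _ => by rw [push_single, ContinuousMap.comp_assoc]

lemma push_comp (n : ℕ) (g : C(Y, Z)) (f : C(X, Y)) (c : Chain n X) :
    push n g (push n f c) = push n (g.comp f) c := by
  induction c using Finsupp.induction_linear with
  | zero => simp
  | add c d hc hd => simp only [map_add, hc, hd]
  | single σ a => simp [ContinuousMap.comp_assoc]

lemma push_id (n : ℕ) (c : Chain n X) : push n (ContinuousMap.id X) c = c := by
  induction c using Finsupp.induction_linear with
  | zero => simp
  | add c d hc hd => simp only [map_add, hc, hd]
  | single σ a => simp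

end

/-! ### Comparison with the singular chain complex of Mathlib -/

open CategoryTheory AlgebraicTopology Simplicial

/-- The singular chain complex with rational coefficients. -/
abbrev singComplex (X : Type) [TopologicalSpace X] : ChainComplex (ModuleCat.{0} ℚ) ℕ :=
  ((singularChainComplexFunctor (ModuleCat.{0} ℚ)).obj (ModuleCat.of ℚ ℚ)).obj (TopCat.of X)

section

variable (X : Type) [TopologicalSpace X]

/-- The generator of the singular chain complex given by a singular simplex. -/
def singGen (n : ℕ) (σ : C(Simp n, X)) : ModuleCat.of ℚ ℚ ⟶ (singComplex X).X n :=
  SSet.ιChainComplex (X := TopCat.toSSet.obj (TopCat.of X)) (n := n)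
    ((TopCat.toSSetObjEquiv (TopCat.of X) (.op ⦋n⦌)).symm σ)

lemma singGen_d (n : ℕ) (σ : C(Simp (n + 1), X)) :
    singGen X (n + 1) σ ≫ (singComplex X).d (n + 1) n =
      ∑ i : Fin (n + 2), (-1 : ℤ) ^ (i : ℕ) • singGen X n (σ.comp (faceMap i)) := by
  exact SSet.ιChainComplex_d (C := ModuleCat.{0} ℚ) (TopCat.toSSet.obj (TopCat.of X))
    (ModuleCat.of ℚ ℚ) _

variable {X} in
lemma singGen_map {Y : Type} [TopologicalSpace Y] (n : ℕ) (f : C(X, Y)) (σ : C(Simp n, X)) :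
    singGen X n σ ≫ (((singularChainComplexFunctor (ModuleCat.{0} ℚ)).obj
      (ModuleCat.of ℚ ℚ)).map (TopCat.ofHom f)).f n = singGen Y n (f.comp σ) := by
  exact SSet.ι_chainComplexMap_f (C := ModuleCat.{0} ℚ) _ _
    (TopCat.toSSet.map (TopCat.ofHom f)) (ModuleCat.of ℚ ℚ) _

-- The term of the complex is a coproduct of copies of ℚ indexed by the singular simplices, so
-- morphisms out of it are determined on the summands.
variable {X} in
lemma singGen_hom_ext {n : ℕ} {T : ModuleCat.{0} ℚ} {f g : (singComplex X).X n ⟶ T}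
    (h : ∀ σ, singGen X n σ ≫ f = singGen X n σ ≫ g) : f = g := by
  refine SSet.chainComplex_hom_ext fun x => ?_
  have := h (TopCat.toSSetObjEquiv (TopCat.of X) (.op ⦋n⦌) x)
  rwa [singGen, Equiv.symm_apply_apply] at this

/-- The map from the term of the singular chain complex to the group of singular chains. -/
def chainInv (n : ℕ) : (singComplex X).X n ⟶ ModuleCat.of ℚ (Chain n X) :=
  Limits.Cofan.IsColimit.desc
    (SSet.isColimitChainComplexXCofan (TopCat.toSSet.obj (TopCat.of X)) (ModuleCat.of ℚ ℚ) n)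
    (fun s => ModuleCat.ofHom (Finsupp.lsingle
      (TopCat.toSSetObjEquiv (TopCat.of X) (.op ⦋n⦌) s)))

lemma singGen_chainInv (n : ℕ) (σ : C(Simp n, X)) :
    singGen X n σ ≫ chainInv X n = ModuleCat.ofHom (Finsupp.lsingle σ) := by
  refine (Limits.Cofan.IsColimit.fac
    (SSet.isColimitChainComplexXCofan (TopCat.toSSet.obj (TopCat.of X)) (ModuleCat.of ℚ ℚ) n)
    _ _).trans ?_
  rw [Equiv.apply_symm_apply]

lemma lsum_hom_single {ι : Type} (M : ModuleCat.{0} ℚ) (F : ι → (ModuleCat.of ℚ ℚ ⟶ M)) (i : ι)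
    (a : ℚ) : Finsupp.lsum ℚ (fun i => (F i).hom) (Finsupp.single i a) = (F i).hom a :=
  Finsupp.lsum_single ℚ _ i a

/-- The map from the group of singular chains to the term of the singular chain complex. -/
def chainHom (n : ℕ) : ModuleCat.of ℚ (Chain n X) ⟶ (singComplex X).X n :=
  ModuleCat.ofHom (Finsupp.lsum ℚ (fun σ => (singGen X n σ).hom))

lemma single_chainHom (n : ℕ) (σ : C(Simp n, X)) :
    ModuleCat.ofHom (Finsupp.lsingle σ) ≫ chainHom X n = singGen X n σ := by
  ext : 1
  exact LinearMap.ext fun a => lsum_hom_single _ (singGen X n) σ a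

lemma chainHom_single (n : ℕ) (σ : C(Simp n, X)) (a : ℚ) :
    (chainHom X n).hom (Finsupp.single σ a) = (singGen X n σ).hom a :=
  lsum_hom_single _ (singGen X n) σ a

/-- The group of singular chains is the term of the singular chain complex. -/
def chainIso (n : ℕ) : ModuleCat.of ℚ (Chain n X) ≅ (singComplex X).X n where
  hom := chainHom X n
  inv := chainInv X n
  hom_inv_id := by
    ext : 1
    refine Finsupp.lhom_ext' fun σ => ?_
    have := single_chainHom X n σ =≫ chainInv X n
    rw [singGen_chainInv] at this
    exact congrArg ModuleCat.Hom.hom this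
  inv_hom_id := by
    refine singGen_hom_ext fun σ => ?_
    rw [← Category.assoc, singGen_chainInv, single_chainHom, Category.comp_id]

lemma chainHom_d (n : ℕ) (c : Chain (n + 1) X) :
    ((singComplex X).d (n + 1) n).hom ((chainHom X (n + 1)).hom c) =
      (chainHom X n).hom (bd n X c) := by
  induction c using Finsupp.induction_linear with
  | zero => simp
  | add c d hc hd => simp only [map_add, hc, hd]
  | single σ a =>
    have := LinearMap.congr_fun (congrArg ModuleCat.Hom.hom (singGen_d X n σ)) a
    rw [ModuleCat.hom_comp, LinearMap.comp_apply] at this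
    rw [chainHom_single, bd_single, map_sum]
    refine this.trans ?_
    rw [ModuleCat.hom_sum, LinearMap.sum_apply]
    refine Finset.sum_congr rfl fun i _ => ?_
    rw [chainHom_single, ModuleCat.hom_zsmul, LinearMap.smul_apply, ← map_zsmul]
    congr 1
    rw [zsmul_eq_mul, mul_comm]
    push_cast
    rfl

variable {X} in
lemma chainHom_map {Y : Type} [TopologicalSpace Y] (n : ℕ) (f : C(X, Y)) (c : Chain n X) :
    ((((singularChainComplexFunctor (ModuleCat.{0} ℚ)).obj
      (ModuleCat.of ℚ ℚ)).map (TopCat.ofHom f)).f n).hom ((chainHom X n).hom c) =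
      (chainHom Y n).hom (push n f c) := by
  induction c using Finsupp.induction_linear with
  | zero => simp
  | add c d hc hd => simp only [map_add, hc, hd]
  | single σ a =>
    have := LinearMap.congr_fun (congrArg ModuleCat.Hom.hom (singGen_map n f σ)) a
    rw [ModuleCat.hom_comp, LinearMap.comp_apply] at this
    rw [chainHom_single, push_single, chainHom_single]
    exact this

lemma chainHom_bijective (n : ℕ) : Function.Bijective (chainHom X n).hom :=
  (chainIso X n).toLinearEquiv.bijective

/-- Transported from d² = 0 in the categorical complex, which avoids the computation with signs. -/
lemma bd_bd (n : ℕ) (c : Chain (n + 2) X) : bd n X (bd (n + 1) X c) = 0 := by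
  apply (chainHom_bijective X n).1
  rw [← chainHom_d, ← chainHom_d, map_zero]
  exact LinearMap.congr_fun
    (congrArg ModuleCat.Hom.hom ((singComplex X).d_comp_d (n + 2) (n + 1) n)) _

/-- The cycles of positive degree `n + 1`. -/
abbrev Cyc (n : ℕ) : Submodule ℚ (Chain (n + 1) X) := LinearMap.ker (bd n X)

/-- The boundaries, as a submodule of the cycles. -/
abbrev Bdr (n : ℕ) : Submodule ℚ (Cyc X n) := (LinearMap.range (bd (n + 1) X)).submoduleOf _

/-- `chainHom` is bijective in each degree and commutes with the boundaries, so it carries cycles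
onto cycles, and the kernel of the resulting map to homology consists of the boundaries. Only
positive degrees are needed below, hence `n` stands for degree `n + 1`. -/
lemma betti_eq (n : ℕ) : betti (n + 1) X = Module.rank ℚ (Cyc X n ⧸ Bdr X n) := by
  let S := (singComplex X).sc' (n + 2) (n + 1) n
  let e : (singComplex X).homology (n + 1) ≅ S.homology :=
    ShortComplex.homologyMapIso ((singComplex X).isoSc' (n + 2) (n + 1) n (by simp) (by simp))
  have h1 : betti (n + 1) X = Module.rank ℚ (S.homology) := e.toLinearEquiv.rank_eq
  rw [h1, S.moduleCatHomologyIso.toLinearEquiv.rank_eq]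
  have hd : ∀ c, S.g.hom ((chainHom X (n + 1)).hom c) = (chainHom X n).hom (bd n X c) :=
    chainHom_d X n
  have hd' : ∀ c, S.f.hom ((chainHom X (n + 2)).hom c) =
    (chainHom X (n + 1)).hom (bd (n + 1) X c) := chainHom_d X (n + 1)
  let L : Cyc X n →ₗ[ℚ] LinearMap.ker S.g.hom :=
    ((chainHom X (n + 1)).hom.comp (Cyc X n).subtype).codRestrict _ (fun c =>
      (hd c).trans ((congrArg _ (LinearMap.mem_ker.1 c.2)).trans (map_zero _)))
  let L' : Cyc X n →ₗ[ℚ] (LinearMap.ker S.g.hom ⧸ LinearMap.range S.moduleCatToCycles) :=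
    (Submodule.mkQ _).comp L
  have hL' : Function.Surjective L' := by
    refine (Submodule.mkQ_surjective _).comp fun y => ?_
    obtain ⟨c, hc⟩ := (chainHom_bijective X (n + 1)).2 y.1
    refine ⟨⟨c, ?_⟩, Subtype.ext hc⟩
    apply (chainHom_bijective X n).1
    rw [← hd, hc, map_zero]
    exact y.2
  have hker : LinearMap.ker L' = Bdr X n := by
    ext c
    rw [LinearMap.mem_ker]
    change _ ↔ c.1 ∈ LinearMap.range (bd (n + 1) X)
    refine (Submodule.Quotient.mk_eq_zero _).trans ⟨?_, ?_⟩
    · rintro ⟨b, hb⟩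
      obtain ⟨b, rfl⟩ := (chainHom_bijective X (n + 2)).2 b
      refine ⟨b, (chainHom_bijective X (n + 1)).1 ?_⟩
      rw [← hd']
      exact congrArg Subtype.val hb
    · rintro ⟨b, hb⟩
      refine ⟨(chainHom X (n + 2)).hom b, Subtype.ext ?_⟩
      refine (hd' b).trans ?_
      rw [hb]
      rfl
  rw [← hker]
  exact (L'.quotKerEquivOfSurjective hL').rank_eq.symm

/-- A chain homotopy K satisfies f − g = dK + Kd, and the second term vanishes on a cycle. The
bounding chain is the concrete form of Kz. -/
lemma push_sub_push_of_homotopic {X Y : Type} [TopologicalSpace X] [TopologicalSpace Y]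
    {f g : C(X, Y)} (h : f.Homotopic g) (n : ℕ) (z : Chain (n + 1) X) (hz : bd n X z = 0) :
    push (n + 1) f z - push (n + 1) g z ∈ LinearMap.range (bd (n + 1) Y) := by
  obtain ⟨H⟩ := h
  let H' : TopCat.Homotopy (TopCat.ofHom f) (TopCat.ofHom g) := H
  have h1 := (H'.singularChainComplexFunctorObjMap (ModuleCat.of ℚ ℚ)).comm (n + 1)
  set K := H'.singularChainComplexFunctorObjMap (ModuleCat.of ℚ ℚ) with hK
  rw [dNext_eq K.hom (i' := n) (by simp), prevD_eq K.hom (j' := n + 2) (by simp)] at h1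
  obtain ⟨b, hb⟩ := (chainHom_bijective Y (n + 2)).2
    ((K.hom (n + 1) (n + 2)).hom ((chainHom X (n + 1)).hom z))
  refine ⟨b, ?_⟩
  have h2 := LinearMap.congr_fun (congrArg ModuleCat.Hom.hom h1) ((chainHom X (n + 1)).hom z)
  apply (chainHom_bijective Y (n + 1)).1
  rw [← chainHom_d, hb, map_sub, ← chainHom_map, ← chainHom_map, h2]
  have h3 : ((singComplex X).d (n + 1) n).hom ((chainHom X (n + 1)).hom z) = 0 := by
    rw [chainHom_d, hz, map_zero]
  simp only [ModuleCat.hom_add, LinearMap.add_apply, ModuleCat.hom_comp, LinearMap.comp_apply]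
  rw [h3, map_zero, zero_add, add_sub_cancel_right]

end

end

noncomputable section

/-! ### Affine simplices and barycentric subdivision -/

section

variable {n k l : ℕ}

/-- The affine simplex with the given vertices. -/
def realize (v : Fin (n + 1) → Simp k) : C(Simp n, Simp k) where
  toFun t := ⟨∑ i, t i • (v i).1,
    (convex_stdSimplex ℝ _).sum_mem (fun i _ => t.2.1 i) t.2.2 (fun i _ => (v i).2)⟩
  continuous_toFun := by
    refine Continuous.subtype_mk (continuous_finsetSum _ fun i _ => ?_) _
    exact ((continuous_apply i).comp continuous_subtype_val).smul continuous_const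

lemma realize_coe (v : Fin (n + 1) → Simp k) (t : Simp n) :
    (realize v t).1 = ∑ i, t i • (v i).1 := rfl

/-- The vertices of the standard simplex. -/
def verts (n : ℕ) : Fin (n + 1) → Simp n := fun i => stdSimplex.vertex i

lemma realize_vertex (v : Fin (n + 1) → Simp k) (i : Fin (n + 1)) :
    realize v (stdSimplex.vertex i) = v i := by
  apply Subtype.ext
  rw [realize_coe]
  have : ∀ j, (stdSimplex.vertex i : Simp n) j = if i = j then (1 : ℝ) else 0 := fun j => by
    change (Pi.single i (1 : ℝ) : Fin (n + 1) → ℝ) j = _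
    simp [Pi.single_apply, eq_comm]
  simp [this]

lemma realize_injective : Function.Injective (realize : (Fin (n + 1) → Simp k) → _) :=
  fun v w h => funext fun i => by rw [← realize_vertex v, h, realize_vertex]

lemma realize_comp (v : Fin (n + 1) → Simp k) (u : Fin (l + 1) → Simp n) :
    (realize v).comp (realize u) = realize (fun i => realize v (u i)) := by
  ext t j
  change (realize v (realize u t)).1 j = (realize _ t).1 j
  simp only [realize_coe, Finset.sum_apply, Pi.smul_apply, smul_eq_mul]
  have : ∀ i, (realize u t) i = ∑ m, t m * u m i := fun i => by
    change (realize u t).1 i = _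
    simp [realize_coe]
    rfl
  simp only [this, Finset.sum_mul, Finset.mul_sum]
  rw [Finset.sum_comm]
  simp only [mul_assoc]

lemma realize_verts : realize (verts n) = ContinuousMap.id (Simp n) := by
  ext t j
  change (realize (verts n) t).1 j = t j
  have : ∀ i, (verts n i).1 = Pi.single i (1 : ℝ) := fun i => rfl
  simp [realize_coe, this, Pi.single_apply]

lemma faceMap_eq (i : Fin (n + 2)) : faceMap i = realize (fun j => verts (n + 1) (i.succAbove j)) := by
  ext t j
  change (stdSimplex.map i.succAbove t).1 j = (realize _ t).1 j
  have : ∀ i, (verts (n + 1) i).1 = Pi.single i (1 : ℝ) := fun i => rfl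
  rw [show (stdSimplex.map i.succAbove t).1 = _ from stdSimplex.map_coe _ _,
    FunOnFinite.linearMap_apply_apply]
  simp [realize_coe, this, Pi.single_apply, Finset.sum_filter, eq_comm]

lemma realize_comp_faceMap (v : Fin (n + 2) → Simp k) (i : Fin (n + 2)) :
    (realize v).comp (faceMap i) = realize (v ∘ i.succAbove) := by
  rw [faceMap_eq, realize_comp]
  congr 1
  funext j
  exact realize_vertex _ _

/-- Formal combinations of affine simplices. -/
abbrev AC (n k : ℕ) : Type := (Fin (n + 1) → Simp k) →₀ ℚ

/-- The boundary of affine chains. -/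
def abd (n k : ℕ) : AC (n + 1) k →ₗ[ℚ] AC n k :=
  Finsupp.linearCombination ℚ
    (fun v => ∑ i : Fin (n + 2), Finsupp.single (v ∘ i.succAbove) ((-1 : ℚ) ^ (i : ℕ)))

lemma abd_single (v : Fin (n + 2) → Simp k) (a : ℚ) :
    abd n k (Finsupp.single v a) =
      ∑ i : Fin (n + 2), Finsupp.single (v ∘ i.succAbove) (a * (-1 : ℚ) ^ (i : ℕ)) := by
  rw [abd, Finsupp.linearCombination_single, Finset.smul_sum]
  exact Finset.sum_congr rfl fun i _ => by rw [Finsupp.smul_single, smul_eq_mul]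

/-- Affine chains as singular chains of a space, through a map of a simplex to it. -/
def pushA {X : Type} [TopologicalSpace X] (n : ℕ) (σ : C(Simp k, X)) : AC n k →ₗ[ℚ] Chain n X :=
  Finsupp.lmapDomain ℚ ℚ (fun v => σ.comp (realize v))

@[simp] lemma pushA_single {X : Type} [TopologicalSpace X] (σ : C(Simp k, X))
    (v : Fin (n + 1) → Simp k) (a : ℚ) :
    pushA n σ (Finsupp.single v a) = Finsupp.single (σ.comp (realize v)) a := by
  simp [pushA]

lemma pushA_abd {X : Type} [TopologicalSpace X] (σ : C(Simp k, X)) (c : AC (n + 1) k) :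
    pushA n σ (abd n k c) = bd n X (pushA (n + 1) σ c) := by
  induction c using Finsupp.induction_linear with
  | zero => simp
  | add c d hc hd => simp only [map_add, hc, hd]
  | single v a =>
    rw [pushA_single, bd_single, abd_single, map_sum]
    refine Finset.sum_congr rfl fun i _ => ?_
    rw [pushA_single, ContinuousMap.comp_assoc, realize_comp_faceMap]

/-- An affine simplex is recovered from its map as the images of the vertices. Identities between
affine chains can therefore be checked on singular chains. -/
lemma pushA_id_injective (n k : ℕ) : Function.Injective (pushA n (ContinuousMap.id (Simp k))) := by
  refine Finsupp.mapDomain_injective fun v w h => realize_injective ?_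
  simpa using h

lemma abd_abd (c : AC (n + 2) k) : abd n k (abd (n + 1) k c) = 0 := by
  apply pushA_id_injective
  rw [pushA_abd, pushA_abd, bd_bd, map_zero]

/-- The cone over an affine chain. -/
def acone (n : ℕ) (b : Simp k) : AC n k →ₗ[ℚ] AC (n + 1) k :=
  Finsupp.lmapDomain ℚ ℚ (fun v => (Fin.cons b v : Fin (n + 2) → Simp k))

@[simp] lemma acone_single (b : Simp k) (v : Fin (n + 1) → Simp k) (a : ℚ) :
    acone n b (Finsupp.single v a) = Finsupp.single (Fin.cons b v) a := by
  simp [acone]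

/-- The face opposite the cone point returns the base; every other face is the cone over a face of
the base, with its index shifted by one and hence the opposite sign. -/
lemma abd_acone (b : Simp k) (c : AC (n + 1) k) :
    abd (n + 1) k (acone (n + 1) b c) = c - acone n b (abd n k c) := by
  induction c using Finsupp.induction_linear with
  | zero => simp
  | add c d hc hd => simp only [map_add, hc, hd]; abel
  | single v a =>
    rw [acone_single, abd_single, Fin.sum_univ_succ, abd_single, map_sum, sub_eq_add_neg,
      ← Finset.sum_neg_distrib]
    congr 1
    · simp
    · refine Finset.sum_congr rfl fun i _ => ?_
      rw [acone_single, ← Finsupp.single_neg]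
      congr 1
      · funext j
        refine Fin.cases ?_ (fun j => ?_) j <;> simp
      · simp [pow_succ]

lemma abd_acone_zero (b : Simp k) (w : Fin 1 → Simp k) (a : ℚ) :
    abd 0 k (acone 0 b (Finsupp.single w a)) =
      Finsupp.single w a - Finsupp.single (fun _ => b) a := by
  rw [acone_single, abd_single, Fin.sum_univ_two, sub_eq_add_neg, ← Finsupp.single_neg]
  congr 1
  · simp
  · congr 1
    · funext j
      fin_cases j
      rfl
    · simp

/-- By `abd_acone_zero` each point contributes an extra copy of the cone point. The two copies
cancel because the coefficients of a boundary sum to zero. This is the start of the induction in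
`abd_asd`. -/
lemma abd_acone_abd (b : Simp k) (c : AC 1 k) :
    abd 0 k (acone 0 b (abd 0 k c)) = abd 0 k c := by
  induction c using Finsupp.induction_linear with
  | zero => simp
  | add c d hc hd => simp only [map_add, hc, hd]
  | single v a =>
    rw [abd_single, Fin.sum_univ_two, map_add, map_add, abd_acone_zero, abd_acone_zero]
    have : (Finsupp.single (fun _ => b) (a * (-1) ^ ((1 : Fin 2) : ℕ)) : AC 0 k) =
      - Finsupp.single (fun _ => b) (a * (-1) ^ ((0 : Fin 2) : ℕ)) := by
      rw [← Finsupp.single_neg]; simp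
    rw [this]
    abel

/-- The affine chain map induced by an affine map of simplices. -/
def amap (n : ℕ) (u : Fin (k + 1) → Simp l) : AC n k →ₗ[ℚ] AC n l :=
  Finsupp.lmapDomain ℚ ℚ (fun v i => realize u (v i))

@[simp] lemma amap_single (u : Fin (k + 1) → Simp l) (v : Fin (n + 1) → Simp k) (a : ℚ) :
    amap n u (Finsupp.single v a) = Finsupp.single (fun i => realize u (v i)) a := by
  simp [amap]

lemma amap_abd (u : Fin (k + 1) → Simp l) (c : AC (n + 1) k) :
    amap n u (abd n k c) = abd n l (amap (n + 1) u c) := by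
  induction c using Finsupp.induction_linear with
  | zero => simp
  | add c d hc hd => simp only [map_add, hc, hd]
  | single v a =>
    rw [amap_single, abd_single, abd_single, map_sum]
    exact Finset.sum_congr rfl fun i _ => by rw [amap_single]; rfl

lemma amap_acone (u : Fin (k + 1) → Simp l) (b : Simp k) (c : AC n k) :
    amap (n + 1) u (acone n b c) = acone n (realize u b) (amap n u c) := by
  induction c using Finsupp.induction_linear with
  | zero => simp
  | add c d hc hd => simp only [map_add, hc, hd]
  | single v a =>
    rw [acone_single, amap_single, amap_single, acone_single]
    congr 1
    funext j
    refine Fin.cases ?_ (fun j => ?_) j <;> simp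

lemma pushA_amap {X : Type} [TopologicalSpace X] (σ : C(Simp l, X)) (u : Fin (k + 1) → Simp l)
    (c : AC n k) : pushA n σ (amap n u c) = pushA n (σ.comp (realize u)) c := by
  induction c using Finsupp.induction_linear with
  | zero => simp
  | add c d hc hd => simp only [map_add, hc, hd]
  | single v a =>
    rw [amap_single, pushA_single, pushA_single, ContinuousMap.comp_assoc, realize_comp]

lemma push_pushA {X Y : Type} [TopologicalSpace X] [TopologicalSpace Y] (f : C(X, Y))
    (σ : C(Simp k, X)) (c : AC n k) : push n f (pushA n σ c) = pushA n (f.comp σ) c := by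
  induction c using Finsupp.induction_linear with
  | zero => simp
  | add c d hc hd => simp only [map_add, hc, hd]
  | single v a => simp [ContinuousMap.comp_assoc]

/-- The barycenter of an affine simplex. -/
def bary (v : Fin (n + 1) → Simp k) : Simp k := realize v stdSimplex.barycenter

lemma realize_bary (u : Fin (k + 1) → Simp l) (v : Fin (n + 1) → Simp k) :
    realize u (bary v) = bary (fun i => realize u (v i)) :=
  DFunLike.congr_fun (realize_comp u v) _

/-- Barycentric subdivision of affine chains. -/
def asd (k : ℕ) : (n : ℕ) → AC n k →ₗ[ℚ] AC n k
  | 0 => LinearMap.id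
  | n + 1 => Finsupp.linearCombination ℚ
      (fun v => acone n (bary v) (asd k n (abd n k (Finsupp.single v 1))))

/-- The chain homotopy between the identity and the barycentric subdivision. -/
def ahom (k : ℕ) : (n : ℕ) → AC n k →ₗ[ℚ] AC (n + 1) k
  | 0 => 0
  -- The chain under the cone has boundary sd(∂v), by the homotopy formula one degree below. Its
  -- cone therefore has boundary v − h(∂v) − sd(v).
  | n + 1 => Finsupp.linearCombination ℚ (fun v => acone (n + 1) (bary v)
      (Finsupp.single v 1 - ahom k n (abd n k (Finsupp.single v 1))))

lemma asd_single (v : Fin (n + 2) → Simp k) :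
    asd k (n + 1) (Finsupp.single v 1) =
      acone n (bary v) (asd k n (abd n k (Finsupp.single v 1))) := by
  rw [asd, Finsupp.linearCombination_single, one_smul]

lemma ahom_single (v : Fin (n + 2) → Simp k) :
    ahom k (n + 1) (Finsupp.single v 1) = acone (n + 1) (bary v)
      (Finsupp.single v 1 - ahom k n (abd n k (Finsupp.single v 1))) := by
  rw [ahom, Finsupp.linearCombination_single, one_smul]

/-- Linear maps on chains agree if they agree on generators. -/
lemma chain_induction {ι V : Type} [AddCommGroup V] [Module ℚ V] {f g : (ι →₀ ℚ) →ₗ[ℚ] V}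
    (h : ∀ i, f (Finsupp.single i 1) = g (Finsupp.single i 1)) : f = g :=
  Finsupp.lhom_ext' fun i => LinearMap.ext_ring (h i)

/-- By the cone formula the boundary of a subdivided simplex is its base minus a cone over the
boundary of the base. The latter vanishes, the base being the subdivision of a boundary. -/
lemma abd_asd (n : ℕ) (c : AC (n + 1) k) : abd n k (asd k (n + 1) c) = asd k n (abd n k c) := by
  suffices h : (abd n k).comp (asd k (n + 1)) = (asd k n).comp (abd n k) from
    LinearMap.congr_fun h c
  induction n with
  | zero =>
    refine chain_induction fun v => ?_
    simp only [LinearMap.comp_apply]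
    rw [asd_single]
    exact abd_acone_abd _ _
  | succ n ih =>
    refine chain_induction fun v => ?_
    simp only [LinearMap.comp_apply]
    have h := LinearMap.congr_fun (ih (abd (n + 1) k (Finsupp.single v 1)))
      (abd (n + 1) k (Finsupp.single v 1))
    simp only [LinearMap.comp_apply] at h
    rw [asd_single, abd_acone, h, abd_abd, map_zero, map_zero, sub_zero]

lemma abd_ahom (n : ℕ) (c : AC (n + 1) k) :
    abd (n + 1) k (ahom k (n + 1) c) + ahom k n (abd n k c) = c - asd k (n + 1) c := by
  suffices h : (abd (n + 1) k).comp (ahom k (n + 1)) + (ahom k n).comp (abd n k) =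
    LinearMap.id - asd k (n + 1) from LinearMap.congr_fun h c
  induction n with
  | zero =>
    refine chain_induction fun v => ?_
    simp only [LinearMap.comp_apply, LinearMap.add_apply, LinearMap.sub_apply, LinearMap.id_apply]
    rw [ahom_single, abd_acone, asd_single]
    simp [ahom, asd]
  | succ n ih =>
    refine chain_induction fun v => ?_
    have h := LinearMap.congr_fun (ih (abd (n + 1) k (Finsupp.single v 1)))
      (abd (n + 1) k (Finsupp.single v 1))
    simp only [LinearMap.comp_apply, LinearMap.add_apply, LinearMap.sub_apply,
      LinearMap.id_apply] at h ⊢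
    rw [abd_abd, map_zero, add_zero] at h
    rw [ahom_single, abd_acone, asd_single, map_sub (abd (n + 1) k), h, sub_sub_cancel]
    abel

/-- Affine maps commute with cones and preserve barycenters. This naturality is what makes the
subdivision of a singular simplex, read off from the standard simplex, agree on faces. -/
lemma amap_asd (u : Fin (k + 1) → Simp l) (n : ℕ) (c : AC n k) :
    amap n u (asd k n c) = asd l n (amap n u c) := by
  suffices h : (amap n u).comp (asd k n) = (asd l n).comp (amap n u) from LinearMap.congr_fun h c
  induction n with
  | zero => rfl
  | succ n ih =>
    refine chain_induction fun v => ?_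
    have h := LinearMap.congr_fun (ih (abd n k (Finsupp.single v 1))) (abd n k (Finsupp.single v 1))
    simp only [LinearMap.comp_apply] at h ⊢
    rw [asd_single, amap_acone, h, amap_abd, amap_single, asd_single, realize_bary]

lemma amap_ahom (u : Fin (k + 1) → Simp l) (n : ℕ) (c : AC n k) :
    amap (n + 1) u (ahom k n c) = ahom l n (amap n u c) := by
  suffices h : (amap (n + 1) u).comp (ahom k n) = (ahom l n).comp (amap n u) from
    LinearMap.congr_fun h c
  induction n with
  | zero => ext; simp [ahom]
  | succ n ih =>
    refine chain_induction fun v => ?_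
    have h := LinearMap.congr_fun (ih (abd n k (Finsupp.single v 1))) (abd n k (Finsupp.single v 1))
    simp only [LinearMap.comp_apply] at h ⊢
    rw [ahom_single, amap_acone, map_sub, h, amap_abd, amap_single, ahom_single, realize_bary]

end

/-! ### Subdivision of singular chains -/

section

variable {X Y : Type} [TopologicalSpace X] [TopologicalSpace Y]

/-- Barycentric subdivision of singular chains. -/
def sd (n : ℕ) (X : Type) [TopologicalSpace X] : Chain n X →ₗ[ℚ] Chain n X :=
  Finsupp.linearCombination ℚ (fun σ => pushA n σ (asd n n (Finsupp.single (verts n) 1)))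

/-- The chain homotopy between the identity and the subdivision. -/
def sdHom (n : ℕ) (X : Type) [TopologicalSpace X] : Chain n X →ₗ[ℚ] Chain (n + 1) X :=
  Finsupp.linearCombination ℚ (fun σ => pushA (n + 1) σ (ahom n n (Finsupp.single (verts n) 1)))

lemma sd_single {n : ℕ} (σ : C(Simp n, X)) :
    sd n X (Finsupp.single σ 1) = pushA n σ (asd n n (Finsupp.single (verts n) 1)) := by
  rw [sd, Finsupp.linearCombination_single, one_smul]

lemma sdHom_single {n : ℕ} (σ : C(Simp n, X)) :
    sdHom n X (Finsupp.single σ 1) = pushA (n + 1) σ (ahom n n (Finsupp.single (verts n) 1)) := by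
  rw [sdHom, Finsupp.linearCombination_single, one_smul]

lemma pushA_verts {n : ℕ} (σ : C(Simp n, X)) :
    pushA n σ (Finsupp.single (verts n) 1) = Finsupp.single σ 1 := by
  rw [pushA_single, realize_verts, ContinuousMap.comp_id]

lemma amap_verts {n k : ℕ} (v : Fin (n + 1) → Simp k) :
    amap n v (Finsupp.single (verts n) 1) = Finsupp.single v 1 := by
  rw [amap_single]
  congr 1
  funext i
  exact realize_vertex _ _

/-- Reduces every identity about the subdivision of singular chains to its affine counterpart inside
one standard simplex. -/
lemma sd_pushA {n k : ℕ} (σ : C(Simp k, X)) (c : AC n k) :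
    sd n X (pushA n σ c) = pushA n σ (asd k n c) := by
  suffices h : (sd n X).comp (pushA n σ) = (pushA n σ).comp (asd k n) from LinearMap.congr_fun h c
  refine chain_induction fun v => ?_
  simp only [LinearMap.comp_apply]
  rw [pushA_single, sd_single, ← pushA_amap, amap_asd, amap_verts]

lemma sdHom_pushA {n k : ℕ} (σ : C(Simp k, X)) (c : AC n k) :
    sdHom n X (pushA n σ c) = pushA (n + 1) σ (ahom k n c) := by
  suffices h : (sdHom n X).comp (pushA n σ) = (pushA (n + 1) σ).comp (ahom k n) from
    LinearMap.congr_fun h c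
  refine chain_induction fun v => ?_
  simp only [LinearMap.comp_apply]
  rw [pushA_single, sdHom_single, ← pushA_amap, amap_ahom, amap_verts]

lemma bd_sd (n : ℕ) (c : Chain (n + 1) X) : bd n X (sd (n + 1) X c) = sd n X (bd n X c) := by
  suffices h : (bd n X).comp (sd (n + 1) X) = (sd n X).comp (bd n X) from LinearMap.congr_fun h c
  refine chain_induction fun σ => ?_
  simp only [LinearMap.comp_apply]
  rw [← pushA_verts σ, sd_pushA, ← pushA_abd, ← pushA_abd, sd_pushA, abd_asd]

lemma bd_sdHom (n : ℕ) (c : Chain (n + 1) X) :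
    bd (n + 1) X (sdHom (n + 1) X c) + sdHom n X (bd n X c) = c - sd (n + 1) X c := by
  suffices h : (bd (n + 1) X).comp (sdHom (n + 1) X) + (sdHom n X).comp (bd n X) =
    LinearMap.id - sd (n + 1) X from LinearMap.congr_fun h c
  refine chain_induction fun σ => ?_
  simp only [LinearMap.comp_apply, LinearMap.add_apply, LinearMap.sub_apply, LinearMap.id_apply]
  rw [← pushA_verts σ, sd_pushA, sdHom_pushA, ← pushA_abd, ← pushA_abd, sdHom_pushA, ← map_add,
    abd_ahom, map_sub]

lemma push_sd (n : ℕ) (f : C(X, Y)) (c : Chain n X) :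
    push n f (sd n X c) = sd n Y (push n f c) := by
  suffices h : (push n f).comp (sd n X) = (sd n Y).comp (push n f) from LinearMap.congr_fun h c
  refine chain_induction fun σ => ?_
  simp only [LinearMap.comp_apply]
  rw [sd_single, push_pushA, push_single, sd_single]

end

end

noncomputable section

/-! ### Small simplices -/

section

variable {n k : ℕ}

/-- A linear map preserves a property of chains if it does so on generators. -/
lemma map_mem_of_supported {ι V : Type} [AddCommGroup V] [Module ℚ V] {f : (ι →₀ ℚ) →ₗ[ℚ] V}
    {s : Set ι} {W : Submodule ℚ V} (h : ∀ i ∈ s, f (Finsupp.single i 1) ∈ W) {c : ι →₀ ℚ}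
    (hc : c ∈ Finsupp.supported ℚ ℚ s) : f c ∈ W := by
  rw [← c.sum_single, Finsupp.sum, map_sum]
  refine Submodule.sum_mem _ fun i hi => ?_
  rw [← Finsupp.smul_single_one, map_smul]
  exact Submodule.smul_mem _ _ (h i (hc hi))

lemma dist_realize_le (v : Fin (n + 1) → Simp k) (t : Simp n) (p : Simp k) (r : ℝ)
    (h : ∀ i, dist p (v i) ≤ r) : dist p (realize v t) ≤ r := by
  have hc := convex_closedBall p.1 r
  have : (realize v t).1 ∈ Metric.closedBall p.1 r :=
    hc.sum_mem (fun i _ => t.2.1 i) t.2.2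
      (fun i _ => by rw [Metric.mem_closedBall, dist_comm]; exact h i)
  rw [Metric.mem_closedBall, dist_comm] at this
  exact this

/-- The difference between barycenter and vertex is the average of the n + 1 vectors v_j − v_i, one
of which is zero; this gives the factor n/(n+1). -/
lemma dist_bary_le (v : Fin (n + 1) → Simp k) (δ : ℝ) (h : ∀ i j, dist (v i) (v j) ≤ δ)
    (i : Fin (n + 1)) : dist (bary v) (v i) ≤ n / (n + 1) * δ := by
  have h0 : (0 : ℝ) < n + 1 := by positivity
  have h1 : (bary v).1 - (v i).1 = ∑ j, (1 / (n + 1 : ℝ)) • ((v j).1 - (v i).1) := by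
    have hb : (bary v).1 = ∑ j, (1 / (n + 1 : ℝ)) • (v j).1 := by
      refine (realize_coe _ _).trans (Finset.sum_congr rfl fun j _ => ?_)
      congr 1
      refine (stdSimplex.barycenter_apply (𝕜 := ℝ) j).trans ?_
      simp
    rw [hb]
    simp only [smul_sub, Finset.sum_sub_distrib, Finset.sum_const, Finset.card_univ,
      Fintype.card_fin]
    rw [← Nat.cast_smul_eq_nsmul ℝ, smul_smul]
    push_cast
    rw [mul_one_div_cancel h0.ne', one_smul]
  have h2 : dist (bary v) (v i) = ‖(bary v).1 - (v i).1‖ :=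
    dist_eq_norm (bary v).1 (v i).1
  rw [h2, h1, ← Finset.sum_erase_add _ _ (Finset.mem_univ i), sub_self, smul_zero, add_zero]
  refine (norm_sum_le _ _).trans ((Finset.sum_le_card_nsmul _ _ (1 / (n + 1 : ℝ) * δ)
    fun j _ => ?_).trans ?_)
  · rw [norm_smul, Real.norm_of_nonneg (by positivity)]
    exact mul_le_mul_of_nonneg_left (h j i) (by positivity)
  · rw [Finset.card_erase_of_mem (Finset.mem_univ i), Finset.card_univ, Fintype.card_fin,
      nsmul_eq_mul]
    simp only [Nat.add_sub_cancel]
    apply le_of_eq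
    ring

/-- The affine simplices with vertices in the set `K` and at mutual distance at most `δ`. -/
def smallTuples (n : ℕ) (K : Set (Simp k)) (δ : ℝ) : Set (Fin (n + 1) → Simp k) :=
  {u | (∀ i, u i ∈ K) ∧ ∀ i j, dist (u i) (u j) ≤ δ}

lemma range_realize_face (v : Fin (n + 2) → Simp k) (i : Fin (n + 2)) :
    range (realize (v ∘ i.succAbove)) ⊆ range (realize v) := by
  rw [← realize_comp_faceMap]
  rintro _ ⟨t, rfl⟩
  exact ⟨_, rfl⟩

/-- By induction: a simplex of the subdivision is the cone from the barycenter over a small simplex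
in a subdivided face. Recording that all vertices stay in the image of v bounds their distance to
the barycenter by convexity. -/
lemma asd_mem_supported (n : ℕ) (v : Fin (n + 1) → Simp k) (δ : ℝ)
    (h : ∀ i j, dist (v i) (v j) ≤ δ) :
    asd k n (Finsupp.single v 1) ∈
      Finsupp.supported ℚ ℚ (smallTuples n (range (realize v)) (n / (n + 1) * δ)) := by
  have hδ : 0 ≤ δ := dist_nonneg.trans (h 0 0)
  induction n with
  | zero =>
    refine Finsupp.single_mem_supported ℚ 1 ⟨fun i => ⟨_, realize_vertex v i⟩, fun i j => ?_⟩
    fin_cases i; fin_cases j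
    simp
  | succ n ih =>
    have key : asd k n (abd n k (Finsupp.single v 1)) ∈ Finsupp.supported ℚ ℚ
        (smallTuples n (range (realize v)) (n / (n + 1) * δ)) := by
      rw [abd_single, map_sum]
      refine Submodule.sum_mem _ fun i _ => ?_
      have := ih (v ∘ i.succAbove) (fun a b => h _ _)
      rw [← Finsupp.smul_single_one, map_smul]
      refine Submodule.smul_mem _ _ (Finsupp.supported_mono ?_ this)
      exact fun u hu => ⟨fun j => range_realize_face v i (hu.1 j), hu.2⟩
    rw [asd_single]
    generalize asd k n (abd n k (Finsupp.single v 1)) = c at key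
    rw [Finsupp.mem_supported] at key ⊢
    intro w hw
    obtain ⟨u, hu, rfl⟩ := Finset.mem_image.1 (Finsupp.mapDomain_support hw)
    obtain ⟨hu1, hu2⟩ := key hu
    have hb : ∀ j, dist (bary v) (u j) ≤ ((n + 1 : ℕ) : ℝ) / ((n + 1 : ℕ) + 1) * δ := fun j => by
      obtain ⟨t, ht⟩ := hu1 j
      rw [← ht]
      exact dist_realize_le _ _ _ _ (dist_bary_le v δ h)
    -- The contraction factor increases with the dimension, so the estimate for faces is good
    -- enough.
    have hθ : (n : ℝ) / (n + 1) * δ ≤ ((n + 1 : ℕ) : ℝ) / ((n + 1 : ℕ) + 1) * δ := by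
      refine mul_le_mul_of_nonneg_right ?_ hδ
      rw [div_le_div_iff₀ (by positivity) (by positivity)]
      push_cast
      nlinarith
    refine ⟨fun i => ?_, fun i j => ?_⟩
    · cases i using Fin.cases with
      | zero => exact ⟨_, rfl⟩
      | succ i => simpa using hu1 i
    · cases i using Fin.cases with
      | zero =>
        cases j using Fin.cases with
        | zero => rw [dist_self]; positivity
        | succ j => simpa using hb j
      | succ i =>
        cases j using Fin.cases with
        | zero => rw [dist_comm]; simpa using hb i
        | succ j => simpa using (hu2 i j).trans hθ

lemma asd_iterate_mem_supported (n : ℕ) (v : Fin (n + 1) → Simp k) (δ : ℝ)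
    (h : ∀ i j, dist (v i) (v j) ≤ δ) (m : ℕ) :
    (asd k n)^[m] (Finsupp.single v 1) ∈
      Finsupp.supported ℚ ℚ (smallTuples n univ ((n / (n + 1)) ^ m * δ)) := by
  induction m with
  | zero => exact Finsupp.single_mem_supported ℚ 1 ⟨fun i => mem_univ _, by simpa using h⟩
  | succ m ih =>
    rw [Function.iterate_succ_apply']
    generalize (asd k n)^[m] (Finsupp.single v 1) = c at ih
    rw [← c.sum_single, Finsupp.sum, map_sum]
    refine Submodule.sum_mem _ fun u hu => ?_
    rw [← Finsupp.smul_single_one, map_smul]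
    refine Submodule.smul_mem _ _ (Finsupp.supported_mono ?_
      (asd_mem_supported n u _ ((ih hu).2)))
    intro w hw
    refine ⟨fun i => mem_univ _, fun i j => (hw.2 i j).trans (le_of_eq ?_)⟩
    rw [pow_succ]
    ring

end

/-! ### Chains supported in a subset, and subdivision subordinate to an open cover. -/

section

variable {X Y : Type} [TopologicalSpace X] [TopologicalSpace Y]

/-- The chains with simplices in the set `U`. -/
def chainsIn (n : ℕ) (U : Set X) : Submodule ℚ (Chain n X) :=
  Finsupp.supported ℚ ℚ {σ | range σ ⊆ U}

lemma chainsIn_mono (n : ℕ) {U V : Set X} (h : U ⊆ V) : chainsIn n U ≤ chainsIn n V :=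
  Finsupp.supported_mono fun _ hσ => hσ.trans h

lemma pushA_mem_chainsIn {n k : ℕ} {σ : C(Simp k, X)} {U : Set X} (h : range σ ⊆ U) (c : AC n k) :
    pushA n σ c ∈ chainsIn n U := by
  refine map_mem_of_supported (s := univ) (fun v _ => ?_) (by simp [Finsupp.supported_univ])
  rw [pushA_single]
  refine Finsupp.single_mem_supported ℚ 1 ?_
  rintro _ ⟨t, rfl⟩
  exact h ⟨_, rfl⟩

lemma bd_mem_chainsIn {n : ℕ} {U : Set X} {c : Chain (n + 1) X} (h : c ∈ chainsIn (n + 1) U) :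
    bd n X c ∈ chainsIn n U := by
  refine map_mem_of_supported (fun σ hσ => ?_) h
  rw [bd_single]
  refine Submodule.sum_mem _ fun i _ => Finsupp.single_mem_supported ℚ _ ?_
  rintro _ ⟨t, rfl⟩
  exact hσ ⟨_, rfl⟩

lemma sd_mem_chainsIn {n : ℕ} {U : Set X} {c : Chain n X} (h : c ∈ chainsIn n U) :
    sd n X c ∈ chainsIn n U :=
  map_mem_of_supported (fun σ hσ => by rw [sd_single]; exact pushA_mem_chainsIn hσ _) h

lemma sdHom_mem_chainsIn {n : ℕ} {U : Set X} {c : Chain n X} (h : c ∈ chainsIn n U) :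
    sdHom n X c ∈ chainsIn (n + 1) U :=
  map_mem_of_supported (fun σ hσ => by rw [sdHom_single]; exact pushA_mem_chainsIn hσ _) h

lemma push_mem_chainsIn {n : ℕ} {f : C(X, Y)} {U : Set X} {V : Set Y} (hf : MapsTo f U V)
    {c : Chain n X} (h : c ∈ chainsIn n U) : push n f c ∈ chainsIn n V := by
  refine map_mem_of_supported (fun σ hσ => ?_) h
  rw [push_single]
  refine Finsupp.single_mem_supported ℚ _ ?_
  rintro _ ⟨t, rfl⟩
  exact hf (hσ ⟨_, rfl⟩)

lemma sd_iterate_mem_chainsIn {n : ℕ} {U : Set X} {c : Chain n X} (h : c ∈ chainsIn n U) (m : ℕ) :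
    (sd n X)^[m] c ∈ chainsIn n U := by
  induction m with
  | zero => exact h
  | succ m ih => rw [Function.iterate_succ_apply']; exact sd_mem_chainsIn ih

lemma bd_sd_iterate (n m : ℕ) (c : Chain (n + 1) X) :
    bd n X ((sd (n + 1) X)^[m] c) = (sd n X)^[m] (bd n X c) := by
  induction m with
  | zero => rfl
  | succ m ih => rw [Function.iterate_succ_apply', Function.iterate_succ_apply', bd_sd, ih]

lemma push_sd_iterate (n m : ℕ) (f : C(X, Y)) (c : Chain n X) :
    push n f ((sd n X)^[m] c) = (sd n Y)^[m] (push n f c) := by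
  induction m with
  | zero => rfl
  | succ m ih => rw [Function.iterate_succ_apply', Function.iterate_succ_apply', push_sd, ih]

lemma sd_iterate_add (n m : ℕ) (c d : Chain n X) :
    (sd n X)^[m] (c + d) = (sd n X)^[m] c + (sd n X)^[m] d :=
  iterate_map_add (sd n X) m c d

/-- A cycle is homologous to its subdivisions. -/
lemma exists_bd_eq_sub_sd_iterate {n : ℕ} {U : Set X} {z : Chain (n + 1) X} (hz : bd n X z = 0)
    (hU : z ∈ chainsIn (n + 1) U) (m : ℕ) :
    ∃ b ∈ chainsIn (n + 2) U, bd (n + 1) X b = z - (sd (n + 1) X)^[m] z := by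
  induction m with
  | zero => exact ⟨0, zero_mem _, by simp⟩
  | succ m ih =>
    obtain ⟨b, hb, hbz⟩ := ih
    refine ⟨b + sdHom (n + 1) X ((sd (n + 1) X)^[m] z),
      add_mem hb (sdHom_mem_chainsIn (sd_iterate_mem_chainsIn hU m)), ?_⟩
    have := bd_sdHom n ((sd (n + 1) X)^[m] z)
    have h0 : (sd n X)^[m] 0 = 0 := iterate_map_zero (sd n X) m
    rw [bd_sd_iterate, hz, h0, map_zero, add_zero] at this
    rw [map_add, hbz, this, Function.iterate_succ_apply']
    abel

/-- Iterated subdivisions of a chain are small with respect to an open cover by two sets. -/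
lemma exists_sd_iterate_mem {n : ℕ} {U V : Set X} (hU : IsOpen U) (hV : IsOpen V)
    (hUV : U ∪ V = univ) (c : Chain n X) :
    ∃ m, ∀ m' ≥ m, (sd n X)^[m'] c ∈ chainsIn n U ⊔ chainsIn n V := by
  induction c using Finsupp.induction_linear with
  | zero =>
    refine ⟨0, fun m' _ => ?_⟩
    have h0 : (sd n X)^[m'] 0 = 0 := iterate_map_zero (sd n X) m'
    rw [h0]
    exact zero_mem _
  | add c d hc hd =>
    obtain ⟨m₁, h₁⟩ := hc
    obtain ⟨m₂, h₂⟩ := hd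
    refine ⟨max m₁ m₂, fun m' hm' => ?_⟩
    rw [sd_iterate_add]
    exact add_mem (h₁ m' (le_trans (le_max_left _ _) hm')) (h₂ m' (le_trans (le_max_right _ _) hm'))
  | single σ a =>
    -- A Lebesgue number of the pulled-back cover. The mesh (n/(n+1))^m δ of the iterated
    -- subdivision falls below it and stays there, so that sums of chains can share one exponent.
    obtain ⟨ε, hε, hball⟩ := lebesgue_number_lemma_of_metric_sUnion (s := (univ : Set (Simp n)))
      (c := {σ ⁻¹' U, σ ⁻¹' V}) isCompact_univ
      (by rintro t (rfl | rfl); exacts [hU.preimage σ.continuous, hV.preimage σ.continuous])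
      (by
        intro x _
        rcases (hUV ▸ mem_univ (σ x) : σ x ∈ U ∪ V) with h | h
        · exact ⟨_, Or.inl rfl, h⟩
        · exact ⟨_, Or.inr rfl, h⟩)
    obtain ⟨δ, hδ⟩ : ∃ δ : ℝ, ∀ i j, dist (verts n i) (verts n j) ≤ δ :=
      ⟨_, fun i j => Metric.dist_le_diam_of_mem (isCompact_univ.isBounded)
        (mem_univ _) (mem_univ _)⟩
    have hθ : (n : ℝ) / (n + 1) < 1 := by
      rw [div_lt_one (by positivity)]; linarith
    have hlim : Tendsto (fun m : ℕ => ((n : ℝ) / (n + 1)) ^ m * δ) atTop (𝓝 0) := by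
      simpa using (tendsto_pow_atTop_nhds_zero_of_lt_one (by positivity) hθ).mul_const δ
    obtain ⟨m, hm⟩ := eventually_atTop.1 (hlim.eventually (gt_mem_nhds hε))
    refine ⟨m, fun m' hm' => ?_⟩
    have h1 : (sd n X)^[m'] (Finsupp.single σ 1) =
        pushA n σ ((asd n n)^[m'] (Finsupp.single (verts n) 1)) := by
      rw [← pushA_verts σ]
      exact ((Function.Semiconj.iterate_right (f := pushA n σ)
        (fun c => (sd_pushA σ c).symm) m').eq _).symm
    have h2 : (Finsupp.single σ a : Chain n X) = a • Finsupp.single σ 1 := by simp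
    have h3 : (sd n X)^[m'] (a • Finsupp.single σ 1) = a • (sd n X)^[m'] (Finsupp.single σ 1) :=
      ((Function.Semiconj.iterate_right (f := fun c => a • c)
        (fun c => (map_smul (sd n X) a c).symm) m').eq _).symm
    rw [h2, h3, h1]
    refine Submodule.smul_mem _ _ (map_mem_of_supported (fun u hu => ?_)
      (asd_iterate_mem_supported n (verts n) δ hδ m'))
    rw [pushA_single]
    obtain ⟨t, ht, hut⟩ := hball (u 0) (mem_univ _)
    have h4 : range (realize u) ⊆ t := by
      rintro _ ⟨s, rfl⟩
      refine hut ?_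
      rw [Metric.mem_ball, dist_comm]
      exact (dist_realize_le u s (u 0) _ (hu.2 0)).trans_lt (hm m' hm')
    rcases ht with rfl | rfl
    · refine Submodule.mem_sup_left (Finsupp.single_mem_supported ℚ 1 ?_)
      rintro _ ⟨s, rfl⟩
      exact h4 ⟨s, rfl⟩
    · refine Submodule.mem_sup_right (Finsupp.single_mem_supported ℚ 1 ?_)
      rintro _ ⟨s, rfl⟩
      exact h4 ⟨s, rfl⟩

end

end

noncomputable section

/-! ### Homology groups and induced maps -/

section

variable {X Y Z : Type} [TopologicalSpace X] [TopologicalSpace Y] [TopologicalSpace Z]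

/-- The rational singular homology in degree `n + 1`. -/
def HH (n : ℕ) (X : Type) [TopologicalSpace X] : Type := Cyc X n ⧸ Bdr X n

instance (n : ℕ) (X : Type) [TopologicalSpace X] : AddCommGroup (HH n X) :=
  inferInstanceAs (AddCommGroup (Cyc X n ⧸ Bdr X n))

instance (n : ℕ) (X : Type) [TopologicalSpace X] : Module ℚ (HH n X) :=
  inferInstanceAs (Module ℚ (Cyc X n ⧸ Bdr X n))

lemma betti_eq_rank (n : ℕ) (X : Type) [TopologicalSpace X] :
    betti (n + 1) X = Module.rank ℚ (HH n X) := betti_eq X n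

/-- The action of a continuous map on cycles. -/
def cycMap (n : ℕ) (f : C(X, Y)) : Cyc X n →ₗ[ℚ] Cyc Y n :=
  ((push (n + 1) f).comp (Cyc X n).subtype).codRestrict _ fun c => by
    rw [LinearMap.mem_ker, LinearMap.comp_apply, ← push_bd]
    change push n f (bd n X c.1) = 0
    rw [LinearMap.mem_ker.1 c.2, map_zero]

/-- The map induced in homology. -/
def Hmap (n : ℕ) (f : C(X, Y)) : HH n X →ₗ[ℚ] HH n Y :=
  Submodule.mapQ _ _ (cycMap n f) (by
    rintro c ⟨b, hb⟩
    refine ⟨push (n + 2) f b, ?_⟩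
    rw [← push_bd, hb]
    rfl)

/-- The homology class of a cycle. -/
def hcls (n : ℕ) (z : Chain (n + 1) X) (hz : bd n X z = 0) : HH n X :=
  Submodule.Quotient.mk ⟨z, hz⟩

lemma exists_hcls (n : ℕ) (w : HH n X) : ∃ z hz, w = hcls n z hz := by
  obtain ⟨z, rfl⟩ := Submodule.Quotient.mk_surjective _ w
  exact ⟨z.1, z.2, rfl⟩

lemma hcls_eq_zero (n : ℕ) (z : Chain (n + 1) X) (hz : bd n X z = 0) :
    hcls n z hz = 0 ↔ ∃ b, bd (n + 1) X b = z :=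
  Submodule.Quotient.mk_eq_zero _

lemma hcls_eq (n : ℕ) (z w : Chain (n + 1) X) (hz : bd n X z = 0) (hw : bd n X w = 0) :
    hcls n z hz = hcls n w hw ↔ ∃ b, bd (n + 1) X b = z - w :=
  Submodule.Quotient.eq _

lemma push_cycle {n : ℕ} (f : C(X, Y)) {z : Chain (n + 1) X} (hz : bd n X z = 0) :
    bd n Y (push (n + 1) f z) = 0 := by rw [← push_bd, hz, map_zero]

lemma Hmap_hcls (n : ℕ) (f : C(X, Y)) (z : Chain (n + 1) X) (hz : bd n X z = 0) :
    Hmap n f (hcls n z hz) = hcls n (push (n + 1) f z) (push_cycle f hz) := rfl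

lemma Hmap_comp (n : ℕ) (g : C(Y, Z)) (f : C(X, Y)) (w : HH n X) :
    Hmap n g (Hmap n f w) = Hmap n (g.comp f) w := by
  obtain ⟨z, hz, rfl⟩ := exists_hcls n w
  simp only [Hmap_hcls, push_comp]

lemma Hmap_id (n : ℕ) (w : HH n X) : Hmap n (ContinuousMap.id X) w = w := by
  obtain ⟨z, hz, rfl⟩ := exists_hcls n w
  simp only [Hmap_hcls, push_id]

lemma Hmap_eq_of_homotopic (n : ℕ) {f g : C(X, Y)} (h : f.Homotopic g) (w : HH n X) :
    Hmap n f w = Hmap n g w := by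
  obtain ⟨z, hz, rfl⟩ := exists_hcls n w
  rw [Hmap_hcls, Hmap_hcls, hcls_eq]
  exact push_sub_push_of_homotopic h n z hz

lemma betti_eq_of_homotopyEquiv (n : ℕ) (e : ContinuousMap.HomotopyEquiv X Y) :
    betti (n + 1) X = betti (n + 1) Y := by
  rw [betti_eq_rank, betti_eq_rank]
  refine (LinearEquiv.ofLinearMap (Hmap n e.toFun) (Hmap n e.invFun) ?_ ?_).rank_eq
  · exact LinearMap.ext fun w => by
      simp only [LinearMap.comp_apply, Hmap_comp, Hmap_eq_of_homotopic n e.right_inv]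
      rw [Hmap_id]; rfl
  · exact LinearMap.ext fun w => by
      simp only [LinearMap.comp_apply, Hmap_comp, Hmap_eq_of_homotopic n e.left_inv]
      rw [Hmap_id]; rfl

lemma betti_eq_of_homeomorph (n : ℕ) (e : X ≃ₜ Y) : betti (n + 1) X = betti (n + 1) Y :=
  betti_eq_of_homotopyEquiv n e.toHomotopyEquiv

lemma betti_eq_zero_of_contractible (n : ℕ) (X : Type) [TopologicalSpace X] [ContractibleSpace X] :
    betti (n + 1) X = 0 := by
  obtain ⟨e⟩ := ContractibleSpace.hequiv_unit X
  rw [betti_eq_of_homotopyEquiv n e]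
  have := AlgebraicTopology.isZero_singularHomologyFunctor_of_totallyDisconnectedSpace
    (ModuleCat.{0} ℚ) (n + 1) (ModuleCat.of ℚ ℚ) (TopCat.of Unit) n.succ_ne_zero
  have h := ModuleCat.subsingleton_of_isZero this
  exact rank_subsingleton' ℚ _

/-- A deformation of a space into a subset that preserves the subset does not change the Betti
numbers. -/
lemma betti_eq_of_deformation (n : ℕ) {Q : Set X} (G : C(X × unitInterval, X))
    (h0 : ∀ x, G (x, 0) = x) (h1 : ∀ x, G (x, 1) ∈ Q) (hQ : ∀ x ∈ Q, ∀ t, G (x, t) ∈ Q) :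
    betti (n + 1) Q = betti (n + 1) X := by
  let r : C(X, Q) := ⟨fun x => ⟨G (x, 1), h1 x⟩, by fun_prop⟩
  let i : C(Q, X) := ⟨Subtype.val, continuous_subtype_val⟩
  refine betti_eq_of_homotopyEquiv n ⟨i, r, ?_, ?_⟩
  · refine ContinuousMap.Homotopic.symm ⟨⟨⟨fun p => ⟨G (p.2.1, p.1), hQ _ p.2.2 _⟩, ?_⟩, ?_, ?_⟩⟩
    · fun_prop
    · intro x; exact Subtype.ext (h0 x.1)
    · intro x; rfl
  · refine ContinuousMap.Homotopic.symm ⟨⟨⟨fun p => G (p.2, p.1), ?_⟩, ?_, ?_⟩⟩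
    · fun_prop
    · intro x; exact h0 x
    · intro x; rfl

lemma exists_bd_eq_of_betti_eq_zero {n : ℕ} (h : betti (n + 1) X = 0) (z : Chain (n + 1) X)
    (hz : bd n X z = 0) : ∃ b, bd (n + 1) X b = z := by
  rw [betti_eq_rank, rank_zero_iff] at h
  exact (hcls_eq_zero n z hz).1 (Subsingleton.elim _ _)

lemma betti_eq_zero_of_exists_bd_eq {n : ℕ}
    (h : ∀ z, bd n X z = 0 → ∃ b, bd (n + 1) X b = z) : betti (n + 1) X = 0 := by
  rw [betti_eq_rank, rank_zero_iff]
  refine subsingleton_of_forall_eq 0 fun w => ?_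
  obtain ⟨z, hz, rfl⟩ := exists_hcls n w
  exact (hcls_eq_zero n z hz).2 (h z hz)

/-! ### Chains of subspaces -/

/-- The inclusion of a subset as a continuous map. -/
def incl (S : Set X) : C(S, X) := ⟨Subtype.val, continuous_subtype_val⟩

lemma push_incl_injective (n : ℕ) (S : Set X) : Function.Injective (push n (incl S)) := by
  refine Finsupp.mapDomain_injective fun σ τ h => ?_
  ext t
  exact DFunLike.congr_fun h t

lemma push_incl_mem (n : ℕ) (S : Set X) (c : Chain n S) : push n (incl S) c ∈ chainsIn n S :=
  push_mem_chainsIn (U := univ) (fun x _ => x.2) (by simp [chainsIn])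

lemma exists_push_incl_eq {n : ℕ} {S : Set X} {c : Chain n X} (hc : c ∈ chainsIn n S) :
    ∃ d, push n (incl S) d = c := by
  suffices h : c ∈ LinearMap.range (push n (incl S)) from h
  refine map_mem_of_supported (f := LinearMap.id) (fun σ hσ => ?_) hc
  refine ⟨Finsupp.single ⟨fun t => ⟨σ t, hσ ⟨t, rfl⟩⟩, by fun_prop⟩ 1, ?_⟩
  rw [push_single]
  rfl

lemma exists_push_incl_cycle {n : ℕ} {S : Set X} {z : Chain (n + 1) X}
    (hz : z ∈ chainsIn (n + 1) S) (hbd : bd n X z = 0) :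
    ∃ d, push (n + 1) (incl S) d = z ∧ bd n S d = 0 := by
  obtain ⟨d, rfl⟩ := exists_push_incl_eq hz
  refine ⟨d, rfl, push_incl_injective n S ?_⟩
  rw [push_bd, hbd, map_zero]

/-- Turns a vanishing Betti number of a subspace into a statement about chains of the ambient space,
the form used in the excision arguments. -/
lemma exists_bd_eq_mem_of_betti {n : ℕ} {S : Set X} (h : betti (n + 1) S = 0)
    {z : Chain (n + 1) X} (hz : z ∈ chainsIn (n + 1) S) (hbd : bd n X z = 0) :
    ∃ b ∈ chainsIn (n + 2) S, bd (n + 1) X b = z := by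
  obtain ⟨d, rfl, hd⟩ := exists_push_incl_cycle hz hbd
  obtain ⟨b, rfl⟩ := exists_bd_eq_of_betti_eq_zero h d hd
  exact ⟨push (n + 2) (incl S) b, push_incl_mem _ _ _, (push_bd _ _ _).symm⟩

/-! ### Additivity of Betti numbers over finite disjoint unions of open sets. -/

section Additivity

variable {ι : Type} {S : ι → Set X}

open Classical in
/-- The part of a chain that lies in a set. -/
def chainRestrict (n : ℕ) (U : Set X) : Chain n X →ₗ[ℚ] Chain n X :=
  Finsupp.linearCombination ℚ (fun σ => if range σ ⊆ U then Finsupp.single σ (1 : ℚ) else 0)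

lemma chainRestrict_single_of_subset {n : ℕ} {U : Set X} {σ : C(Simp n, X)} (h : range σ ⊆ U) :
    chainRestrict n U (Finsupp.single σ 1) = Finsupp.single σ 1 := by
  rw [chainRestrict, Finsupp.linearCombination_single, if_pos h, one_smul]

lemma chainRestrict_single_of_not_subset {n : ℕ} {U : Set X} {σ : C(Simp n, X)}
    (h : ¬ range σ ⊆ U) : chainRestrict n U (Finsupp.single σ 1) = 0 := by
  rw [chainRestrict, Finsupp.linearCombination_single, if_neg h, smul_zero]

lemma chainRestrict_mem (n : ℕ) (U : Set X) (c : Chain n X) :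
    chainRestrict n U c ∈ chainsIn n U := by
  refine map_mem_of_supported (s := univ) (fun σ _ => ?_) (by simp)
  by_cases h : range σ ⊆ U
  · rw [chainRestrict_single_of_subset h]
    exact Finsupp.single_mem_supported ℚ 1 h
  · rw [chainRestrict_single_of_not_subset h]
    exact zero_mem _

lemma exists_range_subset (hS : ∀ i, IsOpen (S i)) (hd : Pairwise (Function.onFun Disjoint S))
    (hc : ⋃ i, S i = univ) {n : ℕ} (σ : C(Simp n, X)) : ∃ i, range σ ⊆ S i := by
  have hpc : IsPreconnected (range σ) := isPreconnected_range σ.continuous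
  obtain ⟨t⟩ : Nonempty (Simp n) := inferInstance
  obtain ⟨i, hi⟩ := mem_iUnion.1 (hc ▸ mem_univ (σ t))
  refine ⟨i, ?_⟩
  have hclopen : IsClopen (S i) := by
    refine ⟨⟨?_⟩, hS i⟩
    have : (S i)ᶜ = ⋃ j ∈ {j | j ≠ i}, S j := by
      ext x
      obtain ⟨j, hj⟩ := mem_iUnion.1 (hc ▸ mem_univ x)
      simp only [mem_compl_iff, mem_ofPred_eq, mem_iUnion, exists_prop]
      refine ⟨fun hx => ⟨j, fun h => hx (h ▸ hj), hj⟩, ?_⟩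
      rintro ⟨l, hl, hxl⟩ hx
      exact (hd hl).le_bot ⟨hxl, hx⟩
    rw [this]
    exact isOpen_biUnion fun j _ => hS j
  exact hpc.subset_isClopen hclopen ⟨σ t, ⟨t, rfl⟩, hi⟩

lemma disjoint_not_subset (hd : Pairwise (Function.onFun Disjoint S)) {n : ℕ} {σ : C(Simp n, X)}
    {i j : ι} (h : range σ ⊆ S i) (hij : i ≠ j) : ¬ range σ ⊆ S j := by
  intro h'
  obtain ⟨t⟩ : Nonempty (Simp n) := inferInstance
  exact (hd hij).le_bot ⟨h ⟨t, rfl⟩, h' ⟨t, rfl⟩⟩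

/-- A simplex is connected and the pieces are clopen, so it lies in one piece together with all its
faces. -/
lemma bd_chainRestrict (hS : ∀ i, IsOpen (S i)) (hd : Pairwise (Function.onFun Disjoint S))
    (hc : ⋃ i, S i = univ) (n : ℕ) (i : ι) (c : Chain (n + 1) X) :
    bd n X (chainRestrict (n + 1) (S i) c) = chainRestrict n (S i) (bd n X c) := by
  suffices h : (bd n X).comp (chainRestrict (n + 1) (S i)) =
    (chainRestrict n (S i)).comp (bd n X) from LinearMap.congr_fun h c
  refine chain_induction fun σ => ?_
  simp only [LinearMap.comp_apply]
  obtain ⟨j, hj⟩ := exists_range_subset hS hd hc σ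
  have hface : ∀ m, range (σ.comp (faceMap m)) ⊆ S j := by
    rintro m _ ⟨t, rfl⟩
    exact hj ⟨_, rfl⟩
  rw [bd_single, map_sum]
  by_cases hij : j = i
  · subst hij
    rw [chainRestrict_single_of_subset hj, bd_single]
    refine Finset.sum_congr rfl fun m _ => ?_
    rw [← Finsupp.smul_single_one, map_smul, chainRestrict_single_of_subset (hface m)]
  · rw [chainRestrict_single_of_not_subset (disjoint_not_subset hd hj hij), map_zero]
    refine (Finset.sum_eq_zero fun m _ => ?_).symm
    rw [← Finsupp.smul_single_one, map_smul,
      chainRestrict_single_of_not_subset (disjoint_not_subset hd (hface m) hij), smul_zero]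

lemma sum_chainRestrict [Fintype ι] (hS : ∀ i, IsOpen (S i)) (hd : Pairwise (Function.onFun Disjoint S))
    (hc : ⋃ i, S i = univ) (n : ℕ) (c : Chain n X) : ∑ i, chainRestrict n (S i) c = c := by
  suffices h : ∑ i, chainRestrict n (S i) = LinearMap.id by
    simpa using LinearMap.congr_fun h c
  refine chain_induction fun σ => ?_
  obtain ⟨j, hj⟩ := exists_range_subset hS hd hc σ
  rw [LinearMap.sum_apply, Finset.sum_eq_single j]
  · rw [chainRestrict_single_of_subset hj]; rfl
  · intro i _ hij
    exact chainRestrict_single_of_not_subset (disjoint_not_subset hd hj hij.symm)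
  · simp

lemma chainRestrict_of_mem {n : ℕ} {U : Set X} {c : Chain n X} (h : c ∈ chainsIn n U) :
    chainRestrict n U c = c := by
  have : c ∈ LinearMap.ker (chainRestrict n U - LinearMap.id) :=
    map_mem_of_supported (f := LinearMap.id) (fun σ hσ => by
      rw [LinearMap.mem_ker, LinearMap.sub_apply, LinearMap.id_apply,
        chainRestrict_single_of_subset hσ]
      simp) h
  rw [LinearMap.mem_ker, LinearMap.sub_apply, sub_eq_zero] at this
  exact this

lemma chainRestrict_of_mem_of_ne (hd : Pairwise (Function.onFun Disjoint S)) {n : ℕ} {i j : ι}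
    (hij : i ≠ j) {c : Chain n X} (h : c ∈ chainsIn n (S i)) : chainRestrict n (S j) c = 0 := by
  have : c ∈ LinearMap.ker (chainRestrict n (S j)) :=
    map_mem_of_supported (f := LinearMap.id) (fun σ hσ => by
      rw [LinearMap.mem_ker, LinearMap.id_apply,
        chainRestrict_single_of_not_subset (disjoint_not_subset hd hσ hij)]) h
  exact this

/-- `rank_pi` expresses a rank by `Cardinal.sum`. Both sides here are additive in `f`, so functions
supported at one index suffice. -/
lemma cardinal_sum_eq [Fintype ι] (f : ι → Cardinal.{0}) : Cardinal.sum f = ∑ i, f i := by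
  classical
  have hs : ∀ i (a : Cardinal.{0}), Cardinal.sum (Pi.single i a : ι → Cardinal.{0}) = a := by
    intro i a
    induction a using Cardinal.inductionOn with | mk α => ?_
    have : (Pi.single i (Cardinal.mk α) : ι → Cardinal.{0}) =
        fun j => Cardinal.mk {_x : α // j = i} := by
      funext j
      by_cases h : j = i
      · subst h
        rw [Pi.single_eq_same]
        exact Cardinal.mk_congr (Equiv.subtypeUnivEquiv fun _ => rfl).symm
      · rw [Pi.single_eq_of_ne h]
        symm
        rw [Cardinal.mk_eq_zero_iff]
        exact ⟨fun x => h x.2⟩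
    rw [this, ← Cardinal.mk_sigma]
    exact Cardinal.mk_congr
      { toFun := fun p => p.2.1
        invFun := fun x => ⟨i, x, rfl⟩
        left_inv := by rintro ⟨j, x, rfl⟩; rfl
        right_inv := fun x => rfl }
  let Φ : (ι → Cardinal.{0}) →+ Cardinal.{0} :=
    { toFun := Cardinal.sum
      map_zero' := by
        change Cardinal.sum (fun _ : ι => (0 : Cardinal.{0})) = 0
        simp
      map_add' := fun f g => Cardinal.sum_add_distrib f g }
  conv_lhs => rw [← Finset.univ_sum_single f]
  refine (map_sum Φ _ _).trans (Finset.sum_congr rfl fun i _ => hs i (f i))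

/-- Betti numbers are additive under finite disjoint unions of open sets. -/
lemma betti_eq_sum [Fintype ι] (n : ℕ) (hS : ∀ i, IsOpen (S i)) (hd : Pairwise (Function.onFun Disjoint S))
    (hc : ⋃ i, S i = univ) : betti (n + 1) X = ∑ i, betti (n + 1) (S i) := by
  classical
  let G : (∀ i, HH n (S i)) →ₗ[ℚ] HH n X := ∑ i, (Hmap n (incl (S i))).comp (LinearMap.proj i)
  have hG : ∀ (z : ∀ i, Chain (n + 1) (S i)) (hz : ∀ i, bd n _ (z i) = 0),
      G (fun i => hcls n (z i) (hz i)) = hcls n (∑ i, push (n + 1) (incl (S i)) (z i))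
        (by rw [map_sum]; exact Finset.sum_eq_zero fun i _ => push_cycle _ (hz i)) := by
    intro z hz
    simp only [G, LinearMap.sum_apply, LinearMap.comp_apply, LinearMap.proj_apply, Hmap_hcls]
    have : ∀ (s : Finset ι) (h), ∑ i ∈ s, hcls n (push (n + 1) (incl (S i)) (z i))
        (push_cycle _ (hz i)) = hcls n (∑ i ∈ s, push (n + 1) (incl (S i)) (z i)) h := by
      intro s h
      refine (map_sum (Submodule.mkQ (Bdr X n)) (fun i => (⟨push (n + 1) (incl (S i)) (z i),
        push_cycle _ (hz i)⟩ : Cyc X n)) s).symm.trans ?_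
      change Submodule.Quotient.mk _ = Submodule.Quotient.mk _
      congr 1
      apply Subtype.ext
      simp
    exact this _ _
  have hbij : Function.Bijective G := by
    constructor
    · rw [← LinearMap.ker_eq_bot, LinearMap.ker_eq_bot']
      intro w hw
      choose z hz hwz using fun i => exists_hcls n (w i)
      obtain rfl : w = fun i => hcls n (z i) (hz i) := funext hwz
      rw [hG, hcls_eq_zero] at hw
      obtain ⟨b, hb⟩ := hw
      -- Restricting the bounding chain to the j-th piece bounds the j-th summand.
      funext j
      refine (hcls_eq_zero n _ _).2 ?_
      obtain ⟨d, hd'⟩ := exists_push_incl_eq (chainRestrict_mem (n + 2) (S j) b)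
      refine ⟨d, push_incl_injective _ _ ?_⟩
      rw [push_bd, hd', bd_chainRestrict hS hd hc, hb, map_sum, Finset.sum_eq_single j]
      · exact chainRestrict_of_mem (push_incl_mem _ _ _)
      · intro i _ hij
        exact chainRestrict_of_mem_of_ne hd hij (push_incl_mem _ _ _)
      · simp
    · intro w
      obtain ⟨z, hz, rfl⟩ := exists_hcls n w
      choose d hd1 hd2 using fun i => exists_push_incl_cycle (chainRestrict_mem (n + 1) (S i) z)
        (by rw [bd_chainRestrict hS hd hc, hz, map_zero])
      refine ⟨fun i => hcls n (d i) (hd2 i), ?_⟩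
      rw [hG]
      congr 1
      simp only [hd1]
      exact sum_chainRestrict hS hd hc _ _
  rw [betti_eq_rank, ← (LinearEquiv.ofBijective G hbij).rank_eq, rank_pi, cardinal_sum_eq]
  simp only [betti_eq_rank]

end Additivity

end

end

noncomputable section

/-! ### Homology and collapsing maps -/

section

variable {X Y : Type} [TopologicalSpace X] [TopologicalSpace Y]

/-- `π` is injective over the complement of `F`, and singular simplices of the complement of `F`
lift to `X`. -/
structure LiftsOff (π : C(X, Y)) (F : Set Y) : Prop where
  injOn : InjOn π (π ⁻¹' Fᶜ)
  lift : ∀ (n : ℕ) (σ : C(Simp n, Y)), range σ ⊆ Fᶜ → ∃ τ : C(Simp n, X), π.comp τ = σ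

variable {π : C(X, Y)} {F O : Set Y}

lemma LiftsOff.exists_lift (h : LiftsOff π F) {n : ℕ} {c : Chain n Y} (hc : c ∈ chainsIn n Fᶜ) :
    ∃ d ∈ chainsIn n (π ⁻¹' Fᶜ), push n π d = c := by
  suffices hs : c ∈ (chainsIn n (π ⁻¹' Fᶜ)).map (push n π) from hs
  refine map_mem_of_supported (f := LinearMap.id) (fun σ hσ => ?_) hc
  obtain ⟨τ, rfl⟩ := h.lift n σ hσ
  refine ⟨Finsupp.single τ 1, Finsupp.single_mem_supported ℚ 1 ?_, ?_⟩
  · rintro _ ⟨t, rfl⟩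
    exact hσ ⟨t, rfl⟩
  · simp

/-- By injectivity over the complement of F, different simplices of d have different images. Nothing
cancels, and the support of the image is the image of the support. -/
lemma LiftsOff.mem_of_push_mem (h : LiftsOff π F) {n : ℕ} {d : Chain n X}
    (hd : d ∈ chainsIn n (π ⁻¹' Fᶜ)) {W : Set Y} (hW : push n π d ∈ chainsIn n W) :
    d ∈ chainsIn n (π ⁻¹' W) := by
  classical
  have hinj : InjOn (fun σ : C(Simp n, X) => π.comp σ) d.support := by
    intro σ hσ τ hτ hστ
    ext t
    exact h.injOn (hd hσ ⟨t, rfl⟩) (hd hτ ⟨t, rfl⟩) (DFunLike.congr_fun hστ t)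
  have hs : (push n π d).support = _ := Finsupp.mapDomain_support_of_injOn d hinj
  intro σ hσ
  have : π.comp σ ∈ (push n π d).support := by
    rw [hs]
    exact Finset.mem_image_of_mem _ hσ
  have h2 := hW this
  rintro _ ⟨t, rfl⟩
  exact h2 ⟨t, rfl⟩

/-- Subdivision subordinate to the cover of Y by the complement of F and by O. The first part can be
lifted to X, the second is to be discarded. -/
lemma exists_small_chain (hF : IsClosed F) (hO : IsOpen O) (hFO : F ⊆ O) {n : ℕ} (c : Chain n Y) :
    ∃ m, ∀ m' ≥ m, ∃ p ∈ chainsIn n Fᶜ, ∃ q ∈ chainsIn n O, (sd n Y)^[m'] c = p + q := by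
  obtain ⟨m, hm⟩ := exists_sd_iterate_mem hF.isOpen_compl hO (by
      rw [eq_univ_iff_forall]
      intro y
      by_cases hy : y ∈ F
      exacts [Or.inr (hFO hy), Or.inl hy]) c
  refine ⟨m, fun m' hm' => ?_⟩
  obtain ⟨p, hp, q, hq, hpq⟩ := Submodule.mem_sup.1 (hm m' hm')
  exact ⟨p, hp, q, hq, hpq.symm⟩

lemma LiftsOff.exists_small (_h : LiftsOff π F) (hF : IsClosed F) (hO : IsOpen O)
    (hFO : F ⊆ O) {n : ℕ} (c : Chain n X) :
    ∃ m, ∀ m' ≥ m, ∃ p ∈ chainsIn n (π ⁻¹' Fᶜ), ∃ q ∈ chainsIn n (π ⁻¹' O),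
      (sd n X)^[m'] c = p + q := by
  obtain ⟨m, hm⟩ := exists_sd_iterate_mem (hF.isOpen_compl.preimage π.continuous)
    (hO.preimage π.continuous) (by
      rw [← preimage_union, eq_univ_iff_forall]
      intro x
      by_cases hy : π x ∈ F
      exacts [Or.inr (hFO hy), Or.inl hy]) c
  refine ⟨m, fun m' hm' => ?_⟩
  obtain ⟨p, hp, q, hq, hpq⟩ := Submodule.mem_sup.1 (hm m' hm')
  exact ⟨p, hp, q, hq, hpq.symm⟩

/-- A chain `x` whose boundary is in `π ⁻¹' O` and whose image bounds modulo `O` is homologous,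
after subdivision, to a chain in `π ⁻¹' O`. -/
lemma LiftsOff.exists_sub_bd_mem (h : LiftsOff π F) (hF : IsClosed F) (hO : IsOpen O)
    (hFO : F ⊆ O) {n : ℕ} (x : Chain (n + 1) X) {b : Chain (n + 2) Y}
    {d : Chain (n + 1) Y} (hd : d ∈ chainsIn (n + 1) O)
    (hb : bd (n + 1) Y b = push (n + 1) π x - d) :
    ∃ m, ∃ e, (sd (n + 1) X)^[m] x - bd (n + 1) X e ∈ chainsIn (n + 1) (π ⁻¹' O) := by
  obtain ⟨m₁, h₁⟩ := h.exists_small hF hO hFO x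
  obtain ⟨m₂, h₂⟩ := exists_small_chain hF hO hFO b
  obtain ⟨xP, hxP, xQ, hxQ, hx⟩ := h₁ (max m₁ m₂) (le_max_left _ _)
  obtain ⟨bP, hbP, bQ, hbQ, hbb⟩ := h₂ (max m₁ m₂) (le_max_right _ _)
  obtain ⟨e, he, rfl⟩ := h.exists_lift hbP
  refine ⟨max m₁ m₂, e, ?_⟩
  have h3 : (sd (n + 1) X)^[max m₁ m₂] x - bd (n + 1) X e = (xP - bd (n + 1) X e) + xQ := by
    rw [hx]; abel
  rw [h3]
  -- The chain xP − ∂e lies off F, so it is enough to see that its image lies in O. The boundary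
  -- relation, after subdivision, expresses this image through chains in O only.
  refine add_mem (h.mem_of_push_mem (sub_mem hxP (bd_mem_chainsIn he)) ?_) hxQ
  have h4 := congrArg (sd (n + 1) Y)^[max m₁ m₂] hb
  rw [← bd_sd_iterate, iterate_map_sub (sd (n + 1) Y), ← push_sd_iterate, hx, hbb, map_add,
    map_add, ← push_bd] at h4
  have h5 : push (n + 1) π (xP - bd (n + 1) X e) = bd (n + 1) Y bQ +
      (sd (n + 1) Y)^[max m₁ m₂] d - push (n + 1) π xQ := by
    rw [map_sub]
    have : push (n + 1) π (bd (n + 1) X e) = push (n + 1) π xP + push (n + 1) π xQ -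
      (sd (n + 1) Y)^[max m₁ m₂] d - bd (n + 1) Y bQ := by rw [← h4]; abel
    rw [this]
    abel
  rw [h5]
  exact sub_mem (add_mem (bd_mem_chainsIn hbQ) (sd_iterate_mem_chainsIn hd _))
    (push_mem_chainsIn (fun _ hx => hx) hxQ)

/-- A cycle whose image bounds is homologous to a cycle in the preimage of `O`. -/
lemma LiftsOff.exists_cycle_mem (h : LiftsOff π F) (hF : IsClosed F) (hO : IsOpen O)
    (hFO : F ⊆ O) {n : ℕ} {x : Chain (n + 1) X} (hx : bd n X x = 0)
    {b : Chain (n + 2) Y} (hb : bd (n + 1) Y b = push (n + 1) π x) :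
    ∃ q ∈ chainsIn (n + 1) (π ⁻¹' O), bd n X q = 0 ∧ ∃ e, bd (n + 1) X e = x - q := by
  obtain ⟨m, e, he⟩ := h.exists_sub_bd_mem hF hO hFO x (zero_mem _) (by rw [hb, sub_zero])
  obtain ⟨f, -, hf⟩ := exists_bd_eq_sub_sd_iterate (U := univ) hx (by simp [chainsIn]) m
  refine ⟨_, he, ?_, f + e, ?_⟩
  · rw [map_sub, bd_bd, bd_sd_iterate, hx, sub_zero]
    exact iterate_map_zero (sd n X) m
  · rw [map_add, hf]
    abel

/-- A cycle in the preimage of `O` that bounds, bounds there. -/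
lemma LiftsOff.exists_bd_eq_mem (h : LiftsOff π F) (hF : IsClosed F) (hO : IsOpen O)
    (hFO : F ⊆ O) {n : ℕ} (hO1 : ∀ z ∈ chainsIn (n + 1) O, bd n Y z = 0 →
      ∃ b ∈ chainsIn (n + 2) O, bd (n + 1) Y b = z)
    (hY : ∀ z, bd (n + 1) Y z = 0 → ∃ b, bd (n + 2) Y b = z)
    {q : Chain (n + 1) X} (hq : q ∈ chainsIn (n + 1) (π ⁻¹' O)) {x : Chain (n + 2) X}
    (hx : bd (n + 1) X x = q) :
    ∃ w ∈ chainsIn (n + 2) (π ⁻¹' O), bd (n + 1) X w = q := by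
  have hq0 : bd n X q = 0 := by rw [← hx, bd_bd]
  have hpush : push (n + 1) π q ∈ chainsIn (n + 1) O := push_mem_chainsIn (fun _ hx => hx) hq
  -- The image of q bounds some d inside O. The image of x minus d is then a cycle of Y, and it
  -- bounds by the vanishing of the homology of Y in that degree.
  obtain ⟨d, hd, hdb⟩ := hO1 _ hpush (by rw [← push_bd, hq0, map_zero])
  obtain ⟨b, hb⟩ := hY (push (n + 2) π x - d) (by rw [map_sub, ← push_bd, hx, hdb, sub_self])
  obtain ⟨m, e, he⟩ := h.exists_sub_bd_mem hF hO hFO x hd hb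
  obtain ⟨f, hf, hfb⟩ := exists_bd_eq_sub_sd_iterate hq0 hq m
  refine ⟨_, add_mem hf he, ?_⟩
  rw [map_add, map_sub, bd_bd, bd_sd_iterate, hx, hfb]
  abel

/-- Every one-cycle of `Y` comes from `X`, up to homology. -/
lemma LiftsOff.exists_push_sub_eq (h : LiftsOff π F) (hF : IsClosed F) (hO : IsOpen O)
    (hFO : F ⊆ O) (hO1 : ∀ z ∈ chainsIn 1 O, bd 0 Y z = 0 →
      ∃ b ∈ chainsIn 2 O, bd 1 Y b = z)
    (h0 : ∀ c ∈ chainsIn 0 (π ⁻¹' O), ∀ d ∈ chainsIn 1 O, bd 0 Y d = push 0 π c →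
      ∃ w ∈ chainsIn 1 (π ⁻¹' O), bd 0 X w = c)
    {y : Chain 1 Y} (hy : bd 0 Y y = 0) :
    ∃ x, bd 0 X x = 0 ∧ ∃ b, bd 1 Y b = push 1 π x - y := by
  obtain ⟨m, hm⟩ := exists_small_chain hF hO hFO y
  obtain ⟨yP, hyP, yQ, hyQ, hyy⟩ := hm m le_rfl
  obtain ⟨b, -, hb⟩ := exists_bd_eq_sub_sd_iterate (U := univ) hy (by simp [chainsIn]) m
  obtain ⟨xP, hxP, rfl⟩ := h.exists_lift hyP
  have hbd : push 0 π (bd 0 X xP) = bd 0 Y (-yQ) := by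
    have h2 : bd 0 Y ((sd 1 Y)^[m] y) = 0 := by
      rw [bd_sd_iterate, hy]; exact iterate_map_zero (sd 0 Y) m
    rw [hyy, map_add, ← push_bd] at h2
    rw [map_neg]
    exact eq_neg_of_add_eq_zero_left h2
  -- The lifted part xP is not a cycle, but its boundary lies over O, since its image is the
  -- boundary of −yQ. Closing it up by a chain w over O costs only a cycle in O, which bounds there.
  have hxPO : bd 0 X xP ∈ chainsIn 0 (π ⁻¹' O) :=
    h.mem_of_push_mem (bd_mem_chainsIn hxP) (by rw [hbd]; exact bd_mem_chainsIn (neg_mem hyQ))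
  obtain ⟨w, hw, hwb⟩ := h0 _ hxPO _ (neg_mem hyQ) hbd.symm
  have hcyc : bd 0 X (xP - w) = 0 := by rw [map_sub, hwb, sub_self]
  have hwO : -push 1 π w - yQ ∈ chainsIn 1 O :=
    sub_mem (neg_mem (push_mem_chainsIn (fun _ hx => hx) hw)) hyQ
  obtain ⟨g, -, hg⟩ := hO1 _ hwO (by rw [map_sub, map_neg, ← push_bd, hwb, hbd]; simp)
  refine ⟨xP - w, hcyc, g - b, ?_⟩
  rw [map_sub, hg, hb, hyy, map_sub]
  abel

end

/-! ### Zero-chains and the exact sequence of a collapsing map. -/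

section

variable {X Y : Type} [TopologicalSpace X] [TopologicalSpace Y]

/-- The singular zero-simplex at a point. -/
def pointSimp (x : X) : C(Simp 0, X) := ContinuousMap.const _ x

lemma exists_bd_eq_of_joinedIn {Q : Set X} {a b : X} (hab : JoinedIn Q a b) :
    ∃ w ∈ chainsIn 1 Q, bd 0 X w = Finsupp.single (pointSimp b) 1 - Finsupp.single (pointSimp a) 1 := by
  obtain ⟨γ, hγ⟩ := hab
  refine ⟨Finsupp.single ((γ : C(unitInterval, X)).comp
    ⟨_, stdSimplexHomeomorphUnitInterval.continuous⟩) 1,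
    Finsupp.single_mem_supported ℚ 1 ?_, ?_⟩
  · rintro _ ⟨t, rfl⟩
    exact hγ _
  · rw [bd_single, Fin.sum_univ_two, sub_eq_add_neg, ← Finsupp.single_neg]
    have hv : ∀ (i : Fin 2) (t : Simp 0), faceMap i t = stdSimplex.vertex (i.succAbove 0) := by
      intro i t
      rw [Subsingleton.elim t (stdSimplex.vertex 0)]
      exact stdSimplex.map_vertex _ _
    congr 1
    · congr 1
      · ext t
        change γ (stdSimplexHomeomorphUnitInterval (faceMap 0 t)) = b
        rw [hv]
        exact γ.target
      · simp
    · congr 1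
      · ext t
        change γ (stdSimplexHomeomorphUnitInterval (faceMap 1 t)) = a
        rw [hv]
        exact γ.source
      · simp

variable {ι : Type} [Fintype ι] {π : C(X, Y)} {O : ι → Set Y}

/-- A zero-chain whose image bounds, bounds, provided that components are not merged. -/
lemma exists_bd_eq_of_isPathConnected (hO : ∀ i, IsOpen (O i))
    (hd : Pairwise (Function.onFun Disjoint O)) (hpc : ∀ i, IsPathConnected (π ⁻¹' O i))
    {c : Chain 0 X} (hc : c ∈ chainsIn 0 (π ⁻¹' ⋃ i, O i)) {d : Chain 1 Y}
    (hdO : d ∈ chainsIn 1 (⋃ i, O i)) (hdc : bd 0 Y d = push 0 π c) :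
    ∃ w ∈ chainsIn 1 (π ⁻¹' ⋃ i, O i), bd 0 X w = c := by
  classical
  choose a ha using fun i => (hpc i).nonempty
  have huniq : ∀ {y i j}, y ∈ O i → y ∈ O j → i = j := fun {y i j} hi hj => by
    by_contra hij
    exact (hd hij).le_bot ⟨hi, hj⟩
  let t₀ : Simp 0 := default
  -- A point of O i is replaced by a base point a i over O i. The extension G kills the boundary of
  -- every 1-simplex in the union of the O i, as it stays in a single one of them. On the other hand
  -- c is homologous to G of its image along paths.
  let g : C(Simp 0, Y) → Chain 0 X := fun τ =>
    if hτ : ∃ i, τ t₀ ∈ O i then Finsupp.single (pointSimp (a hτ.choose)) 1 else 0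
  have hg : ∀ (τ : C(Simp 0, Y)) i, τ t₀ ∈ O i → g τ = Finsupp.single (pointSimp (a i)) 1 := by
    intro τ i hi
    have hτ : ∃ i, τ t₀ ∈ O i := ⟨i, hi⟩
    simp only [g, dif_pos hτ]
    rw [huniq hτ.choose_spec hi]
  let G : Chain 0 Y →ₗ[ℚ] Chain 0 X := Finsupp.linearCombination ℚ g
  have hG1 : G (bd 0 Y d) = 0 := by
    have : d ∈ LinearMap.ker (G.comp (bd 0 Y)) := by
      refine map_mem_of_supported (f := LinearMap.id) (fun σ hσ => ?_) hdO
      have hS : ∃ i, range σ ⊆ O i := by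
        have := isPreconnected_range σ.continuous
        obtain ⟨s⟩ : Nonempty (Simp 1) := inferInstance
        obtain ⟨i, hi⟩ := mem_iUnion.1 (hσ ⟨s, rfl⟩)
        refine ⟨i, this.subset_left_of_subset_union (hO i)
          (isOpen_biUnion fun j (_ : j ≠ i) => hO j) ?_ ?_ ⟨_, ⟨s, rfl⟩, hi⟩⟩
        · rw [disjoint_iUnion₂_right]
          exact fun j hj => hd (Ne.symm hj)
        · intro y hy
          obtain ⟨j, hj⟩ := mem_iUnion.1 (hσ hy)
          by_cases hji : j = i
          · exact Or.inl (hji ▸ hj)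
          · exact Or.inr (mem_biUnion (x := j) hji hj)
      obtain ⟨i, hi⟩ := hS
      rw [LinearMap.mem_ker, LinearMap.comp_apply, LinearMap.id_apply, bd_single,
        Fin.sum_univ_two, map_add]
      simp only [G, Finsupp.linearCombination_single]
      rw [hg _ i (hi ⟨_, rfl⟩), hg _ i (hi ⟨_, rfl⟩)]
      simp
    exact this
  have hG2 : ∃ w ∈ chainsIn 1 (π ⁻¹' ⋃ i, O i), bd 0 X w = c - G (push 0 π c) := by
    suffices hs : (LinearMap.id - G.comp (push 0 π) : Chain 0 X →ₗ[ℚ] Chain 0 X) c ∈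
      (chainsIn 1 (π ⁻¹' ⋃ i, O i)).map (bd 0 X) from hs
    refine map_mem_of_supported (fun σ hσ => ?_) hc
    obtain ⟨i, hi⟩ := mem_iUnion.1 (hσ ⟨t₀, rfl⟩)
    obtain ⟨w, hw, hwb⟩ := exists_bd_eq_of_joinedIn ((hpc i).joinedIn (a i) (ha i) (σ t₀) hi)
    refine ⟨w, chainsIn_mono _ (preimage_mono (subset_iUnion O i)) hw, ?_⟩
    rw [hwb, LinearMap.sub_apply, LinearMap.comp_apply, push_single, LinearMap.id_apply]
    simp only [G, Finsupp.linearCombination_single, one_smul]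
    rw [hg _ i hi]
    congr 2
    ext t
    rw [Subsingleton.elim t t₀]
    rfl
  obtain ⟨w, hw, hwb⟩ := hG2
  exact ⟨w, hw, by rw [hwb, ← hdc, hG1, sub_zero]⟩

/-- **Betti numbers under collapsing**: if `π : X → Y` is a homeomorphism off a closed set `F`
contained in the disjoint union of the open sets `O i`, which are acyclic in degree one and have
path connected preimages, and if the second Betti numbers of `Y` and of the preimages vanish, then
so does that of `X`, and the first Betti number of `X` is that of `Y` plus those of the
preimages. -/
theorem betti_collapse {F : Set Y} (h : LiftsOff π F) (hF : IsClosed F) (hO : ∀ i, IsOpen (O i))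
    (hd : Pairwise (Function.onFun Disjoint O)) (hFO : F ⊆ ⋃ i, O i)
    (hpc : ∀ i, IsPathConnected (π ⁻¹' O i)) (hO1 : ∀ i, betti 1 (O i) = 0)
    (hY : betti 2 Y = 0) (hQ : ∀ i, betti 2 (π ⁻¹' O i) = 0) :
    betti 2 X = 0 ∧ betti 1 X = betti 1 Y + ∑ i, betti 1 (π ⁻¹' O i) := by
  have hOu : IsOpen (⋃ i, O i) := isOpen_iUnion hO
  set Q : Set X := π ⁻¹' ⋃ i, O i with hQdef
  have hsub : ∀ {Z : Type} [TopologicalSpace Z] (S : ι → Set Z) (n : ℕ), (∀ i, IsOpen (S i)) →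
      Pairwise (Function.onFun Disjoint S) →
      betti (n + 1) (⋃ i, S i : Set Z) = ∑ i, betti (n + 1) (S i) := by
    intro Z _ S n hS hdS
    rw [betti_eq_sum n (X := (⋃ i, S i : Set Z)) (S := fun i => Subtype.val ⁻¹' S i)
      (fun i => (hS i).preimage continuous_subtype_val)
      (fun i j hij => (hdS hij).preimage _)
      (by rw [← preimage_iUnion]; exact Subtype.coe_preimage_self _)]
    refine Finset.sum_congr rfl fun i _ => betti_eq_of_homeomorph n ?_
    exact
      { toFun := fun x => ⟨x.1.1, x.2⟩
        invFun := fun x => ⟨⟨x.1, mem_iUnion.2 ⟨i, x.2⟩⟩, x.2⟩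
        left_inv := fun x => rfl
        right_inv := fun x => rfl
        continuous_toFun := by fun_prop
        continuous_invFun := by fun_prop }
  have hOO : betti 1 (⋃ i, O i : Set Y) = 0 := by
    rw [hsub O 0 hO hd]; exact Finset.sum_eq_zero fun i _ => hO1 i
  have hQO : ∀ i, IsOpen (π ⁻¹' O i) := fun i => (hO i).preimage π.continuous
  have hQd : Pairwise (Function.onFun Disjoint fun i => π ⁻¹' O i) :=
    fun i j hij => (hd hij).preimage _
  have hQeq : Q = ⋃ i, π ⁻¹' O i := preimage_iUnion
  have hQ2 : betti 2 Q = 0 := by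
    rw [hQeq, hsub _ 1 hQO hQd]; exact Finset.sum_eq_zero fun i _ => hQ i
  have hQ1 : betti 1 Q = ∑ i, betti 1 (π ⁻¹' O i) := by
    rw [hQeq, hsub _ 0 hQO hQd]
  have hO1' : ∀ z ∈ chainsIn 1 (⋃ i, O i), bd 0 Y z = 0 →
      ∃ b ∈ chainsIn 2 (⋃ i, O i), bd 1 Y b = z := fun z hz hbd => exists_bd_eq_mem_of_betti hOO hz hbd
  have hY' : ∀ z, bd 1 Y z = 0 → ∃ b, bd 2 Y b = z :=
    fun z hz => exists_bd_eq_of_betti_eq_zero hY z hz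
  constructor
  · refine betti_eq_zero_of_exists_bd_eq fun z hz => ?_
    obtain ⟨b, hb⟩ := hY' _ (push_cycle π hz)
    obtain ⟨q, hq, hq0, e, he⟩ := h.exists_cycle_mem hF hOu hFO hz hb
    obtain ⟨w, -, hw⟩ := exists_bd_eq_mem_of_betti hQ2 hq hq0
    exact ⟨e + w, by rw [map_add, he, hw]; abel⟩
  · rw [← hQ1]
    simp only [betti_eq_rank]
    -- What follows is the exactness of 0 → H₁(Q) → H₁(X) → H₁(Y) → 0, from which the ranks add by
    -- rank-nullity. Injectivity is where H₂(Y) = 0 enters, surjectivity where the preimages of the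
    -- O i must be path connected.
    have hinj : Function.Injective (Hmap 0 (incl Q)) := by
      rw [injective_iff_map_eq_zero]
      intro w hw
      obtain ⟨z, hz, rfl⟩ := exists_hcls 0 w
      rw [Hmap_hcls, hcls_eq_zero] at hw
      obtain ⟨b, hb⟩ := hw
      obtain ⟨v, hv, hvb⟩ := h.exists_bd_eq_mem hF hOu hFO hO1' hY' (push_incl_mem 1 Q z) hb
      obtain ⟨v, rfl⟩ := exists_push_incl_eq hv
      refine (hcls_eq_zero 0 _ _).2 ⟨v, push_incl_injective _ _ ?_⟩
      rw [push_bd, hvb]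
    have hsurj : Function.Surjective (Hmap 0 π) := by
      intro w
      obtain ⟨y, hy, rfl⟩ := exists_hcls 0 w
      obtain ⟨x, hx, hb⟩ := h.exists_push_sub_eq hF hOu hFO hO1'
        (fun c hc d hd' hdc => exists_bd_eq_of_isPathConnected hO hd hpc hc hd' hdc) hy
      exact ⟨hcls 0 x hx, by rw [Hmap_hcls]; exact (hcls_eq 0 _ _ _ _).2 hb⟩
    have hker : LinearMap.ker (Hmap 0 π) = LinearMap.range (Hmap 0 (incl Q)) := by
      ext w
      constructor
      · intro hw
        obtain ⟨x, hx, rfl⟩ := exists_hcls 0 w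
        rw [LinearMap.mem_ker, Hmap_hcls, hcls_eq_zero] at hw
        obtain ⟨b, hb⟩ := hw
        obtain ⟨q, hq, hq0, he⟩ := h.exists_cycle_mem hF hOu hFO hx hb
        obtain ⟨d, rfl, hd0⟩ := exists_push_incl_cycle hq hq0
        refine ⟨hcls 0 d hd0, ?_⟩
        rw [Hmap_hcls]
        symm
        exact (hcls_eq 0 _ _ _ _).2 he
      · rintro ⟨v, rfl⟩
        obtain ⟨z, hz, rfl⟩ := exists_hcls 0 v
        rw [LinearMap.mem_ker, Hmap_hcls, Hmap_hcls, hcls_eq_zero]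
        obtain ⟨b, -, hb⟩ := hO1' _ (push_mem_chainsIn (fun _ hx => hx) (push_incl_mem 1 Q z))
          (push_cycle π (push_cycle _ hz))
        exact ⟨b, hb⟩
    rw [← LinearMap.rank_range_add_rank_ker (Hmap 0 π), hker, rank_range_of_surjective _ hsurj,
      (LinearEquiv.ofInjective _ hinj).rank_eq]

end

end

noncomputable section

/-! ### Winding numbers -/

/-- A non-vanishing continuous function on a normed space has a continuous logarithm. -/
lemma exists_log {E : Type} [NormedAddCommGroup E] [NormedSpace ℝ E] {f : E → ℂ}
    (hf : Continuous f) (h0 : ∀ x, f x ≠ 0) :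
    ∃ L : E → ℂ, Continuous L ∧ ∀ x, Complex.exp (L x) = f x := by
  obtain ⟨F, ⟨-, hF⟩, -⟩ := Complex.isCoveringMapOn_exp.existsUnique_continuousMap_lifts
    (⟨f, hf⟩ : C(E, ℂ)) (a₀ := 0) (e₀ := Complex.log (f 0)) (Complex.exp_log (h0 0))
    (fun x => h0 x)
  exact ⟨F, F.continuous, fun x => congrFun hF x⟩

/-- The values lie in the discrete set 2πiℤ. Applied to differences of logarithms, this yields all
rigidity of winding numbers below. -/
lemma eq_of_exp_eq_one {A : Type} [TopologicalSpace A] {s : Set A} (hs : IsPreconnected s)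
    {f : A → ℂ} (hf : ContinuousOn f s) (h : ∀ x ∈ s, Complex.exp (f x) = 1) {x y : A}
    (hx : x ∈ s) (hy : y ∈ s) : f x = f y :=
  Complex.isCoveringMap_exp.constOn_of_comp hs hf
    (fun a ha b hb => Subtype.ext ((h a ha).trans (h b hb).symm)) hx hy

/-- The loop `γ` in the punctured plane has winding number `d`. -/
def HasWinding (γ : ℝ → ℂ) (d : ℤ) : Prop :=
  ∃ θ : ℝ → ℝ, Continuous θ ∧ θ 1 = θ 0 + d ∧
    ∀ t ∈ Icc (0 : ℝ) 1, γ t ≠ 0 ∧ γ t = ‖γ t‖ * Complex.exp (2 * Real.pi * Complex.I * θ t)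

lemma hasWinding_of_log {γ : ℝ → ℂ} {L : ℝ → ℂ} (hL : ContinuousOn L (Icc 0 1)) {d : ℤ}
    (h : ∀ t ∈ Icc (0 : ℝ) 1, Complex.exp (L t) = γ t)
    (hd : (L 1).im = (L 0).im + d * (2 * Real.pi)) : HasWinding γ d := by
  have hL' : Continuous (fun t => L (projIcc (0 : ℝ) 1 zero_le_one t)) :=
    (continuousOn_iff_continuous_domRestrict.1 hL).comp continuous_projIcc
  refine ⟨fun t => (L (projIcc (0 : ℝ) 1 zero_le_one t)).im / (2 * Real.pi), ?_, ?_, ?_⟩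
  · exact (Complex.continuous_im.comp hL').div_const _
  · simp only [projIcc_left, projIcc_right, hd]
    field_simp [Real.pi_ne_zero]
  · intro t ht
    dsimp only
    rw [projIcc_of_mem _ ht, ← h t ht]
    refine ⟨Complex.exp_ne_zero _, ?_⟩
    rw [Complex.norm_exp, Complex.ofReal_exp, ← Complex.exp_add]
    congr 1
    have hpi : (Real.pi : ℂ) ≠ 0 := Complex.ofReal_ne_zero.2 Real.pi_ne_zero
    conv_lhs => rw [← Complex.re_add_im (L t)]
    push_cast
    field_simp

/-- The function ln‖γ‖ + 2πiθ is another logarithm of γ, and two continuous logarithms differ by a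
constant. -/
lemma HasWinding.log_eq {γ : ℝ → ℂ} {d : ℤ} (hγ : HasWinding γ d) {L : ℝ → ℂ}
    (hL : ContinuousOn L (Icc 0 1)) (h : ∀ t ∈ Icc (0 : ℝ) 1, Complex.exp (L t) = γ t) :
    (L 1).im = (L 0).im + d * (2 * Real.pi) := by
  obtain ⟨θ, hθ, hd, hγθ⟩ := hγ
  have hpi : (Real.pi : ℂ) ≠ 0 := Complex.ofReal_ne_zero.2 Real.pi_ne_zero
  have key := eq_of_exp_eq_one (s := Icc (0 : ℝ) 1) isPreconnected_Icc
    (f := fun t => L t - (L t).re - 2 * Real.pi * Complex.I * θ t)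
    ((hL.sub (Complex.continuous_ofReal.comp_continuousOn
      (Complex.continuous_re.comp_continuousOn hL))).sub (by fun_prop)) (fun t ht => by
      have h1 := (hγθ t ht).2
      have h2 : (‖γ t‖ : ℂ) = Complex.exp (L t).re := by
        rw [← h t ht, Complex.norm_exp, Complex.ofReal_exp]
      rw [Complex.exp_sub, Complex.exp_sub, h t ht, ← h2, div_div, ← h1,
        div_self (hγθ t ht).1]) (x := 0) (y := 1) (by simp) (by simp)
  have := congrArg Complex.im key
  simp at this
  rw [hd] at this
  linarith

/-- The winding number is invariant under homotopies of loops. -/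
lemma HasWinding.of_homotopy {H : ℝ → ℝ → ℂ}
    (hH : ContinuousOn (Function.uncurry H) (Icc 0 1 ×ˢ Icc 0 1))
    (h0 : ∀ s ∈ Icc (0 : ℝ) 1, ∀ t ∈ Icc (0 : ℝ) 1, H s t ≠ 0)
    (hloop : ∀ s ∈ Icc (0 : ℝ) 1, H s 0 = H s 1) {d : ℤ} (hd : HasWinding (H 0) d) :
    HasWinding (H 1) d := by
  -- Clamping both parameters to [0, 1] extends H to the whole plane, as `exists_log` requires.
  let P : ℝ × ℝ → ℝ × ℝ := fun p => (projIcc (0 : ℝ) 1 zero_le_one p.1,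
    projIcc (0 : ℝ) 1 zero_le_one p.2)
  have hP : Continuous P := by fun_prop
  have hPm : ∀ p, P p ∈ Icc (0 : ℝ) 1 ×ˢ Icc (0 : ℝ) 1 := fun p => ⟨Subtype.mem _, Subtype.mem _⟩
  obtain ⟨L, hL, hLe⟩ := exists_log (f := fun p => Function.uncurry H (P p))
    (hH.comp_continuous hP hPm) (fun p => h0 _ (hPm p).1 _ (hPm p).2)
  have hLH : ∀ s ∈ Icc (0 : ℝ) 1, ∀ t ∈ Icc (0 : ℝ) 1, Complex.exp (L (s, t)) = H s t := by
    intro s hs t ht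
    rw [hLe]
    simp [P, projIcc_of_mem _ hs, projIcc_of_mem _ ht, Function.uncurry]
  have hslice : ∀ s, Continuous fun t => L (s, t) := fun s => hL.comp (by fun_prop)
  have h00 : (0 : ℝ) ∈ Icc (0 : ℝ) 1 := by simp
  have h11 : (1 : ℝ) ∈ Icc (0 : ℝ) 1 := by simp
  -- Since every H s is a loop, the increment of the logarithm along it is an integral multiple of
  -- 2πi, hence independent of s.
  have key := eq_of_exp_eq_one (s := Icc (0 : ℝ) 1) isPreconnected_Icc
    (f := fun s => L (s, 1) - L (s, 0)) (by fun_prop)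
    (fun s hs => by
      rw [Complex.exp_sub, hLH s hs 1 h11, hLH s hs 0 h00, hloop s hs,
        div_self (h0 s hs 1 h11)]) h00 h11
  have h2 := hd.log_eq (hslice 0).continuousOn (fun t ht => hLH 0 h00 t ht)
  refine hasWinding_of_log (hslice 1).continuousOn (fun t ht => hLH 1 h11 t ht) ?_
  have := congrArg Complex.im key
  simp only [Complex.sub_im] at this
  linarith

lemma HasWinding.congr {γ δ : ℝ → ℂ} {d : ℤ} (h : HasWinding γ d)
    (hγδ : ∀ t ∈ Icc (0 : ℝ) 1, γ t = δ t) : HasWinding δ d := by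
  obtain ⟨θ, h1, h2, h3⟩ := h
  exact ⟨θ, h1, h2, fun t ht => by rw [← hγδ t ht]; exact h3 t ht⟩

/-- The standard parametrization of the unit circle. -/
def circ (t : ℝ) : ℂ := Complex.exp (2 * Real.pi * Complex.I * t)

@[fun_prop] lemma continuous_circ : Continuous circ := by unfold circ; fun_prop

@[simp] lemma norm_circ (t : ℝ) : ‖circ t‖ = 1 := by
  rw [circ, show (2 * Real.pi * Complex.I * t : ℂ) = ((2 * Real.pi * t : ℝ) : ℂ) * Complex.I by
    push_cast; ring]
  exact Complex.norm_exp_ofReal_mul_I _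

lemma circ_zero : circ 0 = 1 := by simp [circ]

lemma circ_one : circ 1 = 1 := by simp [circ, Complex.exp_two_pi_mul_I]

lemma circ_add_half (t : ℝ) : circ (t + 1 / 2) = -circ t := by
  rw [circ, circ, show (2 * Real.pi * Complex.I * ((t + 1 / 2 : ℝ) : ℂ) : ℂ) =
    2 * Real.pi * Complex.I * t + Real.pi * Complex.I by push_cast; ring, Complex.exp_add,
    Complex.exp_pi_mul_I]
  ring

/-- An odd loop does not have winding number zero. -/
lemma not_hasWinding_zero_of_odd {γ : ℝ → ℂ} (hodd : ∀ t ∈ Icc (0 : ℝ) (1 / 2),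
    γ (t + 1 / 2) = -γ t) (h : HasWinding γ 0) : False := by
  obtain ⟨θ, hθ, hd, hγ⟩ := h
  have hsub : ∀ t ∈ Icc (0 : ℝ) (1 / 2), t ∈ Icc (0 : ℝ) 1 ∧ t + 1 / 2 ∈ Icc (0 : ℝ) 1 :=
    fun t ht => ⟨⟨ht.1, by linarith [ht.2]⟩, ⟨by linarith [ht.1], by linarith [ht.2]⟩⟩
  have hexp : ∀ t ∈ Icc (0 : ℝ) (1 / 2),
      Complex.exp (2 * Real.pi * Complex.I * (θ (t + 1 / 2) - θ t - 1 / 2)) = 1 := by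
    intro t ht
    obtain ⟨h1, h2⟩ := hγ t (hsub t ht).1
    obtain ⟨-, h3⟩ := hγ _ (hsub t ht).2
    rw [hodd t ht, norm_neg] at h3
    have hn : (‖γ t‖ : ℂ) ≠ 0 := by simpa using h1
    have h4 : Complex.exp (2 * Real.pi * Complex.I * θ (t + 1 / 2)) =
        -Complex.exp (2 * Real.pi * Complex.I * θ t) := by
      apply mul_left_cancel₀ hn
      rw [← h3, mul_neg, ← h2]
    rw [show (2 * Real.pi * Complex.I * (θ (t + 1 / 2) - θ t - 1 / 2) : ℂ) =
      2 * Real.pi * Complex.I * θ (t + 1 / 2) - 2 * Real.pi * Complex.I * θ t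
        - Real.pi * Complex.I by ring, Complex.exp_sub, Complex.exp_sub, h4, Complex.exp_pi_mul_I]
    field_simp
  -- Thus θ(t + 1/2) − θ(t) − 1/2 is a constant integer k. Adding its values at t = 0 and t = 1/2
  -- gives θ(1) − θ(0) = 2k + 1, which cannot be zero.
  have key := eq_of_exp_eq_one (s := Icc (0 : ℝ) (1 / 2)) isPreconnected_Icc
    (f := fun t => 2 * Real.pi * Complex.I * (θ (t + 1 / 2) - θ t - 1 / 2)) (by fun_prop) hexp
    (x := 0) (y := 1 / 2) (by norm_num) (by norm_num)
  obtain ⟨k, hk⟩ := Complex.exp_eq_one_iff.1 (hexp 0 (by norm_num))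
  norm_num at key
  have hpi : (Real.pi : ℂ) ≠ 0 := Complex.ofReal_ne_zero.2 Real.pi_ne_zero
  have h5 : (θ (1 / 2) - θ 0 - 1 / 2 : ℂ) = k := by
    have hk' : (2 * Real.pi * Complex.I) * (θ (1 / 2) - θ 0 - 1 / 2 : ℂ) =
        (2 * Real.pi * Complex.I) * k := by
      rw [mul_comm _ (k : ℂ), ← hk]; norm_num
    exact mul_left_cancel₀ (by simp [hpi]) hk'
  have h6 : (θ (1 / 2) - θ 0 - 1 / 2 : ℂ) = θ 1 - θ (1 / 2) - 1 / 2 := by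
    linear_combination key
  have h6' : θ (1 / 2) - θ 0 - 1 / 2 = θ 1 - θ (1 / 2) - 1 / 2 := by
    apply Complex.ofReal_injective; push_cast; exact h6
  have h7 : (θ (1 / 2) - θ 0 - 1 / 2 : ℝ) = k := by
    apply Complex.ofReal_injective; push_cast; exact h5
  have h8 : (2 * k + 1 : ℝ) = 0 := by
    rw [← h7]; simp at hd; linarith
  have : (2 * k + 1 : ℤ) = 0 := by exact_mod_cast h8
  omega


/-! ### Invariance of domain in the plane -/

/-- Otherwise φ misses points y arbitrarily close to 0. Then φ − y has a logarithm on the disk, so φ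
on the unit circle has winding number 0 around y and, y being small, also around 0. But injectivity
allows a homotopy of this loop to an odd one, whose winding number is not zero. -/
lemma mem_interior_image_closedBall_of_zero {φ : ℂ → ℂ}
    (hc : ContinuousOn φ (Metric.closedBall 0 1)) (hi : InjOn φ (Metric.closedBall 0 1))
    (h0 : φ 0 = 0) : (0 : ℂ) ∈ interior (φ '' Metric.closedBall 0 1) := by
  by_contra hn
  have hcirc : ∀ t, circ t ∈ Metric.closedBall (0 : ℂ) 1 := fun t => by simp
  have hmem : ∀ a t : ℝ, |a| ≤ 1 → (a : ℂ) * circ t ∈ Metric.closedBall (0 : ℂ) 1 := by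
    intro a t ha; simpa using ha
  have hzero : (0 : ℂ) ∈ Metric.closedBall (0 : ℂ) 1 := by simp
  have hφc : Continuous fun t => φ (circ t) := hc.comp_continuous continuous_circ hcirc
  have hne : ∀ t, φ (circ t) ≠ 0 := by
    intro t h
    have := hi (hcirc t) hzero (h.trans h0.symm)
    have h1 := norm_circ t
    rw [this] at h1; simp at h1
  obtain ⟨t0, -, ht0⟩ := (isCompact_Icc (a := (0 : ℝ)) (b := 1)).exists_isMinOn
    ⟨0, by simp⟩ (hφc.norm.continuousOn)
  have hδ : 0 < ‖φ (circ t0)‖ := norm_pos_iff.2 (hne t0)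
  obtain ⟨y, hyK, hyδ⟩ : ∃ y, y ∉ φ '' Metric.closedBall 0 1 ∧ ‖y‖ < ‖φ (circ t0)‖ := by
    by_contra! hcon
    refine hn (mem_interior.2 ⟨Metric.ball 0 ‖φ (circ t0)‖, fun y hy => ?_, Metric.isOpen_ball,
      Metric.mem_ball_self hδ⟩)
    by_contra hyK
    exact absurd (hcon y hyK) (not_le.2 (by simpa using hy))
  -- The radial retraction of the plane onto the disk, so that `exists_log` applies on the whole
  -- plane.
  have hcl : Continuous fun z : ℂ => z / (max 1 ‖z‖ : ℝ) :=
    continuous_id.div (by fun_prop) (fun z => by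
      have : (0 : ℝ) < max 1 ‖z‖ := lt_of_lt_of_le one_pos (le_max_left _ _)
      exact_mod_cast this.ne')
  have hclm : ∀ z : ℂ, z / (max 1 ‖z‖ : ℝ) ∈ Metric.closedBall (0 : ℂ) 1 := by
    intro z
    have : (0 : ℝ) < max 1 ‖z‖ := lt_of_lt_of_le one_pos (le_max_left _ _)
    rw [mem_closedBall_zero_iff, norm_div, Complex.norm_real, Real.norm_of_nonneg this.le,
      div_le_one this]
    exact le_max_right _ _
  obtain ⟨L, hL, hLe⟩ := exists_log (f := fun z : ℂ => φ (z / (max 1 ‖z‖ : ℝ)) - y)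
    ((hc.comp_continuous hcl hclm).sub continuous_const)
    (fun z h => hyK ⟨_, hclm z, sub_eq_zero.1 h⟩)
  have w1 : HasWinding (fun t => φ (circ t) - y) 0 :=
    hasWinding_of_log (L := fun t => L (circ t)) (hL.comp continuous_circ).continuousOn
      (fun t _ => by simp [hLe]) (by simp [circ_one, circ_zero])
  have w2 : HasWinding (fun t => φ (circ t)) 0 := by
    have := HasWinding.of_homotopy (H := fun s t => φ (circ t) - (1 - s) * y)
      (by
        refine Continuous.continuousOn ?_
        exact (hφc.comp continuous_snd).sub (by fun_prop))
      (fun s hs t ht h => ?_) (fun s _ => by simp [circ_one, circ_zero])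
      (w1.congr fun t _ => by simp)
    · exact this.congr fun t _ => by simp
    · have h1 : φ (circ t) = (1 - s) * y := sub_eq_zero.1 h
      have h2 : ‖φ (circ t)‖ ≤ ‖y‖ := by
        rw [h1, norm_mul, show (1 - s : ℂ) = ((1 - s : ℝ) : ℂ) by push_cast; ring,
          Complex.norm_real, Real.norm_of_nonneg (by linarith [hs.2])]
        exact mul_le_of_le_one_left (norm_nonneg _) (by linarith [hs.1])
      exact absurd (ht0 ht) (not_le.2 (lt_of_le_of_lt h2 hyδ))
  have hb1 : ∀ s ∈ Icc (0 : ℝ) 1, |1 / (1 + s)| ≤ 1 := by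
    intro s hs
    rw [abs_of_nonneg (by have := hs.1; positivity), div_le_one (by linarith [hs.1])]
    linarith [hs.1]
  have hb2 : ∀ s ∈ Icc (0 : ℝ) 1, |-s / (1 + s)| ≤ 1 := by
    intro s hs
    rw [neg_div, abs_neg, abs_of_nonneg (by have := hs.1; positivity),
      div_le_one (by linarith [hs.1])]
    linarith [hs.1]
  -- The two arguments of φ lie in the disk and differ by the point of the circle itself, so their
  -- images are distinct. At s = 0 the loop is φ, at s = 1 it is the odd loop φ(z/2) − φ(−z/2).
  have w3 := HasWinding.of_homotopy (d := 0)
    (H := fun s t => φ ((1 / (1 + s) : ℝ) * circ t) - φ ((-s / (1 + s) : ℝ) * circ t))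
    (by
      have hd : ContinuousOn (fun p : ℝ × ℝ => 1 / (1 + p.1)) (Icc 0 1 ×ˢ Icc 0 1) :=
        ContinuousOn.div (by fun_prop) (by fun_prop) (fun p hp => by
          have := hp.1.1; positivity)
      have hd' : ContinuousOn (fun p : ℝ × ℝ => -p.1 / (1 + p.1)) (Icc 0 1 ×ˢ Icc 0 1) :=
        ContinuousOn.div (by fun_prop) (by fun_prop) (fun p hp => by
          have := hp.1.1; positivity)
      refine ContinuousOn.sub (hc.comp ?_ fun p hp => hmem _ _ (hb1 _ hp.1))
        (hc.comp ?_ fun p hp => hmem _ _ (hb2 _ hp.1))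
      · exact (Complex.continuous_ofReal.comp_continuousOn hd).mul (by fun_prop)
      · exact (Complex.continuous_ofReal.comp_continuousOn hd').mul (by fun_prop))
    (fun s hs t ht h => by
      have h1 := hi (hmem _ _ (hb1 s hs)) (hmem _ _ (hb2 s hs)) (sub_eq_zero.1 h)
      have h2 : circ t ≠ 0 := fun h => by simpa [h] using norm_circ t
      have h3 := Complex.ofReal_injective (mul_right_cancel₀ h2 h1)
      have h4 : 0 < 1 + s := by linarith [hs.1]
      field_simp at h3
      linarith [hs.1])
    (fun s _ => by simp [circ_one, circ_zero]) (w2.congr fun t _ => by simp [h0])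
  refine not_hasWinding_zero_of_odd (fun t _ => ?_) w3
  simp only [circ_add_half]
  norm_num
  try rw [neg_div]
  try ring

/-- Invariance of domain in the plane. -/
theorem mem_interior_image_closedBall {φ : ℂ → ℂ} {c : ℂ} {R : ℝ} (hR : 0 < R)
    (hc : ContinuousOn φ (Metric.closedBall c R)) (hi : InjOn φ (Metric.closedBall c R)) :
    φ c ∈ interior (φ '' Metric.closedBall c R) := by
  have hm : MapsTo (fun z : ℂ => c + R * z) (Metric.closedBall 0 1) (Metric.closedBall c R) := by
    intro z hz
    have : ‖z‖ ≤ 1 := by simpa using hz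
    rw [mem_closedBall_iff_norm, add_sub_cancel_left, norm_mul, Complex.norm_real,
      Real.norm_of_nonneg hR.le]
    exact mul_le_of_le_one_right hR.le this
  have hR' : (R : ℂ) ≠ 0 := Complex.ofReal_ne_zero.2 hR.ne'
  have key := mem_interior_image_closedBall_of_zero (φ := fun z => φ (c + R * z) - φ c)
    ((hc.comp (by fun_prop) hm).sub continuousOn_const)
    (fun x hx y hy h => by
      have := hi (hm hx) (hm hy) (sub_left_injective h)
      simpa [hR'] using this) (by simp)
  obtain ⟨U, hU, hUo, h0⟩ := mem_interior.1 key
  refine mem_interior.2 ⟨(fun z => z - φ c) ⁻¹' U, fun y hy => ?_, hUo.preimage (by fun_prop),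
    by simpa using h0⟩
  obtain ⟨z, hz, hzy⟩ := hU hy
  exact ⟨_, hm hz, sub_left_injective hzy⟩

end

noncomputable section

/-! ### Affine coordinates on the sphere -/

/-- The parametrization of the complement of the point `q` of the sphere by the plane. -/
def affinePt (q : Sphere2) : ℂ → Sphere2 :=
  q.elim (fun z => (z : Sphere2))
    (fun a z => if z = 0 then OnePoint.infty else ((a + z⁻¹ : ℂ) : Sphere2))

/-- The coordinate on the complement of the point `q` of the sphere: `z` if `q = ∞` and
`1 / (z - q)` otherwise. -/
def affineCoord (q : Sphere2) : Sphere2 → ℂ :=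
  q.elim (fun y => y.elim 0 id) (fun a y => y.elim 0 (fun z => (z - a)⁻¹))

lemma affineCoord_affinePt (q : Sphere2) (z : ℂ) : affineCoord q (affinePt q z) = z := by
  induction q using OnePoint.rec with
  | infty => rfl
  | coe a =>
    by_cases h : z = 0
    · subst h; simp [affineCoord, affinePt]
    · simp [affineCoord, affinePt, h]

lemma affinePt_ne (q : Sphere2) (z : ℂ) : affinePt q z ≠ q := by
  induction q using OnePoint.rec with
  | infty => exact OnePoint.coe_ne_infty z
  | coe a =>
    by_cases h : z = 0
    · subst h; simp [affinePt]
    · simp [affinePt, h]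

lemma affinePt_affineCoord {q y : Sphere2} (h : y ≠ q) : affinePt q (affineCoord q y) = y := by
  induction q using OnePoint.rec with
  | infty =>
    induction y using OnePoint.rec with
    | infty => exact absurd rfl h
    | coe z => rfl
  | coe a =>
    induction y using OnePoint.rec with
    | infty => simp [affineCoord, affinePt]
    | coe z =>
      have : z - a ≠ 0 := fun h' => h (by rw [sub_eq_zero.1 h'])
      simp [affineCoord, affinePt, this]

lemma injOn_affineCoord (q : Sphere2) : InjOn (affineCoord q) {q}ᶜ := fun x hx y hy h => by
  rw [← affinePt_affineCoord hx, h, affinePt_affineCoord hy]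

lemma continuous_affinePt (q : Sphere2) : Continuous (affinePt q) := by
  induction q using OnePoint.rec with
  | infty => exact OnePoint.continuous_coe
  | coe a =>
    rw [continuous_iff_continuousAt]
    intro z
    by_cases h : z = 0
    · subst h
      rw [continuousAt_iff_punctured_nhds]
      have h1 : Tendsto (fun z : ℂ => ((a + z⁻¹ : ℂ) : Sphere2)) (𝓝[≠] 0) (𝓝 OnePoint.infty) := by
        refine OnePoint.tendsto_coe_infty.comp ?_
        rw [coclosedCompact_eq_cocompact, ← Metric.cobounded_eq_cocompact]
        exact (tendsto_const_add_cobounded a).comp tendsto_inv₀_nhdsNE_zero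
      refine Tendsto.congr' ?_ (by simpa [affinePt] using h1)
      filter_upwards [self_mem_nhdsWithin] with z hz
      have hz' : z ≠ 0 := hz
      simp [affinePt, hz']
    · have h1 : ContinuousAt (fun z : ℂ => ((a + z⁻¹ : ℂ) : Sphere2)) z :=
        OnePoint.continuous_coe.continuousAt.comp (continuousAt_const.add (continuousAt_inv₀ h))
      refine h1.congr ?_
      filter_upwards [isOpen_ne.mem_nhds h] with z hz
      have hz' : z ≠ 0 := hz
      simp [affinePt, hz']

lemma continuousAt_affineCoord {q y : Sphere2} (h : y ≠ q) : ContinuousAt (affineCoord q) y := by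
  induction q using OnePoint.rec with
  | infty =>
    induction y using OnePoint.rec with
    | infty => exact absurd rfl h
    | coe z => rw [OnePoint.continuousAt_coe]; exact continuousAt_id
  | coe a =>
    induction y using OnePoint.rec with
    | infty =>
      rw [OnePoint.continuousAt_infty', coclosedCompact_eq_cocompact,
        ← Metric.cobounded_eq_cocompact]
      exact tendsto_inv₀_cobounded.comp (tendsto_sub_const_cobounded a)
    | coe z =>
      rw [OnePoint.continuousAt_coe]
      have : z - a ≠ 0 := fun h' => h (by rw [sub_eq_zero.1 h'])
      exact (continuousAt_id.sub continuousAt_const).inv₀ this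

lemma continuousOn_affineCoord (q : Sphere2) : ContinuousOn (affineCoord q) {q}ᶜ :=
  fun _ hy => (continuousAt_affineCoord hy).continuousWithinAt

lemma isOpenMap_affinePt (q : Sphere2) : IsOpenMap (affinePt q) := by
  intro U hU
  have : affinePt q '' U = {q}ᶜ ∩ affineCoord q ⁻¹' U := by
    ext y
    constructor
    · rintro ⟨z, hz, rfl⟩
      exact ⟨affinePt_ne q z, by simpa [affineCoord_affinePt] using hz⟩
    · rintro ⟨h1, h2⟩
      exact ⟨_, h2, affinePt_affineCoord h1⟩
  rw [this]
  exact (continuousOn_affineCoord q).isOpen_inter_preimage isOpen_compl_singleton hU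

/-! ### Closed disks in the sphere -/

/-- A closed disk with center `w`, with a homeomorphism `Φ` from the unit disk and its inverse
`κ`. -/
structure DiskChart (D : Set Sphere2) (w : Sphere2) where
  Φ : ℂ → Sphere2
  κ : Sphere2 → ℂ
  contΦ : ContinuousOn Φ (Metric.closedBall 0 1)
  contκ : ContinuousOn κ D
  mapsΦ : ∀ z, ‖z‖ ≤ 1 → Φ z ∈ D
  mapsκ : ∀ y ∈ D, ‖κ y‖ ≤ 1
  κΦ : ∀ z, ‖z‖ ≤ 1 → κ (Φ z) = z
  Φκ : ∀ y ∈ D, Φ (κ y) = y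
  center : Φ 0 = w

namespace DiskChart

variable {D : Set Sphere2} {w : Sphere2}

lemma eq_image (C : DiskChart D w) : D = C.Φ '' Metric.closedBall 0 1 := by
  ext y
  constructor
  · exact fun hy => ⟨C.κ y, by simpa using C.mapsκ y hy, C.Φκ y hy⟩
  · rintro ⟨z, hz, rfl⟩
    exact C.mapsΦ z (by simpa using hz)

lemma isCompact (C : DiskChart D w) : IsCompact D := by
  rw [C.eq_image]
  exact (isCompact_closedBall 0 1).image_of_continuousOn C.contΦ

lemma isClosed (C : DiskChart D w) : IsClosed D := C.isCompact.isClosed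

lemma κ_center (C : DiskChart D w) : C.κ w = 0 := by
  have := C.κΦ 0 (by simp)
  rwa [C.center] at this

lemma center_mem (C : DiskChart D w) : w ∈ D := by rw [← C.center]; exact C.mapsΦ 0 (by simp)

lemma κ_eq_zero (C : DiskChart D w) {y : Sphere2} (hy : y ∈ D) : C.κ y = 0 ↔ y = w := by
  constructor
  · intro h; rw [← C.Φκ y hy, h, C.center]
  · rintro rfl; exact C.κ_center

lemma injOn_Φ (C : DiskChart D w) : InjOn C.Φ (Metric.closedBall 0 1) := fun x hx y hy h => by
  rw [← C.κΦ x (by simpa using hx), h, C.κΦ y (by simpa using hy)]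

/-- If D were the whole sphere, κ would be a non-vanishing function on the complement of w, which is
a plane, and would have a logarithm there. Evaluated along Φ of the unit circle this would give the
standard circle winding number zero. The omitted point supplies an affine coordinate on all of D. -/
lemma ne_univ (C : DiskChart D w) : ∃ q, q ∉ D := by
  by_contra! hD
  have hcont : Continuous C.κ := by
    rw [← continuousOn_univ]; exact C.contκ.mono fun y _ => hD y
  obtain ⟨L, hL, hLe⟩ := exists_log (f := fun z => C.κ (affinePt w z))
    (hcont.comp (continuous_affinePt w))
    (fun z h => affinePt_ne w z ((C.κ_eq_zero (hD _)).1 h))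
  have hne : ∀ t, C.Φ (circ t) ≠ w := fun t h => by
    have h1 := C.κΦ (circ t) (by simp)
    rw [h, C.κ_center] at h1
    simpa [← h1] using norm_circ t
  have hlc : Continuous fun t => L (affineCoord w (C.Φ (circ t))) :=
    hL.comp ((continuousOn_affineCoord w).comp_continuous
      (C.contΦ.comp_continuous continuous_circ (fun t => by simp)) hne)
  refine not_hasWinding_zero_of_odd (γ := circ) (fun t _ => circ_add_half t)
    (hasWinding_of_log hlc.continuousOn (fun t _ => ?_) (by simp [circ_zero, circ_one]))
  rw [hLe, affinePt_affineCoord (hne t), C.κΦ _ (by simp)]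

/-- Both directions are invariance of domain, for κ and for Φ respectively, read in an affine
coordinate centered at an omitted point. -/
lemma mem_interior_iff (C : DiskChart D w) {y : Sphere2} (hy : y ∈ D) :
    y ∈ interior D ↔ ‖C.κ y‖ < 1 := by
  obtain ⟨q, hq⟩ := C.ne_univ
  have hne : ∀ y ∈ D, y ≠ q := fun y hy h => hq (h ▸ hy)
  constructor
  · intro hyi
    have hU : affinePt q ⁻¹' interior D ∈ 𝓝 (affineCoord q y) :=
      (continuous_affinePt q).continuousAt.preimage_mem_nhds (by
        rw [affinePt_affineCoord (hne y hy)]; exact isOpen_interior.mem_nhds hyi)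
    obtain ⟨R, hR, hRU⟩ := Metric.nhds_basis_closedBall.mem_iff.1 hU
    have hm : ∀ z ∈ Metric.closedBall (affineCoord q y) R, affinePt q z ∈ D :=
      fun z hz => interior_subset (hRU hz)
    have key := mem_interior_image_closedBall hR (φ := fun z => C.κ (affinePt q z))
      (c := affineCoord q y)
      (C.contκ.comp (continuous_affinePt q).continuousOn hm)
      (fun a ha b hb h => by
        have h1 : affinePt q a = affinePt q b := by
          rw [← C.Φκ _ (hm a ha), ← C.Φκ _ (hm b hb)]; exact congrArg _ h
        rw [← affineCoord_affinePt q a, h1, affineCoord_affinePt])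
    rw [affinePt_affineCoord (hne y hy)] at key
    have hsub : (fun z => C.κ (affinePt q z)) '' Metric.closedBall (affineCoord q y) R ⊆
        Metric.closedBall 0 1 := by
      rintro _ ⟨z, hz, rfl⟩
      simpa using C.mapsκ _ (hm z hz)
    have := interior_mono hsub key
    rw [interior_closedBall _ one_ne_zero] at this
    simpa using this
  · intro hlt
    set R := 1 - ‖C.κ y‖ with hRdef
    have hR : 0 < R := by linarith
    have hsub : Metric.closedBall (C.κ y) R ⊆ Metric.closedBall 0 1 := by
      apply Metric.closedBall_subset_closedBall'
      rw [dist_zero_right]; linarith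
    have hΦ : ∀ z ∈ Metric.closedBall (C.κ y) R, C.Φ z ∈ D := fun z hz =>
      C.mapsΦ z (by simpa using hsub hz)
    have key := mem_interior_image_closedBall hR (φ := fun z => affineCoord q (C.Φ z))
      (c := C.κ y)
      ((continuousOn_affineCoord q).comp (C.contΦ.mono hsub) (fun z hz => hne _ (hΦ z hz)))
      (fun a ha b hb h => C.injOn_Φ (hsub ha) (hsub hb)
        (injOn_affineCoord q (hne _ (hΦ a ha)) (hne _ (hΦ b hb)) h))
    obtain ⟨U, hU, hUo, hyU⟩ := mem_interior.1 key
    refine mem_interior.2 ⟨affinePt q '' U, ?_, isOpenMap_affinePt q U hUo,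
      ⟨_, hyU, by rw [C.Φκ y hy, affinePt_affineCoord (hne y hy)]⟩⟩
    rintro _ ⟨u, hu, rfl⟩
    obtain ⟨z, hz, rfl⟩ := hU hu
    rw [affinePt_affineCoord (hne _ (hΦ z hz))]
    exact hΦ z hz

lemma center_mem_interior (C : DiskChart D w) : w ∈ interior D := by
  rw [C.mem_interior_iff C.center_mem, C.κ_center]; simp

/-- The concentric subdisk of radius `r`. -/
def sub (C : DiskChart D w) {r : ℝ} (hr : 0 < r) (hr1 : r ≤ 1) :
    DiskChart (C.Φ '' Metric.closedBall 0 r) w where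
  Φ z := C.Φ (r * z)
  κ y := (r : ℂ)⁻¹ * C.κ y
  contΦ := C.contΦ.comp (by fun_prop) (fun z hz => by
    have : ‖z‖ ≤ 1 := by simpa using hz
    rw [mem_closedBall_zero_iff, norm_mul, Complex.norm_real, Real.norm_of_nonneg hr.le]
    nlinarith)
  contκ := continuousOn_const.mul (C.contκ.mono (by
    rintro _ ⟨z, hz, rfl⟩
    exact C.mapsΦ z (le_trans (by simpa using hz) hr1)))
  mapsΦ z hz := ⟨_, by
    rw [mem_closedBall_zero_iff, norm_mul, Complex.norm_real, Real.norm_of_nonneg hr.le]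
    nlinarith, rfl⟩
  mapsκ := by
    rintro _ ⟨z, hz, rfl⟩
    have hz' : ‖z‖ ≤ r := by simpa using hz
    rw [C.κΦ z (hz'.trans hr1), norm_mul, norm_inv, Complex.norm_real,
      Real.norm_of_nonneg hr.le, inv_mul_le_iff₀ hr, mul_one]
    exact hz'
  κΦ z hz := by
    have hr' : (r : ℂ) ≠ 0 := Complex.ofReal_ne_zero.2 hr.ne'
    rw [C.κΦ, inv_mul_cancel_left₀ hr']
    rw [norm_mul, Complex.norm_real, Real.norm_of_nonneg hr.le]
    nlinarith
  Φκ := by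
    rintro _ ⟨z, hz, rfl⟩
    have hr' : (r : ℂ) ≠ 0 := Complex.ofReal_ne_zero.2 hr.ne'
    rw [mul_inv_cancel_left₀ hr', C.κΦ z (le_trans (by simpa using hz) hr1)]
  center := by simp [C.center]

end DiskChart

/-! ### Möbius transformations of the disk, and disk charts with a prescribed center. -/

lemma normSq_moebius (p z : ℂ) : Complex.normSq (1 + star p * z) - Complex.normSq (z + p) =
    (1 - Complex.normSq p) * (1 - Complex.normSq z) := by
  simp only [Complex.normSq_apply, Complex.star_def, Complex.add_re, Complex.add_im,
    Complex.mul_re, Complex.mul_im, Complex.conj_re, Complex.conj_im, Complex.one_re,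
    Complex.one_im]
  ring

lemma moebius_ne {p z : ℂ} (hp : ‖p‖ < 1) (hz : ‖z‖ ≤ 1) : 1 + star p * z ≠ 0 := by
  intro h
  have h1 : ‖star p * z‖ = 1 := by
    rw [show star p * z = -1 by linear_combination h]; simp
  rw [norm_mul, norm_star] at h1
  nlinarith [norm_nonneg p, norm_nonneg z]

lemma norm_moebius_le {p z : ℂ} (hp : ‖p‖ < 1) (hz : ‖z‖ ≤ 1) :
    ‖(z + p) / (1 + star p * z)‖ ≤ 1 := by
  rw [norm_div, div_le_one (norm_pos_iff.2 (moebius_ne hp hz))]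
  have h := normSq_moebius p z
  rw [Complex.normSq_eq_norm_sq, Complex.normSq_eq_norm_sq, Complex.normSq_eq_norm_sq,
    Complex.normSq_eq_norm_sq] at h
  have h1 : 0 ≤ (1 - ‖p‖ ^ 2) * (1 - ‖z‖ ^ 2) :=
    mul_nonneg (by nlinarith [norm_nonneg p]) (by nlinarith [norm_nonneg z])
  exact (sq_le_sq₀ (norm_nonneg _) (norm_nonneg _)).1 (by linarith)

lemma moebius_moebius {p z : ℂ} (hp : ‖p‖ < 1) (hz : ‖z‖ ≤ 1) :
    ((z + p) / (1 + star p * z) + -p) / (1 + star (-p) * ((z + p) / (1 + star p * z))) = z := by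
  have h0 := moebius_ne hp hz
  have h1 : (1 - star p * p : ℂ) ≠ 0 := by
    have := moebius_ne (p := p) (z := -p) hp (by simpa using hp.le)
    intro h; apply this; rw [← h]; ring
  have h2 : (z + p) / (1 + star p * z) + -p = z * (1 - star p * p) / (1 + star p * z) := by
    rw [div_add' _ _ _ h0]; congr 1; ring
  have h3 : 1 + star (-p) * ((z + p) / (1 + star p * z)) =
      (1 - star p * p) / (1 + star p * z) := by
    rw [star_neg, ← mul_div_assoc, add_div' _ _ _ h0]; congr 1; ring
  rw [h2, h3, div_div_div_cancel_right₀ h0, mul_div_cancel_right₀ _ h1]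

lemma continuousOn_moebius {p : ℂ} (hp : ‖p‖ < 1) :
    ContinuousOn (fun z : ℂ => (z + p) / (1 + star p * z)) (Metric.closedBall 0 1) :=
  ContinuousOn.div (by fun_prop) (by fun_prop) (fun z hz => moebius_ne hp (by simpa using hz))

/-- Recentering of a disk. -/
lemma DiskChart.recenter {D : Set Sphere2} {w w' : Sphere2} (C : DiskChart D w)
    (hw' : w' ∈ interior D) : Nonempty (DiskChart D w') := by
  have hD := interior_subset hw'
  have hp : ‖C.κ w'‖ < 1 := (C.mem_interior_iff hD).1 hw'
  set p := C.κ w' with hpdef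
  have hp' : ‖-p‖ < 1 := by simpa using hp
  -- The Möbius map with parameter p is a homeomorphism of the closed disk that takes 0 to p; its
  -- inverse is the one with parameter −p.
  exact ⟨{
    Φ := fun z => C.Φ ((z + p) / (1 + star p * z))
    κ := fun y => (C.κ y + -p) / (1 + star (-p) * C.κ y)
    contΦ := C.contΦ.comp (continuousOn_moebius hp)
      (fun z hz => by simpa using norm_moebius_le hp (by simpa using hz))
    contκ := (continuousOn_moebius hp').comp C.contκ (fun y hy => by simpa using C.mapsκ y hy)
    mapsΦ := fun z hz => C.mapsΦ _ (norm_moebius_le hp hz)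
    mapsκ := fun y hy => norm_moebius_le hp' (C.mapsκ y hy)
    κΦ := fun z hz => by
      rw [C.κΦ _ (norm_moebius_le hp hz)]; exact moebius_moebius hp hz
    Φκ := fun y hy => by
      have := moebius_moebius hp' (C.mapsκ y hy)
      rw [neg_neg] at this
      rw [this, C.Φκ y hy]
    center := by simp [hpdef, C.Φκ w' hD] }⟩

/-- A homeomorphism to the unit disk is extended by junk values outside D and outside the unit disk;
it sends some interior point to 0, and recentering moves 0 to w. -/
lemma IsClosedDisk.exists_diskChart {D : Set Sphere2} (hD : IsClosedDisk D) {w : Sphere2}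
    (hw : w ∈ interior D) : Nonempty (DiskChart D w) := by
  classical
  obtain ⟨e⟩ := hD
  have C : DiskChart D (e ⟨0, by simp⟩) := {
    Φ := fun z => if h : z ∈ Metric.closedBall (0 : ℂ) 1 then e ⟨z, h⟩ else OnePoint.infty
    κ := fun y => if h : y ∈ D then e.symm ⟨y, h⟩ else 0
    contΦ := by
      rw [continuousOn_iff_continuous_domRestrict]
      refine (continuous_subtype_val.comp e.continuous).congr fun z => ?_
      simp [domRestrict]
    contκ := by
      rw [continuousOn_iff_continuous_domRestrict]
      refine (continuous_subtype_val.comp e.symm.continuous).congr fun z => ?_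
      simp [domRestrict]
    mapsΦ := fun z hz => by
      have : z ∈ Metric.closedBall (0 : ℂ) 1 := by simpa using hz
      rw [dif_pos this]; exact Subtype.mem _
    mapsκ := fun y hy => by
      rw [dif_pos hy]; exact mem_closedBall_zero_iff.1 (e.symm ⟨y, hy⟩).2
    κΦ := fun z hz => by
      have : z ∈ Metric.closedBall (0 : ℂ) 1 := by simpa using hz
      simp only [dif_pos this, Subtype.coe_prop, dite_true, Subtype.coe_eta, e.symm_apply_apply]
    Φκ := fun y hy => by
      simp [dif_pos hy]
    center := by simp }
  exact C.recenter hw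

lemma DiskChart.isClosedDisk {D : Set Sphere2} {w : Sphere2} (C : DiskChart D w) :
    IsClosedDisk D :=
  ⟨{ toFun := fun z => ⟨C.Φ z, C.mapsΦ z (mem_closedBall_zero_iff.1 z.2)⟩
     invFun := fun y => ⟨C.κ y, mem_closedBall_zero_iff.2 (C.mapsκ y y.2)⟩
     left_inv := fun z => Subtype.ext (C.κΦ z (mem_closedBall_zero_iff.1 z.2))
     right_inv := fun y => Subtype.ext (C.Φκ y y.2)
     continuous_toFun := (continuousOn_iff_continuous_domRestrict.1 C.contΦ).subtype_mk _
     continuous_invFun := (continuousOn_iff_continuous_domRestrict.1 C.contκ).subtype_mk _ }⟩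

end

noncomputable section

/-! ### Wedges of disks -/

namespace Wedge

variable {m : ℕ}

/-- The point of the `i`-th branch with the coordinate `z`. -/
def single (i : Fin m) (z : ℂ) (hz : ‖z‖ < 1) : Wedge m :=
  ⟨Pi.single i z, fun j => by
    by_cases h : j = i
    · subst h; simpa using hz
    · simp [h], fun j k hjk => by
    by_cases h : j = i
    · subst h; right; simp [hjk.symm]
    · left; simp [h]⟩

lemma single_same (i : Fin m) (z : ℂ) (hz : ‖z‖ < 1) : (single i z hz).1 i = z := by simp [single]

lemma single_ne {i j : Fin m} (h : j ≠ i) (z : ℂ) (hz : ‖z‖ < 1) : (single i z hz).1 j = 0 := by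
  simp [single, h]

lemma continuous_val : Continuous (fun p : Wedge m => p.1) := continuous_subtype_val

@[fun_prop] lemma continuous_coord (i : Fin m) : Continuous (fun p : Wedge m => p.1 i) :=
  (continuous_apply i).comp continuous_val

@[ext] lemma ext {p q : Wedge m} (h : ∀ i, p.1 i = q.1 i) : p = q := Subtype.ext (funext h)

lemma norm_single_lt {i : Fin m} {z : ℂ} {hz : ‖z‖ < 1} {δ : ℝ} (h : ‖z‖ < δ) (j : Fin m) :
    ‖(single i z hz).1 j‖ < δ := by
  by_cases hj : j = i
  · subst hj; rwa [single_same]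
  · rw [single_ne hj]; simpa using (norm_nonneg z).trans_lt h

/-- A point with a non-zero coordinate lies on the corresponding branch. -/
lemma eq_single {p : Wedge m} {i : Fin m} (h : p.1 i ≠ 0) : p = single i (p.1 i) (p.2.1 i) := by
  ext j
  by_cases hj : j = i
  · subst hj; rw [single_same]
  · rw [single_ne hj]; exact (p.2.2 j i hj).resolve_right h

/-- Radial contraction. -/
def smul (t : ℝ) (ht : t ∈ Icc (0 : ℝ) 1) (p : Wedge m) : Wedge m :=
  ⟨fun i => t * p.1 i, fun i => by
    have := p.2.1 i
    rw [norm_mul, Complex.norm_real, Real.norm_of_nonneg ht.1]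
    exact lt_of_le_of_lt (mul_le_of_le_one_left (norm_nonneg _) ht.2) this, fun i j hij => by
    rcases p.2.2 i j hij with h | h <;> simp [h]⟩

/-- The model of a branched covering near a point. -/
def powSum (k : Fin m → ℕ) (p : Wedge m) : ℂ := ∑ i, p.1 i ^ k i

lemma continuous_powSum (k : Fin m → ℕ) : Continuous (powSum k) :=
  continuous_finsetSum _ fun i _ => (continuous_coord i).pow _

lemma powSum_single (k : Fin m → ℕ) (hk : ∀ i, 0 < k i) (i : Fin m) (z : ℂ) (hz : ‖z‖ < 1) :
    powSum k (single i z hz) = z ^ k i := by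
  rw [powSum, Finset.sum_eq_single i, single_same]
  · intro j _ hj; rw [single_ne hj, zero_pow (hk j).ne']
  · simp

lemma powSum_of_ne {k : Fin m → ℕ} (hk : ∀ i, 0 < k i) {p : Wedge m} {i : Fin m}
    (h : p.1 i ≠ 0) : powSum k p = p.1 i ^ k i := by
  rw [eq_single h, powSum_single k hk, single_same]

lemma powSum_eq_zero {k : Fin m → ℕ} (hk : ∀ i, 0 < k i) {p : Wedge m} :
    powSum k p = 0 ↔ ∀ i, p.1 i = 0 := by
  constructor
  · intro h i
    by_contra hi
    rw [powSum_of_ne hk hi] at h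
    exact hi (pow_eq_zero_iff (hk i).ne' |>.1 h)
  · intro h
    exact Finset.sum_eq_zero fun i _ => by rw [h i, zero_pow (hk i).ne']

end Wedge

namespace IsAdmissibleChart

variable {X : Type} [TopologicalSpace X] {m : ℕ} {e : OpenPartialHomeomorph X (Wedge m)} {x : X}

lemma symm_mem (he : IsAdmissibleChart e x) (p : Wedge m) : e.symm p ∈ e.source :=
  e.map_target (by rw [he.2.1]; trivial)

lemma apply_symm (he : IsAdmissibleChart e x) (p : Wedge m) : e (e.symm p) = p :=
  e.right_inv (by rw [he.2.1]; trivial)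

lemma continuous_symm (he : IsAdmissibleChart e x) : Continuous e.symm := by
  rw [← continuousOn_univ, ← he.2.1]; exact e.continuousOn_symm

lemma symm_eq (he : IsAdmissibleChart e x) {p : Wedge m} (hp : ∀ i, p.1 i = 0) :
    e.symm p = x := by
  rw [show p = e x from Wedge.ext fun i => by rw [hp i, he.2.2 i], e.left_inv he.1]

lemma exists_ball (he : IsAdmissibleChart e x) {N : Set X} (hN : N ∈ 𝓝 x) :
    ∃ δ > 0, δ ≤ 1 ∧ ∀ p : Wedge m, (∀ i, ‖p.1 i‖ < δ) → e.symm p ∈ N := by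
  have h1 : e.symm ⁻¹' N ∈ 𝓝 (e x) :=
    he.continuous_symm.continuousAt.preimage_mem_nhds (by rwa [e.left_inv he.1])
  rw [(⟨rfl⟩ : IsInducing (fun p : Wedge m => p.1)).nhds_eq_comap, mem_comap] at h1
  obtain ⟨t, ht, hts⟩ := h1
  have h0 : ((e x).1 : Fin m → ℂ) = 0 := funext he.2.2
  rw [h0] at ht
  obtain ⟨δ, hδ, hb⟩ := Metric.mem_nhds_iff.1 ht
  refine ⟨min δ 1, lt_min hδ one_pos, min_le_right _ _, fun p hp => hts (hb ?_)⟩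
  rw [mem_ball_zero_iff, pi_norm_lt_iff hδ]
  exact fun i => (hp i).trans_le (min_le_left _ _)

lemma ball_mem (he : IsAdmissibleChart e x) {δ : ℝ} (hδ : 0 < δ) :
    e.source ∩ e ⁻¹' {p | ∀ i, ‖p.1 i‖ < δ} ∈ 𝓝 x := by
  refine (e.isOpen_inter_preimage ?_).mem_nhds ⟨he.1, fun i => by rw [he.2.2 i]; simpa⟩
  have : {p : Wedge m | ∀ i, ‖p.1 i‖ < δ} = ⋂ i, {p : Wedge m | ‖p.1 i‖ < δ} := by ext; simp
  rw [this]
  exact isOpen_iInter_of_finite fun i => isOpen_lt (by fun_prop) continuous_const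

end IsAdmissibleChart

/-- In a chart every point of a small ball is joined to the center by the radial contraction. This
turns connected open sets into path connected ones, as `betti_collapse` demands. -/
instance (S : ClosedSurface) : LocallyPathConnectedSpace S := by
  choose e he using S.exists_chart
  refine LocallyPathConnectedSpace.of_bases (p := fun _ (δ : ℝ) => 0 < δ ∧ δ ≤ 1)
    (s := fun x δ => (e x).source ∩ e x ⁻¹' {p | ∀ i, ‖p.1 i‖ < δ}) (fun x => ?_) ?_
  · refine ⟨fun N => ⟨fun hN => ?_, ?_⟩⟩
    · obtain ⟨δ, hδ, hδ1, h⟩ := (he x).exists_ball hN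
      refine ⟨δ, ⟨hδ, hδ1⟩, fun y hy => ?_⟩
      rw [← (e x).left_inv hy.1]
      exact h _ hy.2
    · rintro ⟨δ, ⟨hδ, -⟩, h⟩
      exact mem_of_superset ((he x).ball_mem hδ) h
  · rintro x δ ⟨hδ, -⟩
    refine ⟨x, ⟨(he x).1, fun i => by rw [(he x).2.2 i]; simpa⟩, fun {y} hy => ?_⟩
    refine ⟨⟨⟨fun t => (e x).symm (Wedge.smul t t.2 (e x y)), ?_⟩, ?_, ?_⟩, ?_⟩
    · refine (he x).continuous_symm.comp (Continuous.subtype_mk ?_ _)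
      fun_prop
    · exact (he x).symm_eq fun i => by simp [Wedge.smul]
    · conv_rhs => rw [← (e x).left_inv hy.1]
      exact congrArg (e x).symm (Wedge.ext fun i => by simp [Wedge.smul])
    · intro t
      refine ⟨(he x).symm_mem _, fun i => ?_⟩
      have h2 := hy.2 i
      simp only [Path.coe_mk_mk]
      rw [(he x).apply_symm]
      simp only [Wedge.smul, norm_mul, Complex.norm_real, Real.norm_of_nonneg t.2.1]
      exact lt_of_le_of_lt (mul_le_of_le_one_left (norm_nonneg _) t.2.2) h2

/-! ### Local structure of branched coverings -/

/-- A normal form of a map near a point. -/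
structure NormalForm (S : ClosedSurface) (f : S → Sphere2) (x : S) where
  e : OpenPartialHomeomorph S (Wedge (S.branches x))
  ψ : OpenPartialHomeomorph Sphere2 ℂ
  k : Fin (S.branches x) → ℕ
  chart : IsAdmissibleChart e x
  pos : ∀ i, 0 < k i
  mem : ∀ y ∈ e.source, f y ∈ ψ.source
  eq : ∀ y ∈ e.source, ψ (f y) = Wedge.powSum k (e y)

namespace Covering

variable (c : Covering)

lemma exists_normalForm (x : c.surf) : Nonempty (NormalForm c.surf c.map x) := by
  obtain ⟨e, ψ, k, h1, h2, h3⟩ := c.isBranched.normal_form x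
  exact ⟨⟨e, ψ, k, h1, h2, fun y hy => (h3 y hy).1, fun y hy => (h3 y hy).2⟩⟩

end Covering

namespace NormalForm

variable {S : ClosedSurface} {f : S → Sphere2} {x : S} (F : NormalForm S f x)

lemma apply_eq {y : S} (hy : y ∈ F.e.source) : f y = F.ψ.symm (Wedge.powSum F.k (F.e y)) := by
  rw [← F.eq y hy, F.ψ.left_inv (F.mem y hy)]

lemma ψ_apply_self : F.ψ (f x) = 0 := by
  rw [F.eq x F.chart.1, (Wedge.powSum_eq_zero F.pos).2 F.chart.2.2]

lemma continuousAt (F : NormalForm S f x) : ContinuousAt f x := by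
  have h1 : ContinuousAt (fun y => F.ψ.symm (Wedge.powSum F.k (F.e y))) x := by
    refine ContinuousAt.comp (g := F.ψ.symm) (F.ψ.continuousAt_symm ?_)
      ((Wedge.continuous_powSum F.k).continuousAt.comp (F.e.continuousAt F.chart.1))
    rw [← F.eq x F.chart.1]; exact F.ψ.map_source (F.mem x F.chart.1)
  refine h1.congr ?_
  filter_upwards [F.e.open_source.mem_nhds F.chart.1] with y hy
  exact (F.apply_eq hy).symm

lemma eq_of_apply_eq {y : S} (hy : y ∈ F.e.source) (h : f y = f x) : y = x := by
  have h1 := F.eq y hy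
  rw [h, F.ψ_apply_self, eq_comm, Wedge.powSum_eq_zero F.pos] at h1
  rw [← F.e.left_inv hy, F.chart.symm_eq h1]

lemma apply_symm {p : Wedge (S.branches x)} :
    f (F.e.symm p) = F.ψ.symm (Wedge.powSum F.k p) := by
  rw [F.apply_eq (F.chart.symm_mem p), F.chart.apply_symm]

/-- Points close to the value have preimages on every branch. -/
lemma eventually_exists {N : Set S} (hN : N ∈ 𝓝 x) (i : Fin (S.branches x)) :
    ∀ᶠ y in 𝓝 (f x), ∃ z : ℂ, ∃ _ : ‖z‖ < 1, z ^ F.k i = F.ψ y ∧ ∀ ζ : ℂ, ∀ hζ : ‖ζ‖ < 1,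
      ‖ζ‖ = ‖z‖ → ζ ^ F.k i = F.ψ y →
        F.e.symm (Wedge.single i ζ hζ) ∈ N ∧ f (F.e.symm (Wedge.single i ζ hζ)) = y := by
  obtain ⟨δ, hδ, hδ1, hb⟩ := F.chart.exists_ball hN
  have h1 : ∀ᶠ y in 𝓝 (f x), ‖F.ψ y‖ < δ ^ F.k i := by
    have := (F.ψ.continuousAt (F.mem x F.chart.1)).norm
    refine this.eventually_lt continuousAt_const ?_
    rw [F.ψ_apply_self]; simpa using pow_pos hδ _
  filter_upwards [h1, F.ψ.open_source.mem_nhds (F.mem x F.chart.1)] with y hy hys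
  obtain ⟨z, hz⟩ := IsAlgClosed.exists_pow_nat_eq (F.ψ y) (F.pos i)
  have hzδ : ‖z‖ < δ := by
    rw [← hz, norm_pow] at hy
    exact lt_of_pow_lt_pow_left₀ _ hδ.le hy
  refine ⟨z, hzδ.trans_le hδ1, hz, fun ζ hζ h2 h3 => ⟨hb _ fun j => ?_, ?_⟩⟩
  · exact Wedge.norm_single_lt (h2.trans_lt hzδ) j
  · rw [F.apply_symm, Wedge.powSum_single _ F.pos, h3, F.ψ.left_inv hys]

lemma nhds_le (F : NormalForm S f x) : 𝓝 (f x) ≤ map f (𝓝 x) := by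
  intro U hU
  rw [mem_map] at hU
  filter_upwards [F.eventually_exists hU ⟨0, S.branches_pos x⟩] with y ⟨z, hz, hzy, h⟩
  obtain ⟨h1, h2⟩ := h z hz rfl hzy
  rw [← h2]; exact h1

/-- `f` takes every value close to `f x` at least twice near `x`. -/
lemma eventually_two (h : 2 ≤ S.branches x ∨ ∃ i, 2 ≤ F.k i) {N : Set S} (hN : N ∈ 𝓝 x) :
    ∀ᶠ y in 𝓝 (f x), y ≠ f x → ∃ a ∈ N, ∃ b ∈ N, a ≠ b ∧ f a = y ∧ f b = y := by
  have hψ : ∀ᶠ y in 𝓝 (f x), y ≠ f x → F.ψ y ≠ 0 := by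
    filter_upwards [F.ψ.open_source.mem_nhds (F.mem x F.chart.1)] with y hy hne h0
    exact hne (F.ψ.injOn hy (F.mem x F.chart.1) (h0.trans F.ψ_apply_self.symm))
  have hinj : ∀ {p q : Wedge (S.branches x)}, F.e.symm p = F.e.symm q → p = q := fun {p q} h => by
    rw [← F.chart.apply_symm p, h, F.chart.apply_symm]
  rcases h with h | ⟨i, hi⟩
  · have hne : (⟨0, by omega⟩ : Fin (S.branches x)) ≠ ⟨1, by omega⟩ := by simp
    filter_upwards [F.eventually_exists hN ⟨0, by omega⟩, F.eventually_exists hN ⟨1, by omega⟩, hψ]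
      with y ⟨z, hz, hzy, h1⟩ ⟨z', hz', hzy', h1'⟩ h2 hyne
    obtain ⟨h3, h4⟩ := h1 z hz rfl hzy
    obtain ⟨h3', h4'⟩ := h1' z' hz' rfl hzy'
    refine ⟨_, h3, _, h3', fun hab => ?_, h4, h4'⟩
    have := congrArg (fun p => p.1 ⟨0, by omega⟩) (hinj hab)
    simp only [Wedge.single_same, Wedge.single_ne hne] at this
    rw [this, zero_pow (F.pos _).ne'] at hzy
    exact h2 hyne hzy.symm
  · filter_upwards [F.eventually_exists hN i, hψ] with y ⟨z, hz, hzy, h1⟩ h2 hyne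
    have hk : F.k i ≠ 0 := (F.pos i).ne'
    -- On a branch of exponent k ≥ 2, multiplication by a primitive k-th root of unity gives a
    -- second preimage.
    set ω : ℂ := Complex.exp (2 * Real.pi * Complex.I / F.k i)
    have hω : IsPrimitiveRoot ω (F.k i) := Complex.isPrimitiveRoot_exp _ hk
    have hn : ‖ω‖ = 1 := hω.norm'_eq_one hk
    have hnz : ‖z * ω‖ = ‖z‖ := by rw [norm_mul, hn, mul_one]
    obtain ⟨h3, h4⟩ := h1 z hz rfl hzy
    obtain ⟨h3', h4'⟩ := h1 (z * ω) (by rwa [hnz]) hnz (by rw [mul_pow, hω.pow_eq_one, mul_one, hzy])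
    refine ⟨_, h3, _, h3', fun hab => ?_, h4, h4'⟩
    have := congrArg (fun p => p.1 i) (hinj hab)
    simp only [Wedge.single_same] at this
    have hz0 : z ≠ 0 := by
      rintro rfl
      rw [zero_pow hk] at hzy
      exact h2 hyne hzy.symm
    exact hω.ne_one (by omega) (mul_left_cancel₀ hz0 (by rw [← this, mul_one]))

/-- At the points of the chart other than the center the map is locally injective. -/
lemma exists_injOn_of_ne {y : S} (hy : y ∈ F.e.source) (hyx : y ≠ x) : ∃ N ∈ 𝓝 y, InjOn f N := by
  obtain ⟨i, hi⟩ : ∃ i, (F.e y).1 i ≠ 0 := by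
    by_contra! h
    exact hyx (by rw [← F.e.left_inv hy, F.chart.symm_eq h])
  -- Off the center the power map has non-zero derivative, so the inverse function theorem applies
  -- on the branch.
  have hd : HasStrictDerivAt (fun z : ℂ => z ^ F.k i)
      (F.k i * (F.e y).1 i ^ (F.k i - 1)) ((F.e y).1 i) := hasStrictDerivAt_pow _ _
  have hd0 : (F.k i * (F.e y).1 i ^ (F.k i - 1) : ℂ) ≠ 0 :=
    mul_ne_zero (Nat.cast_ne_zero.2 (F.pos i).ne') (pow_ne_zero _ hi)
  obtain ⟨U, hU, hUi⟩ : ∃ U ∈ 𝓝 ((F.e y).1 i), InjOn (fun z : ℂ => z ^ F.k i) U := by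
    have hf := hd.hasStrictFDerivAt_equiv hd0
    refine ⟨_, (hf.toOpenPartialHomeomorph _).open_source.mem_nhds
      hf.mem_toOpenPartialHomeomorph_source, ?_⟩
    exact (hf.toOpenPartialHomeomorph _).injOn
  refine ⟨F.e.source ∩ F.e ⁻¹' ((fun p => p.1 i) ⁻¹' (U ∩ {0}ᶜ)), ?_, ?_⟩
  · refine inter_mem (F.e.open_source.mem_nhds hy) ((F.e.continuousAt hy).preimage_mem_nhds
      ((Wedge.continuous_coord i).continuousAt.preimage_mem_nhds (inter_mem hU ?_)))
    exact isOpen_compl_singleton.mem_nhds hi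
  · intro a ha b hb hab
    have h1 := F.eq a ha.1
    rw [hab, F.eq b hb.1, Wedge.powSum_of_ne F.pos ha.2.2, Wedge.powSum_of_ne F.pos hb.2.2] at h1
    have h2 := hUi ha.2.1 hb.2.1 h1.symm
    rw [← F.e.left_inv ha.1, ← F.e.left_inv hb.1]
    congr 1
    rw [Wedge.eq_single ha.2.2, Wedge.eq_single hb.2.2]
    simp only at h2
    congr 1

lemma exists_injOn_of_simple (hm : S.branches x = 1) (hk : ∀ i, F.k i = 1) :
    ∃ N ∈ 𝓝 x, InjOn f N := by
  refine ⟨F.e.source, F.e.open_source.mem_nhds F.chart.1, fun a ha b hb hab => ?_⟩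
  have h1 := F.eq a ha
  have : Subsingleton (Fin (S.branches x)) := by rw [hm]; infer_instance
  have i0 : Fin (S.branches x) := ⟨0, by omega⟩
  have hp : ∀ p : Wedge (S.branches x), Wedge.powSum F.k p = p.1 i0 := fun p => by
    rw [Wedge.powSum, Finset.sum_eq_single i0 (fun j _ hj => absurd (Subsingleton.elim j i0) hj)
      (by simp), hk, pow_one]
  rw [hab, F.eq b hb, hp, hp] at h1
  rw [← F.e.left_inv ha, ← F.e.left_inv hb]
  congr 1
  ext i
  rw [Subsingleton.elim i i0, h1]

end NormalForm

/-! ### Global consequences: openness, finiteness of critical points and fibers, the covering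
property. -/

namespace Covering

variable (c : Covering)

lemma continuous : Continuous c.map :=
  continuous_iff_continuousAt.2 fun x => (c.exists_normalForm x).some.continuousAt

lemma isOpenMap : IsOpenMap c.map :=
  isOpenMap_iff_nhds_le.2 fun x => (c.exists_normalForm x).some.nhds_le

lemma isClosedMap : IsClosedMap c.map := c.continuous.isClosedMap

/-- A singular point with one branch is ramified by the definition of a covering. If there are at
least two branches, each of them covers a neighbourhood of the value, and the map is not injective.
-/
lemma critical_iff {x : c.surf} : x ∈ c.critPoints ↔ IsRamified c.map x := by
  refine ⟨fun h => ?_, Or.inl⟩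
  rcases h with h | h
  · exact h
  · by_cases h1 : c.surf.branches x = 1
    · exact c.isBranched.ramified x h h1
    · have h2 : 2 ≤ c.surf.branches x := by have := c.surf.branches_pos x; omega
      rintro ⟨N, hN, hinj⟩
      have h3 := (c.exists_normalForm x).some.eventually_two (Or.inl h2) hN
      obtain ⟨y, hy, hne⟩ := ((h3.filter_mono nhdsWithin_le_nhds).and
        (self_mem_nhdsWithin : {c.map x}ᶜ ∈ 𝓝[≠] (c.map x))).exists
      obtain ⟨a, ha, b, hb, hab, h4, h5⟩ := hy hne
      exact hab (hinj ha hb (h4.trans h5.symm))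

lemma eventually_two {x : c.surf} (hx : x ∈ c.critPoints) {N : Set c.surf} (hN : N ∈ 𝓝 x) :
    ∀ᶠ y in 𝓝 (c.map x), y ≠ c.map x → ∃ a ∈ N, ∃ b ∈ N, a ≠ b ∧ c.map a = y ∧ c.map b = y := by
  have F := (c.exists_normalForm x).some
  refine F.eventually_two ?_ hN
  by_contra! h
  refine c.critical_iff.1 hx (F.exists_injOn_of_simple ?_ fun i => ?_)
  · have := c.surf.branches_pos x; omega
  · have := F.pos i; have := h.2 i; omega

/-- The source of a normal form contains at most one critical point, its center, and finitely many
such sources cover the surface. -/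
lemma finite_critPoints : c.critPoints.Finite := by
  have F := fun x => (c.exists_normalForm x).some
  obtain ⟨t, ht⟩ := isCompact_univ.elim_nhds_subcover (fun x => (F x).e.source)
    (fun x _ => (F x).e.open_source.mem_nhds (F x).chart.1)
  refine t.finite_toSet.subset fun y hy => ?_
  obtain ⟨x, hx, hyx⟩ := mem_iUnion₂.1 (ht.2 (mem_univ y))
  by_cases h : y = x
  · exact h ▸ hx
  · exact absurd ((F x).exists_injOn_of_ne hyx h) (c.critical_iff.1 hy)

lemma finite_critValues : c.critValues.Finite := c.finite_critPoints.image _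

lemma finite_fiber (y : Sphere2) : (c.map ⁻¹' {y}).Finite := by
  have F := fun x => (c.exists_normalForm x).some
  refine ((isClosed_singleton (x := y)).preimage c.continuous).isCompact.finite ?_
  rw [isDiscrete_iff_forall_mem_exists_isOpen]
  intro x hx
  refine ⟨(F x).e.source, (F x).e.open_source, ?_⟩
  ext z
  constructor
  · rintro ⟨h1, h2⟩
    exact (F x).eq_of_apply_eq h1 (h2.trans hx.symm)
  · rintro rfl
    exact ⟨(F z).chart.1, hx⟩

lemma isCoveringMapOn : IsCoveringMapOn c.map c.critValuesᶜ := by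
  refine .of_isLocalHomeomorphOn c.continuous ?_
  rw [isLocalHomeomorphOn_iff_isOpenEmbedding_restrict]
  intro x hx
  have h1 : x ∉ c.critPoints := fun h => hx ⟨x, h, rfl⟩
  rw [c.critical_iff, IsRamified, not_not] at h1
  obtain ⟨N, hN, hinj⟩ := h1
  obtain ⟨U, hUN, hU, hxU⟩ := mem_nhds_iff.1 hN
  refine ⟨U, hU.mem_nhds hxU, .of_continuous_injective_isOpenMap ?_ ?_ ?_⟩
  · exact c.continuous.comp continuous_subtype_val
  · exact fun a b h => Subtype.ext (hinj (hUN a.2) (hUN b.2) h)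
  · exact c.isOpenMap.comp hU.isOpenMap_subtype_val

/-- The map is open, so every open set takes values other than the finitely many critical ones. -/
lemma dense_compl_critPoints : Dense (c.critPointsᶜ) := by
  intro x
  rw [mem_closure_iff_nhds]
  intro N hN
  have h1 : c.map '' N ∈ 𝓝 (c.map x) := c.isOpenMap.image_mem_nhds hN
  have h2 : c.critValuesᶜ ∈ 𝓝[≠] (c.map x) := by
    refine mem_nhdsWithin.2 ⟨(c.critValues \ {c.map x})ᶜ,
      (c.finite_critValues.sdiff).isClosed.isOpen_compl, by simp, ?_⟩
    rintro y ⟨h, h'⟩ hy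
    exact h ⟨hy, h'⟩
  obtain ⟨y, ⟨z, hz, rfl⟩, hy⟩ := Filter.nonempty_of_mem
    (inter_mem (mem_nhdsWithin_of_mem_nhds h1) h2)
  exact ⟨z, hz, fun h => hy ⟨z, h, rfl⟩⟩

end Covering

end

noncomputable section

lemma IsPreconnected.eq_of_locallyConst {X Z : Type} [TopologicalSpace X] {s : Set X}
    (hs : IsPreconnected s) {g : X → Z} (h : ∀ x ∈ s, ∀ᶠ y in 𝓝[s] x, g y = g x) {x y : X}
    (hx : x ∈ s) (hy : y ∈ s) : g x = g y := by
  have : PreconnectedSpace s := Subtype.preconnectedSpace hs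
  have hl : IsLocallyConstant (fun z : s => g z) := by
    rw [IsLocallyConstant.iff_eventually_eq]
    intro z
    have := h z z.2
    rwa [← map_nhds_subtype_val, eventually_map] at this
  exact hl.apply_eq_of_preconnectedSpace ⟨x, hx⟩ ⟨y, hy⟩

/-! ### The number of branches is a topological invariant -/

lemma exists_circ (z : ℂ) : ∃ t : ℝ, z = ‖z‖ * circ t := by
  refine ⟨z.arg / (2 * Real.pi), ?_⟩
  have hpi : (Real.pi : ℂ) ≠ 0 := Complex.ofReal_ne_zero.2 Real.pi_ne_zero
  conv_lhs => rw [← Complex.norm_mul_exp_arg_mul_I z]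
  rw [circ]
  congr 2
  push_cast
  field_simp

lemma isPreconnected_punctured_ball (δ : ℝ) : IsPreconnected {z : ℂ | z ≠ 0 ∧ ‖z‖ < δ} := by
  have h : {z : ℂ | z ≠ 0 ∧ ‖z‖ < δ} =
      (fun p : ℝ × ℝ => (p.1 : ℂ) * circ p.2) '' (Ioo 0 δ ×ˢ univ) := by
    ext z
    constructor
    · rintro ⟨h1, h2⟩
      obtain ⟨t, ht⟩ := exists_circ z
      exact ⟨(‖z‖, t), ⟨⟨norm_pos_iff.2 h1, h2⟩, trivial⟩, ht.symm⟩
    · rintro ⟨⟨r, t⟩, ⟨⟨h1, h2⟩, -⟩, rfl⟩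
      have hn : ‖(r : ℂ) * circ t‖ = r := by simp [abs_of_pos h1]
      exact ⟨norm_pos_iff.1 (by rw [hn]; exact h1), by simpa only [mem_ofPred_eq, hn] using h2⟩
  rw [h]
  refine (isPreconnected_Ioo.prod isPreconnected_univ).image _ (Continuous.continuousOn ?_)
  fun_prop

/-- A chart centered at `x` with values in a wedge. -/
def IsCenteredChart {X : Type} [TopologicalSpace X] {m : ℕ}
    (e : OpenPartialHomeomorph X (Wedge m)) (x : X) : Prop :=
  x ∈ e.source ∧ ∀ i, (e x).1 i = 0

namespace IsCenteredChart

variable {X : Type} [TopologicalSpace X] {m : ℕ} {e : OpenPartialHomeomorph X (Wedge m)} {x : X}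

lemma exists_ball (he : IsCenteredChart e x) {N : Set X} (hN : N ∈ 𝓝 x) :
    ∃ δ > 0, δ ≤ 1 ∧ ∀ p : Wedge m, (∀ i, ‖p.1 i‖ < δ) → p ∈ e.target ∧ e.symm p ∈ N := by
  have h1 : e.target ∩ e.symm ⁻¹' N ∈ 𝓝 (e x) :=
    inter_mem (e.open_target.mem_nhds (e.map_source he.1))
      ((e.continuousAt_symm (e.map_source he.1)).preimage_mem_nhds (by rwa [e.left_inv he.1]))
  rw [(⟨rfl⟩ : IsInducing (fun p : Wedge m => p.1)).nhds_eq_comap, mem_comap] at h1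
  obtain ⟨t, ht, hts⟩ := h1
  have h0 : ((e x).1 : Fin m → ℂ) = 0 := funext he.2
  rw [h0] at ht
  obtain ⟨δ, hδ, hb⟩ := Metric.mem_nhds_iff.1 ht
  refine ⟨min δ 1, lt_min hδ one_pos, min_le_right _ _, fun p hp => hts (hb ?_)⟩
  rw [mem_ball_zero_iff, pi_norm_lt_iff hδ]
  exact fun i => (hp i).trans_le (min_le_left _ _)

lemma ball_mem (he : IsCenteredChart e x) {δ : ℝ} (hδ : 0 < δ) :
    e.source ∩ e ⁻¹' {p | ∀ i, ‖p.1 i‖ < δ} ∈ 𝓝 x := by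
  refine (e.isOpen_inter_preimage ?_).mem_nhds ⟨he.1, fun i => by rw [he.2 i]; simpa⟩
  have : {p : Wedge m | ∀ i, ‖p.1 i‖ < δ} = ⋂ i, {p : Wedge m | ‖p.1 i‖ < δ} := by ext; simp
  rw [this]
  exact isOpen_iInter_of_finite fun i => isOpen_lt (by fun_prop) continuous_const

lemma eq_of_center (he : IsCenteredChart e x) {y : X} (hy : y ∈ e.source)
    (h : ∀ i, (e y).1 i = 0) : y = x :=
  e.injOn hy he.1 (Wedge.ext fun i => by rw [h i, he.2 i])

end IsCenteredChart

/-- A punctured branch is connected, so a centered chart carries it into one punctured branch of the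
other. The resulting map of branches is onto, since points of any branch of `e'` close to x lie on
some branch of `e`. -/
lemma branches_le {X : Type} [TopologicalSpace X] {m m' : ℕ} {x : X}
    {e : OpenPartialHomeomorph X (Wedge m)} {e' : OpenPartialHomeomorph X (Wedge m')}
    (he : IsCenteredChart e x) (he' : IsCenteredChart e' x) : m' ≤ m := by
  obtain ⟨δ, hδ, hδ1, hb⟩ := he.exists_ball (e'.open_source.mem_nhds he'.1)
  have hne : ∀ p : Wedge m, (∀ i, ‖p.1 i‖ < δ) → ∀ i, p.1 i ≠ 0 →
      ∃ j, (e' (e.symm p)).1 j ≠ 0 := by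
    intro p hp i hi
    by_contra! h
    have h1 : e.symm p = x := he'.eq_of_center (hb p hp).2 h
    have h2 := e.right_inv (hb p hp).1
    rw [h1] at h2
    exact hi (by rw [← h2]; exact he.2 i)
  let T := {z : ℂ | z ≠ 0 ∧ ‖z‖ < δ}
  have hT1 : ∀ z ∈ T, ‖z‖ < 1 := fun z hz => hz.2.trans_le hδ1
  have hsing : ∀ i : Fin m, ∃ j : Fin m', ∀ z : ℂ, ∀ hz : z ∈ T,
      (e' (e.symm (Wedge.single i z (hT1 z hz)))).1 j ≠ 0 := by
    intro i
    classical
    -- Stated for all z in order to choose a function on ℂ. Outside T the index is irrelevant, and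
    -- the sample point δ/2 only provides some element of `Fin m'`.
    have hex : ∀ z : ℂ, ∃ j : Fin m', ∀ hz : z ∈ T,
        (e' (e.symm (Wedge.single i z (hT1 z hz)))).1 j ≠ 0 := by
      intro z
      by_cases hz : z ∈ T
      · obtain ⟨j, hj⟩ := hne (Wedge.single i z (hT1 z hz)) (Wedge.norm_single_lt hz.2) i
          (by rw [Wedge.single_same]; exact hz.1)
        exact ⟨j, fun _ => hj⟩
      · obtain ⟨j, -⟩ := hne (Wedge.single i (δ / 2 : ℝ) (by
          rw [Complex.norm_real, Real.norm_of_nonneg (by linarith)]; linarith))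
          (Wedge.norm_single_lt (by
            rw [Complex.norm_real, Real.norm_of_nonneg (by linarith)]; linarith)) i
          (by rw [Wedge.single_same]; exact Complex.ofReal_ne_zero.2 (by linarith))
        exact ⟨j, fun h => absurd h hz⟩
    choose g hg using hex
    have hz0 : ((δ / 2 : ℝ) : ℂ) ∈ T := by
      refine ⟨Complex.ofReal_ne_zero.2 (by linarith), ?_⟩
      rw [Complex.norm_real, Real.norm_of_nonneg (by linarith)]; linarith
    refine ⟨g (δ / 2 : ℝ), fun z hz => ?_⟩
    -- A non-zero coordinate stays non-zero nearby, and at most one coordinate is non-zero, so the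
    -- chosen index is locally constant.
    rw [(isPreconnected_punctured_ball δ).eq_of_locallyConst (g := g) (fun a ha => ?_) hz0 hz]
    · exact hg z hz
    · have hcont : ContinuousAt (fun z : T =>
          (e' (e.symm (Wedge.single i z (hT1 z z.2)))).1 (g a)) ⟨a, ha⟩ := by
        have hs : Continuous fun z : T => Wedge.single i z.1 (hT1 z z.2) :=
          Continuous.subtype_mk (f := fun z : T => Pi.single (M := fun _ => ℂ) i z.1)
            ((continuous_single i).comp continuous_subtype_val) _
        have hba := hb _ (Wedge.norm_single_lt (hz := hT1 a ha) ha.2 (i := i))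
        have h1 : ContinuousAt (fun p => (e' (e.symm p)).1 (g a)) (Wedge.single i a (hT1 a ha)) :=
          (Wedge.continuous_coord (g a)).continuousAt.comp
            ((e'.continuousAt hba.2).comp (e.continuousAt_symm hba.1))
        exact h1.comp_of_eq hs.continuousAt rfl
      have h1 := hcont.eventually_ne (hg a ha)
      have h2 : ∀ᶠ z : T in 𝓝 ⟨a, ha⟩, g z = g a := by
        filter_upwards [h1] with z hz
        by_contra hne'
        exact (((e' (e.symm (Wedge.single i z (hT1 z z.2)))).2.2 _ _ hne').resolve_left
          (hg z z.2) |> hz)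
      change ∀ᶠ y in 𝓝[T] a, g y = g a
      rw [← map_nhds_subtype_val (⟨a, ha⟩ : T), eventually_map]
      exact h2
  choose I hI using hsing
  have hsurj : Function.Surjective I := by
    intro j
    obtain ⟨δ', hδ', hδ1', hb'⟩ := he'.exists_ball (he.ball_mem hδ)
    set ζ : ℂ := ((δ' / 2 : ℝ) : ℂ)
    have hζ0 : ζ ≠ 0 := Complex.ofReal_ne_zero.2 (by linarith)
    have hζn : ‖ζ‖ < δ' := by
      rw [Complex.norm_real, Real.norm_of_nonneg (by linarith)]; linarith
    set q := Wedge.single j ζ (hζn.trans_le hδ1')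
    obtain ⟨h0, h1, h2⟩ := hb' q (Wedge.norm_single_lt hζn)
    obtain ⟨i, hi⟩ : ∃ i, (e (e'.symm q)).1 i ≠ 0 := by
      by_contra! h
      have h3 : e'.symm q = x := he.eq_of_center h1 h
      have h4 := e'.right_inv h0
      rw [h3] at h4
      apply hζ0
      rw [← Wedge.single_same j ζ (hζn.trans_le hδ1')]
      change q.1 j = 0
      rw [← h4]; exact he'.2 j
    refine ⟨i, ?_⟩
    have h5 := hI i _ ⟨hi, h2 i⟩
    rw [← Wedge.eq_single hi, e.left_inv h1, e'.right_inv h0] at h5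
    by_contra hne'
    exact h5 (Wedge.single_ne hne' _ _)
  simpa using Fintype.card_le_of_surjective I hsurj

/-- The number of branches is preserved by local homeomorphisms. -/
lemma branches_eq_of_isOpenEmbedding {X : Type} [TopologicalSpace X] {S S' : ClosedSurface}
    {a : X → S} {b : X → S'} (ha : IsOpenEmbedding a) (hb : IsOpenEmbedding b) (x : X) :
    S'.branches (b x) = S.branches (a x) := by
  have : Nonempty X := ⟨x⟩
  have key : ∀ {S : ClosedSurface} {a : X → S}, IsOpenEmbedding a →
      ∃ e : OpenPartialHomeomorph X (Wedge (S.branches (a x))), IsCenteredChart e x := by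
    intro S a ha
    obtain ⟨e, he⟩ := S.exists_chart (a x)
    refine ⟨(ha.toOpenPartialHomeomorph a).trans e, ?_, he.2.2⟩
    rw [OpenPartialHomeomorph.trans_source]
    exact ⟨trivial, he.1⟩
  obtain ⟨e, he⟩ := key ha
  obtain ⟨e', he'⟩ := key hb
  exact le_antisymm (branches_le he he') (branches_le he' he)

end

noncomputable section

/-! ### Radial lifts -/

/-- The direction of a complex number. -/
def dir (z : ℂ) : ℂ := z / (‖z‖ : ℂ)

/-- The convention 0/0 = 0 makes the direction of 0 equal to 0, so no case distinction is needed
here. -/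
lemma norm_mul_dir (z : ℂ) : (‖z‖ : ℂ) * dir z = z := by
  by_cases h : z = 0
  · simp [h]
  · have : (‖z‖ : ℂ) ≠ 0 := by simpa using h
    rw [dir, mul_div_cancel₀ _ this]

lemma norm_dir {z : ℂ} (h : z ≠ 0) : ‖dir z‖ = 1 := by
  have : ‖z‖ ≠ 0 := by simpa using h
  rw [dir, norm_div, Complex.norm_real, norm_norm, div_self this]

lemma norm_dir_le (z : ℂ) : ‖dir z‖ ≤ 1 := by
  by_cases h : z = 0
  · simp [h, dir]
  · exact (norm_dir h).le

lemma norm_real_mul_dir {z : ℂ} (h : z ≠ 0) {s : ℝ} (hs : 0 ≤ s) : ‖(s : ℂ) * dir z‖ = s := by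
  rw [norm_mul, norm_dir h, mul_one, Complex.norm_real, Real.norm_of_nonneg hs]

lemma norm_real_mul_dir_le (z : ℂ) {s : ℝ} (hs : s ∈ Icc (0 : ℝ) 1) : ‖(s : ℂ) * dir z‖ ≤ 1 := by
  rw [norm_mul, Complex.norm_real, Real.norm_of_nonneg hs.1]
  exact mul_le_one₀ hs.2 (norm_nonneg _) (norm_dir_le z)

lemma dir_real_mul_dir (z : ℂ) {s : ℝ} (hs : 0 < s) : dir ((s : ℂ) * dir z) = dir z := by
  by_cases h : z = 0
  · simp [h, dir]
  · conv_lhs => rw [dir, norm_real_mul_dir h hs.le]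
    rw [mul_div_cancel_left₀ _ (Complex.ofReal_ne_zero.2 hs.ne')]

lemma continuousOn_dir : ContinuousOn dir {0}ᶜ :=
  continuousOn_id.div (by fun_prop) (fun z hz => by simpa using hz)

namespace Covering

variable (c : Covering) {D : Set Sphere2} {w : Sphere2} (C : DiskChart D w)

/-- The domain of radial lifts over the annulus `r < |z| ≤ 1`. -/
def radialDomain (r : ℝ) : Set (c.surf × ℝ) :=
  {p | c.map p.1 ∈ D ∧ r < ‖C.κ (c.map p.1)‖ ∧ p.2 ∈ Ioc r 1}

/-- Radial motions over an annulus without critical values. -/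
structure RadialLift (r : ℝ) where
  R : c.surf → ℝ → c.surf
  cont : ContinuousOn (Function.uncurry R) (c.radialDomain C r)
  map : ∀ x s, (x, s) ∈ c.radialDomain C r → c.map (R x s) = C.Φ (s * dir (C.κ (c.map x)))
  self : ∀ x, c.map x ∈ D → r < ‖C.κ (c.map x)‖ → R x ‖C.κ (c.map x)‖ = x
  comp : ∀ x s t, (x, s) ∈ c.radialDomain C r → t ∈ Ioc r 1 → R (R x s) t = R x t

/-- Without critical values the map is a covering over the annulus. The lifts come from the homotopy
lifting property, simultaneously for all points and all target radii, which gives joint continuity.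
-/
lemma exists_radialLift {r : ℝ} (hr : 0 ≤ r)
    (hcrit : ∀ y ∈ D, r < ‖C.κ y‖ → y ∉ c.critValues) : Nonempty (c.RadialLift C r) := by
  classical
  have cov := c.isCoveringMapOn.isCoveringMap_restrictPreimage
  set p := c.critValuesᶜ.restrictPreimage c.map with hp
  let A := c.radialDomain C r
  have hz0 : ∀ a : A, C.κ (c.map a.1.1) ≠ 0 := fun a => norm_pos_iff.1 (hr.trans_lt a.2.2.1)
  have hz1 : ∀ a : A, ‖C.κ (c.map a.1.1)‖ ≤ 1 := fun a => C.mapsκ _ a.2.1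
  have hΦreg : ∀ z : ℂ, ‖z‖ ≤ 1 → r < ‖z‖ → C.Φ z ∉ c.critValues := fun z h1 h2 =>
    hcrit _ (C.mapsΦ z h1) (by rwa [C.κΦ z h1])
  have hzc : Continuous fun a : A => C.κ (c.map a.1.1) :=
    C.contκ.comp_continuous (c.continuous.comp (continuous_fst.comp continuous_subtype_val))
      (fun a => a.2.1)
  have hdc : Continuous fun a : A => dir (C.κ (c.map a.1.1)) :=
    continuousOn_dir.comp_continuous hzc hz0
  -- The radius moves linearly from that of the given point to the target radius, at constant
  -- direction; R is the end point of the lift.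
  let ρ : unitInterval × A → ℝ := fun q =>
    (1 - (q.1 : ℝ)) * ‖C.κ (c.map q.2.1.1)‖ + (q.1 : ℝ) * q.2.1.2
  have hρc : Continuous ρ := by
    have h1 : Continuous fun q : unitInterval × A => ‖C.κ (c.map q.2.1.1)‖ :=
      (hzc.comp continuous_snd).norm
    have h2 : Continuous fun q : unitInterval × A => q.2.1.2 :=
      (continuous_snd.comp continuous_subtype_val).comp continuous_snd
    have h3 : Continuous fun q : unitInterval × A => (q.1 : ℝ) :=
      continuous_subtype_val.comp continuous_fst
    exact ((continuous_const.sub h3).mul h1).add (h3.mul h2)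
  have hρ : ∀ q, ρ q ∈ Ioc r 1 := fun q =>
    convex_Ioc r 1 ⟨q.2.2.2.1, hz1 q.2⟩ q.2.2.2.2 (by linarith [q.1.2.2]) q.1.2.1 (by ring)
  have hn : ∀ q : unitInterval × A, ‖(ρ q : ℂ) * dir (C.κ (c.map q.2.1.1))‖ = ρ q := fun q =>
    norm_real_mul_dir (hz0 q.2) (hr.trans (hρ q).1.le)
  let H : C(unitInterval × A, ↥(c.critValuesᶜ)) :=
    ⟨fun q => ⟨C.Φ ((ρ q : ℂ) * dir (C.κ (c.map q.2.1.1))),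
      hΦreg _ (by rw [hn]; exact (hρ q).2) (by rw [hn]; exact (hρ q).1)⟩,
      Continuous.subtype_mk (C.contΦ.comp_continuous
        ((Complex.continuous_ofReal.comp hρc).mul (hdc.comp continuous_snd))
        (fun q => mem_closedBall_zero_iff.2 ((hn q).trans_le (hρ q).2))) _⟩
  let f0 : C(A, ↥(c.map ⁻¹' c.critValuesᶜ)) :=
    ⟨fun a => ⟨a.1.1, hcrit _ a.2.1 a.2.2.1⟩,
      (continuous_fst.comp continuous_subtype_val).subtype_mk _⟩
  have H0 : ∀ a, H (0, a) = p (f0 a) := fun a => Subtype.ext (by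
    simp [H, hp, f0, ρ, norm_mul_dir, C.Φκ _ a.2.1])
  let L := cov.liftHomotopy H f0 H0
  have hLlift : ∀ q, c.map (L q).1 = C.Φ ((ρ q : ℂ) * dir (C.κ (c.map q.2.1.1))) := fun q =>
    congrArg Subtype.val (congrFun (cov.liftHomotopy_lifts H f0 H0) q)
  have hL0 : ∀ a, L (0, a) = f0 a := cov.liftHomotopy_zero H f0 H0
  let R : c.surf → ℝ → c.surf := fun x s =>
    if h : (x, s) ∈ A then (L (1, ⟨(x, s), h⟩)).1 else x
  have hR : ∀ a : A, R a.1.1 a.1.2 = (L (1, a)).1 := fun a => dif_pos a.2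
  have hmap : ∀ x s, (x, s) ∈ A → c.map (R x s) = C.Φ (s * dir (C.κ (c.map x))) := by
    intro x s h
    rw [hR ⟨(x, s), h⟩, hLlift]
    simp [ρ]
  have hcont : ContinuousOn (Function.uncurry R) A := by
    rw [continuousOn_iff_continuous_domRestrict]
    refine (continuous_subtype_val.comp (L.continuous.comp (Continuous.prodMk_right 1))).congr
      fun a => ?_
    exact (hR a).symm
  have hself : ∀ x, c.map x ∈ D → r < ‖C.κ (c.map x)‖ → R x ‖C.κ (c.map x)‖ = x := by
    intro x h1 h2
    have hA : (x, ‖C.κ (c.map x)‖) ∈ A := ⟨h1, h2, h2, C.mapsκ _ h1⟩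
    rw [hR ⟨_, hA⟩]
    -- If the target radius is the initial one, the path downstairs is constant, hence so is its
    -- lift.
    have := cov.const_of_comp (g := fun t => L (t, ⟨_, hA⟩))
      (L.continuous.comp (Continuous.prodMk_left _)) (fun t t' => by
        refine Subtype.ext ?_
        change c.map (L _).1 = c.map (L _).1
        rw [hLlift, hLlift]
        simp only [ρ]
        congr 3
        ring) 1 0
    rw [this, hL0]; rfl
  refine ⟨⟨R, hcont, hmap, hself, ?_⟩⟩
  intro x s t hxs ht
  have hz : C.κ (c.map x) ≠ 0 := hz0 ⟨_, hxs⟩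
  have hs0 : 0 < s := hr.trans_lt hxs.2.2.1
  have hn' : ‖(s : ℂ) * dir (C.κ (c.map x))‖ = s := norm_real_mul_dir hz hs0.le
  have hκ : C.κ (c.map (R x s)) = s * dir (C.κ (c.map x)) := by
    rw [hmap x s hxs, C.κΦ _ (by rw [hn']; exact hxs.2.2.2)]
  have hD : c.map (R x s) ∈ D := by
    rw [hmap x s hxs]; exact C.mapsΦ _ (by rw [hn']; exact hxs.2.2.2)
  have hA1 : ∀ t : Ioc r 1, (x, t.1) ∈ A := fun t => ⟨hxs.1, hxs.2.1, t.2⟩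
  have hA2 : ∀ t : Ioc r 1, (R x s, t.1) ∈ A := fun t =>
    ⟨hD, by rw [hκ, hn']; exact hxs.2.2.1, t.2⟩
  have : PreconnectedSpace (Ioc r 1) := Subtype.preconnectedSpace isPreconnected_Ioc
  -- As functions of t both sides lift the same ray, and they agree at t = s.
  have key := cov.eq_of_comp_eq
    (g₁ := fun t : Ioc r 1 => L (1, ⟨(R x s, t.1), hA2 t⟩))
    (g₂ := fun t : Ioc r 1 => L (1, ⟨(x, t.1), hA1 t⟩))
    (L.continuous.comp (continuous_const.prodMk (Continuous.subtype_mk (by fun_prop) _)))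
    (L.continuous.comp (continuous_const.prodMk (Continuous.subtype_mk (by fun_prop) _)))
    (by
      funext t
      refine Subtype.ext ?_
      change c.map (L _).1 = c.map (L _).1
      rw [← hR ⟨_, hA2 t⟩, ← hR ⟨_, hA1 t⟩]
      dsimp only
      rw [hmap _ _ (hA2 t), hmap _ _ (hA1 t), hκ, dir_real_mul_dir _ hs0])
    ⟨s, hxs.2.2⟩ (by
      refine Subtype.ext ?_
      rw [← hR ⟨_, hA2 ⟨s, hxs.2.2⟩⟩, ← hR ⟨_, hA1 ⟨s, hxs.2.2⟩⟩]
      dsimp only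
      have := hself (R x s) hD (by rw [hκ, hn']; exact hxs.2.2.1)
      rwa [hκ, hn'] at this)
  have h1 := congrArg Subtype.val (congrFun key ⟨t, ht⟩)
  dsimp only at h1
  rwa [← hR ⟨_, hA2 ⟨t, ht⟩⟩, ← hR ⟨_, hA1 ⟨t, ht⟩⟩] at h1

namespace RadialLift

variable {c C} {r : ℝ} (Q : c.RadialLift C r)

lemma map_mem {x : c.surf} {s : ℝ} (hr : 0 ≤ r) (h : (x, s) ∈ c.radialDomain C r) :
    c.map (Q.R x s) ∈ D := by
  rw [Q.map x s h]
  exact C.mapsΦ _ (norm_real_mul_dir_le _ ⟨hr.trans h.2.2.1.le, h.2.2.2⟩)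

lemma κ_map {x : c.surf} {s : ℝ} (hr : 0 ≤ r) (h : (x, s) ∈ c.radialDomain C r) :
    C.κ (c.map (Q.R x s)) = s * dir (C.κ (c.map x)) := by
  rw [Q.map x s h, C.κΦ _ (norm_real_mul_dir_le _ ⟨hr.trans h.2.2.1.le, h.2.2.2⟩)]

lemma norm_κ_map {x : c.surf} {s : ℝ} (hr : 0 ≤ r) (h : (x, s) ∈ c.radialDomain C r) :
    ‖C.κ (c.map (Q.R x s))‖ = s := by
  rw [Q.κ_map hr h, norm_real_mul_dir (norm_pos_iff.1 (hr.trans_lt h.2.1)) (hr.trans h.2.2.1.le)]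

end RadialLift

end Covering

end

noncomputable section

/-! ### Radial flow near a critical value -/

namespace Covering

variable (c : Covering) {D : Set Sphere2} {w : Sphere2} (C : DiskChart D w)

/-- The domain of the radial flow over a disk. -/
def flowDomain (_ : DiskChart D w) : Set (c.surf × ℝ) :=
  {p | c.map p.1 ∈ D ∧ p.2 ∈ Icc (0 : ℝ) 1 ∧ (c.map p.1 = w → p.2 = 0)}

/-- Radial motion over a disk in which only the center may be a critical value: `R x s` is the
point at distance `s` from the center on the ray through `x`. -/
structure Flow where
  R : c.surf → ℝ → c.surf
  cont : ContinuousOn (Function.uncurry R) (c.flowDomain C)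
  map : ∀ x s, (x, s) ∈ c.flowDomain C → c.map (R x s) = C.Φ (s * dir (C.κ (c.map x)))
  self : ∀ x, c.map x ∈ D → R x ‖C.κ (c.map x)‖ = x
  comp : ∀ x s t, (x, s) ∈ c.flowDomain C → t ∈ Icc (0 : ℝ) 1 → (s = 0 → t = 0) →
    R (R x s) t = R x t
  locallyConst : ∀ x, c.map x ∈ D → ∀ᶠ x' in 𝓝[c.map ⁻¹' D] x, R x' 0 = R x 0
  nhds : ∀ v, c.map v = w → ∀ N ∈ 𝓝 v, ∃ ε > 0, ∀ x, c.map x ∈ D → R x 0 = v →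
    ‖C.κ (c.map x)‖ < ε → x ∈ N

variable {c C}

/-- Radial lifts approach points of the fiber uniformly. -/
lemma RadialLift.exists_uniform (Q : c.RadialLift C 0) {N : c.surf → Set c.surf}
    (hN : ∀ v, c.map v = w → IsOpen (N v) ∧ v ∈ N v)
    (hd : (c.map ⁻¹' {w}).PairwiseDisjoint N) : ∃ ε > 0, ε ≤ 1 ∧ ∀ x, c.map x ∈ D → c.map x ≠ w →
      ∃ v, c.map v = w ∧ ∀ s ∈ Ioo 0 ε, Q.R x s ∈ N v := by
  -- The map is closed, so a neighbourhood of the fiber contains the preimage of a neighbourhood of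
  -- w.
  obtain ⟨W, hW, hwW, hWN⟩ : ∃ W, IsOpen W ∧ w ∈ W ∧ c.map ⁻¹' W ⊆ ⋃ v ∈ c.map ⁻¹' {w}, N v := by
    have ho : IsOpen (⋃ v ∈ c.map ⁻¹' {w}, N v) := isOpen_biUnion fun v hv => (hN v hv).1
    refine ⟨(c.map '' (⋃ v ∈ c.map ⁻¹' {w}, N v)ᶜ)ᶜ,
      (c.isClosedMap _ ho.isClosed_compl).isOpen_compl, ?_, ?_⟩
    · rintro ⟨v, hv, hvw⟩
      exact hv (mem_biUnion (show v ∈ c.map ⁻¹' {w} from hvw) (hN v hvw).2)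
    · intro x hx
      by_contra h
      exact hx ⟨x, h, rfl⟩
  have hΦ : ContinuousAt C.Φ 0 :=
    C.contΦ.continuousAt (Metric.closedBall_mem_nhds 0 one_pos)
  obtain ⟨ε, hε, hb⟩ := Metric.mem_nhds_iff.1 (hΦ.preimage_mem_nhds
    (by rw [C.center]; exact hW.mem_nhds hwW))
  refine ⟨min ε 1, lt_min hε one_pos, min_le_right _ _, fun x hx hxw => ?_⟩
  have hκ : C.κ (c.map x) ≠ 0 := fun h => hxw ((C.κ_eq_zero hx).1 h)
  have hdom : ∀ s ∈ Ioo 0 (min ε 1), (x, s) ∈ c.radialDomain C 0 := fun s hs =>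
    ⟨hx, norm_pos_iff.2 hκ, hs.1, hs.2.le.trans (min_le_right _ _)⟩
  have hmem : ∀ s ∈ Ioo 0 (min ε 1), Q.R x s ∈ ⋃ v ∈ c.map ⁻¹' {w}, N v := by
    intro s hs
    refine hWN ?_
    rw [mem_preimage, Q.map x s (hdom s hs)]
    refine hb ?_
    rw [mem_ball_zero_iff, norm_real_mul_dir hκ hs.1.le]
    exact hs.2.trans_le (min_le_left _ _)
  have hcont : ContinuousOn (Q.R x) (Ioo 0 (min ε 1)) :=
    Q.cont.comp (f := fun s => (x, s)) (by fun_prop) hdom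
  have hε1 : 0 < min ε 1 := lt_min hε one_pos
  obtain ⟨v, hv, hv0⟩ := mem_iUnion₂.1 (hmem (min ε 1 / 2) ⟨by linarith, by linarith⟩)
  refine ⟨v, hv, fun s hs => ?_⟩
  -- A radial path close to the fiber is connected and lies in the disjoint union of the sets N v,
  -- so it stays in one of them.
  have hpre := isPreconnected_Ioo.image _ hcont
  suffices h : Q.R x '' Ioo 0 (min ε 1) ⊆ N v from h ⟨s, hs, rfl⟩
  refine hpre.subset_left_of_subset_union (hN v hv).1
    (isOpen_biUnion fun v' (h : v' ∈ c.map ⁻¹' {w} \ {v}) => (hN v' h.1).1)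
    ?_ ?_ ⟨_, ⟨min ε 1 / 2, ⟨by linarith, by linarith⟩, rfl⟩, hv0⟩
  · rw [disjoint_iUnion₂_right]
    exact fun v' h => hd hv h.1 (fun h' => h.2 h'.symm)
  · rintro _ ⟨t, ht, rfl⟩
    obtain ⟨v', hv', hv'0⟩ := mem_iUnion₂.1 (hmem t ht)
    by_cases h : v' = v
    · subst h; exact Or.inl hv'0
    · exact Or.inr (mem_biUnion (show v' ∈ c.map ⁻¹' {w} \ {v} from ⟨hv', h⟩) hv'0)

/-- Over the punctured disk the radial lift with r = 0 exists. As the radius tends to 0, each path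
remains in the prescribed neighbourhood of one point of the finite fiber over w; this point is taken
as the position at radius 0, and uniformity of the approach gives continuity there. -/
lemma exists_flow (c : Covering) (C : DiskChart D w) (hcrit : ∀ y ∈ D, y ∈ c.critValues → y = w) :
    Nonempty (c.Flow C) := by
  classical
  obtain ⟨Q⟩ := c.exists_radialLift C le_rfl (fun y hy hy0 hyc => by
    rw [hcrit y hy hyc, C.κ_center] at hy0; simp at hy0)
  obtain ⟨N, hN, hNd⟩ := (c.finite_fiber w).t2_separation
  obtain ⟨ε₀, hε₀, hε₀1, hQ⟩ := Q.exists_uniform (fun v _ => ⟨(hN v).2, (hN v).1⟩) hNd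
  choose! L hLw hLN using hQ
  have hdom : ∀ {x s}, c.map x ∈ D → c.map x ≠ w → s ∈ Ioc (0 : ℝ) 1 →
      (x, s) ∈ c.radialDomain C 0 := fun {x s} hx hxw hs =>
    ⟨hx, norm_pos_iff.2 fun h => hxw ((C.κ_eq_zero hx).1 h), hs⟩
  have huniq : ∀ {v v' y}, c.map v = w → c.map v' = w → y ∈ N v → y ∈ N v' → v = v' := by
    intro v v' y hv hv' h h'
    by_contra hne
    exact disjoint_left.1 (hNd hv hv' hne) h h'
  -- `exists_uniform` is applied with N v shrunk inside O for this one v. Disjointness of the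
  -- original sets shows that the point it finds is the limit already chosen.
  have hunif : ∀ v, c.map v = w → ∀ O ∈ 𝓝 v, ∃ ε > 0, ε ≤ 1 ∧ ∀ x, c.map x ∈ D → c.map x ≠ w →
      L x = v → ∀ s ∈ Ioo 0 ε, Q.R x s ∈ O := by
    intro v hv O hO
    obtain ⟨O', hO'O, hO', hvO'⟩ := mem_nhds_iff.1 hO
    obtain ⟨ε, hε, hε1, h⟩ := Q.exists_uniform (N := fun u => if u = v then N u ∩ O' else N u)
      (fun u _ => by
        by_cases hu : u = v
        · subst hu; simp only [if_true]; exact ⟨(hN u).2.inter hO', (hN u).1, hvO'⟩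
        · simp only [if_neg hu]; exact ⟨(hN u).2, (hN u).1⟩)
      (hNd.mono_on fun u _ => by
        by_cases hu : u = v
        · subst hu; simp
        · simp [if_neg hu])
    refine ⟨min ε ε₀, lt_min hε hε₀, (min_le_left _ _).trans hε1, fun x hx hxw hLx s hs => ?_⟩
    obtain ⟨u, hu, hus⟩ := h x hx hxw
    have h1 := hus s ⟨hs.1, hs.2.trans_le (min_le_left _ _)⟩
    have h2 := hLN x hx hxw s ⟨hs.1, hs.2.trans_le (min_le_right _ _)⟩
    have h3 : Q.R x s ∈ N u := by
      by_cases huv : u = v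
      · simp only [if_pos huv] at h1; exact h1.1
      · simpa only [if_neg huv] using h1
    have h4 : u = v := hLx ▸ huniq hu (hLw x hx hxw) h3 h2
    simp only [if_pos h4] at h1
    exact hO'O h1.2
  -- On the fiber over w there is no direction to follow, and a point is its own limit.
  let L' : c.surf → c.surf := fun x => if c.map x = w then x else L x
  have hL'w : ∀ x, c.map x ∈ D → c.map (L' x) = w := by
    intro x hx
    by_cases h : c.map x = w
    · simp [L', h]
    · simp only [L', if_neg h]; exact hLw x hx h
  have hL'v : ∀ v, c.map v = w → L' v = v := fun v hv => if_pos hv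
  have hLeq : ∀ x v s, c.map x ∈ D → c.map x ≠ w → c.map v = w → s ∈ Ioo 0 ε₀ → Q.R x s ∈ N v →
      L x = v := fun x v s hx hxw hv hs h => huniq (hLw x hx hxw) hv (hLN x hx hxw s hs) h
  have hself : ∀ x, c.map x ∈ D → c.map x ≠ w → Q.R x ‖C.κ (c.map x)‖ = x := fun x hx hxw =>
    Q.self x hx (norm_pos_iff.2 fun h => hxw ((C.κ_eq_zero hx).1 h))
  have hκc : ∀ x, c.map x ∈ D → ContinuousWithinAt (fun x => ‖C.κ (c.map x)‖) (c.map ⁻¹' D) x :=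
    fun x hx => ((C.contκ (c.map x) hx).comp c.continuous.continuousWithinAt
      (fun _ h => h)).norm
  have hne_nhds : ∀ x, c.map x ≠ w → ∀ᶠ x' in 𝓝 x, c.map x' ≠ w := fun x hxw =>
    c.continuous.continuousAt.eventually_ne hxw
  have hlc : ∀ x, c.map x ∈ D → ∀ᶠ x' in 𝓝[c.map ⁻¹' D] x, L' x' = L' x := by
    intro x hx
    by_cases hxw : c.map x = w
    · have h1 : ∀ᶠ x' in 𝓝[c.map ⁻¹' D] x, ‖C.κ (c.map x')‖ < ε₀ := by
        refine (hκc x hx).eventually_lt continuousWithinAt_const ?_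
        simpa only [hxw, C.κ_center, norm_zero] using hε₀
      filter_upwards [h1, self_mem_nhdsWithin,
        mem_nhdsWithin_of_mem_nhds ((hN x).2.mem_nhds (hN x).1)] with x' h1 h2 h3
      by_cases h : c.map x' = w
      · rw [hL'v x' h, hL'v x hxw]
        exact huniq h hxw (hN x').1 h3
      · rw [hL'v x hxw]
        simp only [L', if_neg h]
        refine hLeq x' x ‖C.κ (c.map x')‖ h2 h hxw ⟨norm_pos_iff.2 fun h0 =>
          h ((C.κ_eq_zero h2).1 h0), h1⟩ ?_
        rwa [hself x' h2 h]
    · have hs : ε₀ / 2 ∈ Ioc (0 : ℝ) 1 := ⟨by linarith, by linarith⟩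
      have h1 : ContinuousWithinAt (fun x' => Q.R x' (ε₀ / 2)) (c.map ⁻¹' D ∩ {x | c.map x ≠ w}) x :=
        (Q.cont (x, ε₀ / 2) (hdom hx hxw hs)).comp (f := fun x' => (x', ε₀ / 2))
          (by fun_prop) (fun x' hx' => hdom hx'.1 hx'.2 hs)
      have h2 := h1.preimage_mem_nhdsWithin ((hN (L x)).2.mem_nhds
        (hLN x hx hxw (ε₀ / 2) ⟨by linarith, by linarith⟩))
      rw [nhdsWithin_inter_of_mem' (mem_nhdsWithin_of_mem_nhds (hne_nhds x hxw))] at h2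
      filter_upwards [h2, self_mem_nhdsWithin, mem_nhdsWithin_of_mem_nhds (hne_nhds x hxw)]
        with x' h2 h3 h4
      simp only [L', if_neg hxw, if_neg h4]
      exact hLeq x' (L x) _ h3 h4 (hLw x hx hxw) ⟨by linarith, by linarith⟩ h2
  let R : c.surf → ℝ → c.surf := fun x s => if 0 < s then Q.R x s else L' x
  have hR0 : ∀ x, R x 0 = L' x := fun x => if_neg (lt_irrefl _)
  have hRpos : ∀ x s, 0 < s → R x s = Q.R x s := fun x s hs => if_pos hs
  have hne : ∀ {x s}, (x, s) ∈ c.flowDomain C → 0 < s → c.map x ≠ w := fun h hs hw =>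
    hs.ne' (h.2.2 hw)
  refine ⟨⟨R, ?_, ?_, ?_, ?_, ?_, ?_⟩⟩
  · rintro ⟨x, s⟩ h
    rcases h.2.1.1.eq_or_lt with hs | hs
    · obtain rfl : 0 = s := hs
      rw [ContinuousWithinAt, Function.uncurry_apply_pair, hR0]
      intro O hO
      obtain ⟨ε, hε, -, hO'⟩ := hunif _ (hL'w x h.1) O hO
      have h1 : ∀ᶠ q in 𝓝[c.flowDomain C] (x, (0 : ℝ)), L' q.1 = L' x := by
        have : Tendsto Prod.fst (𝓝[c.flowDomain C] (x, (0 : ℝ))) (𝓝[c.map ⁻¹' D] x) :=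
          tendsto_nhdsWithin_of_tendsto_nhds_of_eventually_within _
            (continuous_fst.continuousAt.mono_left nhdsWithin_le_nhds)
            (eventually_nhdsWithin_of_forall fun q hq => hq.1)
        exact this.eventually (hlc x h.1)
      have h2 : ∀ᶠ q in 𝓝[c.flowDomain C] (x, (0 : ℝ)), q.2 < ε :=
        mem_nhdsWithin_of_mem_nhds ((continuous_snd.continuousAt (x := (x, (0 : ℝ)))).eventually_lt
          continuousAt_const hε)
      rw [mem_map]
      filter_upwards [h1, h2, self_mem_nhdsWithin] with q hq1 hq2 hq3
      rcases hq3.2.1.1.eq_or_lt with hs | hs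
      · change R q.1 q.2 ∈ O
        rw [← hs, hR0, hq1]; exact mem_of_mem_nhds hO
      · change R q.1 q.2 ∈ O
        rw [hRpos _ _ hs]
        have hw := hne hq3 hs
        refine hO' q.1 hq3.1 hw ?_ q.2 ⟨hs, hq2⟩
        rw [← hq1]; exact (if_neg hw).symm
    · have h1 : ContinuousWithinAt (Function.uncurry Q.R)
          (c.flowDomain C ∩ {q | 0 < q.2}) (x, s) :=
        (Q.cont (x, s) (hdom h.1 (hne h hs) ⟨hs, h.2.1.2⟩)).mono fun q hq =>
          hdom hq.1.1 (hne hq.1 hq.2) ⟨hq.2, hq.1.2.1.2⟩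
      have hpos : ∀ᶠ q : c.surf × ℝ in 𝓝 (x, s), 0 < q.2 :=
        continuousAt_const.eventually_lt (continuous_snd.continuousAt (x := (x, s))) hs
      rw [ContinuousWithinAt,
        nhdsWithin_inter_of_mem' (mem_nhdsWithin_of_mem_nhds hpos)] at h1
      have h2 : ContinuousWithinAt (Function.uncurry Q.R) (c.flowDomain C) (x, s) := h1
      refine h2.congr_of_eventuallyEq ?_ (hRpos x s hs)
      filter_upwards [mem_nhdsWithin_of_mem_nhds hpos] with q hq using hRpos _ _ hq
  · intro x s h
    rcases h.2.1.1.eq_or_lt with hs | hs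
    · obtain rfl : 0 = s := hs
      rw [hR0, hL'w x h.1]; simp [C.center]
    · rw [hRpos _ _ hs, Q.map x s (hdom h.1 (hne h hs) ⟨hs, h.2.1.2⟩)]
  · intro x hx
    by_cases h : c.map x = w
    · rw [h, C.κ_center, norm_zero, hR0, hL'v x h]
    · rw [hRpos _ _ (norm_pos_iff.2 fun h0 => h ((C.κ_eq_zero hx).1 h0)), hself x hx h]
  · intro x s t h ht hst
    rcases h.2.1.1.eq_or_lt with hs | hs
    · obtain rfl : 0 = s := hs
      rw [hst rfl, hR0 x, hR0, hL'v _ (hL'w x h.1)]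
    · have hw := hne h hs
      have hdm := hdom h.1 hw ⟨hs, h.2.1.2⟩
      rw [hRpos x s hs]
      rcases ht.1.eq_or_lt with ht0 | ht0
      · rw [← ht0, hR0, hR0]
        simp only [L', if_neg hw]
        have h1 : c.map (Q.R x s) ≠ w := by
          intro h1
          have := Q.norm_κ_map le_rfl hdm
          rw [h1, C.κ_center, norm_zero] at this
          exact hs.ne this
        rw [if_neg h1]
        have hm : ε₀ / 2 ∈ Ioc (0 : ℝ) 1 := ⟨by linarith, by linarith⟩
        refine hLeq _ _ (ε₀ / 2) (Q.map_mem le_rfl hdm) h1 (hLw x h.1 hw)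
          ⟨by linarith, by linarith⟩ ?_
        rw [Q.comp x s _ hdm hm]
        exact hLN x h.1 hw _ ⟨by linarith, by linarith⟩
      · rw [hRpos _ _ ht0, hRpos _ _ ht0, Q.comp x s t hdm ⟨ht0, ht.2⟩]
  · intro x hx
    simpa only [hR0] using hlc x hx
  · intro v hv O hO
    obtain ⟨ε, hε, -, hO'⟩ := hunif v hv O hO
    refine ⟨ε, hε, fun x hx hxv hxε => ?_⟩
    rw [hR0] at hxv
    by_cases h : c.map x = w
    · rw [hL'v x h] at hxv; rw [hxv]; exact mem_of_mem_nhds hO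
    · simp only [L', if_neg h] at hxv
      rw [← hself x hx h]
      exact hO' x hx h hxv _ ⟨norm_pos_iff.2 fun h0 => h ((C.κ_eq_zero hx).1 h0), hxε⟩

end Covering

end

/-! ### The neighbourhoods U_v described by the radial flow. -/

noncomputable section

namespace Covering

namespace Flow

variable {c : Covering} {D : Sphere2 → Set Sphere2} {w : Sphere2} {C : DiskChart (D w) w}
  (F : c.Flow C)

lemma map_mem {x : c.surf} {s : ℝ} (h : (x, s) ∈ c.flowDomain C) : c.map (F.R x s) ∈ D w := by
  rw [F.map x s h]
  exact C.mapsΦ _ (norm_real_mul_dir_le _ h.2.1)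

lemma κ_map {x : c.surf} {s : ℝ} (h : (x, s) ∈ c.flowDomain C) :
    C.κ (c.map (F.R x s)) = s * dir (C.κ (c.map x)) := by
  rw [F.map x s h, C.κΦ _ (norm_real_mul_dir_le _ h.2.1)]

lemma norm_κ_map {x : c.surf} {s : ℝ} (h : (x, s) ∈ c.flowDomain C) :
    ‖C.κ (c.map (F.R x s))‖ = s := by
  rw [F.κ_map h]
  by_cases hw : c.map x = w
  · have h0 : s = 0 := h.2.2 hw
    simp [h0]
  · exact norm_real_mul_dir (fun h0 => hw ((C.κ_eq_zero h.1).1 h0)) h.2.1.1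

lemma zero_of_map_eq {v : c.surf} (hv : c.map v = w) : F.R v 0 = v := by
  have := F.self v (by rw [hv]; exact C.center_mem)
  rwa [hv, C.κ_center, norm_zero] at this

lemma zero_zero {x : c.surf} {s : ℝ} (h : (x, s) ∈ c.flowDomain C) :
    F.R (F.R x s) 0 = F.R x 0 :=
  F.comp x s 0 h (by simp) fun _ => rfl

/-- Contraction along the rays. -/
def shrink (x : c.surf) (t : ℝ) : c.surf := F.R x (t * ‖C.κ (c.map x)‖)

lemma shrink_mem_domain {x : c.surf} {t : ℝ} (hx : c.map x ∈ D w) (ht : t ∈ Icc (0 : ℝ) 1) :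
    (x, t * ‖C.κ (c.map x)‖) ∈ c.flowDomain C :=
  ⟨hx, ⟨mul_nonneg ht.1 (norm_nonneg _), mul_le_one₀ ht.2 (norm_nonneg _) (C.mapsκ _ hx)⟩,
    fun h => by simp [h, C.κ_center]⟩

lemma continuousOn_norm : ContinuousOn (fun x => ‖C.κ (c.map x)‖) (c.map ⁻¹' D w) :=
  (C.contκ.comp c.continuous.continuousOn fun _ h => h).norm

lemma continuousOn_shrink :
    ContinuousOn (Function.uncurry F.shrink) ((c.map ⁻¹' D w) ×ˢ Icc 0 1) := by
  refine F.cont.comp (f := fun q : c.surf × ℝ => (q.1, q.2 * ‖C.κ (c.map q.1)‖)) ?_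
    fun q hq => shrink_mem_domain hq.1 hq.2
  exact continuousOn_fst.prodMk (continuousOn_snd.mul
    (continuousOn_norm.comp continuousOn_fst fun q hq => hq.1))

/-- Contraction along the rays deforms S, within S, from the identity to the constant map to v. -/
lemma contractible {v : c.surf} {S : Set c.surf}
    (hS : ∀ x ∈ S, c.map x ∈ D w ∧ F.R x 0 = v) (hvS : v ∈ S)
    (hsh : ∀ x ∈ S, ∀ t ∈ Icc (0 : ℝ) 1, F.shrink x t ∈ S) : ContractibleSpace S := by
  refine (contractible_iff_id_nullhomotopic S).2 ⟨⟨v, hvS⟩, ⟨?_⟩⟩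
  refine ContinuousMap.Homotopy.symm ⟨⟨fun q => ⟨F.shrink q.2.1 q.1, hsh _ q.2.2 _ q.1.2⟩, ?_⟩,
    fun x => ?_, fun x => ?_⟩
  · refine Continuous.subtype_mk ?_ _
    exact F.continuousOn_shrink.comp_continuous
      (f := fun q : unitInterval × S => ((q.2 : c.surf), (q.1 : ℝ)))
      (by fun_prop) (fun q => ⟨(hS _ q.2.2).1, q.1.2⟩)
  · apply Subtype.ext
    simp [shrink, (hS _ x.2).2]
  · apply Subtype.ext
    simp [shrink, F.self _ (hS _ x.2).1]

lemma shrink_spec {x : c.surf} (hx : c.map x ∈ D w) {t : ℝ} (ht : t ∈ Icc (0 : ℝ) 1) :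
    c.map (F.shrink x t) ∈ D w ∧ F.R (F.shrink x t) 0 = F.R x 0 ∧
      ‖C.κ (c.map (F.shrink x t))‖ ≤ ‖C.κ (c.map x)‖ := by
  have h := shrink_mem_domain (C := C) hx ht
  refine ⟨F.map_mem h, F.zero_zero h, ?_⟩
  rw [shrink, F.norm_κ_map h]
  exact mul_le_of_le_one_left (norm_nonneg _) ht.2

lemma contractible_fiber {v : c.surf} (hv : c.map v = w) :
    ContractibleSpace {x | c.map x ∈ D w ∧ F.R x 0 = v} := by
  refine F.contractible (v := v) (fun x hx => hx)
    ⟨by rw [hv]; exact C.center_mem, F.zero_of_map_eq hv⟩ fun x hx t ht => ?_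
  have h := F.shrink_spec hx.1 ht
  exact ⟨h.1, h.2.1.trans hx.2⟩

/-- The end point of the flow is locally constant over the disk, hence constant on connected sets,
and each set of points with a given end point is contractible. -/
lemma nbhd_eq {v : c.surf} (hv : c.map v = w) :
    c.nbhd D v = {x | c.map x ∈ D w ∧ F.R x 0 = v} := by
  have hvm : v ∈ c.map ⁻¹' D w := by rw [mem_preimage, hv]; exact C.center_mem
  rw [nbhd, hv]
  apply Subset.antisymm
  · intro x hx
    have h1 := connectedComponentIn_subset _ _ hx
    refine ⟨h1, ?_⟩
    rw [← F.zero_of_map_eq hv]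
    exact isPreconnected_connectedComponentIn.eq_of_locallyConst (g := fun x => F.R x 0)
      (fun y hy => nhdsWithin_mono _ (connectedComponentIn_subset _ _)
        (F.locallyConst y (connectedComponentIn_subset (c.map ⁻¹' D w) v hy))) hx (mem_connectedComponentIn hvm)
  · have := F.contractible_fiber hv
    have hp : IsPathConnected {x | c.map x ∈ D w ∧ F.R x 0 = v} :=
      isPathConnected_iff_pathConnectedSpace.2 inferInstance
    exact hp.isConnected.isPreconnected.subset_connectedComponentIn
      ⟨hvm, F.zero_of_map_eq hv⟩ fun x hx => hx.1

variable {v : c.surf}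

lemma mem_nbhd_iff (hv : c.map v = w) {x : c.surf} :
    x ∈ c.nbhd D v ↔ c.map x ∈ D w ∧ F.R x 0 = v := by rw [F.nbhd_eq hv]; rfl

lemma self_mem_nbhd (F : c.Flow C) (hv : c.map v = w) : v ∈ c.nbhd D v :=
  (F.mem_nbhd_iff hv).2 ⟨by rw [hv]; exact C.center_mem, F.zero_of_map_eq hv⟩

lemma eventually_mem_nbhd (F : c.Flow C) (hv : c.map v = w) {x : c.surf} (hx : x ∈ c.nbhd D v) :
    c.nbhd D v ∈ 𝓝[c.map ⁻¹' D w] x := by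
  obtain ⟨h1, h2⟩ := (F.mem_nbhd_iff hv).1 hx
  filter_upwards [F.locallyConst x h1, self_mem_nhdsWithin] with y hy hyD
  exact (F.mem_nbhd_iff hv).2 ⟨hyD, hy.trans h2⟩

lemma isClosed_nbhd (_ : c.Flow C) (hv : c.map v = w) : IsClosed (c.nbhd D v) := by
  rw [nbhd, hv]
  have hvm : v ∈ c.map ⁻¹' D w := by rw [mem_preimage, hv]; exact C.center_mem
  refine isClosed_of_closure_subset ?_
  exact isPreconnected_connectedComponentIn.closure.subset_connectedComponentIn
    (subset_closure (mem_connectedComponentIn hvm))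
    (closure_minimal (connectedComponentIn_subset _ _) (C.isClosed.preimage c.continuous))

/-- One direction is openness of the map, the other is that U_v is open in the preimage of the disk.
-/
lemma mem_interior_nbhd (F : c.Flow C) (hv : c.map v = w) {x : c.surf} :
    x ∈ interior (c.nbhd D v) ↔ x ∈ c.nbhd D v ∧ c.map x ∈ interior (D w) := by
  constructor
  · intro h
    refine ⟨interior_subset h, ?_⟩
    have h1 : c.map '' interior (c.nbhd D v) ⊆ D w := by
      rintro _ ⟨y, hy, rfl⟩
      exact ((F.mem_nbhd_iff hv).1 (interior_subset hy)).1
    exact interior_maximal h1 (c.isOpenMap _ isOpen_interior) ⟨x, h, rfl⟩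
  · rintro ⟨h1, h2⟩
    rw [mem_interior_iff_mem_nhds]
    have h3 := F.eventually_mem_nbhd hv h1
    rwa [nhdsWithin_eq_nhds.2 (mem_of_superset (c.continuous.continuousAt.preimage_mem_nhds
      (isOpen_interior.mem_nhds h2)) (preimage_mono interior_subset))] at h3

lemma self_mem_interior_nbhd (F : c.Flow C) (hv : c.map v = w) : v ∈ interior (c.nbhd D v) :=
  (F.mem_interior_nbhd hv).2 ⟨F.self_mem_nbhd hv, by rw [hv]; exact C.center_mem_interior⟩

lemma contractible_nbhd (F : c.Flow C) (hv : c.map v = w) : ContractibleSpace (c.nbhd D v) := by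
  rw [F.nbhd_eq hv]; exact F.contractible_fiber hv

lemma contractible_interior_nbhd (F : c.Flow C) (hv : c.map v = w) :
    ContractibleSpace (interior (c.nbhd D v)) := by
  refine F.contractible (v := v) (fun x hx => (F.mem_nbhd_iff hv).1 (interior_subset hx))
    (F.self_mem_interior_nbhd hv) fun x hx t ht => ?_
  obtain ⟨h1, h2⟩ := (F.mem_interior_nbhd hv).1 hx
  obtain ⟨h3, h4⟩ := (F.mem_nbhd_iff hv).1 h1
  obtain ⟨h5, h6, h7⟩ := F.shrink_spec h3 ht
  refine (F.mem_interior_nbhd hv).2 ⟨(F.mem_nbhd_iff hv).2 ⟨h5, h6.trans h4⟩, ?_⟩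
  rw [C.mem_interior_iff h5]
  exact h7.trans_lt ((C.mem_interior_iff h3).1 h2)

end Flow

/-! ### Neighbourhoods of critical points -/

section Family

variable {c : Covering} {D : Sphere2 → Set Sphere2}

lemma IsDiskFamily.exists_chart (hD : c.IsDiskFamily D) {w : Sphere2} (hw : w ∈ c.critValues) :
    Nonempty (DiskChart (D w) w) := (hD.1 w hw).1.exists_diskChart (hD.1 w hw).2

lemma IsDiskFamily.eq_of_mem (hD : c.IsDiskFamily D) {w w' y : Sphere2} (hw : w ∈ c.critValues)
    (hw' : w' ∈ c.critValues) (h : y ∈ D w) (h' : y ∈ D w') : w = w' := by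
  by_contra hne
  exact disjoint_left.1 (hD.2 hw hw' hne) h h'

lemma IsDiskFamily.mem_self (hD : c.IsDiskFamily D) {w : Sphere2} (hw : w ∈ c.critValues) :
    w ∈ D w := interior_subset (hD.1 w hw).2

lemma IsDiskFamily.exists_flow (hD : c.IsDiskFamily D) {w : Sphere2} (hw : w ∈ c.critValues)
    (C : DiskChart (D w) w) : Nonempty (c.Flow C) :=
  c.exists_flow C fun _ hy hyc => hD.eq_of_mem hyc hw (hD.mem_self hyc) hy

lemma IsDiskFamily.exists_flow_at (hD : c.IsDiskFamily D) {v : c.surf} (hv : v ∈ c.critPoints) :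
    ∃ C : DiskChart (D (c.map v)) (c.map v), Nonempty (c.Flow C) := by
  obtain ⟨C⟩ := hD.exists_chart (mem_image_of_mem _ hv)
  exact ⟨C, hD.exists_flow (mem_image_of_mem _ hv) C⟩

lemma IsDiskFamily.isClosed (hD : c.IsDiskFamily D) {w : Sphere2} (hw : w ∈ c.critValues) :
    IsClosed (D w) := (hD.exists_chart hw).some.isClosed

lemma nbhd_subset (v : c.surf) : c.nbhd D v ⊆ c.map ⁻¹' D (c.map v) :=
  connectedComponentIn_subset _ _

lemma IsDiskFamily.self_mem_interior (hD : c.IsDiskFamily D) {v : c.surf}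
    (hv : v ∈ c.critPoints) : v ∈ interior (c.nbhd D v) := by
  obtain ⟨C, ⟨F⟩⟩ := hD.exists_flow_at hv
  exact F.self_mem_interior_nbhd rfl

lemma IsDiskFamily.isClosed_nbhd (hD : c.IsDiskFamily D) {v : c.surf}
    (hv : v ∈ c.critPoints) : IsClosed (c.nbhd D v) := by
  obtain ⟨C, ⟨F⟩⟩ := hD.exists_flow_at hv
  exact F.isClosed_nbhd rfl

lemma IsDiskFamily.mem_interior (hD : c.IsDiskFamily D) {v : c.surf}
    (hv : v ∈ c.critPoints) {x : c.surf} :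
    x ∈ interior (c.nbhd D v) ↔ x ∈ c.nbhd D v ∧ c.map x ∈ interior (D (c.map v)) := by
  obtain ⟨C, ⟨F⟩⟩ := hD.exists_flow_at hv
  exact F.mem_interior_nbhd rfl

/-- Disjointness of the disks forces equal values, and then both points are the end point of the
flow from x. -/
lemma IsDiskFamily.eq_of_mem_nbhd (hD : c.IsDiskFamily D) {v v' x : c.surf}
    (hv : v ∈ c.critPoints) (hv' : v' ∈ c.critPoints) (h : x ∈ c.nbhd D v)
    (h' : x ∈ c.nbhd D v') : v = v' := by
  have hw : c.map v' = c.map v := hD.eq_of_mem (mem_image_of_mem _ hv') (mem_image_of_mem _ hv)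
    (nbhd_subset v' h') (nbhd_subset v h)
  obtain ⟨C, ⟨F⟩⟩ := hD.exists_flow_at hv
  rw [← ((F.mem_nbhd_iff rfl).1 h).2, ((F.mem_nbhd_iff hw).1 h').2]

lemma IsDiskFamily.eq_of_crit_mem (hD : c.IsDiskFamily D) {v v' : c.surf}
    (hv : v ∈ c.critPoints) (hv' : v' ∈ c.critPoints) (h : v' ∈ c.nbhd D v) : v' = v :=
  hD.eq_of_mem_nbhd hv' hv (interior_subset (hD.self_mem_interior hv')) h

end Family

end Covering

end

/-! ### Perturbations as collapsing maps, and their composition. -/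

noncomputable section

lemma betti_congr_set {X Y : Type} [TopologicalSpace X] [TopologicalSpace Y] (n : ℕ) (e : X ≃ₜ Y)
    {S : Set X} {T : Set Y} (h : ∀ x, x ∈ S ↔ e x ∈ T) :
    betti (n + 1) S = betti (n + 1) T :=
  betti_eq_of_homeomorph n
    { toFun := fun x => ⟨e x, (h x).1 x.2⟩
      invFun := fun y => ⟨e.symm y, (h _).2 (by rw [e.apply_symm_apply]; exact y.2)⟩
      left_inv := fun x => Subtype.ext (e.symm_apply_apply _)
      right_inv := fun x => Subtype.ext (e.apply_symm_apply _)
      continuous_toFun := (e.continuous.comp continuous_subtype_val).subtype_mk _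
      continuous_invFun := (e.symm.continuous.comp continuous_subtype_val).subtype_mk _ }

lemma betti_preimage_val {X : Type} [TopologicalSpace X] (n : ℕ) {S T : Set X} (h : T ⊆ S) :
    betti (n + 1) (Subtype.val ⁻¹' T : Set S) = betti (n + 1) T :=
  betti_eq_of_homeomorph n
    { toFun := fun x => ⟨x.1.1, x.2⟩
      invFun := fun y => ⟨⟨y.1, h y.2⟩, y.2⟩
      left_inv := fun x => rfl
      right_inv := fun x => rfl
      continuous_toFun := by fun_prop
      continuous_invFun := by fun_prop }

namespace Covering

lemma milnor_eq_zero {c : Covering} {x : c.surf} (h : x ∉ c.critPoints) : c.surf.milnor x = 0 := by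
  by_contra h'
  exact h (Or.inr (Nat.pos_of_ne_zero h'))

/-- Milnor numbers vanish off the critical points. The intersection makes the index set finite, so
that sums can be split. -/
lemma finsum_milnor_inter (c : Covering) (S : Set c.surf) :
    ∑ᶠ x ∈ S, c.surf.milnor x = ∑ᶠ x ∈ S ∩ c.critPoints, c.surf.milnor x := by
  refine finsum_mem_inter_support_eq _ _ _ ?_
  ext x
  simp only [mem_inter_iff, Function.mem_support]
  constructor
  · rintro ⟨h1, h2⟩
    exact ⟨⟨h1, by_contra fun h => h2 (milnor_eq_zero h)⟩, h2⟩
  · rintro ⟨⟨h1, -⟩, h2⟩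
    exact ⟨h1, h2⟩

/-- A description of perturbations by maps collapsing the perturbed pieces. -/
structure Collapse (c₀ c₁ : Covering) (D : Sphere2 → Set Sphere2) (π : C(c₁.surf, c₀.surf)) :
    Prop where
  crit : ∀ x ∈ c₁.critPoints, π x ∈ c₀.critPoints
  inj : ∀ x y, π x = π y → π x ∉ c₀.critPoints → x = y
  surj : ∀ x ∉ c₀.critPoints, ∃ y, π y = x
  map_eq : ∀ y, (∀ v ∈ c₀.critPoints, π y ∉ interior (c₀.nbhd D v)) → c₀.map (π y) = c₁.map y
  genus_eq : ∀ y, (∀ v ∈ c₀.critPoints, π y ∉ interior (c₀.nbhd D v)) →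
    c₀.surf.genus (π y) = c₁.surf.genus y
  mapsTo : ∀ v ∈ c₀.critPoints, ∀ y, π y ∈ c₀.nbhd D v → c₁.map y ∈ D (c₀.map v)
  connected : ∀ v ∈ c₀.critPoints, IsConnected (π ⁻¹' c₀.nbhd D v)
  -- The interiors are recorded as well because `betti_collapse` works with open sets.
  connected_interior : ∀ v ∈ c₀.critPoints, IsConnected (π ⁻¹' interior (c₀.nbhd D v))
  betti_one : ∀ v ∈ c₀.critPoints, betti 1 (π ⁻¹' c₀.nbhd D v) +
    ((∑ᶠ x ∈ π ⁻¹' c₀.nbhd D v, c₁.surf.milnor x : ℕ) : Cardinal) = (c₀.surf.milnor v : Cardinal)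
  betti_one_interior : ∀ v ∈ c₀.critPoints,
    betti 1 (π ⁻¹' interior (c₀.nbhd D v)) = betti 1 (π ⁻¹' c₀.nbhd D v)
  betti_two : ∀ v ∈ c₀.critPoints, betti 2 (π ⁻¹' c₀.nbhd D v) = 0
  betti_two_interior : ∀ v ∈ c₀.critPoints, betti 2 (π ⁻¹' interior (c₀.nbhd D v)) = 0

namespace Collapse

/-- The trivial perturbation. -/
lemma refl {c : Covering} {D : Sphere2 → Set Sphere2} (hD : c.IsDiskFamily D) :
    Collapse c c D (ContinuousMap.id _) := by
  have hc : ∀ v ∈ c.critPoints, ContractibleSpace (c.nbhd D v) ∧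
      ContractibleSpace (interior (c.nbhd D v)) := by
    intro v hv
    obtain ⟨C, ⟨F⟩⟩ := hD.exists_flow_at hv
    exact ⟨F.contractible_nbhd rfl, F.contractible_interior_nbhd rfl⟩
  have hconn : ∀ S : Set c.surf, ContractibleSpace S → IsConnected S := fun S h =>
    (isPathConnected_iff_pathConnectedSpace.2 inferInstance).isConnected
  have hb : ∀ n, ∀ S : Set c.surf, ContractibleSpace S → betti (n + 1) S = 0 := fun n S h =>
    betti_eq_zero_of_contractible n S
  refine ⟨fun x hx => hx, fun x y h _ => h, fun x _ => ⟨x, rfl⟩, fun _ _ => rfl, fun _ _ => rfl,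
    fun v _ y hy => nbhd_subset v hy, fun v hv => hconn _ (hc v hv).1,
    fun v hv => hconn _ (hc v hv).2, fun v hv => ?_,
    fun v hv => (hb 0 _ (hc v hv).2).trans (hb 0 _ (hc v hv).1).symm,
    fun v hv => hb 1 _ (hc v hv).1, fun v hv => hb 1 _ (hc v hv).2⟩
  have h1 : betti 1 (ContinuousMap.id c.surf ⁻¹' c.nbhd D v) = 0 := hb 0 _ (hc v hv).1
  rw [h1, zero_add]
  congr 1
  rw [finsum_milnor_inter]
  have : (ContinuousMap.id c.surf ⁻¹' c.nbhd D v) ∩ c.critPoints = {v} := by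
    ext x
    constructor
    · rintro ⟨hx, hxc⟩
      exact hD.eq_of_crit_mem hv hxc hx
    · rintro rfl
      exact ⟨interior_subset (hD.self_mem_interior hv), hv⟩
  rw [this, finsum_mem_singleton]

variable {c₀ c₁ c₂ : Covering} {D D' : Sphere2 → Set Sphere2} {π : C(c₁.surf, c₀.surf)}
  {π' : C(c₂.surf, c₁.surf)}

/-- The image is compact and contains the dense set of non-critical points. -/
lemma surjective (h : Collapse c₀ c₁ D π) : Function.Surjective π := by
  have hd : range π = univ := by
    have h1 : IsClosed (range π) := (isCompact_range π.continuous).isClosed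
    rw [← h1.closure_eq, ← univ_subset_iff, ← c₀.dense_compl_critPoints.closure_eq]
    exact closure_mono fun x hx => h.surj x hx
  exact range_eq_univ.1 hd

/-- The inverse of a collapsing map away from the critical points. -/
lemma exists_section (h : Collapse c₀ c₁ D π) :
    ∃ g : C(↥(c₀.critPointsᶜ), c₁.surf), ∀ x, π (g x) = x := by
  choose g hg using h.surj
  refine ⟨⟨fun x => g x.1 x.2, ?_⟩, fun x => hg _ _⟩
  refine continuous_iff_isClosed.2 fun K hK => ?_
  have : (fun x : ↥(c₀.critPointsᶜ) => g x.1 x.2) ⁻¹' K = Subtype.val ⁻¹' (π '' K) := by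
    ext x
    constructor
    · exact fun hx => ⟨_, hx, hg _ _⟩
    · rintro ⟨y, hy, hyx⟩
      have : y = g x.1 x.2 := h.inj _ _ (hyx.trans (hg _ _).symm) (hyx ▸ x.2)
      rw [this] at hy
      exact hy
  rw [this]
  exact (π.continuous.isClosedMap K hK).preimage continuous_subtype_val

/-- Collapsing maps come from perturbations. -/
lemma isPerturbationAt (h : Collapse c₀ c₁ D π) (hD : c₀.IsDiskFamily D) :
    ∃ j T, IsPerturbationAt c₀ c₁ D c₀.critPoints j T := by
  have hZ : ∀ x : ↥((⋃ v ∈ c₀.critPoints, interior (c₀.nbhd D v))ᶜ), x.1 ∉ c₀.critPoints :=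
    fun x hx => x.2 (mem_biUnion hx (hD.self_mem_interior hx))
  have hZ' : ∀ x : ↥((⋃ v ∈ c₀.critPoints, interior (c₀.nbhd D v))ᶜ), ∀ v ∈ c₀.critPoints,
      x.1 ∉ interior (c₀.nbhd D v) := fun x v hv hx => x.2 (mem_biUnion hv hx)
  obtain ⟨g, hg⟩ := h.exists_section
  let j : ↥((⋃ v ∈ c₀.critPoints, interior (c₀.nbhd D v))ᶜ) → c₁.surf := fun x => g ⟨x.1, hZ x⟩
  have hj : ∀ x, π (j x) = x := fun x => hg _
  have hjc : Continuous j := g.continuous.comp (continuous_subtype_val.subtype_mk _)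
  have hjeq : ∀ y (hy : π y ∈ (⋃ v ∈ c₀.critPoints, interior (c₀.nbhd D v))ᶜ),
      j ⟨π y, hy⟩ = y := fun y hy => h.inj _ _ (hj _) (by rw [hj]; exact hZ ⟨_, hy⟩)
  refine ⟨j, fun v => π ⁻¹' c₀.nbhd D v, ⟨subset_rfl, ?_, fun x => ?_, fun x => ?_, fun v hv => ?_,
    h.connected, fun v hv v' hv' hne => ?_, ?_, fun v hv => ?_, fun v hv y hy => h.mapsTo v hv y hy,
    h.betti_one, h.betti_two⟩⟩
  · refine IsEmbedding.of_comp hjc π.continuous ?_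
    have : π ∘ j = Subtype.val := funext hj
    rw [this]; exact IsEmbedding.subtypeVal
  · rw [← h.map_eq _ (by rw [hj]; exact hZ' x), hj]
  · rw [← h.genus_eq _ (by rw [hj]; exact hZ' x), hj]
  · exact (hD.isClosed_nbhd hv).preimage π.continuous
  · exact disjoint_left.2 fun y hy hy' => hne (hD.eq_of_mem_nbhd hv hv' hy hy')
  · refine eq_univ_of_forall fun y => ?_
    by_cases hy : π y ∈ ⋃ v ∈ c₀.critPoints, interior (c₀.nbhd D v)
    · obtain ⟨v, hv, hyv⟩ := mem_iUnion₂.1 hy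
      exact Or.inr (mem_biUnion hv (show y ∈ π ⁻¹' _ from interior_subset (s := c₀.nbhd D v) hyv))
    · exact Or.inl ⟨⟨_, hy⟩, hjeq y hy⟩
  · ext y
    constructor
    · rintro ⟨hy, x, rfl⟩
      refine ⟨x, ⟨subset_closure ?_, hZ' x v hv⟩, rfl⟩
      rw [mem_preimage, hj] at hy; exact hy
    · rintro ⟨x, hx, rfl⟩
      refine ⟨?_, x, rfl⟩
      rw [mem_preimage, hj]
      exact (hD.isClosed_nbhd hv).frontier_subset hx

/-! ### Change of the target by an isomorphism -/

lemma _root_.Covering.isRamified_comp {c c' : Covering} (α : c.surf ≃ₜ c'.surf)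
    (hα : ∀ x, c'.map (α x) = c.map x) {x : c.surf} (h : IsRamified c.map x) :
    IsRamified c'.map (α x) := by
  rintro ⟨N, hN, hinj⟩
  refine h ⟨α ⁻¹' N, α.continuous.continuousAt.preimage_mem_nhds hN, fun a ha b hb hab => ?_⟩
  exact α.injective (hinj ha hb (by rw [hα, hα, hab]))

/-- The genus is preserved by assumption, the number of branches because it is determined by the
topology. -/
lemma _root_.Covering.milnor_apply {c c' : Covering} (α : c.surf ≃ₜ c'.surf)
    (hg : ∀ x, c'.surf.genus (α x) = c.surf.genus x) (x : c.surf) :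
    c'.surf.milnor (α x) = c.surf.milnor x := by
  rw [ClosedSurface.milnor, ClosedSurface.milnor, hg,
    branches_eq_of_isOpenEmbedding (S := c.surf) (S' := c'.surf) IsOpenEmbedding.id
      α.isOpenEmbedding x, id]

lemma _root_.Covering.critPoints_apply {c c' : Covering} (α : c.surf ≃ₜ c'.surf)
    (hα : ∀ x, c'.map (α x) = c.map x) {x : c.surf} :
    α x ∈ c'.critPoints ↔ x ∈ c.critPoints := by
  rw [c'.critical_iff, c.critical_iff]
  refine ⟨fun h => ?_, isRamified_comp α hα⟩
  have := isRamified_comp (c := c') (c' := c) α.symm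
    (fun y => by rw [← hα, α.apply_symm_apply]) h
  rwa [α.symm_apply_apply] at this

lemma _root_.Covering.Iso.critValues_eq {c c' : Covering} (h : Iso c c') :
    c'.critValues = c.critValues := by
  obtain ⟨α, -, hα⟩ := h
  ext y
  constructor
  · rintro ⟨x, hx, rfl⟩
    obtain ⟨x, rfl⟩ := α.surjective x
    exact ⟨x, (critPoints_apply α hα).1 hx, (hα x).symm⟩
  · rintro ⟨x, hx, rfl⟩
    exact ⟨α x, (critPoints_apply α hα).2 hx, hα x⟩

lemma congr_right (h : Collapse c₀ c₁ D π) (hi : Iso c₁ c₂) :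
    ∃ π₂ : C(c₂.surf, c₀.surf), Collapse c₀ c₂ D π₂ := by
  obtain ⟨α, hg, hα⟩ := hi
  have hα' : ∀ y, c₁.map (α.symm y) = c₂.map y := fun y => by rw [← hα, α.apply_symm_apply]
  have hg' : ∀ y, c₁.surf.genus (α.symm y) = c₂.surf.genus y := fun y => by
    rw [← hg, α.apply_symm_apply]
  let π₂ : C(c₂.surf, c₀.surf) := ⟨fun y => π (α.symm y), π.continuous.comp α.symm.continuous⟩
  have hb : ∀ n (S : Set c₀.surf), betti (n + 1) (π₂ ⁻¹' S) = betti (n + 1) (π ⁻¹' S) :=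
    fun n S => betti_congr_set n α.symm fun y => Iff.rfl
  have hconn : ∀ S : Set c₀.surf, IsConnected (π ⁻¹' S) → IsConnected (π₂ ⁻¹' S) := by
    intro S hS
    have : π₂ ⁻¹' S = α '' (π ⁻¹' S) := by
      rw [α.image_eq_preimage_symm]; rfl
    rw [this]; exact hS.image _ α.continuous.continuousOn
  refine ⟨π₂, fun x hx => h.crit _ ?_, fun x y hxy hx => ?_, fun x hx => ?_, fun y hy => ?_,
    fun y hy => ?_, fun v hv y hy => ?_, fun v hv => hconn _ (h.connected v hv),
    fun v hv => hconn _ (h.connected_interior v hv), fun v hv => ?_, fun v hv => ?_,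
    fun v hv => (hb 1 _).trans (h.betti_two v hv),
    fun v hv => (hb 1 _).trans (h.betti_two_interior v hv)⟩
  · exact (critPoints_apply α.symm hα').2 hx
  · exact α.symm.injective (h.inj _ _ hxy hx)
  · obtain ⟨y, hy⟩ := h.surj x hx
    exact ⟨α y, by simpa [π₂] using hy⟩
  · exact (h.map_eq _ hy).trans (hα' y)
  · exact (h.genus_eq _ hy).trans (hg' y)
  · rw [← hα']; exact h.mapsTo v hv _ hy
  · rw [hb 0, ← h.betti_one v hv]
    congr 2
    refine finsum_mem_eq_of_bijOn α.symm ?_ fun x _ => ?_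
    · exact (α.symm.toEquiv.bijOn (s := π₂ ⁻¹' c₀.nbhd D v) (t := π ⁻¹' c₀.nbhd D v)
        fun y => Iff.rfl)
    · exact (milnor_apply α.symm hg' x).symm
  · rw [hb 0, hb 0]; exact h.betti_one_interior v hv

/-! ### Composition -/

/-- The preimage of a set under a collapsing map. -/
lemma isConnected_preimage (h : Collapse c₀ c₁ D π) (hD : c₀.IsDiskFamily D) {Y : Set c₀.surf}
    (hY : IsConnected Y) (hYc : ∀ v ∈ c₀.critPoints, v ∈ Y → c₀.nbhd D v ⊆ Y) :
    IsConnected (π ⁻¹' Y) := by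
  refine ⟨?_, ?_⟩
  · obtain ⟨y, hy⟩ := hY.nonempty
    obtain ⟨x, rfl⟩ := h.surjective y
    exact ⟨x, hy⟩
  · refine isPreconnected_closed_iff.2 fun A B hA hB hAB ⟨a, haY, haA⟩ ⟨b, hbY, hbB⟩ => ?_
    obtain ⟨y, hyY, ⟨a', haA', ha'⟩, ⟨b', hbB', hb'⟩⟩ :=
      isPreconnected_closed_iff.1 hY.isPreconnected (π '' A) (π '' B)
      (π.continuous.isClosedMap _ hA) (π.continuous.isClosedMap _ hB) (fun y hy => by
        obtain ⟨x, rfl⟩ := h.surjective y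
        rcases hAB hy with hx | hx
        · exact Or.inl ⟨x, hx, rfl⟩
        · exact Or.inr ⟨x, hx, rfl⟩) ⟨π a, haY, a, haA, rfl⟩ ⟨π b, hbY, b, hbB, rfl⟩
    by_cases hy : y ∈ c₀.critPoints
    · have hs : π ⁻¹' c₀.nbhd D y ⊆ π ⁻¹' Y := preimage_mono (hYc y hy hyY)
      have hm : y ∈ c₀.nbhd D y := interior_subset (hD.self_mem_interior hy)
      obtain ⟨z, hz, hz'⟩ := isPreconnected_closed_iff.1 (h.connected y hy).isPreconnected A B hA hB
        (hs.trans hAB) ⟨a', by rw [mem_preimage, ha']; exact hm, haA'⟩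
        ⟨b', by rw [mem_preimage, hb']; exact hm, hbB'⟩
      exact ⟨z, hs hz, hz'⟩
    · have : a' = b' := h.inj _ _ (ha'.trans hb'.symm) (by rwa [ha'])
      subst this
      exact ⟨a', by rw [mem_preimage, ha']; exact hyY, haA', hbB'⟩

/-- `betti_collapse` for the restriction of π over Y: F is the set of critical points in Y, and the
open sets are the interiors of their neighbourhoods, which are contractible. `betti_one_interior`
then passes to the closed neighbourhoods. -/
lemma betti_preimage (h : Collapse c₀ c₁ D π) (hD : c₀.IsDiskFamily D) {Y : Set c₀.surf}
    (hYc : ∀ v ∈ c₀.critPoints, v ∈ Y → c₀.nbhd D v ⊆ Y) (hY : betti 2 Y = 0) :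
    betti 2 (π ⁻¹' Y) = 0 ∧
      betti 1 (π ⁻¹' Y) = betti 1 Y +
        ∑ᶠ v ∈ Y ∩ c₀.critPoints, betti 1 (π ⁻¹' c₀.nbhd D v) := by
  classical
  have hfin : (Y ∩ c₀.critPoints).Finite := c₀.finite_critPoints.subset inter_subset_right
  have : Fintype ↥(Y ∩ c₀.critPoints) := hfin.fintype
  let πY : C(π ⁻¹' Y, Y) := ⟨fun x => ⟨π x, x.2⟩, by fun_prop⟩
  let O : ↥(Y ∩ c₀.critPoints) → Set Y := fun v => Subtype.val ⁻¹' interior (c₀.nbhd D v)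
  have hsub : ∀ v : ↥(Y ∩ c₀.critPoints), interior (c₀.nbhd D v) ⊆ Y := fun v =>
    interior_subset.trans (hYc v v.2.2 v.2.1)
  have hpre : ∀ v, πY ⁻¹' O v = Subtype.val ⁻¹' (π ⁻¹' interior (c₀.nbhd D v)) := fun v => rfl
  have hpsub : ∀ v : ↥(Y ∩ c₀.critPoints), π ⁻¹' interior (c₀.nbhd D v) ⊆ π ⁻¹' Y := fun v =>
    preimage_mono (hsub v)
  obtain ⟨g, hg⟩ := h.exists_section
  have key := betti_collapse (π := πY) (O := O) (F := Subtype.val ⁻¹' c₀.critPoints)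
    ⟨fun x hx y hy hxy => Subtype.ext (h.inj _ _ (congrArg Subtype.val hxy) hx),
      fun n σ hσ => by
        have hσ' : ∀ p, (σ p).1 ∈ c₀.critPointsᶜ := fun p => hσ ⟨p, rfl⟩
        refine ⟨⟨fun p => ⟨g ⟨(σ p).1, hσ' p⟩, by rw [mem_preimage, hg]; exact (σ p).2⟩, ?_⟩, ?_⟩
        · fun_prop
        · exact ContinuousMap.ext fun p => Subtype.ext (hg _)⟩
    (c₀.finite_critPoints.isClosed.preimage continuous_subtype_val)
    (fun v => isOpen_interior.preimage continuous_subtype_val)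
    (fun v v' hne => disjoint_left.2 fun y hy hy' => hne (Subtype.ext (hD.eq_of_mem_nbhd
      v.2.2 v'.2.2 (interior_subset hy) (interior_subset hy'))))
    (fun y hy => mem_iUnion.2 ⟨⟨y.1, y.2, hy⟩, hD.self_mem_interior hy⟩)
    (fun v => by
      rw [hpre]
      refine IsPathConnected.preimage_coe ?_ (hpsub v)
      exact (isOpen_interior.preimage π.continuous).isConnected_iff_isPathConnected.1
        (h.connected_interior v v.2.2))
    (fun v => by
      rw [betti_preimage_val 0 (hsub v)]
      obtain ⟨C, ⟨F⟩⟩ := hD.exists_flow_at v.2.2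
      have := F.contractible_interior_nbhd rfl
      exact betti_eq_zero_of_contractible 0 _)
    hY
    (fun v => by
      rw [hpre, betti_preimage_val 1 (hpsub v)]
      exact h.betti_two_interior v v.2.2)
  refine ⟨key.1, key.2.trans ?_⟩
  congr 1
  rw [← finsum_set_coe_eq_finsum_mem, finsum_eq_sum_of_fintype]
  refine Finset.sum_congr rfl fun v _ => ?_
  rw [hpre, betti_preimage_val 0 (hpsub v), h.betti_one_interior v v.2.2]

/-- The connected set U'_x contains x and maps into the interior of the disk. On the preimage of the
frontier of U_v the collapse does not change the map, so values there are not interior, and U'_x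
cannot cross it. -/
lemma nbhd_subset_preimage (h : Collapse c₀ c₁ D π) (hD : c₀.IsDiskFamily D)
    (hD' : c₁.IsDiskFamily D')
    (hsub : ∀ w' ∈ c₁.critValues, ∃ w ∈ c₀.critValues, D' w' ⊆ interior (D w))
    {x : c₁.surf} (hx : x ∈ c₁.critPoints) :
    D' (c₁.map x) ⊆ interior (D (c₀.map (π x))) ∧
      c₁.nbhd D' x ⊆ π ⁻¹' interior (c₀.nbhd D (π x)) := by
  have hv := h.crit x hx
  have hvm := hD.self_mem_interior hv
  have hxm := hD'.self_mem_interior hx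
  have hD'w : D' (c₁.map x) ⊆ interior (D (c₀.map (π x))) := by
    obtain ⟨w, hw, hws⟩ := hsub _ (mem_image_of_mem _ hx)
    have h1 : c₁.map x ∈ D (c₀.map (π x)) := h.mapsTo _ hv x (interior_subset hvm)
    have h2 : c₁.map x ∈ D w :=
      interior_subset (hws (hD'.mem_self (mem_image_of_mem _ hx)))
    rwa [hD.eq_of_mem hw (mem_image_of_mem _ hv) h2 h1] at hws
  refine ⟨hD'w, ?_⟩
  have hpre : IsPreconnected (c₁.nbhd D' x) := isPreconnected_connectedComponentIn
  refine hpre.subset_left_of_subset_union (isOpen_interior.preimage π.continuous)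
    ((hD.isClosed_nbhd hv).preimage π.continuous).isOpen_compl
    (disjoint_left.2 fun y hy hy' => hy' (interior_subset (s := c₀.nbhd D (π x)) hy))
    (fun y hy => ?_) ⟨x, interior_subset hxm, hvm⟩
  by_cases hyv : π y ∈ c₀.nbhd D (π x)
  · left
    by_contra hyi
    have h1 := h.map_eq y fun v' hv' hv'y => by
      by_cases he : v' = π x
      · exact hyi (he ▸ hv'y)
      · exact he (hD.eq_of_mem_nbhd hv' hv (interior_subset hv'y) hyv)
    refine hyi ((hD.mem_interior hv).2 ⟨hyv, ?_⟩)
    rw [h1]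
    exact hD'w (nbhd_subset x hy)
  · exact Or.inr hyv

/-- A perturbation of a perturbation in smaller disks is a perturbation. -/
theorem trans (h : Collapse c₀ c₁ D π) (h' : Collapse c₁ c₂ D' π') (hD : c₀.IsDiskFamily D)
    (hD' : c₁.IsDiskFamily D')
    (hsub : ∀ w' ∈ c₁.critValues, ∃ w ∈ c₀.critValues, D' w' ⊆ interior (D w)) :
    Collapse c₀ c₂ D (π.comp π') := by
  have hA := fun {x} hx => h.nbhd_subset_preimage hD hD' hsub (x := x) hx
  have hY : ∀ v ∈ c₀.critPoints, ∀ x ∈ c₁.critPoints, π x ∈ c₀.nbhd D v →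
      c₁.nbhd D' x ⊆ π ⁻¹' interior (c₀.nbhd D v) := by
    intro v hv x hx hxv
    have := (hA hx).2
    rwa [hD.eq_of_crit_mem hv (h.crit x hx) hxv] at this
  have hY1 : ∀ v ∈ c₀.critPoints, ∀ x ∈ c₁.critPoints, x ∈ π ⁻¹' c₀.nbhd D v →
      c₁.nbhd D' x ⊆ π ⁻¹' c₀.nbhd D v := fun v hv x hx hxv =>
    (hY v hv x hx hxv).trans (preimage_mono interior_subset)
  have hY2 : ∀ v ∈ c₀.critPoints, ∀ x ∈ c₁.critPoints, x ∈ π ⁻¹' interior (c₀.nbhd D v) →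
      c₁.nbhd D' x ⊆ π ⁻¹' interior (c₀.nbhd D v) := fun v hv x hx hxv =>
    hY v hv x hx (interior_subset (s := c₀.nbhd D v) hxv)
  have hout : ∀ y, (∀ v ∈ c₀.critPoints, π (π' y) ∉ interior (c₀.nbhd D v)) →
      ∀ x ∈ c₁.critPoints, π' y ∉ interior (c₁.nbhd D' x) := fun y hy x hx hyx =>
    hy _ (h.crit x hx) ((hA hx).2 (interior_subset hyx))
  -- The closed neighbourhood and its interior have preimages with the same critical points of `c₁`,
  -- so the second collapse changes both first Betti numbers by the same sum.
  have hset : ∀ v ∈ c₀.critPoints, (π ⁻¹' interior (c₀.nbhd D v)) ∩ c₁.critPoints =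
      (π ⁻¹' c₀.nbhd D v) ∩ c₁.critPoints := by
    intro v hv
    ext x
    refine and_congr_left fun hx => ⟨fun hxv => interior_subset (s := c₀.nbhd D v) hxv,
      fun hxv => hY v hv x hx hxv (interior_subset (hD'.self_mem_interior hx))⟩
  refine ⟨fun x hx => h.crit _ (h'.crit x hx), fun x y hxy hx => ?_, fun x hx => ?_,
    fun y hy => ?_, fun y hy => ?_, fun v hv y hy => ?_,
    fun v hv => h'.isConnected_preimage hD' (h.connected v hv) (hY1 v hv),
    fun v hv => h'.isConnected_preimage hD' (h.connected_interior v hv) (hY2 v hv),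
    fun v hv => ?_, fun v hv => ?_,
    fun v hv => (h'.betti_preimage hD' (hY1 v hv) (h.betti_two v hv)).1,
    fun v hv => (h'.betti_preimage hD' (hY2 v hv) (h.betti_two_interior v hv)).1⟩
  · have h1 := h.inj _ _ hxy hx
    exact h'.inj _ _ h1 fun h2 => hx (h.crit _ h2)
  · obtain ⟨y, rfl⟩ := h.surj x hx
    obtain ⟨z, rfl⟩ := h'.surjective y
    exact ⟨z, rfl⟩
  · exact (h.map_eq _ hy).trans (h'.map_eq _ (hout y hy))
  · exact (h.genus_eq _ hy).trans (h'.genus_eq _ (hout y hy))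
  · by_cases hx : ∃ x ∈ c₁.critPoints, π' y ∈ interior (c₁.nbhd D' x)
    · obtain ⟨x, hx, hxy⟩ := hx
      have h1 := h'.mapsTo x hx y (interior_subset hxy)
      have h2 : π x = v := hD.eq_of_mem_nbhd (h.crit x hx) hv
        (interior_subset ((hA hx).2 (interior_subset hxy))) hy
      rw [← h2]
      exact interior_subset ((hA hx).1 h1)
    · push Not at hx
      rw [← h'.map_eq y hx]
      exact h.mapsTo v hv _ hy
  · have hb := (h'.betti_preimage hD' (hY1 v hv) (h.betti_two v hv)).2
    change betti 1 (π' ⁻¹' (π ⁻¹' c₀.nbhd D v)) +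
      ((∑ᶠ x ∈ π' ⁻¹' (π ⁻¹' c₀.nbhd D v), c₂.surf.milnor x : ℕ) : Cardinal) = _
    have hfin : ((π ⁻¹' c₀.nbhd D v) ∩ c₁.critPoints).Finite :=
      c₁.finite_critPoints.subset inter_subset_right
    -- The critical points of `c₂` are grouped by the critical point of `c₁` to which they collapse.
    -- Each group together with the Betti number of its piece replaces the Milnor number of that
    -- point.
    have hsum : ∑ᶠ x ∈ π' ⁻¹' (π ⁻¹' c₀.nbhd D v), c₂.surf.milnor x =
        ∑ᶠ x ∈ (π ⁻¹' c₀.nbhd D v) ∩ c₁.critPoints,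
          ∑ᶠ y ∈ π' ⁻¹' c₁.nbhd D' x, c₂.surf.milnor y := by
      rw [finsum_milnor_inter]
      simp_rw [finsum_milnor_inter c₂ (π' ⁻¹' c₁.nbhd D' _)]
      have hu : π' ⁻¹' (π ⁻¹' c₀.nbhd D v) ∩ c₂.critPoints =
          ⋃ x ∈ (π ⁻¹' c₀.nbhd D v) ∩ c₁.critPoints,
            π' ⁻¹' c₁.nbhd D' x ∩ c₂.critPoints := by
        ext y
        simp only [mem_iUnion, exists_prop]
        constructor
        · rintro ⟨hy, hyc⟩
          have hyc' := h'.crit y hyc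
          exact ⟨π' y, ⟨hy, hyc'⟩, (interior_subset (hD'.self_mem_interior hyc') :
            π' y ∈ c₁.nbhd D' (π' y)), hyc⟩
        · rintro ⟨x, ⟨hx, hxc⟩, hy, hyc⟩
          exact ⟨hY1 v hv x hxc hx hy, hyc⟩
      rw [hu, finsum_mem_biUnion _ hfin fun x _ => c₂.finite_critPoints.subset inter_subset_right]
      · intro x hx x' hx' hne
        exact disjoint_left.2 fun y hy hy' =>
          hne (hD'.eq_of_mem_nbhd hx.2 hx'.2 hy.1 hy'.1)
    rw [hb, hsum, ← h.betti_one v hv, add_assoc, finsum_mem_eq_finite_toFinset_sum _ hfin,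
      finsum_mem_eq_finite_toFinset_sum _ hfin, Nat.cast_sum, ← Finset.sum_add_distrib,
      finsum_milnor_inter, finsum_mem_eq_finite_toFinset_sum _ hfin, Nat.cast_sum]
    congr 1
    exact Finset.sum_congr rfl fun x hx => h'.betti_one x (hfin.mem_toFinset.1 hx).2
  · have hb := (h'.betti_preimage hD' (hY1 v hv) (h.betti_two v hv)).2
    have hb' := (h'.betti_preimage hD' (hY2 v hv) (h.betti_two_interior v hv)).2
    refine hb'.trans (Eq.trans ?_ hb.symm)
    rw [hset v hv, h.betti_one_interior v hv]

end Collapse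

end Covering

end

/-! ### Perturbations in which every critical point is replaced. -/

noncomputable section

namespace Covering

/-- The part of the surface outside the neighbourhoods of the critical points. -/
def outer (c : Covering) (D : Sphere2 → Set Sphere2) : Set c.surf :=
  (⋃ v ∈ c.critPoints, interior (c.nbhd D v))ᶜ

lemma mem_outer {c : Covering} {D : Sphere2 → Set Sphere2} {x : c.surf} :
    x ∈ c.outer D ↔ ∀ v ∈ c.critPoints, x ∉ interior (c.nbhd D v) := by
  simp [outer]

lemma isClosed_outer (c : Covering) (D : Sphere2 → Set Sphere2) : IsClosed (c.outer D) :=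
  (isOpen_biUnion fun _ _ => isOpen_interior).isClosed_compl

/-- A perturbation in which all neighbourhoods of critical points are replaced. -/
structure Gluing (c₀ c₁ : Covering) (D : Sphere2 → Set Sphere2) (g : c₀.surf → c₁.surf)
    (T : c₀.surf → Set c₁.surf) : Prop where
  cont : ContinuousOn g (c₀.outer D)
  inj : InjOn g (c₀.outer D)
  map_eq : ∀ x ∈ c₀.outer D, c₁.map (g x) = c₀.map x
  genus_eq : ∀ x ∈ c₀.outer D, c₁.surf.genus (g x) = c₀.surf.genus x
  closed : ∀ v ∈ c₀.critPoints, IsClosed (T v)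
  connected : ∀ v ∈ c₀.critPoints, IsConnected (T v)
  disjoint : c₀.critPoints.PairwiseDisjoint T
  cover : ∀ y, (∃ x ∈ c₀.outer D, g x = y) ∨ ∃ v ∈ c₀.critPoints, y ∈ T v
  boundary : ∀ v ∈ c₀.critPoints, ∀ x ∈ c₀.outer D, g x ∈ T v ↔ x ∈ c₀.nbhd D v
  mapsTo : ∀ v ∈ c₀.critPoints, ∀ y ∈ T v, c₁.map y ∈ D (c₀.map v)
  betti_one : ∀ v ∈ c₀.critPoints,
    betti 1 (T v) + ((∑ᶠ x ∈ T v, c₁.surf.milnor x : ℕ) : Cardinal) = (c₀.surf.milnor v : Cardinal)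
  betti_two : ∀ v ∈ c₀.critPoints, betti 2 (T v) = 0

/-- For a critical point outside A the unchanged neighbourhood serves as its own piece. It is
contractible, and v is its only critical point, with unchanged Milnor number. -/
lemma IsPerturbationAt.exists_gluing {c₀ c₁ : Covering} {D : Sphere2 → Set Sphere2}
    {A : Set c₀.surf} {j : ↥((⋃ v ∈ A, interior (c₀.nbhd D v))ᶜ) → c₁.surf}
    {T : c₀.surf → Set c₁.surf} (P : IsPerturbationAt c₀ c₁ D A j T) (hD : c₀.IsDiskFamily D) :
    ∃ g T', Gluing c₀ c₁ D g T' := by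
  classical
  let Z : Set c₀.surf := (⋃ v ∈ A, interior (c₀.nbhd D v))ᶜ
  have hZ : Z = (⋃ v ∈ A, interior (c₀.nbhd D v))ᶜ := rfl
  have hAfin : A.Finite := c₀.finite_critPoints.subset P.critical
  have hZmem : ∀ {x}, x ∈ Z ↔ ∀ v ∈ A, x ∉ interior (c₀.nbhd D v) := fun {x} => by simp [hZ]
  -- Extending `j` to the whole surface needs a junk value; if the target is empty, so is the
  -- source.
  have hne : Nonempty c₁.surf ∨ IsEmpty c₀.surf := by
    by_cases h : Nonempty c₁.surf
    · exact Or.inl h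
    · right
      refine ⟨fun x => ?_⟩
      by_cases hx : x ∈ Z
      · exact h ⟨j ⟨x, hx⟩⟩
      · simp only [hZ, mem_compl_iff, not_not, mem_iUnion, exists_prop] at hx
        obtain ⟨v, hv, -⟩ := hx
        exact h ⟨(P.connected v hv).nonempty.some⟩
  obtain ⟨g, hg⟩ : ∃ g : c₀.surf → c₁.surf, ∀ x (hx : x ∈ Z), g x = j ⟨x, hx⟩ := by
    rcases hne with ⟨⟨y⟩⟩ | h
    · exact ⟨fun x => if hx : x ∈ Z then j ⟨x, hx⟩ else y, fun x hx => dif_pos hx⟩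
    · exact ⟨fun x => h.elim x, fun x => h.elim x⟩
  have hsubZ : c₀.outer D ⊆ Z := fun x hx =>
    hZmem.2 fun v hv => mem_outer.1 hx v (P.critical hv)
  have hUZ : ∀ u ∈ c₀.critPoints, u ∉ A → c₀.nbhd D u ⊆ Z := by
    intro u hu huA x hx
    refine hZmem.2 fun v hv hxv => huA ?_
    rwa [hD.eq_of_mem_nbhd hu (P.critical hv) hx (interior_subset hxv)]
  have hginj : InjOn g Z := fun x hx y hy h => by
    rw [hg x hx, hg y hy] at h
    exact congrArg Subtype.val (P.embedding.injective h)
  have hgc : ContinuousOn g Z := by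
    rw [continuousOn_iff_continuous_domRestrict]
    exact P.embedding.continuous.congr fun x => (hg x.1 x.2).symm
  have hgT : ∀ v ∈ A, ∀ x ∈ Z, g x ∈ T v ↔ x ∈ c₀.nbhd D v := by
    intro v hv x hx
    constructor
    · intro h
      have : g x ∈ T v ∩ range j := ⟨h, ⟨x, hx⟩, (hg x hx).symm⟩
      rw [P.boundary v hv] at this
      obtain ⟨x', hx', he⟩ := this
      have : x' = ⟨x, hx⟩ := P.embedding.injective (he.trans (hg x hx))
      subst this
      exact (hD.isClosed_nbhd (P.critical hv)).frontier_subset hx'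
    · intro h
      have : g x ∈ T v ∩ range j := by
        rw [P.boundary v hv]
        exact ⟨⟨x, hx⟩, ⟨subset_closure h, hZmem.1 hx v hv⟩, (hg x hx).symm⟩
      exact this.1
  let T' : c₀.surf → Set c₁.surf := fun v => if v ∈ A then T v else g '' c₀.nbhd D v
  have hTA : ∀ v ∈ A, T' v = T v := fun v hv => if_pos hv
  have hTn : ∀ v, v ∉ A → T' v = g '' c₀.nbhd D v := fun v hv => if_neg hv
  have hgT' : ∀ v ∈ c₀.critPoints, ∀ x ∈ Z, g x ∈ T' v ↔ x ∈ c₀.nbhd D v := by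
    intro v hv x hx
    by_cases hvA : v ∈ A
    · rw [hTA v hvA]; exact hgT v hvA x hx
    · rw [hTn v hvA]
      constructor
      · rintro ⟨x', hx', he⟩
        rwa [← hginj (hUZ v hv hvA hx') hx he]
      · exact fun h => ⟨x, h, rfl⟩
  -- the map is a local homeomorphism away from the replaced pieces
  let Ω : Set c₀.surf := (⋃ v ∈ A, c₀.nbhd D v)ᶜ
  have hΩ : IsOpen Ω := (hAfin.isClosed_biUnion fun v hv =>
    hD.isClosed_nbhd (P.critical hv)).isOpen_compl
  have hΩmem : ∀ {x}, x ∈ Ω ↔ ∀ v ∈ A, x ∉ c₀.nbhd D v := fun {x} => by simp [Ω]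
  have hΩZ : Ω ⊆ Z := fun x hx => hZmem.2 fun v hv hxv => hΩmem.1 hx v hv (interior_subset hxv)
  have hopen : IsOpenEmbedding (fun x : Ω => g x) := by
    have h1 : (fun x : Ω => g x) = j ∘ fun x : Ω => ⟨x.1, hΩZ x.2⟩ :=
      funext fun x => hg _ (hΩZ x.2)
    refine ⟨?_, ?_⟩
    · rw [h1]
      exact P.embedding.comp (IsEmbedding.inclusion hΩZ)
    -- The range is the complement of the finitely many closed pieces, so the embedding is open;
    -- this permits comparing numbers of branches.
    · have h2 : range (fun x : Ω => g x) = (⋃ v ∈ A, T v)ᶜ := by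
        ext y
        constructor
        · rintro ⟨x, rfl⟩ hy
          obtain ⟨v, hv, hy⟩ := mem_iUnion₂.1 hy
          exact hΩmem.1 x.2 v hv ((hgT v hv x (hΩZ x.2)).1 hy)
        · intro hy
          have := P.cover.symm ▸ mem_univ y
          rcases this with ⟨x, rfl⟩ | h
          · refine ⟨⟨x.1, hΩmem.2 fun v hv hxv => hy ?_⟩, hg x.1 x.2⟩
            refine mem_biUnion hv ?_
            have := (hgT v hv x.1 x.2).2 hxv
            rwa [hg x.1 x.2] at this
          · exact absurd h hy
      rw [h2]
      exact (hAfin.isClosed_biUnion fun v hv => P.closed v hv).isOpen_compl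
  have hmil : ∀ x ∈ Ω, c₁.surf.milnor (g x) = c₀.surf.milnor x := by
    intro x hx
    have h1 := branches_eq_of_isOpenEmbedding (S := c₀.surf) (S' := c₁.surf)
      hΩ.isOpenEmbedding_subtypeVal hopen ⟨x, hx⟩
    have h2 : c₁.surf.genus (g x) = c₀.surf.genus x := by
      rw [hg x (hΩZ hx)]; exact P.genus_eq ⟨x, hΩZ hx⟩
    dsimp only at h1
    rw [ClosedSurface.milnor, ClosedSurface.milnor, h1, h2]
  have hUΩ : ∀ u ∈ c₀.critPoints, u ∉ A → c₀.nbhd D u ⊆ Ω := by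
    intro u hu huA x hx
    refine hΩmem.2 fun v hv hxv => huA ?_
    rwa [hD.eq_of_mem_nbhd hu (P.critical hv) hx hxv]
  have hbetti : ∀ n, ∀ u ∈ c₀.critPoints, u ∉ A → betti (n + 1) (g '' c₀.nbhd D u) = 0 := by
    intro n u hu huA
    obtain ⟨C, ⟨F⟩⟩ := hD.exists_flow_at hu
    have := F.contractible_nbhd rfl
    rw [← betti_eq_zero_of_contractible n (c₀.nbhd D u)]
    have hU := hUΩ u hu huA
    let e : c₀.nbhd D u ≃ g '' c₀.nbhd D u :=
      Equiv.ofBijective (fun x => ⟨g x, x, x.2, rfl⟩) ⟨fun x y h => Subtype.ext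
        (hginj (hΩZ (hU x.2)) (hΩZ (hU y.2)) (congrArg Subtype.val h)), by
        rintro ⟨_, x, hx, rfl⟩; exact ⟨⟨x, hx⟩, rfl⟩⟩
    have hcomp : CompactSpace (c₀.nbhd D u) :=
      isCompact_iff_compactSpace.1 (hD.isClosed_nbhd hu).isCompact
    have he : Continuous e := Continuous.subtype_mk
      (hgc.comp_continuous continuous_subtype_val fun x => hΩZ (hU x.2)) _
    exact (betti_eq_of_homeomorph n (he.homeoOfEquivCompactToT2 (f := e))).symm
  refine ⟨g, T', ⟨hgc.mono hsubZ, hginj.mono hsubZ, fun x hx => ?_, fun x hx => ?_, fun v hv => ?_,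
    fun v hv => ?_, fun v hv v' hv' hvv' => ?_, fun y => ?_,
    fun v hv x hx => hgT' v hv x (hsubZ hx), fun v hv y hy => ?_, fun v hv => ?_, fun v hv => ?_⟩⟩
  · rw [hg x (hsubZ hx)]; exact P.map_eq ⟨x, hsubZ hx⟩
  · rw [hg x (hsubZ hx)]; exact P.genus_eq ⟨x, hsubZ hx⟩
  · by_cases hvA : v ∈ A
    · rw [hTA v hvA]; exact P.closed v hvA
    · rw [hTn v hvA]
      exact ((hD.isClosed_nbhd hv).isCompact.image_of_continuousOn
        (hgc.mono (hUZ v hv hvA))).isClosed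
  · by_cases hvA : v ∈ A
    · rw [hTA v hvA]; exact P.connected v hvA
    · rw [hTn v hvA]
      refine IsConnected.image ⟨⟨v, interior_subset (hD.self_mem_interior hv)⟩,
        isPreconnected_connectedComponentIn⟩ _ (hgc.mono (hUZ v hv hvA))
  · refine disjoint_left.2 fun y hy hy' => ?_
    by_cases hvA : v ∈ A
    · by_cases hvA' : v' ∈ A
      · rw [hTA v hvA] at hy; rw [hTA v' hvA'] at hy'
        exact disjoint_left.1 (P.disjoint hvA hvA' hvv') hy hy'
      · rw [hTn v' hvA'] at hy'
        obtain ⟨x, hx, rfl⟩ := hy'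
        exact hvv' (hD.eq_of_mem_nbhd hv hv' ((hgT' v hv x (hUZ v' hv' hvA' hx)).1 hy) hx)
    · rw [hTn v hvA] at hy
      obtain ⟨x, hx, rfl⟩ := hy
      exact hvv' (hD.eq_of_mem_nbhd hv hv' hx ((hgT' v' hv' x (hUZ v hv hvA hx)).1 hy'))
  · have := P.cover.symm ▸ mem_univ y
    rcases this with ⟨x, rfl⟩ | h
    · by_cases hx : x.1 ∈ c₀.outer D
      · exact Or.inl ⟨x.1, hx, hg x.1 x.2⟩
      · simp only [mem_outer, not_forall, not_not] at hx
        obtain ⟨v, hv, hxv⟩ := hx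
        refine Or.inr ⟨v, hv, ?_⟩
        rw [← hg x.1 x.2]
        exact (hgT' v hv x.1 x.2).2 (interior_subset hxv)
    · obtain ⟨v, hv, hy⟩ := mem_iUnion₂.1 h
      exact Or.inr ⟨v, P.critical hv, by rwa [hTA v hv]⟩
  · by_cases hvA : v ∈ A
    · rw [hTA v hvA] at hy; exact P.mapsTo v hvA hy
    · rw [hTn v hvA] at hy
      obtain ⟨x, hx, rfl⟩ := hy
      rw [hg x (hUZ v hv hvA hx), P.map_eq]
      exact nbhd_subset v hx
  · by_cases hvA : v ∈ A
    · rw [hTA v hvA]; exact P.betti_one v hvA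
    · rw [hTn v hvA, hbetti 0 v hv hvA, zero_add]
      congr 1
      have hvU : v ∈ c₀.nbhd D v := interior_subset (hD.self_mem_interior hv)
      rw [finsum_mem_image (hginj.mono (hUZ v hv hvA)),
        finsum_mem_congr rfl fun x hx => hmil x (hUΩ v hv hvA hx), finsum_milnor_inter]
      have : c₀.nbhd D v ∩ c₀.critPoints = {v} := by
        ext x
        constructor
        · rintro ⟨hx, hxc⟩
          exact hD.eq_of_crit_mem hv hxc hx
        · rintro rfl
          exact ⟨hvU, hv⟩
      rw [this, finsum_mem_singleton]
  · by_cases hvA : v ∈ A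
    · rw [hTA v hvA]; exact P.betti_two v hvA
    · rw [hTn v hvA]; exact hbetti 1 v hv hvA

end Covering

end

/-! ### Position of the critical points of a perturbation. -/

noncomputable section

namespace Covering.Gluing

variable {c₀ c₁ : Covering} {D : Sphere2 → Set Sphere2} {g : c₀.surf → c₁.surf}
  {T : c₀.surf → Set c₁.surf}

lemma isClosed_image (G : Gluing c₀ c₁ D g T) {K : Set c₀.surf} (hK : IsClosed K)
    (hKo : K ⊆ c₀.outer D) : IsClosed (g '' K) :=
  (hK.isCompact.image_of_continuousOn (G.cont.mono hKo)).isClosed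

/-- The part of the outer region away from x is compact, so its image is closed, and by injectivity
it misses g x. This is continuity of the inverse of g, in a form that needs no inverse. -/
lemma mem_nhds_of (G : Gluing c₀ c₁ D g T) {x : c₀.surf} (hx : x ∈ c₀.outer D)
    {N : Set c₀.surf} (hN : N ∈ 𝓝 x) : ∀ᶠ y in 𝓝 (g x), ∀ x' ∈ c₀.outer D, g x' = y → x' ∈ N := by
  have hcl : IsClosed (g '' (c₀.outer D \ interior N)) :=
    G.isClosed_image ((isClosed_outer c₀ D).sdiff isOpen_interior) sdiff_subset
  have hmem : g x ∉ g '' (c₀.outer D \ interior N) := by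
    rintro ⟨x', hx', he⟩
    rw [G.inj hx'.1 hx he] at hx'
    exact hx'.2 (mem_interior_iff_mem_nhds.2 hN)
  filter_upwards [hcl.isOpen_compl.mem_nhds hmem] with y hy x' hx' he
  by_contra hxN
  exact hy ⟨x', ⟨hx', fun h => hxN (interior_subset h)⟩, he⟩

lemma exists_inverse [Nonempty c₀.surf] (G : Gluing c₀ c₁ D g T) : ∃ h : c₁.surf → c₀.surf,
    (∀ x ∈ c₀.outer D, h (g x) = x) ∧ ContinuousOn h (g '' c₀.outer D) := by
  have h1 : ∀ x ∈ c₀.outer D, Function.invFunOn g (c₀.outer D) (g x) = x :=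
    G.inj.leftInvOn_invFunOn
  refine ⟨Function.invFunOn g (c₀.outer D), h1, ?_⟩
  rintro _ ⟨x, hx, rfl⟩ N hN
  rw [h1 x hx] at hN
  rw [Filter.mem_map]
  filter_upwards [mem_nhdsWithin_of_mem_nhds (G.mem_nhds_of hx hN), self_mem_nhdsWithin]
    with y hy hyo
  obtain ⟨x', hx', rfl⟩ := hyo
  rw [mem_preimage, h1 x' hx']
  exact hy x' hx' rfl

lemma eventually_notMem (G : Gluing c₀ c₁ D g T) {v : c₀.surf} {y : c₁.surf} (hy : y ∈ T v)
    (hv : v ∈ c₀.critPoints) : ∀ᶠ y' in 𝓝 y, ∀ v' ∈ c₀.critPoints, y' ∈ T v' → v' = v := by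
  have hcl : IsClosed (⋃ v' ∈ c₀.critPoints \ {v}, T v') :=
    (c₀.finite_critPoints.subset sdiff_subset).isClosed_biUnion fun v' hv' => G.closed v' hv'.1
  have hmem : y ∉ ⋃ v' ∈ c₀.critPoints \ {v}, T v' := by
    rintro h
    obtain ⟨v', hv', h⟩ := mem_iUnion₂.1 h
    exact disjoint_left.1 (G.disjoint hv hv'.1 fun h => hv'.2 h.symm) hy h
  filter_upwards [hcl.isOpen_compl.mem_nhds hmem] with y' hy' v' hv' hT
  by_contra hne
  exact hy' (mem_biUnion (⟨hv', hne⟩ : v' ∈ c₀.critPoints \ {v}) hT)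

/-- Over the boundary of the disk, the pieces coincide with the images of the frontiers. -/
lemma exists_of_notMem_interior (G : Gluing c₀ c₁ D g T) {v : c₀.surf} (hv : v ∈ c₀.critPoints)
    {y : c₁.surf} (hy : y ∈ T v) (h : c₁.map y ∉ interior (D (c₀.map v))) :
    ∃ x ∈ c₀.outer D, x ∈ c₀.nbhd D v ∧ g x = y := by
  by_contra hne
  have hyo : y ∉ g '' c₀.outer D := by
    rintro ⟨x, hx, rfl⟩
    exact hne ⟨x, hx, (G.boundary v hv x hx).1 hy, rfl⟩
  have h1 := (G.isClosed_image (isClosed_outer c₀ D) subset_rfl).isOpen_compl.mem_nhds hyo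
  -- If y did not come from the outer region, the piece would be a neighbourhood of y, and the open
  -- map would put the value of y in the interior of the disk.
  have h2 : T v ∈ 𝓝 y := by
    filter_upwards [h1, G.eventually_notMem hy hv] with y' h3 h4
    rcases G.cover y' with ⟨x, hx, rfl⟩ | ⟨v', hv', hT⟩
    · exact absurd ⟨x, hx, rfl⟩ h3
    · rwa [h4 v' hv' hT] at hT
  refine h (mem_interior_iff_mem_nhds.2 (mem_of_superset (c₁.isOpenMap.image_mem_nhds h2) ?_))
  rintro _ ⟨y', hy', rfl⟩
  exact G.mapsTo v hv y' hy'

/-- Connected sets over the disk do not leave the piece. -/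
lemma subset_of_isPreconnected (G : Gluing c₀ c₁ D g T) (hD : c₀.IsDiskFamily D) {v : c₀.surf}
    (hv : v ∈ c₀.critPoints) {S : Set c₁.surf} (hS : IsPreconnected S)
    (hSD : ∀ y ∈ S, c₁.map y ∈ D (c₀.map v)) (hST : (S ∩ T v).Nonempty) : S ⊆ T v := by
  obtain ⟨C, ⟨F⟩⟩ := hD.exists_flow_at hv
  have hcv : c₀.map v ∈ c₀.critValues := ⟨v, hv, rfl⟩
  -- The points over the disk outside U_v form a closed set because U_v is relatively open. With the
  -- other pieces their images make up a closed set, disjoint from T v, that contains the rest of S.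
  let K : Set c₀.surf := {x | c₀.map x ∈ D (c₀.map v) ∧ x ∉ c₀.nbhd D v}
  have hK : IsClosed K := by
    rw [← isOpen_compl_iff, isOpen_iff_mem_nhds]
    intro x hx
    by_cases hxD : c₀.map x ∈ D (c₀.map v)
    · have hxU : x ∈ c₀.nbhd D v := by by_contra h; exact hx ⟨hxD, h⟩
      filter_upwards [mem_nhdsWithin_iff_eventually.1 (F.eventually_mem_nbhd rfl hxU)] with x' h h'
      exact h'.2 (h h'.1)
    · filter_upwards [c₀.continuous.continuousAt.preimage_mem_nhds
        ((hD.isClosed hcv).isOpen_compl.mem_nhds hxD)] with x' h h'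
      exact h h'.1
  let E : Set c₁.surf := (⋃ v' ∈ c₀.critPoints \ {v}, T v') ∪ g '' (c₀.outer D ∩ K)
  have hE : IsClosed E := ((c₀.finite_critPoints.subset sdiff_subset).isClosed_biUnion
    fun v' hv' => G.closed v' hv'.1).union
      (G.isClosed_image ((isClosed_outer c₀ D).inter hK) inter_subset_left)
  have hdis : ∀ y ∈ T v, y ∉ E := by
    rintro y hy (h | ⟨x, ⟨hx, hxK⟩, rfl⟩)
    · obtain ⟨v', hv', h⟩ := mem_iUnion₂.1 h
      exact disjoint_left.1 (G.disjoint hv hv'.1 fun h => hv'.2 h.symm) hy h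
    · exact hxK.2 ((G.boundary v hv x hx).1 hy)
  have hcov : S ⊆ T v ∪ E := by
    intro y hy
    by_cases hyT : y ∈ T v
    · exact Or.inl hyT
    · refine Or.inr ?_
      rcases G.cover y with ⟨x, hx, rfl⟩ | ⟨v', hv', hT⟩
      · refine Or.inr ⟨x, ⟨hx, ?_, fun h => hyT ((G.boundary v hv x hx).2 h)⟩, rfl⟩
        rw [← G.map_eq x hx]
        exact hSD _ hy
      · exact Or.inl (mem_biUnion
          (⟨hv', fun h => hyT (h ▸ hT)⟩ : v' ∈ c₀.critPoints \ {v}) hT)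
  intro y hy
  by_contra hyT
  obtain ⟨z, -, hzT, hzE⟩ := isPreconnected_closed_iff.1 hS _ _ (G.closed v hv) hE hcov hST
    ⟨y, hy, (hcov hy).resolve_left hyT⟩
  exact hdis z hzT hzE

/-- Near a critical point every nearby value is taken twice. On the outer region the map is locally
the one of `c₀` at a non-critical point, hence injective. The delicate case is the boundary of a
piece, where values just outside the disk are used. -/
lemma notMem_image_of_crit (G : Gluing c₀ c₁ D g T) (hD : c₀.IsDiskFamily D) {y : c₁.surf}
    (hy : y ∈ c₁.critPoints) : y ∉ g '' c₀.outer D := by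
  rintro ⟨x, hx, rfl⟩
  have hxc : x ∉ c₀.critPoints := fun h => mem_outer.1 hx x h (hD.self_mem_interior h)
  obtain ⟨N₀, hN₀, hinj⟩ : ∃ N ∈ 𝓝 x, InjOn c₀.map N := by
    by_contra h
    exact hxc (c₀.critical_iff.2 h)
  have hN := G.mem_nhds_of hx hN₀
  have hinj' : ∀ a b, (∀ x' ∈ c₀.outer D, g x' = a → x' ∈ N₀) →
      (∀ x' ∈ c₀.outer D, g x' = b → x' ∈ N₀) → a ∈ g '' c₀.outer D → b ∈ g '' c₀.outer D →
      c₁.map a = c₁.map b → a = b := by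
    rintro _ _ ha hb ⟨a, hao, rfl⟩ ⟨b, hbo, rfl⟩ h
    rw [G.map_eq a hao, G.map_eq b hbo] at h
    rw [hinj (ha a hao rfl) (hb b hbo rfl) h]
  by_cases hxU : ∃ v ∈ c₀.critPoints, x ∈ c₀.nbhd D v
  · obtain ⟨v, hv, hxU⟩ := hxU
    have hcv : c₀.map v ∈ c₀.critValues := ⟨v, hv, rfl⟩
    have h1 : c₀.map x ∉ interior (D (c₀.map v)) := fun h =>
      mem_outer.1 hx v hv ((hD.mem_interior hv).2 ⟨hxU, h⟩)
    have hxD : c₀.map x ∈ D (c₀.map v) := nbhd_subset v hxU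
    -- On the boundary there are arbitrarily close values outside the disk. They can also be kept
    -- outside the other disks, so that all their preimages come from the outer region.
    have h2 : ∃ᶠ z in 𝓝 (c₁.map (g x)), z ∉ D (c₀.map v) := by
      rw [G.map_eq x hx]
      intro h
      refine h1 (mem_interior_iff_mem_nhds.2 ?_)
      filter_upwards [h] with z hz using not_not.1 hz
    have h3 : ∀ᶠ z in 𝓝 (c₁.map (g x)), ∀ w ∈ c₀.critValues, z ∈ D w → w = c₀.map v := by
      have hcl : IsClosed (⋃ w ∈ c₀.critValues \ {c₀.map v}, D w) :=
        (c₀.finite_critValues.subset sdiff_subset).isClosed_biUnion fun w hw => hD.isClosed hw.1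
      have hmem : c₁.map (g x) ∉ ⋃ w ∈ c₀.critValues \ {c₀.map v}, D w := by
        intro h
        obtain ⟨w, hw, h⟩ := mem_iUnion₂.1 h
        rw [G.map_eq x hx] at h
        exact hw.2 (hD.eq_of_mem hw.1 hcv h hxD)
      filter_upwards [hcl.isOpen_compl.mem_nhds hmem] with z hz w hw hzw
      by_contra hne
      exact hz (mem_biUnion (⟨hw, hne⟩ : w ∈ c₀.critValues \ {c₀.map v}) hzw)
    obtain ⟨z, hzD, hz3, hz4⟩ := (h2.and_eventually (h3.and (c₁.eventually_two hy hN))).exists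
    obtain ⟨a, ha, b, hb, hab, haz, hbz⟩ := hz4 fun h => hzD (by rwa [h, G.map_eq x hx])
    have h5 : ∀ a, c₁.map a = z → a ∈ g '' c₀.outer D := by
      intro a ha
      rcases G.cover a with h | ⟨v', hv', hT⟩
      · exact h
      · have := G.mapsTo v' hv' a hT
        rw [ha] at this
        rw [hz3 _ ⟨v', hv', rfl⟩ this] at this
        exact absurd this hzD
    exact hab (hinj' a b ha hb (h5 a haz) (h5 b hbz) (haz.trans hbz.symm))
  · have hcl : IsClosed (⋃ v ∈ c₀.critPoints, T v) :=
      c₀.finite_critPoints.isClosed_biUnion fun v hv => G.closed v hv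
    have hmem : g x ∉ ⋃ v ∈ c₀.critPoints, T v := by
      intro h
      obtain ⟨v, hv, h⟩ := mem_iUnion₂.1 h
      exact hxU ⟨v, hv, (G.boundary v hv x hx).1 h⟩
    have h5 : ∀ a, a ∉ ⋃ v ∈ c₀.critPoints, T v → a ∈ g '' c₀.outer D := by
      intro a ha
      rcases G.cover a with h | ⟨v', hv', hT⟩
      · exact h
      · exact absurd (mem_biUnion hv' hT) ha
    refine c₁.critical_iff.1 hy ⟨_, inter_mem hN (hcl.isOpen_compl.mem_nhds hmem), ?_⟩
    intro a ha b hb hab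
    exact hinj' a b ha.1 hb.1 (h5 a ha.2) (h5 b hb.2) hab

/-- All critical points of a perturbation lie in the interiors of the new pieces. -/
lemma exists_of_crit (G : Gluing c₀ c₁ D g T) (hD : c₀.IsDiskFamily D) {y : c₁.surf}
    (hy : y ∈ c₁.critPoints) :
    ∃ v ∈ c₀.critPoints, y ∈ T v ∧ c₁.map y ∈ interior (D (c₀.map v)) := by
  have hyo := G.notMem_image_of_crit hD hy
  rcases G.cover y with h | ⟨v, hv, hT⟩
  · exact absurd h hyo
  · refine ⟨v, hv, hT, ?_⟩
    by_contra h
    obtain ⟨x, hx, -, rfl⟩ := G.exists_of_notMem_interior hv hT h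
    exact hyo ⟨x, hx, rfl⟩

end Covering.Gluing

end

/-! ### Collapse of a single piece. -/

noncomputable section

/-- A reparametrization of `(r', 1]` onto `(0, 1]` that is the identity on `[r, 1]`. -/
def squeeze (r' r s : ℝ) : ℝ := min s (r * (s - r') / (r - r'))

/-- The difference r(s − r') − s(r − r') equals r'(s − r), so the two terms of the minimum cross at
s = r. -/
lemma squeeze_of_le {r' r s : ℝ} (hr' : 0 ≤ r') (hrr : r' < r) (hs : r ≤ s) :
    squeeze r' r s = s := by
  refine min_eq_left ?_
  rw [le_div_iff₀ (by linarith)]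
  nlinarith

lemma squeeze_of_ge {r' r s : ℝ} (hr' : 0 ≤ r') (hrr : r' < r) (hs : s ≤ r) :
    squeeze r' r s = r * (s - r') / (r - r') := by
  refine min_eq_right ?_
  rw [div_le_iff₀ (by linarith)]
  nlinarith

lemma strictMono_squeeze {r' r : ℝ} (hr' : 0 ≤ r') (hrr : r' < r) :
    StrictMono (squeeze r' r) := by
  intro s t h
  refine lt_min ((min_le_left _ _).trans_lt h) ((min_le_right _ _).trans_lt ?_)
  have : 0 < r := hr'.trans_lt hrr
  exact div_lt_div_of_pos_right (mul_lt_mul_of_pos_left (by linarith) this) (by linarith)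

lemma continuous_squeeze (r' r : ℝ) : Continuous (squeeze r' r) := by
  unfold squeeze; fun_prop

lemma squeeze_self {r' r : ℝ} (hr' : 0 ≤ r') (hrr : r' < r) : squeeze r' r r' = 0 := by
  rw [squeeze_of_ge hr' hrr hrr.le, sub_self, mul_zero, zero_div]

lemma squeeze_mem {r' r s : ℝ} (hr' : 0 ≤ r') (hrr : r' < r) (hs : s ∈ Ioc r' 1) :
    squeeze r' r s ∈ Ioc 0 1 := by
  refine ⟨?_, (min_le_left _ _).trans hs.2⟩
  rw [← squeeze_self hr' hrr]
  exact strictMono_squeeze hr' hrr hs.1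

lemma exists_squeeze_eq {r' r t : ℝ} (hr' : 0 ≤ r') (hrr : r' < r) (hr1 : r ≤ 1)
    (ht : t ∈ Ioc (0 : ℝ) 1) : ∃ s ∈ Ioc r' 1, squeeze r' r s = t := by
  obtain ⟨s, hs, h⟩ := intermediate_value_Icc (hrr.le.trans hr1)
    (continuous_squeeze r' r).continuousOn (show t ∈ Icc _ _ by
      rw [squeeze_self hr' hrr, squeeze_of_le hr' hrr hr1]; exact ⟨ht.1.le, ht.2⟩)
  refine ⟨s, ⟨lt_of_le_of_ne hs.1 ?_, hs.2⟩, h⟩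
  rintro rfl
  rw [squeeze_self hr' hrr] at h
  exact ht.1.ne h

namespace Covering

/-- The data from which a piece of a perturbation is collapsed to the neighbourhood that it
replaces. -/
structure LocalCollapse (c₀ c₁ : Covering) (D : Sphere2 → Set Sphere2) (g : c₀.surf → c₁.surf)
    (T : c₀.surf → Set c₁.surf) (v : c₀.surf) (C : DiskChart (D (c₀.map v)) (c₀.map v))
    (r' r : ℝ) where
  G : Gluing c₀ c₁ D g T
  hD : c₀.IsDiskFamily D
  hv : v ∈ c₀.critPoints
  F : c₀.Flow C
  h : c₁.surf → c₀.surf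
  hh : ∀ x ∈ c₀.outer D, h (g x) = x
  hhc : ContinuousOn h (g '' c₀.outer D)
  hr' : 0 ≤ r'
  hrr : r' < r
  hr1 : r ≤ 1
  crit : ∀ y ∈ c₁.critValues, y ∈ D (c₀.map v) → ‖C.κ y‖ ≤ r'
  Q : c₁.RadialLift C r'

namespace LocalCollapse

variable {c₀ c₁ : Covering} {D : Sphere2 → Set Sphere2} {g : c₀.surf → c₁.surf}
  {T : c₀.surf → Set c₁.surf} {v : c₀.surf} {C : DiskChart (D (c₀.map v)) (c₀.map v)}
  {r' r : ℝ} (L : LocalCollapse c₀ c₁ D g T v C r' r)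

/-- The distance to the center of the disk. -/
def height (_ : LocalCollapse c₀ c₁ D g T v C r' r) (y : c₁.surf) : ℝ := ‖C.κ (c₁.map y)‖

lemma height_le {y : c₁.surf} (hy : y ∈ T v) : L.height y ≤ 1 :=
  C.mapsκ _ (L.G.mapsTo v L.hv y hy)

lemma continuousOn_height : ContinuousOn L.height (T v) :=
  (C.contκ.comp c₁.continuous.continuousOn (L.G.mapsTo v L.hv)).norm

lemma mem_domain {y : c₁.surf} (hy : y ∈ T v) (hn : r' < L.height y) {s : ℝ}
    (hs : s ∈ Ioc r' 1) : (y, s) ∈ c₁.radialDomain C r' :=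
  ⟨L.G.mapsTo v L.hv y hy, hn, hs⟩

lemma one_mem (L : LocalCollapse c₀ c₁ D g T v C r' r) : (1 : ℝ) ∈ Ioc r' 1 := ⟨L.hrr.trans_le L.hr1, le_rfl⟩

lemma height_lift {y : c₁.surf} (hy : y ∈ T v) (hn : r' < L.height y) {s : ℝ}
    (hs : s ∈ Ioc r' 1) : L.height (L.Q.R y s) = s :=
  L.Q.norm_κ_map L.hr' (L.mem_domain hy hn hs)

/-- The radial path through y is a connected set over the disk that meets T v, and such sets do not
leave the piece. -/
lemma lift_mem {y : c₁.surf} (hy : y ∈ T v) (hn : r' < L.height y) {s : ℝ}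
    (hs : s ∈ Ioc r' 1) : L.Q.R y s ∈ T v := by
  have hc : ContinuousOn (fun s => L.Q.R y s) (Ioc r' 1) :=
    L.Q.cont.comp (by fun_prop) fun s hs => L.mem_domain hy hn hs
  refine L.G.subset_of_isPreconnected L.hD L.hv (isPreconnected_Ioc.image _ hc) ?_ ?_
    (mem_image_of_mem _ hs)
  · rintro _ ⟨s, hs, rfl⟩
    exact L.Q.map_mem L.hr' (L.mem_domain hy hn hs)
  · refine ⟨y, ⟨L.height y, ⟨hn, L.height_le hy⟩, ?_⟩, hy⟩
    exact L.Q.self y (L.G.mapsTo v L.hv y hy) hn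

/-- The end point on the boundary of the radial path through `y`. -/
def top (y : c₁.surf) : c₀.surf := L.h (L.Q.R y 1)

/-- The end of the path has height 1 and so does not lie over the interior of the disk; there the
piece consists of frontier points of U_v. -/
lemma top_spec {y : c₁.surf} (hy : y ∈ T v) (hn : r' < L.height y) :
    L.top y ∈ c₀.outer D ∧ L.top y ∈ c₀.nbhd D v ∧ g (L.top y) = L.Q.R y 1 := by
  have h1 := L.lift_mem hy hn L.one_mem
  obtain ⟨x, hx, hxU, he⟩ := L.G.exists_of_notMem_interior L.hv h1 (by
    rw [C.mem_interior_iff (L.G.mapsTo v L.hv _ h1)]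
    exact (L.height_lift hy hn L.one_mem).ge.not_gt)
  have : L.top y = x := by rw [top, ← he, L.hh x hx]
  rw [this]
  exact ⟨hx, hxU, he⟩

lemma κ_map_top {y : c₁.surf} (hy : y ∈ T v) (hn : r' < L.height y) :
    C.κ (c₀.map (L.top y)) = dir (C.κ (c₁.map y)) := by
  obtain ⟨h1, -, h3⟩ := L.top_spec hy hn
  rw [← L.G.map_eq _ h1, h3, L.Q.κ_map L.hr' (L.mem_domain hy hn L.one_mem)]
  simp

lemma κ_ne {y : c₁.surf} (hn : r' < L.height y) : C.κ (c₁.map y) ≠ 0 :=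
  norm_pos_iff.1 (L.hr'.trans_lt hn)

lemma norm_κ_map_top {y : c₁.surf} (hy : y ∈ T v) (hn : r' < L.height y) :
    ‖C.κ (c₀.map (L.top y))‖ = 1 := by
  rw [L.κ_map_top hy hn, norm_dir (L.κ_ne hn)]

lemma top_mem_flowDomain {y : c₁.surf} (hy : y ∈ T v) (hn : r' < L.height y) {s : ℝ}
    (hs : s ∈ Icc (0 : ℝ) 1) : (L.top y, s) ∈ c₀.flowDomain C := by
  refine ⟨nbhd_subset v (L.top_spec hy hn).2.1, hs, fun h => ?_⟩
  have := L.norm_κ_map_top hy hn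
  dsimp only at h
  rw [h, C.κ_center, norm_zero] at this
  exact absurd this zero_ne_one

open Classical in
/-- The collapse of the piece. -/
def p (y : c₁.surf) : c₀.surf :=
  if r' < L.height y then L.F.R (L.top y) (squeeze r' r (L.height y)) else v

lemma p_of_lt {y : c₁.surf} (hn : r' < L.height y) :
    L.p y = L.F.R (L.top y) (squeeze r' r (L.height y)) := if_pos hn

lemma p_of_le {y : c₁.surf} (hn : L.height y ≤ r') : L.p y = v := if_neg hn.not_gt

lemma squeeze_mem {y : c₁.surf} (hy : y ∈ T v) (hn : r' < L.height y) :
    squeeze r' r (L.height y) ∈ Ioc 0 1 :=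
  _root_.squeeze_mem L.hr' L.hrr ⟨hn, L.height_le hy⟩

lemma p_mem_domain {y : c₁.surf} (hy : y ∈ T v) (hn : r' < L.height y) :
    (L.top y, squeeze r' r (L.height y)) ∈ c₀.flowDomain C :=
  L.top_mem_flowDomain hy hn (Ioc_subset_Icc_self (L.squeeze_mem hy hn))

lemma p_mem {y : c₁.surf} (hy : y ∈ T v) : L.p y ∈ c₀.nbhd D v := by
  rcases lt_or_ge r' (L.height y) with hn | hn
  · rw [L.p_of_lt hn, L.F.mem_nbhd_iff rfl]
    have h := L.p_mem_domain hy hn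
    exact ⟨L.F.map_mem h, by
      rw [L.F.zero_zero h]; exact ((L.F.mem_nbhd_iff rfl).1 (L.top_spec hy hn).2.1).2⟩
  · rw [L.p_of_le hn]
    exact interior_subset (L.hD.self_mem_interior L.hv)

lemma norm_κ_map_p {y : c₁.surf} (hy : y ∈ T v) (hn : r' < L.height y) :
    ‖C.κ (c₀.map (L.p y))‖ = squeeze r' r (L.height y) := by
  rw [L.p_of_lt hn, L.F.norm_κ_map (L.p_mem_domain hy hn)]

lemma norm_κ_map_p_of_le {y : c₁.surf} (hn : L.height y ≤ r') :
    ‖C.κ (c₀.map (L.p y))‖ = 0 := by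
  rw [L.p_of_le hn, C.κ_center, norm_zero]

lemma norm_κ_map_p_le_iff {y : c₁.surf} (hy : y ∈ T v) :
    ‖C.κ (c₀.map (L.p y))‖ ≤ r ↔ L.height y ≤ r := by
  have hr := L.hr'.trans_lt L.hrr
  rcases lt_or_ge r' (L.height y) with hn | hn
  · rw [L.norm_κ_map_p hy hn]
    conv_lhs => rhs; rw [← squeeze_of_le L.hr' L.hrr le_rfl]
    exact (strictMono_squeeze L.hr' L.hrr).le_iff_le
  · rw [L.norm_κ_map_p_of_le hn]
    exact iff_of_true hr.le (hn.trans L.hrr.le)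

lemma norm_κ_map_p_lt_iff {y : c₁.surf} (hy : y ∈ T v) :
    ‖C.κ (c₀.map (L.p y))‖ < r ↔ L.height y < r := by
  have hr := L.hr'.trans_lt L.hrr
  rcases lt_or_ge r' (L.height y) with hn | hn
  · rw [L.norm_κ_map_p hy hn]
    conv_lhs => rhs; rw [← squeeze_of_le L.hr' L.hrr le_rfl]
    exact (strictMono_squeeze L.hr' L.hrr).lt_iff_lt
  · rw [L.norm_κ_map_p_of_le hn]
    exact iff_of_true hr (hn.trans_lt L.hrr)

lemma p_ne {y : c₁.surf} (hy : y ∈ T v) (hn : r' < L.height y) : L.p y ≠ v := by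
  intro h
  have := L.norm_κ_map_p hy hn
  rw [h, C.κ_center, norm_zero] at this
  exact (L.squeeze_mem hy hn).1.ne this

lemma lt_of_p_ne {y : c₁.surf} (h : L.p y ≠ v) : r' < L.height y := by
  by_contra hn
  exact h (L.p_of_le (not_lt.1 hn))

lemma flow_p_one {y : c₁.surf} (hy : y ∈ T v) (hn : r' < L.height y) :
    L.F.R (L.p y) 1 = L.top y := by
  rw [L.p_of_lt hn, L.F.comp _ _ _ (L.p_mem_domain hy hn) ⟨zero_le_one, le_rfl⟩
    fun h => absurd h (L.squeeze_mem hy hn).1.ne']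
  conv_lhs => rw [← L.norm_κ_map_top hy hn]
  exact L.F.self _ (nbhd_subset v (L.top_spec hy hn).2.1)

/-- Off v, the image determines the height of y, because `squeeze` is injective, and the boundary
point of its radial path, by flowing outward. These two determine y. -/
lemma p_inj {y y' : c₁.surf} (hy : y ∈ T v) (hy' : y' ∈ T v) (h : L.p y = L.p y')
    (hne : L.p y ≠ v) : y = y' := by
  have hn := L.lt_of_p_ne hne
  have hn' := L.lt_of_p_ne (h ▸ hne)
  have h1 : L.height y = L.height y' := by
    refine (strictMono_squeeze L.hr' L.hrr).injective ?_
    rw [← L.norm_κ_map_p hy hn, ← L.norm_κ_map_p hy' hn', h]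
  have h2 : L.Q.R y 1 = L.Q.R y' 1 := by
    rw [← (L.top_spec hy hn).2.2, ← (L.top_spec hy' hn').2.2, ← L.flow_p_one hy hn, h,
      L.flow_p_one hy' hn']
  have h3 : ∀ {y}, y ∈ T v → r' < L.height y → L.Q.R (L.Q.R y 1) (L.height y) = y := by
    intro y hy hn
    rw [L.Q.comp _ _ _ (L.mem_domain hy hn L.one_mem) ⟨hn, L.height_le hy⟩]
    exact L.Q.self y (L.G.mapsTo v L.hv y hy) hn
  rw [← h3 hy hn, ← h3 hy' hn', h2, h1]

lemma top_g {x : c₀.surf} (hx : x ∈ c₀.outer D) (hxU : x ∈ c₀.nbhd D v) :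
    g x ∈ T v ∧ L.height (g x) = 1 ∧ L.top (g x) = x := by
  have h1 := (L.G.boundary v L.hv x hx).2 hxU
  have h2 : L.height (g x) = 1 := by
    refine le_antisymm (L.height_le h1) (not_lt.1 fun h => ?_)
    rw [height, L.G.map_eq x hx, ← C.mem_interior_iff (nbhd_subset v hxU)] at h
    exact mem_outer.1 hx v L.hv ((L.hD.mem_interior L.hv).2 ⟨hxU, h⟩)
  refine ⟨h1, h2, ?_⟩
  have h3 := L.Q.self (g x) (L.G.mapsTo v L.hv _ h1) (L.one_mem.1.trans_le h2.ge)
  rw [show ‖C.κ (c₁.map (g x))‖ = 1 from h2] at h3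
  rw [top, h3, L.hh x hx]

lemma p_g {x : c₀.surf} (hx : x ∈ c₀.outer D) (hxU : x ∈ c₀.nbhd D v) : L.p (g x) = x := by
  obtain ⟨h1, h2, h3⟩ := L.top_g hx hxU
  have hn := L.one_mem.1.trans_le h2.ge
  rw [L.p_of_lt hn, h2, h3, squeeze_of_le L.hr' L.hrr L.hr1]
  have h4 := L.norm_κ_map_top h1 hn
  rw [h3] at h4
  conv_lhs => rw [← h4]
  exact L.F.self _ (nbhd_subset v hxU)

/-- Flow x outward to the boundary, transfer the end point by g, and return along the radial lift to
the height that `squeeze` sends to the radius of x. -/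
lemma p_surj {x : c₀.surf} (hx : x ∈ c₀.nbhd D v) (hne : x ≠ v) : ∃ y ∈ T v, L.p y = x := by
  obtain ⟨hxD, hx0⟩ := (L.F.mem_nbhd_iff rfl).1 hx
  have hxw : c₀.map x ≠ c₀.map v := by
    intro h
    rw [L.F.zero_of_map_eq h] at hx0
    exact hne hx0
  have hdom : (x, (1 : ℝ)) ∈ c₀.flowDomain C := ⟨hxD, ⟨zero_le_one, le_rfl⟩, fun h => absurd h hxw⟩
  have hxU : L.F.R x 1 ∈ c₀.nbhd D v :=
    (L.F.mem_nbhd_iff rfl).2 ⟨L.F.map_mem hdom, by rw [L.F.zero_zero hdom, hx0]⟩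
  have hxo : L.F.R x 1 ∈ c₀.outer D := by
    refine mem_outer.2 fun v' hv' h => ?_
    have : v' = v := L.hD.eq_of_mem_nbhd hv' L.hv (interior_subset h) hxU
    rw [this, L.hD.mem_interior L.hv, C.mem_interior_iff (L.F.map_mem hdom),
      L.F.norm_κ_map hdom] at h
    exact lt_irrefl _ h.2
  obtain ⟨h1, h2, h3⟩ := L.top_g hxo hxU
  have hn := L.one_mem.1.trans_le h2.ge
  have hpos : ‖C.κ (c₀.map x)‖ ∈ Ioc (0 : ℝ) 1 :=
    ⟨norm_pos_iff.2 fun h => hxw ((C.κ_eq_zero hxD).1 h), C.mapsκ _ hxD⟩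
  obtain ⟨s, hs, hsq⟩ := exists_squeeze_eq L.hr' L.hrr L.hr1 hpos
  have h4 := L.height_lift h1 hn hs
  refine ⟨L.Q.R (g (L.F.R x 1)) s, L.lift_mem h1 hn hs, ?_⟩
  rw [L.p_of_lt (hs.1.trans_le h4.ge), h4, hsq, top,
    L.Q.comp _ _ _ (L.mem_domain h1 hn hs) L.one_mem]
  change L.F.R (L.top (g (L.F.R x 1))) _ = x
  rw [h3, L.F.comp _ _ _ hdom (Ioc_subset_Icc_self hpos) fun h => absurd h one_ne_zero]
  exact L.F.self x hxD

lemma map_p {y : c₁.surf} (hy : y ∈ T v) (hn : r ≤ L.height y) : c₀.map (L.p y) = c₁.map y := by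
  have hn' := L.hrr.trans_le hn
  rw [L.p_of_lt hn', L.F.map _ _ (L.p_mem_domain hy hn'), L.κ_map_top hy hn',
    squeeze_of_le L.hr' L.hrr hn, height]
  have : dir (dir (C.κ (c₁.map y))) = dir (C.κ (c₁.map y)) := by
    simpa using dir_real_mul_dir (C.κ (c₁.map y)) zero_lt_one
  rw [this, norm_mul_dir, C.Φκ _ (L.G.mapsTo v L.hv y hy)]

lemma p_crit {y : c₁.surf} (hy : y ∈ T v) (hc : y ∈ c₁.critPoints) : L.p y = v :=
  L.p_of_le (L.crit _ ⟨y, hc, rfl⟩ (L.G.mapsTo v L.hv y hy))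

lemma genus_eq_zero {c : Covering} {x : c.surf} (h : x ∉ c.critPoints) : c.surf.genus x = 0 := by
  have := milnor_eq_zero h
  rw [ClosedSurface.milnor] at this
  lia

/-- Neither y nor its image is critical at such a height, so both genera are zero. -/
lemma genus_p {y : c₁.surf} (hy : y ∈ T v) (hn : r ≤ L.height y) :
    c₀.surf.genus (L.p y) = c₁.surf.genus y := by
  have hn' := L.hrr.trans_le hn
  rw [genus_eq_zero fun h => L.p_ne hy hn' (L.p_crit hy h), genus_eq_zero fun h =>
    L.p_ne hy hn' (L.hD.eq_of_crit_mem L.hv h (L.p_mem hy))]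

lemma continuousOn_top : ContinuousOn L.top {y | y ∈ T v ∧ r' < L.height y} := by
  refine L.hhc.comp (L.Q.cont.comp (f := fun y => (y, (1 : ℝ))) (by fun_prop)
    fun y hy => L.mem_domain hy.1 hy.2 L.one_mem) fun y hy => ?_
  exact ⟨_, (L.top_spec hy.1 hy.2).1, (L.top_spec hy.1 hy.2).2.2⟩

lemma continuousOn_p : ContinuousOn L.p (T v) := by
  intro y hy
  rcases lt_or_ge r' (L.height y) with hn | hn
  · have h1 : ContinuousOn L.p {y | y ∈ T v ∧ r' < L.height y} := by
      have h2 : ContinuousOn (fun y => L.F.R (L.top y) (squeeze r' r (L.height y)))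
          {y | y ∈ T v ∧ r' < L.height y} :=
        L.F.cont.comp (L.continuousOn_top.prodMk
          ((continuous_squeeze r' r).comp_continuousOn
            (L.continuousOn_height.mono fun y hy => hy.1))) fun y hy => L.p_mem_domain hy.1 hy.2
      exact h2.congr fun y hy => L.p_of_lt hy.2
    refine (h1 y ⟨hy, hn⟩).mono_of_mem_nhdsWithin ?_
    filter_upwards [self_mem_nhdsWithin, (L.continuousOn_height y hy).eventually
      (lt_mem_nhds hn)] with y' h h' using ⟨h, h'⟩
  · intro N hN
    rw [L.p_of_le hn] at hN
    -- At the core the image is v. Points nearby go to small radii on rays ending at v, and by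
    -- `Flow.nhds` these are close to v.
    obtain ⟨ε, hε, hball⟩ := L.F.nhds v rfl N hN
    have h1 : squeeze r' r (L.height y) < ε := by
      refine lt_of_le_of_lt ?_ hε
      rw [← squeeze_self L.hr' L.hrr]
      exact (strictMono_squeeze L.hr' L.hrr).monotone hn
    rw [Filter.mem_map]
    filter_upwards [self_mem_nhdsWithin, ((continuous_squeeze r' r).continuousAt.comp_continuousWithinAt
      (L.continuousOn_height y hy)).eventually (gt_mem_nhds h1)] with y' h h'
    have h3 := (L.F.mem_nbhd_iff rfl).1 (L.p_mem h)
    refine hball _ h3.1 h3.2 ?_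
    rcases lt_or_ge r' (L.height y') with hn' | hn'
    · rw [L.norm_κ_map_p h hn']; exact h'
    · rw [L.norm_κ_map_p_of_le hn']; exact hε

/-! The deformation of the piece to a smaller one -/

open Classical in
/-- The deformation to the part of height at most `ρ`. -/
def squash (ρ : ℝ) (y : c₁.surf) (t : ℝ) : c₁.surf :=
  if L.height y ≤ ρ then y else L.Q.R y ((1 - t) * L.height y + t * ρ)

variable {ρ : ℝ}

lemma squash_of_le {y : c₁.surf} (hn : L.height y ≤ ρ) (t : ℝ) : L.squash ρ y t = y := if_pos hn

lemma level_mem (hρ : r' < ρ) {y : c₁.surf} (hy : y ∈ T v) (hn : ρ ≤ L.height y) {t : ℝ}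
    (ht : t ∈ Icc (0 : ℝ) 1) :
    (1 - t) * L.height y + t * ρ ∈ Ioc r' 1 ∧
    (1 - t) * L.height y + t * ρ ∈ Icc ρ (L.height y) := by
  have h1 := L.height_le hy
  have h2 : (1 - t) * L.height y + t * ρ ∈ Icc ρ (L.height y) := by
    constructor <;> nlinarith [ht.1, ht.2]
  exact ⟨⟨hρ.trans_le h2.1, h2.2.trans h1⟩, h2⟩

lemma squash_of_ge (hρ : r' < ρ) {y : c₁.surf} (hy : y ∈ T v) (hn : ρ ≤ L.height y) (t : ℝ) :
    L.squash ρ y t = L.Q.R y ((1 - t) * L.height y + t * ρ) := by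
  by_cases h : L.height y ≤ ρ
  · rw [L.squash_of_le h]
    have : (1 - t) * L.height y + t * ρ = L.height y := by rw [le_antisymm hn h]; ring
    rw [this]
    exact (L.Q.self y (L.G.mapsTo v L.hv y hy) (hρ.trans_le hn)).symm
  · exact if_neg h

lemma squash_mem (hρ : r' < ρ) {y : c₁.surf} (hy : y ∈ T v) {t : ℝ} (ht : t ∈ Icc (0 : ℝ) 1) :
    L.squash ρ y t ∈ T v ∧ L.height (L.squash ρ y t) ≤ L.height y := by
  rcases le_total (L.height y) ρ with hn | hn
  · rw [L.squash_of_le hn]; exact ⟨hy, le_rfl⟩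
  · obtain ⟨h1, h2⟩ := L.level_mem hρ hy hn ht
    rw [L.squash_of_ge hρ hy hn]
    refine ⟨L.lift_mem hy (hρ.trans_le hn) h1, ?_⟩
    rw [L.height_lift hy (hρ.trans_le hn) h1]
    exact h2.2

lemma height_squash_one (hρ : r' < ρ) {y : c₁.surf} (hy : y ∈ T v) :
    L.height (L.squash ρ y 1) ≤ ρ := by
  rcases le_total (L.height y) ρ with hn | hn
  · rwa [L.squash_of_le hn]
  · have h1 := (L.level_mem hρ hy hn (t := 1) ⟨zero_le_one, le_rfl⟩).1
    rw [L.squash_of_ge hρ hy hn, L.height_lift hy (hρ.trans_le hn) h1]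
    simp

lemma squash_zero (hρ : r' < ρ) {y : c₁.surf} (hy : y ∈ T v) : L.squash ρ y 0 = y := by
  rcases le_total (L.height y) ρ with hn | hn
  · exact L.squash_of_le hn _
  · rw [L.squash_of_ge hρ hy hn]
    simp only [sub_zero, one_mul, zero_mul, add_zero]
    exact L.Q.self y (L.G.mapsTo v L.hv y hy) (hρ.trans_le hn)

lemma continuousOn_squash (hρ : r' < ρ) :
    ContinuousOn (Function.uncurry (L.squash ρ)) (T v ×ˢ Icc 0 1) := by
  have hT := L.G.closed v L.hv
  have hc1 : IsClosed {y | y ∈ T v ∧ L.height y ≤ ρ} :=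
    L.continuousOn_height.preimage_isClosed_of_isClosed hT isClosed_Iic
  have hc2 : IsClosed {y | y ∈ T v ∧ ρ ≤ L.height y} :=
    L.continuousOn_height.preimage_isClosed_of_isClosed hT isClosed_Ici
  have h1 : ContinuousOn (Function.uncurry (L.squash ρ))
      ({y | y ∈ T v ∧ L.height y ≤ ρ} ×ˢ Icc 0 1) :=
    continuousOn_fst.congr fun q hq => L.squash_of_le hq.1.2 _
  have h2 : ContinuousOn (Function.uncurry (L.squash ρ))
      ({y | y ∈ T v ∧ ρ ≤ L.height y} ×ˢ Icc 0 1) := by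
    have hh : ContinuousOn (fun q : c₁.surf × ℝ => L.height q.1)
        ({y | y ∈ T v ∧ ρ ≤ L.height y} ×ˢ Icc 0 1) :=
      L.continuousOn_height.comp continuousOn_fst fun q hq => hq.1.1
    refine (L.Q.cont.comp (f := fun q : c₁.surf × ℝ =>
      (q.1, (1 - q.2) * L.height q.1 + q.2 * ρ)) ?_ fun q hq => ?_).congr
      fun q hq => L.squash_of_ge hρ hq.1.1 hq.1.2 _
    · exact continuousOn_fst.prodMk (((continuousOn_const.sub continuousOn_snd).mul hh).add
        (continuousOn_snd.mul continuousOn_const))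
    · exact L.mem_domain hq.1.1 (hρ.trans_le hq.1.2) (L.level_mem hρ hq.1.1 hq.1.2 hq.2).1
  refine (h1.union_of_isClosed h2 (hc1.prod isClosed_Icc) (hc2.prod isClosed_Icc)).mono ?_
  rintro ⟨y, t⟩ ⟨hy, ht⟩
  rcases le_total (L.height y) ρ with hn | hn
  · exact Or.inl ⟨⟨hy, hn⟩, ht⟩
  · exact Or.inr ⟨⟨hy, hn⟩, ht⟩

lemma isConnected_sublevel (hρ : r' < ρ) : IsConnected {y | y ∈ T v ∧ L.height y ≤ ρ} := by
  have h1 : ContinuousOn (fun y => L.squash ρ y 1) (T v) :=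
    (L.continuousOn_squash hρ).comp (f := fun y => (y, (1 : ℝ))) (by fun_prop)
      fun y hy => ⟨hy, zero_le_one, le_rfl⟩
  have h2 := (L.G.connected v L.hv).image _ h1
  convert h2 using 1
  ext y
  constructor
  · rintro ⟨hy, hn⟩
    exact ⟨y, hy, L.squash_of_le hn 1⟩
  · rintro ⟨y, hy, rfl⟩
    exact ⟨(L.squash_mem hρ hy ⟨zero_le_one, le_rfl⟩).1, L.height_squash_one hρ hy⟩

/-- A union of closed sublevel sets through one common point, each of them a continuous image of the
connected piece. -/
lemma isConnected_strict_sublevel (hρ : r' < ρ) :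
    IsConnected {y | y ∈ T v ∧ L.height y < ρ} := by
  obtain ⟨σ, h1, h2⟩ := exists_between hρ
  obtain ⟨x, hx⟩ := (L.isConnected_sublevel h1).nonempty
  refine ⟨⟨x, hx.1, hx.2.trans_lt h2⟩, isPreconnected_of_forall x fun y hy => ?_⟩
  exact ⟨{z | z ∈ T v ∧ L.height z ≤ max σ (L.height y)},
    fun z hz => ⟨hz.1, hz.2.trans_lt (max_lt h2 hy.2)⟩, ⟨hx.1, hx.2.trans (le_max_left _ _)⟩,
    ⟨hy.1, le_max_right _ _⟩, (L.isConnected_sublevel (h1.trans_le (le_max_left _ _))).2⟩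

/-- `squash` deforms the larger set into the sublevel set and fixes the latter. The choices of J
used are the whole line, `Iic r` and `Iio r`: the piece itself and the preimages of the closed
neighbourhood and of its interior. -/
lemma betti_eq (n : ℕ) (hρ : r' < ρ) {J : Set ℝ} (hJ : ∀ s ≤ ρ, s ∈ J) (hJd : J.OrdConnected) :
    betti (n + 1) {y | y ∈ T v ∧ L.height y ∈ J} =
      betti (n + 1) {y | y ∈ T v ∧ L.height y ≤ ρ} := by
  have hsub : {y | y ∈ T v ∧ L.height y ≤ ρ} ⊆ {y | y ∈ T v ∧ L.height y ∈ J} :=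
    fun y hy => ⟨hy.1, hJ _ hy.2⟩
  rw [← betti_preimage_val n hsub]
  have hmem : ∀ (y : {y | y ∈ T v ∧ L.height y ∈ J}) (t : unitInterval),
      L.squash ρ y t ∈ {y | y ∈ T v ∧ L.height y ∈ J} := by
    intro y t
    obtain ⟨h1, h2⟩ := L.squash_mem hρ y.2.1 t.2
    refine ⟨h1, ?_⟩
    rcases le_total (L.height (L.squash ρ y t)) ρ with h | h
    · exact hJ _ h
    · exact hJd.out (hJ ρ le_rfl) y.2.2 ⟨h, h2⟩
  refine (betti_eq_of_deformation n ⟨fun q => ⟨L.squash ρ q.1 q.2, hmem q.1 q.2⟩,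
    Continuous.subtype_mk ?_ _⟩ (fun y => Subtype.ext (L.squash_zero hρ y.2.1)) (fun y => ?_)
    (fun y hy t => ?_)).symm
  · exact (L.continuousOn_squash hρ).comp_continuous
      (f := fun q : {y | y ∈ T v ∧ L.height y ∈ J} × unitInterval => ((q.1 : c₁.surf), (q.2 : ℝ)))
      (by fun_prop) fun q => ⟨q.1.2.1, q.2.2⟩
  · exact ⟨(L.squash_mem hρ y.2.1 ⟨zero_le_one, le_rfl⟩).1, L.height_squash_one hρ y.2.1⟩
  · have : L.squash ρ y t = y := L.squash_of_le hy.2 _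
    change L.squash ρ y t ∈ {y | y ∈ T v ∧ L.height y ≤ ρ}
    rw [this]
    exact hy

end LocalCollapse

end Covering

end

/-! ### Concentric subdisks and the global collapsing map. -/

noncomputable section

namespace Covering

section Sub

variable {c : Covering} {D D' : Sphere2 → Set Sphere2}
  {C : ∀ w, w ∈ c.critValues → DiskChart (D w) w} {r : ℝ}

lemma mem_sub {D : Set Sphere2} {w : Sphere2} (C : DiskChart D w) (hr1 : r ≤ 1)
    {y : Sphere2} : y ∈ C.Φ '' Metric.closedBall 0 r ↔ y ∈ D ∧ ‖C.κ y‖ ≤ r := by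
  constructor
  · rintro ⟨z, hz, rfl⟩
    rw [mem_closedBall_zero_iff] at hz
    rw [C.κΦ z (hz.trans hr1)]
    exact ⟨C.mapsΦ z (hz.trans hr1), hz⟩
  · rintro ⟨hy, h⟩
    exact ⟨C.κ y, mem_closedBall_zero_iff.2 h, C.Φκ y hy⟩

lemma mem_interior_sub {D : Set Sphere2} {w : Sphere2} (C : DiskChart D w) (hr : 0 < r)
    (hr1 : r ≤ 1) {y : Sphere2} :
    y ∈ interior (C.Φ '' Metric.closedBall 0 r) ↔ y ∈ D ∧ ‖C.κ y‖ < r := by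
  have h1 : ∀ hy : y ∈ C.Φ '' Metric.closedBall 0 r, y ∈ interior (C.Φ '' Metric.closedBall 0 r) ↔
      ‖C.κ y‖ < r := by
    intro hy
    rw [(C.sub hr hr1).mem_interior_iff hy]
    change ‖(r : ℂ)⁻¹ * C.κ y‖ < 1 ↔ _
    rw [norm_mul, norm_inv, Complex.norm_real, Real.norm_of_nonneg hr.le, inv_mul_lt_iff₀ hr,
      mul_one]
  constructor
  · intro h
    have h2 := interior_subset h
    exact ⟨((mem_sub C hr1).1 h2).1, (h1 h2).1 h⟩
  · intro h
    exact (h1 ((mem_sub C hr1).2 ⟨h.1, h.2.le⟩)).2 h.2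

lemma IsDiskFamily.sub (hD : c.IsDiskFamily D) (hr : 0 < r) (hr1 : r ≤ 1)
    (hD' : ∀ w hw, D' w = (C w hw).Φ '' Metric.closedBall 0 r) : c.IsDiskFamily D' := by
  refine ⟨fun w hw => ?_, fun w hw w' hw' hne => ?_⟩
  · rw [hD' w hw]
    exact ⟨((C w hw).sub hr hr1).isClosedDisk, ((C w hw).sub hr hr1).center_mem_interior⟩
  · refine (hD.2 hw hw' hne).mono ?_ ?_
    · rw [hD' w hw]
      exact fun y hy => ((mem_sub (C w hw) hr1).1 hy).1
    · rw [hD' w' hw']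
      exact fun y hy => ((mem_sub (C w' hw') hr1).1 hy).1

/-- The flow only decreases the radius, so the right-hand set is contractible and therefore
connected; the other inclusion is monotonicity of components. -/
lemma Flow.nbhd_sub {v : c.surf} {C : DiskChart (D (c.map v)) (c.map v)} (F : c.Flow C)
    (hr : 0 < r) (hr1 : r ≤ 1) (hD' : D' (c.map v) = C.Φ '' Metric.closedBall 0 r) :
    c.nbhd D' v = {x | x ∈ c.nbhd D v ∧ ‖C.κ (c.map x)‖ ≤ r} := by
  have hvm : v ∈ {x | x ∈ c.nbhd D v ∧ ‖C.κ (c.map x)‖ ≤ r} :=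
    ⟨F.self_mem_nbhd rfl, by rw [C.κ_center, norm_zero]; exact hr.le⟩
  have hv' : v ∈ c.map ⁻¹' D' (c.map v) := by
    rw [mem_preimage, hD']
    exact (mem_sub C hr1).2 ⟨C.center_mem, hvm.2⟩
  apply Subset.antisymm
  · intro x hx
    have hsub : c.map ⁻¹' D' (c.map v) ⊆ c.map ⁻¹' D (c.map v) := by
      rw [hD']
      exact fun y hy => ((mem_sub C hr1).1 hy).1
    refine ⟨connectedComponentIn_mono v hsub hx, ?_⟩
    have := nbhd_subset v hx
    rw [mem_preimage, hD', mem_sub C hr1] at this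
    exact this.2
  · have hcon : ContractibleSpace {x | x ∈ c.nbhd D v ∧ ‖C.κ (c.map x)‖ ≤ r} := by
      refine F.contractible (v := v) (fun x hx => (F.mem_nbhd_iff rfl).1 hx.1) hvm
        fun x hx t ht => ?_
      have h1 := (F.mem_nbhd_iff rfl).1 hx.1
      obtain ⟨h2, h3, h4⟩ := F.shrink_spec h1.1 ht
      exact ⟨(F.mem_nbhd_iff rfl).2 ⟨h2, h3.trans h1.2⟩, h4.trans hx.2⟩
    refine IsPreconnected.subset_connectedComponentIn ?_ hvm fun x hx => ?_
    · exact isPreconnected_iff_preconnectedSpace.2 inferInstance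
    · rw [mem_preimage, hD', mem_sub C hr1]
      exact ⟨nbhd_subset v hx.1, hx.2⟩

end Sub

variable {c₀ c₁ : Covering} {D D' : Sphere2 → Set Sphere2} {g : c₀.surf → c₁.surf}
  {T : c₀.surf → Set c₁.surf} {r : ℝ}

/-- The pieces of a perturbation can be collapsed to the smaller disks that contain the critical
values. -/
theorem Gluing.exists_collapse (G : Gluing c₀ c₁ D g T) (hD : c₀.IsDiskFamily D)
    {C : ∀ w, w ∈ c₀.critValues → DiskChart (D w) w} (hr : 0 < r) (hr1 : r ≤ 1)
    (hcrit : ∀ w hw, ∀ y ∈ c₁.critValues, y ∈ D w → ‖(C w hw).κ y‖ < r)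
    (hD' : ∀ w hw, D' w = (C w hw).Φ '' Metric.closedBall 0 r) :
    ∃ π, Collapse c₀ c₁ D' π := by
  classical
  -- The inverse of g requires a non-empty surface; over the empty one everything is vacuous.
  rcases isEmpty_or_nonempty c₀.surf with hemp | hne
  · have hemp' : IsEmpty c₁.surf := ⟨fun y => by
      rcases G.cover y with ⟨x, -⟩ | ⟨x, -⟩ <;> exact hemp.elim x⟩
    refine ⟨⟨fun y => hemp'.elim y, continuous_of_const fun y => hemp'.elim y⟩, ?_⟩
    constructor
    all_goals first
      | exact fun y => hemp'.elim y
      | exact fun v => hemp.elim v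
  have hDf := hD.sub hr hr1 hD'
  obtain ⟨h, hh, hhc⟩ := G.exists_inverse
  have hcv : ∀ v ∈ c₀.critPoints, c₀.map v ∈ c₀.critValues := fun v hv => ⟨v, hv, rfl⟩
  -- There are finitely many critical values in the disk, so the largest of their radii is still
  -- less than r; it is 0 if there are none.
  have hr'ex : ∀ v (hv : v ∈ c₀.critPoints), ∃ r', 0 ≤ r' ∧ r' < r ∧ ∀ y ∈ c₁.critValues,
      y ∈ D (c₀.map v) → ‖(C _ (hcv v hv)).κ y‖ ≤ r' := by
    intro v hv
    have hfin : (c₁.critValues ∩ D (c₀.map v)).Finite := c₁.finite_critValues.inter_of_left _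
    rcases (c₁.critValues ∩ D (c₀.map v)).eq_empty_or_nonempty with h0 | h0
    · exact ⟨0, le_rfl, hr, fun y h1 h2 => (h0.subset ⟨h1, h2⟩).elim⟩
    · obtain ⟨y₀, hy₀, hmax⟩ := exists_max_image _ (fun y => ‖(C _ (hcv v hv)).κ y‖) hfin h0
      exact ⟨_, norm_nonneg _, hcrit _ (hcv v hv) y₀ hy₀.1 hy₀.2, fun y h1 h2 => hmax y ⟨h1, h2⟩⟩
  choose! r' hr'0 hr'r hr'c using hr'ex
  have hL : ∀ v (hv : v ∈ c₀.critPoints),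
      Nonempty (LocalCollapse c₀ c₁ D g T v (C _ (hcv v hv)) (r' v) r) := by
    intro v hv
    obtain ⟨F⟩ := hD.exists_flow (hcv v hv) (C _ (hcv v hv))
    obtain ⟨Q⟩ := c₁.exists_radialLift (C _ (hcv v hv)) (hr'0 v hv) fun y hy hlt hyc =>
      absurd hlt (hr'c v hv y hyc hy).not_gt
    exact ⟨⟨G, hD, hv, F, h, hh, hhc, hr'0 v hv, hr'r v hv, hr1, hr'c v hv, Q⟩⟩
  obtain ⟨L⟩ : Nonempty (∀ v (hv : v ∈ c₀.critPoints),
      LocalCollapse c₀ c₁ D g T v (C _ (hcv v hv)) (r' v) r) := ⟨fun v hv => (hL v hv).some⟩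
  let π : c₁.surf → c₀.surf := fun y =>
    if hy : ∃ v, ∃ _ : v ∈ c₀.critPoints, y ∈ T v then
      (L hy.choose hy.choose_spec.choose).p y else h y
  have hπT : ∀ v (hv : v ∈ c₀.critPoints), ∀ y ∈ T v, π y = (L v hv).p y := by
    intro v hv y hy
    have hex : ∃ v, ∃ _ : v ∈ c₀.critPoints, y ∈ T v := ⟨v, hv, hy⟩
    have h1 : hex.choose = v := by
      by_contra hne
      exact disjoint_left.1 (G.disjoint hex.choose_spec.choose hv hne)
        hex.choose_spec.choose_spec hy
    have h2 : ∀ u (hu : u ∈ c₀.critPoints), u = v → (L u hu).p y = (L v hv).p y := by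
      rintro u hu rfl; rfl
    exact (dif_pos hex).trans (h2 _ _ h1)
  have hπg : ∀ x ∈ c₀.outer D, π (g x) = x := by
    intro x hx
    by_cases hex : ∃ v, ∃ _ : v ∈ c₀.critPoints, g x ∈ T v
    · obtain ⟨v, hv, hT⟩ := hex
      rw [hπT v hv _ hT]
      exact (L v hv).p_g hx ((G.boundary v hv x hx).1 hT)
    · exact (dif_neg hex).trans (hh x hx)
  -- The outer part, indexed by `none`, and the pieces form a finite closed cover on each member of
  -- which the map is continuous.
  have hπc : Continuous π := by
    let K : Option c₀.critPoints → Set c₁.surf := fun o => o.elim (g '' c₀.outer D) fun v => T v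
    have hfin : Finite c₀.critPoints := c₀.finite_critPoints
    refine (locallyFinite_of_finite K).continuous ?_ ?_ ?_
    · refine eq_univ_of_forall fun y => mem_iUnion.2 ?_
      rcases G.cover y with hy | ⟨v, hv, hy⟩
      · exact ⟨none, hy⟩
      · exact ⟨some ⟨v, hv⟩, hy⟩
    · rintro (_ | v)
      · exact G.isClosed_image (isClosed_outer c₀ D) subset_rfl
      · exact G.closed v v.2
    · rintro (_ | v)
      · refine hhc.congr ?_
        rintro _ ⟨x, hx, rfl⟩
        rw [hπg x hx, hh x hx]
      · exact (L v v.2).continuousOn_p.congr fun y hy => hπT v v.2 y hy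
  have hmemT : ∀ v ∈ c₀.critPoints, ∀ y, π y ∈ c₀.nbhd D v ↔ y ∈ T v := by
    intro v hv y
    constructor
    · intro hy
      rcases G.cover y with ⟨x, hx, rfl⟩ | ⟨v', hv', hT⟩
      · rw [hπg x hx] at hy
        exact (G.boundary v hv x hx).2 hy
      · rw [hπT v' hv' y hT] at hy
        rwa [hD.eq_of_mem_nbhd hv hv' hy ((L v' hv').p_mem hT)]
    · intro hT
      rw [hπT v hv y hT]
      exact (L v hv).p_mem hT
  have hnbhd : ∀ v (hv : v ∈ c₀.critPoints), π ⁻¹' c₀.nbhd D' v =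
      {y | y ∈ T v ∧ (L v hv).height y ≤ r} := by
    intro v hv
    ext y
    rw [mem_preimage, (L v hv).F.nbhd_sub hr hr1 (hD' _ (hcv v hv)), mem_ofPred_eq,
      hmemT v hv, mem_ofPred_eq]
    refine and_congr_right fun hT => ?_
    rw [hπT v hv y hT, (L v hv).norm_κ_map_p_le_iff hT]
  have hint : ∀ v (hv : v ∈ c₀.critPoints), π ⁻¹' interior (c₀.nbhd D' v) =
      {y | y ∈ T v ∧ (L v hv).height y < r} := by
    intro v hv
    ext y
    rw [mem_preimage, hDf.mem_interior hv, ← mem_preimage, hnbhd v hv, hD' _ (hcv v hv),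
      mem_interior_sub _ hr hr1]
    constructor
    · rintro ⟨h1, h2⟩
      rw [hπT v hv y h1.1, (L v hv).norm_κ_map_p_lt_iff h1.1] at h2
      exact ⟨h1.1, h2.2⟩
    · rintro ⟨h1, h2⟩
      refine ⟨⟨h1, h2.le⟩, nbhd_subset v ((hmemT v hv y).2 h1), ?_⟩
      rwa [hπT v hv y h1, (L v hv).norm_κ_map_p_lt_iff h1]
  have hbetti : ∀ n, ∀ v ∈ c₀.critPoints, betti (n + 1) (π ⁻¹' c₀.nbhd D' v) = betti (n + 1) (T v) ∧
      betti (n + 1) (π ⁻¹' interior (c₀.nbhd D' v)) = betti (n + 1) (T v) := by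
    intro n v hv
    -- An intermediate radius: the piece and both preimages deform to the part of height at most ρ.
    obtain ⟨ρ, h1, h2⟩ := exists_between (hr'r v hv)
    have h3 := (L v hv).betti_eq n h1 (J := univ) (fun s _ => mem_univ s) ordConnected_univ
    have h4 := (L v hv).betti_eq n h1 (J := Iic r) (fun s hs => hs.trans h2.le) ordConnected_Iic
    have h5 := (L v hv).betti_eq n h1 (J := Iio r) (fun s hs => hs.trans_lt h2) ordConnected_Iio
    have h6 : {y | y ∈ T v ∧ (L v hv).height y ∈ univ} = T v := by ext y; simp
    rw [h6] at h3
    rw [hnbhd v hv, hint v hv, h3]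
    exact ⟨h4, h5⟩
  have houter : ∀ y, (∀ v ∈ c₀.critPoints, π y ∉ interior (c₀.nbhd D' v)) →
      (∃ x ∈ c₀.outer D, g x = y) ∨ ∃ v, ∃ hv : v ∈ c₀.critPoints, y ∈ T v ∧
        r ≤ (L v hv).height y := by
    intro y hy
    rcases G.cover y with hx | ⟨v, hv, hT⟩
    · exact Or.inl hx
    · refine Or.inr ⟨v, hv, hT, not_lt.1 fun hlt => hy v hv ?_⟩
      rw [← mem_preimage, hint v hv]
      exact ⟨hT, hlt⟩
  refine ⟨⟨π, hπc⟩, ⟨fun y hy => ?_, fun x y hxy hx => ?_, fun x hx => ?_, fun y hy => ?_,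
    fun y hy => ?_, fun v hv y hy => ?_, fun v hv => ?_, fun v hv => ?_, fun v hv => ?_,
    fun v hv => ?_, fun v hv => ?_, fun v hv => ?_⟩⟩ <;> dsimp only [ContinuousMap.coe_mk] at *
  · obtain ⟨v, hv, hT, -⟩ := G.exists_of_crit hD hy
    rw [hπT v hv y hT, (L v hv).p_crit hT hy]
    exact hv
  · have key : ∀ v ∈ c₀.critPoints, x ∈ T v → x = y := by
      intro v hv hxT
      have hyT : y ∈ T v := by rwa [← hmemT v hv, ← hxy, hmemT v hv]
      rw [hπT v hv x hxT, hπT v hv y hyT] at hxy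
      refine (L v hv).p_inj hxT hyT hxy fun he => hx ?_
      rwa [hπT v hv x hxT, he]
    rcases G.cover x with ⟨a, ha, rfl⟩ | ⟨v, hv, hT⟩
    · rcases G.cover y with ⟨b, hb, rfl⟩ | ⟨v, hv, hT⟩
      · rw [hπg a ha, hπg b hb] at hxy
        rw [hxy]
      · exact key v hv (by rwa [← hmemT v hv, hxy, hmemT v hv])
    · exact key v hv hT
  · by_cases hxo : x ∈ c₀.outer D
    · exact ⟨g x, hπg x hxo⟩
    · simp only [mem_outer, not_forall, not_not] at hxo
      obtain ⟨v, hv, hxv⟩ := hxo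
      obtain ⟨y, hy, he⟩ := (L v hv).p_surj (interior_subset hxv) fun he => hx (he ▸ hv)
      exact ⟨y, (hπT v hv y hy).trans he⟩
  · rcases houter y hy with ⟨x, hx, rfl⟩ | ⟨v, hv, hT, hle⟩
    · rw [hπg x hx, G.map_eq x hx]
    · rw [hπT v hv y hT, (L v hv).map_p hT hle]
  · rcases houter y hy with ⟨x, hx, rfl⟩ | ⟨v, hv, hT, hle⟩
    · rw [hπg x hx, G.genus_eq x hx]
    · rw [hπT v hv y hT, (L v hv).genus_p hT hle]
  · rw [← mem_preimage, hnbhd v hv] at hy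
    rw [hD' _ (hcv v hv)]
    exact (mem_sub _ hr1).2 ⟨G.mapsTo v hv y hy.1, hy.2⟩
  · rw [hnbhd v hv]; exact (L v hv).isConnected_sublevel (hr'r v hv)
  · rw [hint v hv]; exact (L v hv).isConnected_strict_sublevel (hr'r v hv)
  · rw [(hbetti 0 v hv).1, ← G.betti_one v hv, finsum_milnor_inter, finsum_milnor_inter c₁ (T v)]
    -- Shrinking the disk loses no Milnor numbers, as all critical points of the piece have height
    -- at most r'.
    have hcr : π ⁻¹' c₀.nbhd D' v ∩ c₁.critPoints = T v ∩ c₁.critPoints := by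
      rw [hnbhd v hv]
      ext y
      refine ⟨fun hy => ⟨hy.1.1, hy.2⟩, fun hy => ⟨⟨hy.1, ?_⟩, hy.2⟩⟩
      exact ((L v hv).crit _ ⟨y, hy.2, rfl⟩ (G.mapsTo v hv y hy.1)).trans (hr'r v hv).le
    rw [hcr]
  · rw [(hbetti 0 v hv).1, (hbetti 0 v hv).2]
  · rw [(hbetti 1 v hv).1]; exact G.betti_two v hv
  · rw [(hbetti 1 v hv).2]; exact G.betti_two v hv

/-- Every perturbation is given by a collapse. -/
theorem IsPerturbationAt.exists_collapse {A : Set c₀.surf}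
    {j : ↥((⋃ v ∈ A, interior (c₀.nbhd D v))ᶜ) → c₁.surf}
    (P : IsPerturbationAt c₀ c₁ D A j T) (hD : c₀.IsDiskFamily D) : ∃ π, Collapse c₀ c₁ D π := by
  obtain ⟨g, T', G⟩ := P.exists_gluing hD
  -- The radius is 1, so the smaller disks are the original ones; what remains is that critical
  -- values are interior.
  refine G.exists_collapse hD (C := fun w hw => (hD.exists_chart hw).some) zero_lt_one le_rfl
    ?_ fun w hw => DiskChart.eq_image _
  rintro w hw _ ⟨y, hy, rfl⟩ hyw
  obtain ⟨v, hv, hT, hin⟩ := G.exists_of_crit hD hy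
  rw [← hD.eq_of_mem hw ⟨v, hv, rfl⟩ hyw (interior_subset hin)] at hin
  exact (DiskChart.mem_interior_iff _ hyw).1 hin

end Covering

end

noncomputable section

/-! ### Invariance of the local degree -/

lemma hasLocalDegree_iff {h : ℂ → ℂ} {z : ℂ} {d : ℤ} : HasLocalDegree h z d ↔
    ∀ᶠ r : ℝ in 𝓝[>] 0, HasWinding (fun t => h (z + r * circ t) - h z) d := by
  simp only [HasLocalDegree, HasWinding, circ, sub_ne_zero]

lemma eventually_circle {z : ℂ} {P : ℂ → Prop} (h : ∀ᶠ ζ in 𝓝[≠] z, P ζ) :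
    ∀ᶠ r : ℝ in 𝓝[>] 0, ∀ t, P (z + r * circ t) := by
  rw [eventually_nhdsWithin_iff, Metric.eventually_nhds_iff] at h
  obtain ⟨ε, hε, h⟩ := h
  filter_upwards [self_mem_nhdsWithin, mem_nhdsWithin_of_mem_nhds (gt_mem_nhds hε)] with r h0 hr t
  have h1 : ‖(r : ℂ) * circ t‖ = r := by
    rw [norm_mul, norm_circ, mul_one, Complex.norm_real, Real.norm_of_nonneg (le_of_lt h0)]
  refine h (by rwa [dist_self_add_left, h1]) fun he => ?_
  have h2 : (r : ℂ) * circ t = 0 := by simpa using he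
  rw [h2, norm_zero] at h1
  exact absurd h1 (ne_of_lt h0)

lemma HasLocalDegree.congr {h₁ h₂ : ℂ → ℂ} {z : ℂ} {d : ℤ} (h : HasLocalDegree h₁ z d)
    (he : ∀ᶠ ζ in 𝓝[≠] z, h₂ ζ - h₂ z = h₁ ζ - h₁ z) : HasLocalDegree h₂ z d := by
  rw [hasLocalDegree_iff] at h ⊢
  filter_upwards [h, eventually_circle he] with r h1 h2
  exact h1.congr fun t _ => (h2 t).symm

lemma HasLocalDegree.of_homotopy {h : ℝ → ℂ → ℂ} {z : ℂ} {d : ℤ} (h0 : HasLocalDegree (h 0) z d)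
    {N : Set ℂ} (hN : N ∈ 𝓝 z) (hc : ContinuousOn (Function.uncurry h) (Icc 0 1 ×ˢ N))
    (hne : ∀ s ∈ Icc (0 : ℝ) 1, ∀ ζ ∈ N, ζ ≠ z → h s ζ ≠ h s z) : HasLocalDegree (h 1) z d := by
  rw [hasLocalDegree_iff] at h0 ⊢
  have h1 : ∀ᶠ ζ in 𝓝[≠] z, ζ ∈ N ∧ ζ ≠ z := by
    filter_upwards [mem_nhdsWithin_of_mem_nhds hN, self_mem_nhdsWithin] with ζ h1 h2 using ⟨h1, h2⟩
  filter_upwards [h0, eventually_circle h1] with r h2 h3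
  refine HasWinding.of_homotopy (H := fun s t => h s (z + r * circ t) - h s z) ?_ ?_ ?_ h2
  · refine ContinuousOn.sub ?_ ?_
    · exact hc.comp (f := fun q : ℝ × ℝ => (q.1, z + r * circ q.2)) (by fun_prop)
        fun q hq => ⟨hq.1, (h3 q.2).1⟩
    · exact hc.comp (f := fun q : ℝ × ℝ => (q.1, z)) (by fun_prop)
        fun q hq => ⟨hq.1, mem_of_mem_nhds hN⟩
  · exact fun s hs t _ => sub_ne_zero.2 (hne s hs _ (h3 t).1 (h3 t).2)
  · intro s _
    simp only [circ_zero, circ_one]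

/-- The local degree does not change if the increment is multiplied by a continuous non-zero
function. -/
lemma HasLocalDegree.of_mul {h₁ h₂ A : ℂ → ℂ} {z : ℂ} {d : ℤ} (h : HasLocalDegree h₁ z d)
    (hc : ∀ᶠ ζ in 𝓝 z, ContinuousAt h₁ ζ) (hne : ∀ᶠ ζ in 𝓝[≠] z, h₁ ζ ≠ h₁ z)
    (hA : ∀ᶠ ζ in 𝓝 z, ContinuousAt A ζ) (hA0 : A z ≠ 0)
    (he : ∀ᶠ ζ in 𝓝[≠] z, h₂ ζ - h₂ z = A ζ * (h₁ ζ - h₁ z)) : HasLocalDegree h₂ z d := by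
  obtain ⟨l, hl⟩ : ∃ l, Complex.exp l = A z := ⟨_, Complex.exp_log hA0⟩
  have hA1 : ∀ᶠ ζ in 𝓝 z, ‖A ζ / A z - 1‖ < 1 := by
    have h1 : ContinuousAt (fun ζ => ‖A ζ / A z - 1‖) z :=
      ((hA.self_of_nhds.div_const _).sub_const _).norm
    refine h1.eventually (gt_mem_nhds ?_)
    change ‖A z / A z - 1‖ < 1
    rw [div_self hA0, sub_self, norm_zero]
    exact one_pos
  obtain ⟨N, hN, hNp⟩ := Filter.eventually_iff_exists_mem.1
    (hc.and (hA.and (hA1.and (eventually_nhdsWithin_iff.1 hne))))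
  -- The factor is joined to 1 by exp(s l)(1 + s(A/A(z) − 1)), with l a logarithm of A(z). It does
  -- not vanish close to z, where |A/A(z) − 1| < 1.
  have h0 : HasLocalDegree (fun ζ => Complex.exp ((0 : ℝ) * l) * (1 + (0 : ℝ) * (A ζ / A z - 1)) *
      (h₁ ζ - h₁ z)) z d := h.congr (Eventually.of_forall fun ζ => by simp)
  have h1 := h0.of_homotopy (h := fun s ζ => Complex.exp ((s : ℝ) * l) *
    (1 + (s : ℝ) * (A ζ / A z - 1)) * (h₁ ζ - h₁ z)) hN ?_ ?_
  · refine h1.congr ?_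
    filter_upwards [he] with ζ hζ
    rw [hζ]
    simp only [Complex.ofReal_one, one_mul, hl, sub_self, mul_zero, sub_zero, add_sub_cancel]
    rw [mul_div_cancel₀ _ hA0]
  · have hA' : ContinuousOn (fun q : ℝ × ℂ => A q.2) (Icc 0 1 ×ˢ N) :=
      ContinuousOn.comp (g := A) (t := N)
        (fun ζ hζ => (hNp ζ hζ).2.1.continuousWithinAt) continuousOn_snd fun q hq => hq.2
    have hh' : ContinuousOn (fun q : ℝ × ℂ => h₁ q.2) (Icc 0 1 ×ˢ N) :=
      ContinuousOn.comp (g := h₁) (t := N)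
        (fun ζ hζ => (hNp ζ hζ).1.continuousWithinAt) continuousOn_snd fun q hq => hq.2
    have h2 : ContinuousOn (fun q : ℝ × ℂ => Complex.exp ((q.1 : ℝ) * l)) (Icc 0 1 ×ˢ N) := by
      fun_prop
    have h3 : ContinuousOn (fun q : ℝ × ℂ => ((q.1 : ℝ) : ℂ)) (Icc 0 1 ×ˢ N) := by
      fun_prop
    exact (h2.mul (continuousOn_const.add (h3.mul
      ((hA'.div_const _).sub continuousOn_const)))).mul (hh'.sub continuousOn_const)
  · intro s hs ζ hζ hζz
    obtain ⟨-, -, h4, h5⟩ := hNp ζ hζ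
    simp only [sub_self, mul_zero]
    refine mul_ne_zero (mul_ne_zero (Complex.exp_ne_zero _) fun h6 => ?_) (sub_ne_zero.2 (h5 hζz))
    have h7 : ‖(s : ℂ) * (A ζ / A z - 1)‖ = 1 := by
      rw [eq_neg_of_add_eq_zero_right h6, norm_neg, norm_one]
    rw [norm_mul, Complex.norm_real, Real.norm_of_nonneg hs.1] at h7
    nlinarith [hs.2, hs.1, norm_nonneg (A ζ / A z - 1)]

lemma sphereCoord_coe (w : ℂ) : sphereCoord (w : Sphere2) = affineCoord OnePoint.infty := rfl

lemma sphereCoord_infty : sphereCoord OnePoint.infty = affineCoord ((0 : ℂ) : Sphere2) := by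
  funext y
  induction y using OnePoint.rec with
  | infty => rfl
  | coe z => simp [sphereCoord, affineCoord]

lemma exists_ne_sphereCoord (w : Sphere2) : ∃ q, q ≠ w ∧ sphereCoord w = affineCoord q := by
  induction w using OnePoint.rec with
  | infty => exact ⟨_, OnePoint.coe_ne_infty 0, sphereCoord_infty⟩
  | coe z => exact ⟨_, OnePoint.infty_ne_coe z, sphereCoord_coe z⟩

/-- Two affine coordinates differ near a point by a non-zero factor. -/
lemma exists_coord_factor {q w : Sphere2} (hq : q ≠ w) : ∃ a : Sphere2 → ℂ,
    (∀ y, y ≠ q → ContinuousAt a y) ∧ a w ≠ 0 ∧ ∀ᶠ y in 𝓝 w,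
      affineCoord q y - affineCoord q w = a y * (sphereCoord w y - sphereCoord w w) := by
  have hev : ∀ {q' : Sphere2}, q' ≠ w → ∀ᶠ y in 𝓝 w, y ≠ q' := fun h =>
    isOpen_compl_singleton.mem_nhds h.symm
  induction w using OnePoint.rec with
  | infty =>
    induction q using OnePoint.rec with
    | infty => exact absurd rfl hq
    | coe a =>
      refine ⟨fun y => 1 + a * affineCoord a y, fun y hy =>
        continuousAt_const.add (continuousAt_const.mul (continuousAt_affineCoord hy)),
        by simp [affineCoord], ?_⟩
      filter_upwards [hev hq, hev (OnePoint.coe_ne_infty (0 : ℂ))] with y h1 h2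
      induction y using OnePoint.rec with
      | infty => simp
      | coe z =>
        have h1' : z - a ≠ 0 := sub_ne_zero.2 fun h => h1 (by rw [h])
        have h2' : z ≠ 0 := fun h => h2 (by rw [h])
        simp only [affineCoord, sphereCoord, OnePoint.elim_some, OnePoint.elim_infty, sub_zero]
        field_simp
        ring
  | coe w =>
    induction q using OnePoint.rec with
    | infty => exact ⟨fun _ => 1, fun y _ => continuousAt_const, one_ne_zero,
        Eventually.of_forall fun y => by rw [sphereCoord_coe, one_mul]⟩
    | coe a =>
      have hwa : w - a ≠ 0 := sub_ne_zero.2 fun h => hq (by rw [h])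
      refine ⟨fun y => -affineCoord a y * (w - a)⁻¹, fun y hy =>
        (continuousAt_affineCoord hy).neg.mul continuousAt_const,
        by simp [affineCoord, hwa], ?_⟩
      filter_upwards [hev hq, hev (OnePoint.infty_ne_coe w)] with y h1 h2
      induction y using OnePoint.rec with
      | infty => exact absurd rfl h2
      | coe z =>
        have h1' : z - a ≠ 0 := sub_ne_zero.2 fun h => h1 (by rw [h])
        simp only [affineCoord, sphereCoord, OnePoint.elim_some]
        field_simp
        ring

/-! ### Radial isotopies of a disk -/

namespace DiskChart

variable {D : Set Sphere2} {w : Sphere2} (C : DiskChart D w)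

/-- The factor of a radial contraction. -/
def pushFactor (m : ℕ) (s x : ℝ) : ℝ := 1 - s + s * x ^ m

lemma pushFactor_mem (m : ℕ) {s x : ℝ} (hs : s ∈ Icc (0 : ℝ) 1) (hx : x ∈ Icc (0 : ℝ) 1) :
    pushFactor m s x ∈ Icc (0 : ℝ) 1 := by
  have h1 : x ^ m ∈ Icc (0 : ℝ) 1 := ⟨pow_nonneg hx.1 _, pow_le_one₀ hx.1 hx.2⟩
  unfold pushFactor
  constructor <;> nlinarith [hs.1, hs.2, h1.1, h1.2]

lemma pushFactor_one_right (m : ℕ) (s : ℝ) : pushFactor m s 1 = 1 := by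
  simp [pushFactor]

/-- The radius goes to (1 − s)x + s x^(m+1). Strict monotonicity at every stage s makes the family
an isotopy, which the invariance of the local degree requires. -/
lemma pushFactor_mul_lt (m : ℕ) {s x y : ℝ} (hs : s ∈ Icc (0 : ℝ) 1) (hx : 0 ≤ x) (hxy : x < y) :
    pushFactor m s x * x < pushFactor m s y * y := by
  have h1 : x ^ (m + 1) < y ^ (m + 1) := pow_lt_pow_left₀ hxy hx (Nat.succ_ne_zero m)
  have h2 : pushFactor m s x * x = (1 - s) * x + s * x ^ (m + 1) := by unfold pushFactor; ring
  have h3 : pushFactor m s y * y = (1 - s) * y + s * y ^ (m + 1) := by unfold pushFactor; ring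
  rw [h2, h3]
  rcases hs.1.eq_or_lt with h | h
  · rw [← h]; linarith
  · have := mul_lt_mul_of_pos_left h1 h
    have := mul_le_mul_of_nonneg_left hxy.le (sub_nonneg.2 hs.2)
    linarith

open Classical in
/-- The radial isotopy of a disk, extended by the identity. -/
def push (m : ℕ) (s : ℝ) (y : Sphere2) : Sphere2 :=
  if y ∈ D then C.Φ (pushFactor m s ‖C.κ y‖ * C.κ y) else y

lemma push_of_mem (m : ℕ) (s : ℝ) {y : Sphere2} (hy : y ∈ D) :
    C.push m s y = C.Φ (pushFactor m s ‖C.κ y‖ * C.κ y) := if_pos hy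

lemma push_of_notMem (m : ℕ) (s : ℝ) {y : Sphere2} (hy : y ∉ D) : C.push m s y = y := if_neg hy

variable {m : ℕ} {s : ℝ}

lemma norm_κ_mem {y : Sphere2} (hy : y ∈ D) : ‖C.κ y‖ ∈ Icc (0 : ℝ) 1 :=
  ⟨norm_nonneg _, C.mapsκ y hy⟩

lemma norm_factor_mul (hs : s ∈ Icc (0 : ℝ) 1) {y : Sphere2} (hy : y ∈ D) :
    ‖(pushFactor m s ‖C.κ y‖ : ℂ) * C.κ y‖ = pushFactor m s ‖C.κ y‖ * ‖C.κ y‖ := by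
  rw [norm_mul, Complex.norm_real,
    Real.norm_of_nonneg (pushFactor_mem m hs (C.norm_κ_mem hy)).1]

lemma norm_factor_mul_le (hs : s ∈ Icc (0 : ℝ) 1) {y : Sphere2} (hy : y ∈ D) :
    ‖(pushFactor m s ‖C.κ y‖ : ℂ) * C.κ y‖ ≤ 1 := by
  rw [C.norm_factor_mul hs hy]
  have h1 := pushFactor_mem m hs (C.norm_κ_mem hy)
  exact mul_le_one₀ h1.2 (norm_nonneg _) (C.mapsκ y hy)

lemma push_mem_iff (hs : s ∈ Icc (0 : ℝ) 1) {y : Sphere2} : C.push m s y ∈ D ↔ y ∈ D := by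
  by_cases hy : y ∈ D
  · rw [C.push_of_mem m s hy]
    exact iff_of_true (C.mapsΦ _ (C.norm_factor_mul_le hs hy)) hy
  · rw [C.push_of_notMem m s hy]

lemma κ_push (hs : s ∈ Icc (0 : ℝ) 1) {y : Sphere2} (hy : y ∈ D) :
    C.κ (C.push m s y) = pushFactor m s ‖C.κ y‖ * C.κ y := by
  rw [C.push_of_mem m s hy, C.κΦ _ (C.norm_factor_mul_le hs hy)]

lemma norm_κ_push (hs : s ∈ Icc (0 : ℝ) 1) {y : Sphere2} (hy : y ∈ D) :
    ‖C.κ (C.push m s y)‖ = pushFactor m s ‖C.κ y‖ * ‖C.κ y‖ := by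
  rw [C.κ_push hs hy, C.norm_factor_mul hs hy]

lemma push_zero (y : Sphere2) : C.push m 0 y = y := by
  by_cases hy : y ∈ D
  · rw [C.push_of_mem m 0 hy]
    simp [pushFactor, C.Φκ y hy]
  · exact C.push_of_notMem m 0 hy

lemma push_injective (hs : s ∈ Icc (0 : ℝ) 1) : Function.Injective (C.push m s) := by
  intro y y' h
  by_cases hy : y ∈ D
  · have hy' : y' ∈ D := by rwa [← C.push_mem_iff hs, ← h, C.push_mem_iff hs]
    have h1 : ‖C.κ y‖ = ‖C.κ y'‖ := by
      have h2 := C.norm_κ_push (m := m) hs hy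
      rw [h, C.norm_κ_push hs hy'] at h2
      rcases lt_trichotomy ‖C.κ y‖ ‖C.κ y'‖ with h3 | h3 | h3
      · exact absurd h2 (pushFactor_mul_lt m hs (norm_nonneg _) h3).ne'
      · exact h3
      · exact absurd h2 (pushFactor_mul_lt m hs (norm_nonneg _) h3).ne
    have h2 := C.κ_push (m := m) hs hy
    rw [h, C.κ_push hs hy', ← h1] at h2
    have h4 : C.κ y' = C.κ y := by
      by_cases h0 : C.κ y = 0
      · rw [h0, norm_zero] at h1
        rw [h0, norm_eq_zero.1 h1.symm]
      · have h5 := pushFactor_mul_lt m hs le_rfl (norm_pos_iff.2 h0)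
        rw [mul_zero] at h5
        refine mul_left_cancel₀ ?_ h2
        intro h6
        rw [Complex.ofReal_eq_zero] at h6
        rw [h6, zero_mul] at h5
        exact lt_irrefl _ h5
    rw [← C.Φκ y hy, ← C.Φκ y' hy', h4]
  · have hy' : y' ∉ D := by rwa [← C.push_mem_iff (m := m) hs, ← h, C.push_mem_iff hs]
    rwa [C.push_of_notMem m s hy, C.push_of_notMem m s hy'] at h

/-- The factor is 1 on the boundary circle, so the two definitions fit together along it. -/
lemma push_eq_self_of_notMem_interior {y : Sphere2} (hy : y ∉ interior D) :
    C.push m s y = y := by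
  by_cases hyD : y ∈ D
  · have h1 : ‖C.κ y‖ = 1 := by
      refine le_antisymm (C.mapsκ y hyD) (not_lt.1 fun h => hy ((C.mem_interior_iff hyD).2 h))
    rw [C.push_of_mem m s hyD, h1, pushFactor_one_right]
    simp [C.Φκ y hyD]
  · exact C.push_of_notMem m s hyD

lemma continuousOn_push :
    ContinuousOn (Function.uncurry (C.push m)) (Icc 0 1 ×ˢ univ) := by
  have h1 : ContinuousOn (Function.uncurry (C.push m)) (Icc 0 1 ×ˢ D) := by
    have hκ : ContinuousOn (fun q : ℝ × Sphere2 => C.κ q.2) (Icc 0 1 ×ˢ D) :=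
      C.contκ.comp continuousOn_snd fun q hq => hq.2
    have hf : ContinuousOn (fun q : ℝ × Sphere2 => (pushFactor m q.1 ‖C.κ q.2‖ : ℂ) * C.κ q.2)
        (Icc 0 1 ×ˢ D) := by
      refine ContinuousOn.mul (Complex.continuous_ofReal.comp_continuousOn ?_) hκ
      unfold pushFactor
      exact (continuousOn_const.sub continuousOn_fst).add (continuousOn_fst.mul (hκ.norm.pow m))
    refine (C.contΦ.comp hf fun q hq => ?_).congr fun q hq => C.push_of_mem m q.1 hq.2
    exact mem_closedBall_zero_iff.2 (C.norm_factor_mul_le hq.1 hq.2)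
  have h2 : ContinuousOn (Function.uncurry (C.push m)) (Icc 0 1 ×ˢ (interior D)ᶜ) :=
    continuousOn_snd.congr fun q hq => C.push_eq_self_of_notMem_interior hq.2
  refine (h1.union_of_isClosed h2 (isClosed_Icc.prod C.isClosed)
    (isClosed_Icc.prod isOpen_interior.isClosed_compl)).mono ?_
  rintro ⟨t, y⟩ ⟨ht, -⟩
  by_cases hy : y ∈ interior D
  · exact Or.inl ⟨ht, interior_subset hy⟩
  · exact Or.inr ⟨ht, hy⟩

lemma continuous_push (hs : s ∈ Icc (0 : ℝ) 1) : Continuous (C.push m s) :=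
  C.continuousOn_push.comp_continuous (f := fun y => (s, y)) (by fun_prop) fun _ => ⟨hs, mem_univ _⟩

lemma push_one_surjective : Function.Surjective (C.push m 1) := by
  intro y
  by_cases hy : y ∈ D
  · obtain ⟨t, ht, h⟩ : ∃ t ∈ Icc (0 : ℝ) 1, t ^ (m + 1) = ‖C.κ y‖ := by
      have := intermediate_value_Icc (zero_le_one (α := ℝ)) (continuous_pow (m + 1)).continuousOn
      simp only [zero_pow (Nat.succ_ne_zero m), one_pow] at this
      exact this (C.norm_κ_mem hy)
    have h1 := norm_real_mul_dir_le (C.κ y) ht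
    refine ⟨C.Φ (t * dir (C.κ y)), ?_⟩
    rw [C.push_of_mem m 1 (C.mapsΦ _ h1), C.κΦ _ h1]
    conv_rhs => rw [← C.Φκ y hy]
    congr 1
    by_cases h0 : C.κ y = 0
    · simp [h0, dir]
    · rw [norm_real_mul_dir h0 ht.1]
      unfold pushFactor
      conv_rhs => rw [← norm_mul_dir (C.κ y), ← h]
      push_cast
      ring
  · exact ⟨y, C.push_of_notMem m 1 hy⟩

lemma one_mem_Icc : (1 : ℝ) ∈ Icc (0 : ℝ) 1 := ⟨zero_le_one, le_rfl⟩

/-- The final homeomorphism of the radial isotopy. -/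
def pushHomeo (m : ℕ) : Sphere2 ≃ₜ Sphere2 :=
  Continuous.homeoOfEquivCompactToT2
    (f := Equiv.ofBijective (C.push m 1) ⟨C.push_injective one_mem_Icc, C.push_one_surjective⟩)
    (C.continuous_push one_mem_Icc)

lemma pushHomeo_apply (m : ℕ) (y : Sphere2) : C.pushHomeo m y = C.push m 1 y := rfl

end DiskChart

end

/-! ### Composition of a covering with a radial push. -/

noncomputable section

lemma isRamified_homeo_comp {X : Type} [TopologicalSpace X] {f : X → Sphere2}
    (H : Sphere2 ≃ₜ Sphere2) {x : X} : IsRamified (H ∘ f) x ↔ IsRamified f x := by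
  unfold IsRamified
  refine not_congr (exists_congr fun N => and_congr_right fun _ => ?_)
  exact ⟨fun h a ha b hb hab => h ha hb (congrArg H hab),
    fun h a ha b hb hab => h ha hb (H.injective hab)⟩

namespace Covering

variable (c : Covering)

lemma eventually_map_ne (x : c.surf) : ∀ᶠ y in 𝓝[≠] x, c.map y ≠ c.map x := by
  have h1 : ((c.map ⁻¹' {c.map x}) \ {x}).Finite := (c.finite_fiber _).subset sdiff_subset
  rw [eventually_nhdsWithin_iff]
  filter_upwards [h1.isClosed.isOpen_compl.mem_nhds fun h => h.2 rfl] with y hy hne he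
  exact hy ⟨he, hne⟩

section Push

variable {D : Set Sphere2} {w : Sphere2} (C : DiskChart D w) (m : ℕ)

/-- The push is joined to the identity by injective maps that keep an omitted point q of D out of
the image of its complement. The coordinate centered at q therefore serves throughout the isotopy,
whereas `sphereCoord` changes its formula at ∞. At both ends the coordinates differ by a
non-vanishing factor, which does not affect the degree. -/
lemma orientation_push (e : OpenPartialHomeomorph c.surf ℂ) {x : c.surf} (hx : x ∈ e.source)
    {d : ℤ} (h : HasLocalDegree (fun z => sphereCoord (c.map x) (c.map (e.symm z))) (e x) d) :
    HasLocalDegree (fun z => sphereCoord (C.push m 1 (c.map x)) (C.push m 1 (c.map (e.symm z))))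
      (e x) d := by
  have hcont : ContinuousAt (fun z => c.map (e.symm z)) (e x) :=
    c.continuous.continuousAt.comp (e.continuousAt_symm (e.map_source hx))
  by_cases hD : c.map x ∈ D
  · obtain ⟨q, hq⟩ := C.ne_univ
    have hqx : q ≠ c.map x := fun h => hq (h ▸ hD)
    have hpq : ∀ s ∈ Icc (0 : ℝ) 1, ∀ y, y ≠ q → C.push m s y ≠ q := by
      intro s hs y hy he
      by_cases hyD : y ∈ D
      · exact hq (by rwa [← he, C.push_mem_iff hs])
      · rw [C.push_of_notMem m s hyD] at he
        exact hy he
    -- A neighbourhood on which the coordinate at q is available and the value at x is taken only at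
    -- x.
    let N : Set ℂ := e.target ∩ {z | c.map (e.symm z) ≠ q ∧
      (z ≠ e x → c.map (e.symm z) ≠ c.map x)}
    have hN : N ∈ 𝓝 (e x) := by
      have h1 : ∀ᶠ z in 𝓝 (e x), c.map (e.symm z) ≠ q := by
        refine hcont.eventually (isOpen_compl_singleton.mem_nhds ?_)
        simpa only [e.left_inv hx, mem_compl_iff, mem_singleton_iff] using hqx.symm
      have h2 : ∀ᶠ z in 𝓝 (e x), e.symm z ≠ x → c.map (e.symm z) ≠ c.map x := by
        have h3 := (e.continuousAt_symm (e.map_source hx)).eventually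
          (p := fun y => y ≠ x → c.map y ≠ c.map x) (by
            rw [e.left_inv hx]
            exact eventually_nhdsWithin_iff.1 (c.eventually_map_ne x))
        exact h3
      filter_upwards [e.open_target.mem_nhds (e.map_source hx), h1, h2] with z h3 h4 h5
      refine ⟨h3, h4, fun hz => h5 fun h6 => hz ?_⟩
      rw [← h6, e.right_inv h3]
    have hcN : ContinuousOn (fun z => c.map (e.symm z)) N :=
      c.continuous.comp_continuousOn (e.continuousOn_symm.mono inter_subset_left)
    have hNo : ∀ᶠ z in 𝓝 (e x), N ∈ 𝓝 z := eventually_mem_nhds_iff.2 hN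
    have hx0 : c.map (e.symm (e x)) = c.map x := by rw [e.left_inv hx]
    let h' : ℝ → ℂ → ℂ := fun s z => affineCoord q (C.push m s (c.map (e.symm z)))
    have hh'c : ContinuousOn (Function.uncurry h') (Icc 0 1 ×ˢ N) := by
      refine (continuousOn_affineCoord q).comp (C.continuousOn_push.comp
        (f := fun p : ℝ × ℂ => (p.1, c.map (e.symm p.2))) (continuousOn_fst.prodMk
          (hcN.comp continuousOn_snd fun p hp => hp.2)) fun p hp => ⟨hp.1, mem_univ _⟩) ?_
      exact fun p hp => hpq p.1 hp.1 _ hp.2.2.1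
    have hne : ∀ s ∈ Icc (0 : ℝ) 1, ∀ z ∈ N, z ≠ e x → h' s z ≠ h' s (e x) := by
      intro s hs z hz hzx he
      have h1 := injOn_affineCoord q (hpq s hs _ hz.2.1)
        (hpq s hs _ (mem_of_mem_nhds hN).2.1) he
      exact hz.2.2 hzx ((C.push_injective hs h1).trans hx0)
    have hcs : ∀ s ∈ Icc (0 : ℝ) 1, ∀ᶠ z in 𝓝 (e x), ContinuousAt (h' s) z := by
      intro s hs
      have h1 : ContinuousOn (h' s) N :=
        hh'c.comp (f := fun z => (s, z)) (by fun_prop) fun z hz => ⟨hs, hz⟩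
      exact hNo.mono fun z hz => h1.continuousAt hz
    have hnes : ∀ s ∈ Icc (0 : ℝ) 1, ∀ᶠ z in 𝓝[≠] (e x), h' s z ≠ h' s (e x) := by
      intro s hs
      filter_upwards [mem_nhdsWithin_of_mem_nhds hN, self_mem_nhdsWithin] with z h1 h2
      exact hne s hs z h1 h2
    have hst : ∀ s ∈ Icc (0 : ℝ) 1, ContinuousAt (fun z => C.push m s (c.map (e.symm z))) (e x) :=
      fun s hs => (C.continuous_push hs).continuousAt.comp hcont
    have hfac : ∀ s ∈ Icc (0 : ℝ) 1, ∃ A : ℂ → ℂ, (∀ᶠ z in 𝓝 (e x), ContinuousAt A z) ∧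
        A (e x) ≠ 0 ∧ ∀ᶠ z in 𝓝 (e x), h' s z - h' s (e x) = A z *
          (sphereCoord (C.push m s (c.map x)) (C.push m s (c.map (e.symm z))) -
            sphereCoord (C.push m s (c.map x)) (C.push m s (c.map (e.symm (e x))))) := by
      intro s hs
      obtain ⟨a, ha, ha0, hae⟩ := exists_coord_factor (hpq s hs _ hqx.symm).symm
      refine ⟨fun z => a (C.push m s (c.map (e.symm z))), ?_, by simpa only [hx0] using ha0, ?_⟩
      · filter_upwards [hNo] with z hz
        refine ContinuousAt.comp (g := a) (ha _ (hpq s hs _ (mem_of_mem_nhds hz).2.1)) ?_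
        exact (C.continuous_push hs).continuousAt.comp (hcN.continuousAt hz)
      · have h1 := hst s hs
        rw [ContinuousAt, hx0] at h1
        filter_upwards [h1.eventually hae] with z hz
        rw [hx0]
        simp only [h']
        rw [hx0]
        exact hz
    have hI0 : (0 : ℝ) ∈ Icc (0 : ℝ) 1 := ⟨le_rfl, zero_le_one⟩
    have hstart : HasLocalDegree (h' 0) (e x) d := by
      obtain ⟨A, hA, hA0, hAe⟩ := hfac 0 hI0
      obtain ⟨q', hq', hqe⟩ := exists_ne_sphereCoord (c.map x)
      simp only [C.push_zero] at hAe
      refine h.of_mul ?_ ?_ hA hA0 (hAe.filter_mono nhdsWithin_le_nhds)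
      · have h1 : ∀ᶠ z in 𝓝 (e x), c.map (e.symm z) ≠ q' :=
          hcont.eventually (isOpen_compl_singleton.mem_nhds (by simpa only [hx0, mem_compl_iff, mem_singleton_iff] using hq'.symm))
        filter_upwards [h1, hNo] with z h1 h2
        rw [hqe]
        exact ContinuousAt.comp (g := affineCoord q') (continuousAt_affineCoord h1)
          (hcN.continuousAt h2)
      · filter_upwards [hnes 0 hI0, hAe.filter_mono nhdsWithin_le_nhds] with z h1 h2 h3
        rw [h3, sub_self, mul_zero, sub_eq_zero] at h2
        exact h1 h2
    have hend := hstart.of_homotopy hN hh'c hne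
    obtain ⟨A, hA, hA0, hAe⟩ := hfac 1 DiskChart.one_mem_Icc
    have hA1 : ∀ᶠ z in 𝓝 (e x), A z ≠ 0 := hA.self_of_nhds.eventually_ne hA0
    refine hend.of_mul (A := fun z => (A z)⁻¹) (hcs 1 DiskChart.one_mem_Icc)
      (hnes 1 DiskChart.one_mem_Icc) ?_ (inv_ne_zero hA0)
      (Eventually.filter_mono nhdsWithin_le_nhds ?_)
    · filter_upwards [hA, hA1] with z h1 h2 using h1.inv₀ h2
    · filter_upwards [hAe, hA1] with z h1 h2
      rw [h1, inv_mul_cancel_left₀ h2]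
  · rw [C.push_of_notMem m 1 hD]
    refine h.congr (Eventually.filter_mono nhdsWithin_le_nhds ?_)
    have h1 : ∀ᶠ z in 𝓝 (e x), c.map (e.symm z) ∉ D :=
      hcont.eventually (C.isClosed.isOpen_compl.mem_nhds (by simpa only [e.left_inv hx, mem_compl_iff] using hD))
    filter_upwards [h1] with z hz
    rw [C.push_of_notMem m 1 hz, e.left_inv hx, C.push_of_notMem m 1 hD]

lemma isBranched_push : IsBranchedCovering c.surf (C.pushHomeo m ∘ c.map) where
  normal_form x := by
    obtain ⟨e, ψ, k, he, hk, h⟩ := c.isBranched.normal_form x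
    -- Only the chart of the sphere changes; the exponents stay.
    refine ⟨e, (C.pushHomeo m).symm.transOpenPartialHomeomorph ψ, k, he, hk, fun y hy => ?_⟩
    obtain ⟨h1, h2⟩ := h y hy
    constructor
    · simpa using h1
    · simpa using h2
  orientation e he x hx := by
    obtain ⟨d, hd, h⟩ := c.isBranched.orientation e he x hx
    exact ⟨d, hd, c.orientation_push C m e hx h⟩
  ramified x h1 h2 := (isRamified_homeo_comp _).2 (c.isBranched.ramified x h1 h2)

/-- The composition of a covering with the radial push in a disk. -/
def pushed : Covering := ⟨c.surf, C.pushHomeo m ∘ c.map, c.isBranched_push C m⟩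

lemma critPoints_pushed : (c.pushed C m).critPoints = c.critPoints := by
  ext x
  exact or_congr (isRamified_homeo_comp _) Iff.rfl

lemma critValues_pushed : (c.pushed C m).critValues = C.push m 1 '' c.critValues := by
  rw [critValues, critPoints_pushed, critValues, image_image]
  rfl

lemma IsSheeted.pushed {n : ℕ} (h : c.IsSheeted n) : (c.pushed C m).IsSheeted n := by
  intro y hy
  have h1 : (c.pushed C m).map ⁻¹' {y} = c.map ⁻¹' {(C.pushHomeo m).symm y} := by
    ext x
    exact (C.pushHomeo m).eq_symm_apply.symm
  rw [h1]
  refine h _ fun hc => hy ?_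
  rw [critValues_pushed]
  exact ⟨_, hc, (C.pushHomeo m).apply_symm_apply y⟩

end Push

/-! ### Lifting a push -/

section Lift

variable {c} {D : Set Sphere2} {w : Sphere2} {C : DiskChart D w} (F : c.Flow C) (m : ℕ)

open Classical in
/-- The lift of a radial push of the disk to the covering surface. -/
def Flow.lift (x : c.surf) : c.surf :=
  if c.map x ∈ D then F.R x (DiskChart.pushFactor m 1 ‖C.κ (c.map x)‖ * ‖C.κ (c.map x)‖) else x

lemma Flow.lift_of_mem {x : c.surf} (hx : c.map x ∈ D) : F.lift m x =
    F.R x (DiskChart.pushFactor m 1 ‖C.κ (c.map x)‖ * ‖C.κ (c.map x)‖) := if_pos hx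

lemma Flow.lift_of_notMem {x : c.surf} (hx : c.map x ∉ D) : F.lift m x = x := if_neg hx

lemma Flow.lift_mem_domain (_ : c.Flow C) (m : ℕ) {x : c.surf} (hx : c.map x ∈ D) :
    (x, DiskChart.pushFactor m 1 ‖C.κ (c.map x)‖ * ‖C.κ (c.map x)‖) ∈ c.flowDomain C := by
  have h1 := DiskChart.pushFactor_mem m DiskChart.one_mem_Icc (C.norm_κ_mem hx)
  refine ⟨hx, ⟨mul_nonneg h1.1 (norm_nonneg _), mul_le_one₀ h1.2 (norm_nonneg _)
    (C.mapsκ _ hx)⟩, fun h => ?_⟩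
  dsimp only at h ⊢
  rw [h, C.κ_center, norm_zero, mul_zero]

lemma Flow.map_lift (x : c.surf) : c.map (F.lift m x) = C.push m 1 (c.map x) := by
  by_cases hx : c.map x ∈ D
  · rw [F.lift_of_mem m hx, F.map _ _ (F.lift_mem_domain m hx), C.push_of_mem m 1 hx]
    push_cast
    rw [mul_assoc, norm_mul_dir]
  · rw [F.lift_of_notMem m hx, C.push_of_notMem m 1 hx]

lemma Flow.lift_of_notMem_interior {x : c.surf} (hx : c.map x ∉ interior D) :
    F.lift m x = x := by
  by_cases hxD : c.map x ∈ D
  · have h1 : ‖C.κ (c.map x)‖ = 1 :=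
      le_antisymm (C.mapsκ _ hxD) (not_lt.1 fun h => hx ((C.mem_interior_iff hxD).2 h))
    have h2 := F.self x hxD
    rw [h1] at h2
    rw [F.lift_of_mem m hxD, h1, DiskChart.pushFactor_one_right, mul_one, h2]
  · exact F.lift_of_notMem m hxD

lemma Flow.continuous_lift : Continuous (F.lift m) := by
  have hcD : IsClosed (c.map ⁻¹' D) := C.isClosed.preimage c.continuous
  have hcO : IsClosed (c.map ⁻¹' (interior D)ᶜ) :=
    isOpen_interior.isClosed_compl.preimage c.continuous
  have h1 : ContinuousOn (F.lift m) (c.map ⁻¹' D) := by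
    have hκ : ContinuousOn (fun x => ‖C.κ (c.map x)‖) (c.map ⁻¹' D) :=
      (C.contκ.comp c.continuous.continuousOn fun x hx => hx).norm
    refine (F.cont.comp (f := fun x => (x, DiskChart.pushFactor m 1 ‖C.κ (c.map x)‖ *
      ‖C.κ (c.map x)‖)) (continuousOn_id.prodMk (ContinuousOn.mul ?_ hκ))
      fun x hx => F.lift_mem_domain m hx).congr fun x hx => F.lift_of_mem m hx
    unfold DiskChart.pushFactor
    exact continuousOn_const.add (continuousOn_const.mul (hκ.pow m))
  have h2 : ContinuousOn (F.lift m) (c.map ⁻¹' (interior D)ᶜ) :=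
    continuousOn_id.congr fun x hx => F.lift_of_notMem_interior m hx
  rw [← continuousOn_univ]
  refine (h1.union_of_isClosed h2 hcD hcO).mono fun x _ => ?_
  by_cases hx : c.map x ∈ interior D
  · exact Or.inl (interior_subset (s := D) hx)
  · exact Or.inr hx

lemma pushFactor_mul_eq_zero {x : ℝ} :
    DiskChart.pushFactor m 1 x * x = 0 ↔ x = 0 := by
  unfold DiskChart.pushFactor
  constructor
  · intro h
    have : x ^ (m + 1) = 0 := by rw [← h]; ring
    exact pow_eq_zero_iff (Nat.succ_ne_zero m) |>.1 this
  · rintro rfl; simp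

lemma Flow.flow_lift {x : c.surf} (hx : c.map x ∈ D) :
    F.R (F.lift m x) ‖C.κ (c.map x)‖ = x := by
  rw [F.lift_of_mem m hx, F.comp _ _ _ (F.lift_mem_domain m hx) (C.norm_κ_mem hx)
    fun h => (pushFactor_mul_eq_zero m).1 h]
  exact F.self x hx

lemma Flow.lift_injective : Function.Injective (F.lift m) := by
  intro x x' h
  have h1 : c.map x = c.map x' := C.push_injective (m := m) DiskChart.one_mem_Icc (by
    rw [← F.map_lift m, ← F.map_lift m, h])
  by_cases hx : c.map x ∈ D
  · rw [← F.flow_lift m hx, h, h1, F.flow_lift m (h1 ▸ hx)]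
  · rwa [F.lift_of_notMem m hx, F.lift_of_notMem m (h1 ▸ hx)] at h

lemma Flow.lift_surjective : Function.Surjective (F.lift m) := by
  intro x
  by_cases hx : c.map x ∈ D
  · obtain ⟨t, ht, h⟩ : ∃ t ∈ Icc (0 : ℝ) 1, t ^ (m + 1) = ‖C.κ (c.map x)‖ := by
      have := intermediate_value_Icc (zero_le_one (α := ℝ)) (continuous_pow (m + 1)).continuousOn
      simp only [zero_pow (Nat.succ_ne_zero m), one_pow] at this
      exact this (C.norm_κ_mem hx)
    have ht0 : t = 0 ↔ C.κ (c.map x) = 0 := by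
      rw [← norm_eq_zero (a := C.κ (c.map x)), ← h, pow_eq_zero_iff (Nat.succ_ne_zero m)]
    have hdom : (x, t) ∈ c.flowDomain C := by
      refine ⟨hx, ht, fun hw => ht0.2 ?_⟩
      dsimp only at hw
      rw [hw, C.κ_center]
    have h1 : C.κ (c.map (F.R x t)) = t * dir (C.κ (c.map x)) := by
      rw [F.map _ _ hdom, C.κΦ _ (norm_real_mul_dir_le _ ht)]
    have h2 : c.map (F.R x t) ∈ D := by
      rw [F.map _ _ hdom]
      exact C.mapsΦ _ (norm_real_mul_dir_le _ ht)
    have h3 : ‖C.κ (c.map (F.R x t))‖ = t := by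
      rw [h1]
      by_cases h0 : C.κ (c.map x) = 0
      · rw [ht0.2 h0]; simp
      · exact norm_real_mul_dir h0 ht.1
    refine ⟨F.R x t, ?_⟩
    have h4 : DiskChart.pushFactor m 1 t * t = ‖C.κ (c.map x)‖ := by
      rw [← h]; unfold DiskChart.pushFactor; ring
    rw [F.lift_of_mem m h2, h3, h4, F.comp _ _ _ hdom (C.norm_κ_mem hx) fun h5 => by
      rw [norm_eq_zero]; exact ht0.1 h5]
    exact F.self x hx
  · exact ⟨x, F.lift_of_notMem m hx⟩

end Lift

/-! ### Perturbations composed with a push are perturbations of the same covering. -/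

section Collapse

variable {c₀ c₁ : Covering} {D : Sphere2 → Set Sphere2} {w : Sphere2} {C : DiskChart (D w) w}
  {m : ℕ}

lemma push_mem_iff_of_mem (hD : c₀.IsDiskFamily D) (hw : w ∈ c₀.critValues) {w' : Sphere2}
    (hw' : w' ∈ c₀.critValues) {y : Sphere2} : C.push m 1 y ∈ D w' ↔ y ∈ D w' := by
  by_cases h : w' = w
  · subst h; exact C.push_mem_iff DiskChart.one_mem_Icc
  · by_cases hy : y ∈ D w
    · refine iff_of_false (fun h1 => h ?_) fun h1 => h (hD.eq_of_mem hw' hw h1 hy)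
      exact hD.eq_of_mem hw' hw h1 ((C.push_mem_iff DiskChart.one_mem_Icc).2 hy)
    · rw [C.push_of_notMem m 1 hy]

lemma lift_mem_nbhd_iff (hD : c₀.IsDiskFamily D) (hw : w ∈ c₀.critValues) (F : c₀.Flow C)
    {v : c₀.surf} (hv : v ∈ c₀.critPoints) {x : c₀.surf} :
    F.lift m x ∈ c₀.nbhd D v ↔ x ∈ c₀.nbhd D v := by
  have hcv : c₀.map v ∈ c₀.critValues := ⟨v, hv, rfl⟩
  by_cases hx : c₀.map x ∈ D w
  · by_cases hvw : c₀.map v = w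
    · rw [F.mem_nbhd_iff hvw, F.mem_nbhd_iff hvw, F.lift_of_mem m hx,
        F.zero_zero (F.lift_mem_domain m hx)]
      exact and_congr_left fun _ => iff_of_true (F.map_mem (F.lift_mem_domain m hx)) hx
    · refine iff_of_false (fun h => hvw ?_) fun h => hvw ?_
      · have h1 := nbhd_subset v h
        rw [mem_preimage, F.map_lift, push_mem_iff_of_mem hD hw hcv] at h1
        exact hD.eq_of_mem hcv hw h1 hx
      · exact hD.eq_of_mem hcv hw (nbhd_subset v h) hx
  · rw [F.lift_of_notMem m hx]

/-- A collapse to a covering can be composed with a push. -/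
lemma Collapse.pushed {π : C(c₁.surf, c₀.surf)} (h : Collapse c₀ c₁ D π)
    (hD : c₀.IsDiskFamily D) (hw : w ∈ c₀.critValues) (C : DiskChart (D w) w) (m : ℕ) :
    ∃ π', Collapse c₀ (c₁.pushed C m) D π' := by
  obtain ⟨F⟩ := hD.exists_flow hw C
  -- Pushing the values of `c₁` is matched by lifting the push to the surface of `c₀`. The lift
  -- preserves the neighbourhoods U_v and fixes the critical points.
  let π' : C(c₁.surf, c₀.surf) := ⟨fun y => F.lift m (π y), (F.continuous_lift m).comp π.continuous⟩
  have hfix : ∀ v ∈ c₀.critPoints, F.lift m v = v := by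
    intro v hv
    by_cases hvw : c₀.map v ∈ D w
    · have h1 : c₀.map v = w :=
        hD.eq_of_mem ⟨v, hv, rfl⟩ hw (hD.mem_self ⟨v, hv, rfl⟩) hvw
      rw [F.lift_of_mem m hvw, h1, C.κ_center, norm_zero, mul_zero, F.zero_of_map_eq h1]
    · exact F.lift_of_notMem m hvw
  have hcrit : ∀ x, F.lift m x ∈ c₀.critPoints ↔ x ∈ c₀.critPoints := by
    intro x
    constructor
    · intro hx
      have := F.lift_injective m (hfix _ hx)
      rwa [this] at hx
    · intro hx
      rwa [hfix x hx]
  have hnb : ∀ v ∈ c₀.critPoints, π' ⁻¹' c₀.nbhd D v = π ⁻¹' c₀.nbhd D v := by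
    intro v hv
    ext y
    exact lift_mem_nbhd_iff hD hw F hv
  have hint : ∀ v ∈ c₀.critPoints, ∀ x,
      F.lift m x ∈ interior (c₀.nbhd D v) ↔ x ∈ interior (c₀.nbhd D v) := by
    intro v hv x
    rw [hD.mem_interior hv, hD.mem_interior hv, lift_mem_nbhd_iff hD hw F hv, F.map_lift]
    refine and_congr_right fun _ => ?_
    have h1 : C.pushHomeo m ⁻¹' D (c₀.map v) = D (c₀.map v) := by
      ext y
      exact push_mem_iff_of_mem hD hw ⟨v, hv, rfl⟩
    have h2 := (C.pushHomeo m).preimage_interior (D (c₀.map v))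
    rw [h1] at h2
    rw [← C.pushHomeo_apply, ← mem_preimage, h2]
  have hnbi : ∀ v ∈ c₀.critPoints,
      π' ⁻¹' interior (c₀.nbhd D v) = π ⁻¹' interior (c₀.nbhd D v) := by
    intro v hv
    ext y
    exact hint v hv _
  have hout : ∀ y, (∀ v ∈ c₀.critPoints, π' y ∉ interior (c₀.nbhd D v)) →
      ∀ v ∈ c₀.critPoints, π y ∉ interior (c₀.nbhd D v) :=
    fun y hy v hv => fun h => hy v hv ((hint v hv _).2 h)
  -- The lift may move points outside the interiors, but the genera there are all zero.
  have hgen : ∀ x, (∀ v ∈ c₀.critPoints, x ∉ interior (c₀.nbhd D v)) → c₀.surf.genus x = 0 :=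
    fun x hx => LocalCollapse.genus_eq_zero fun h => hx x h (hD.self_mem_interior h)
  refine ⟨π', ⟨fun x hx => ?_, fun x y hxy hx => ?_, fun x hx => ?_, fun y hy => ?_,
    fun y hy => ?_, fun v hv y hy => ?_, fun v hv => ?_, fun v hv => ?_, fun v hv => ?_,
    fun v hv => ?_, fun v hv => ?_, fun v hv => ?_⟩⟩
  · rw [critPoints_pushed] at hx
    exact (hcrit _).2 (h.crit x hx)
  · exact h.inj x y (F.lift_injective m hxy) fun h => hx ((hcrit _).2 h)
  · obtain ⟨x', rfl⟩ := F.lift_surjective m x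
    obtain ⟨y, rfl⟩ := h.surj x' fun h => hx ((hcrit _).2 h)
    exact ⟨y, rfl⟩
  · change c₀.map (F.lift m (π y)) = C.push m 1 (c₁.map y)
    rw [F.map_lift, h.map_eq y (hout y hy)]
  · have h1 := h.genus_eq y (hout y hy)
    rw [hgen _ (hout y hy)] at h1
    rw [hgen _ hy]
    exact h1
  · change C.push m 1 (c₁.map y) ∈ _
    rw [push_mem_iff_of_mem hD hw ⟨v, hv, rfl⟩]
    exact h.mapsTo v hv y ((hnb v hv).subset hy)
  · exact (hnb v hv).symm ▸ h.connected v hv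
  · exact (hnbi v hv).symm ▸ h.connected_interior v hv
  · have := h.betti_one v hv
    rw [← hnb v hv] at this
    exact this
  · have := h.betti_one_interior v hv
    rw [← hnb v hv, ← hnbi v hv] at this
    exact this
  · have := h.betti_two v hv
    rw [← hnb v hv] at this
    exact this
  · have := h.betti_two_interior v hv
    rw [← hnbi v hv] at this
    exact this

end Collapse

end Covering

end

noncomputable section

/-! ### Small disks -/

lemma exists_diskChart_subset {w : Sphere2} {O : Set Sphere2} (hO : IsOpen O) (hw : w ∈ O) :
    ∃ D ⊆ O, Nonempty (DiskChart D w) := by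
  obtain ⟨q, hq, -⟩ := exists_ne_sphereCoord w
  have h0 := affinePt_affineCoord hq.symm
  obtain ⟨ρ, hρ, hball⟩ : ∃ ρ > 0, Metric.closedBall (affineCoord q w) ρ ⊆ affinePt q ⁻¹' O := by
    refine Metric.nhds_basis_closedBall.mem_iff.1 ?_
    exact (hO.preimage (continuous_affinePt q)).mem_nhds (by rwa [mem_preimage, h0])
  have hρ' : (ρ : ℂ) ≠ 0 := Complex.ofReal_ne_zero.2 hρ.ne'
  refine ⟨affinePt q '' Metric.closedBall (affineCoord q w) ρ, image_subset_iff.2 hball, ⟨{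
    Φ := fun z => affinePt q (affineCoord q w + ρ * z)
    κ := fun y => (affineCoord q y - affineCoord q w) / ρ
    contΦ := ((continuous_affinePt q).comp (by fun_prop)).continuousOn
    contκ := ?_
    mapsΦ := fun z hz => ⟨_, ?_, rfl⟩
    mapsκ := ?_
    κΦ := fun z _ => ?_
    Φκ := ?_
    center := by rw [mul_zero, add_zero, h0] }⟩⟩
  · refine (((continuousOn_affineCoord q).mono ?_).sub continuousOn_const).div_const _
    rintro _ ⟨z, -, rfl⟩
    exact affinePt_ne q z
  · rw [mem_closedBall_iff_norm, add_sub_cancel_left, norm_mul, Complex.norm_real,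
      Real.norm_of_nonneg hρ.le]
    exact mul_le_of_le_one_right hρ.le hz
  · rintro _ ⟨z, hz, rfl⟩
    rw [mem_closedBall_iff_norm] at hz
    rw [affineCoord_affinePt, norm_div, Complex.norm_real, Real.norm_of_nonneg hρ.le]
    exact (div_le_one hρ).2 hz
  · rw [affineCoord_affinePt, add_sub_cancel_left, mul_div_cancel_left₀ _ hρ']
  · rintro _ ⟨z, hz, rfl⟩
    rw [affineCoord_affinePt, mul_div_cancel₀ _ hρ', add_sub_cancel]

/-! ### Disk families and the change of the perturbation domain. -/

namespace Covering

lemma exists_isDiskFamily (c : Covering) (O : Sphere2 → Set Sphere2)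
    (hO : ∀ w ∈ c.critValues, IsOpen (O w) ∧ w ∈ O w) :
    ∃ D, c.IsDiskFamily D ∧ ∀ w ∈ c.critValues, D w ⊆ O w := by
  obtain ⟨U, hU, hdisj⟩ := c.finite_critValues.t2_separation
  have h : ∀ w, ∃ D : Set Sphere2, w ∈ c.critValues → D ⊆ U w ∩ O w ∧ Nonempty (DiskChart D w) := by
    intro w
    by_cases hw : w ∈ c.critValues
    · obtain ⟨D, h1, h2⟩ := exists_diskChart_subset ((hU w).2.inter (hO w hw).1)
        ⟨(hU w).1, (hO w hw).2⟩
      exact ⟨D, fun _ => ⟨h1, h2⟩⟩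
    · exact ⟨∅, fun h => absurd h hw⟩
  choose D hD using h
  refine ⟨D, ⟨fun w hw => ?_, fun w hw w' hw' hne => ?_⟩, fun w hw => ?_⟩
  · obtain ⟨-, ⟨C⟩⟩ := hD w hw
    exact ⟨C.isClosedDisk, C.center_mem_interior⟩
  · exact (hdisj hw hw' hne).mono ((hD w hw).1.trans inter_subset_left)
      ((hD w' hw').1.trans inter_subset_left)
  · exact (hD w hw).1.trans inter_subset_right

lemma _root_.DiskChart.isPreconnected {D : Set Sphere2} {w : Sphere2} (C : DiskChart D w) :
    IsPreconnected D := by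
  have := (convex_closedBall (0 : ℂ) 1).isPreconnected.image C.Φ C.contΦ
  rwa [← C.eq_image] at this

/-- The disks of a family are determined by their union. -/
lemma IsDiskFamily.subset_of_iUnion_eq {c c' : Covering} {D D' : Sphere2 → Set Sphere2}
    (hD : c.IsDiskFamily D) (hD' : c'.IsDiskFamily D') (hcv : c'.critValues = c.critValues)
    (hU : (⋃ w ∈ c'.critValues, D' w) = ⋃ w ∈ c.critValues, D w) {w : Sphere2}
    (hw : w ∈ c'.critValues) : D' w ⊆ D w := by
  have hwc : w ∈ c.critValues := hcv ▸ hw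
  obtain ⟨C⟩ := hD'.exists_chart hw
  have hE : IsClosed (⋃ w' ∈ c.critValues \ {w}, D w') :=
    (c.finite_critValues.subset sdiff_subset).isClosed_biUnion fun w' hw' => hD.isClosed hw'.1
  -- The connected disk is covered by two disjoint closed sets and meets the first one in w.
  have hcov : D' w ⊆ D w ∪ ⋃ w' ∈ c.critValues \ {w}, D w' := by
    intro y hy
    have : y ∈ ⋃ w ∈ c.critValues, D w := hU ▸ mem_biUnion hw hy
    obtain ⟨w', hw', hy'⟩ := mem_iUnion₂.1 this
    by_cases h : w' = w
    · exact Or.inl (h ▸ hy')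
    · exact Or.inr (mem_biUnion (⟨hw', h⟩ : w' ∈ c.critValues \ {w}) hy')
  intro y hy
  by_contra hyD
  obtain ⟨z, -, hz, hz'⟩ := isPreconnected_closed_iff.1 C.isPreconnected _ _
    (hD.isClosed hwc) hE hcov ⟨w, C.center_mem, hD.mem_self hwc⟩
    ⟨y, hy, (hcov hy).resolve_left hyD⟩
  obtain ⟨w', hw', hz'⟩ := mem_iUnion₂.1 hz'
  exact hw'.2 (hD.eq_of_mem hw'.1 hwc hz' hz)

lemma IsDiskFamily.of_critValues_eq {c c' : Covering} {D : Sphere2 → Set Sphere2}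
    (hD : c.IsDiskFamily D) (h : c'.critValues = c.critValues) : c'.IsDiskFamily D := by
  unfold IsDiskFamily at *
  rwa [h]

variable {c₀ c₁ : Covering} {D : Sphere2 → Set Sphere2}

/-- The covering is an open map and sends the open preimage of the interior of U_v into the disk. -/
lemma Collapse.exists_mem_interior {π : C(c₁.surf, c₀.surf)} (h : Collapse c₀ c₁ D π)
    (hD : c₀.IsDiskFamily D) {y : Sphere2} (hy : y ∈ c₁.critValues) :
    ∃ w ∈ c₀.critValues, y ∈ interior (D w) := by
  obtain ⟨x, hx, rfl⟩ := hy
  have hv := h.crit x hx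
  refine ⟨c₀.map (π x), ⟨_, hv, rfl⟩, mem_interior_iff_mem_nhds.2 ?_⟩
  refine mem_of_superset (c₁.isOpenMap.image_mem_nhds
    ((isOpen_interior.preimage π.continuous).mem_nhds (hD.self_mem_interior hv))) ?_
  rintro _ ⟨y, hy, rfl⟩
  exact h.mapsTo _ hv y (interior_subset hy)

/-- A perturbation can be changed by pushes so that the critical values come close to the original
ones. -/
lemma Collapse.exists_small {P : Covering → Prop}
    (hP : ∀ c, P c → ∀ (D : Set Sphere2) (w : Sphere2) (C : DiskChart D w) m, P (c.pushed C m))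
    {π : C(c₁.surf, c₀.surf)} (h : Collapse c₀ c₁ D π) (hP₁ : P c₁) (hD : c₀.IsDiskFamily D)
    (C : ∀ w, w ∈ c₀.critValues → DiskChart (D w) w) {r : ℝ} (hr : 0 < r) :
    ∃ c₂ π₂, P c₂ ∧ Collapse c₀ c₂ D π₂ ∧
      ∀ w hw, ∀ y ∈ c₂.critValues, y ∈ D w → ‖(C w hw).κ y‖ < r := by
  -- The disks are treated one at a time; a push in one of them leaves the critical values in the
  -- others alone.
  have key : ∀ s : Set Sphere2, s.Finite → s ⊆ c₀.critValues → ∃ c₂ π₂, P c₂ ∧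
      Collapse c₀ c₂ D π₂ ∧ ∀ w hw, w ∈ s → ∀ y ∈ c₂.critValues, y ∈ D w →
        ‖(C w hw).κ y‖ < r := by
    intro s hs
    induction s, hs using Set.Finite.induction_on with
    | empty => exact fun _ => ⟨c₁, π, hP₁, h, fun w _ hw => absurd hw (notMem_empty w)⟩
    | @insert w s _ _ ih =>
      intro hsub
      obtain ⟨c₂, π₂, hP₂, h₂, hsm⟩ := ih fun w' hw' => hsub (mem_insert_of_mem w hw')
      have hw : w ∈ c₀.critValues := hsub (mem_insert w s)
      have hlt : ∀ y ∈ c₂.critValues ∩ D w, ‖(C w hw).κ y‖ < 1 := by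
        rintro y ⟨hy, hyD⟩
        obtain ⟨w', hw', hin⟩ := h₂.exists_mem_interior hD hy
        rw [hD.eq_of_mem hw' hw (interior_subset hin) hyD] at hin
        exact ((C w hw).mem_interior_iff hyD).1 hin
      -- The push raises radii to the power m + 1. The finitely many critical values in the disk
      -- have radius less than 1, so a large m suffices.
      have hev : ∀ᶠ m : ℕ in atTop, ∀ y ∈ c₂.critValues ∩ D w, ‖(C w hw).κ y‖ ^ (m + 1) < r := by
        refine (eventually_all_finite (c₂.finite_critValues.inter_of_left _)).2 fun y hy => ?_
        exact ((tendsto_pow_atTop_nhds_zero_of_lt_one (norm_nonneg _) (hlt y hy)).comp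
          (tendsto_add_atTop_nat 1)).eventually (gt_mem_nhds hr)
      obtain ⟨m, hm⟩ := hev.exists
      obtain ⟨π₃, h₃⟩ := h₂.pushed hD hw (C w hw) m
      refine ⟨_, π₃, hP c₂ hP₂ _ _ (C w hw) m, h₃, fun w' hw' hw's y hy hyD => ?_⟩
      rw [critValues_pushed] at hy
      obtain ⟨y, hy, rfl⟩ := hy
      rw [push_mem_iff_of_mem hD hw hw'] at hyD
      by_cases heq : w' = w
      · subst heq
        rw [(C w' hw').norm_κ_push DiskChart.one_mem_Icc hyD]
        have := hm y ⟨hy, hyD⟩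
        rw [pow_succ] at this
        simpa [DiskChart.pushFactor] using this
      · have hyw : y ∉ D w := fun h => heq (hD.eq_of_mem hw' hw hyD h)
        rw [(C w hw).push_of_notMem m 1 hyw]
        exact hsm w' hw' (hw's.resolve_left heq) y hy hyD
  obtain ⟨c₂, π₂, h1, h2, h3⟩ := key _ c₀.finite_critValues subset_rfl
  exact ⟨c₂, π₂, h1, h2, fun w hw => h3 w hw hw⟩

lemma Collapse.isPerturbation {π : C(c₁.surf, c₀.surf)} (h : Collapse c₀ c₁ D π)
    (hD : c₀.IsDiskFamily D) : IsPerturbation (⋃ w ∈ c₀.critValues, D w) c₀ c₁ :=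
  ⟨D, hD, rfl, _, h.isPerturbationAt hD⟩

/-- A covering that has a perturbation with some property invariant under pushes has one with an
arbitrarily given perturbation domain. -/
lemma exists_isPerturbation {P : Covering → Prop}
    (hP : ∀ c, P c → ∀ (D : Set Sphere2) (w : Sphere2) (C : DiskChart D w) m, P (c.pushed C m))
    {π : C(c₁.surf, c₀.surf)} (h : Collapse c₀ c₁ D π) (hP₁ : P c₁) (hD : c₀.IsDiskFamily D)
    {E : Sphere2 → Set Sphere2} (hE : c₀.IsDiskFamily E) :
    ∃ c₂, P c₂ ∧ IsPerturbation (⋃ w ∈ c₀.critValues, E w) c₀ c₂ := by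
  obtain ⟨C⟩ : Nonempty (∀ w, w ∈ c₀.critValues → DiskChart (D w) w) :=
    ⟨fun w hw => (hD.exists_chart hw).some⟩
  -- A radius for which the subdisks of the given domain lie inside the prescribed disks.
  obtain ⟨r, hr, hr1, hrE⟩ : ∃ r : ℝ, 0 < r ∧ r ≤ 1 ∧ ∀ w ∈ c₀.critValues, ∀ hw,
      (C w hw).Φ '' Metric.closedBall 0 r ⊆ interior (E w) := by
    have hev : ∀ w ∈ c₀.critValues, ∀ᶠ r : ℝ in 𝓝[>] 0, ∀ hw,
        (C w hw).Φ '' Metric.closedBall 0 r ⊆ interior (E w) := by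
      intro w hw
      have h1 : ContinuousAt (C w hw).Φ 0 :=
        (C w hw).contΦ.continuousAt (Metric.closedBall_mem_nhds 0 one_pos)
      have h2 : (C w hw).Φ ⁻¹' interior (E w) ∈ 𝓝 0 := by
        refine h1.preimage_mem_nhds (isOpen_interior.mem_nhds ?_)
        rw [(C w hw).center]
        exact (hE.1 w hw).2
      obtain ⟨ε, hε, hb⟩ := Metric.mem_nhds_iff.1 h2
      filter_upwards [mem_nhdsWithin_of_mem_nhds (gt_mem_nhds hε)] with r hr _
      exact image_subset_iff.2 ((Metric.closedBall_subset_ball hr).trans hb)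
    have h1 : ∀ᶠ r : ℝ in 𝓝[>] 0, r < 1 := mem_nhdsWithin_of_mem_nhds (gt_mem_nhds one_pos)
    obtain ⟨r, h1, h2, h3⟩ := (((eventually_all_finite c₀.finite_critValues).2 hev).and
      (h1.and self_mem_nhdsWithin)).exists
    exact ⟨r, h3, h2.le, h1⟩
  obtain ⟨c₂, π₂, hP₂, h₂, hsm⟩ := h.exists_small hP hP₁ hD C hr
  obtain ⟨j, T, hj⟩ := h₂.isPerturbationAt hD
  obtain ⟨g, T', G⟩ := hj.exists_gluing hD
  classical
  let D' : Sphere2 → Set Sphere2 := fun w =>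
    if hw : w ∈ c₀.critValues then (C w hw).Φ '' Metric.closedBall 0 r else ∅
  have hD' : ∀ w hw, D' w = (C w hw).Φ '' Metric.closedBall 0 r := fun w hw => dif_pos hw
  obtain ⟨π₃, h₃⟩ := G.exists_collapse hD hr hr1 hsm hD'
  -- The trivial perturbation in the prescribed disks, followed by the one in the tiny disks, is a
  -- perturbation with the prescribed domain.
  have h₄ := (Collapse.refl hE).trans h₃ hE (hD.sub hr hr1 hD') fun w hw =>
    ⟨w, hw, by rw [hD' w hw]; exact hrE w hw hw⟩
  exact ⟨c₂, hP₂, h₄.isPerturbation hE⟩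

end Covering

/-! ### The topology on the completion -/

section Completion

variable {S : ClosedSurface} {n : ℕ}

lemma exists_isPerturbation_self (c : Covering) (O : Sphere2 → Set Sphere2)
    (hO : ∀ w ∈ c.critValues, IsOpen (O w) ∧ w ∈ O w) :
    ∃ D, c.IsDiskFamily D ∧ (∀ w ∈ c.critValues, D w ⊆ O w) ∧
      Covering.IsPerturbation (⋃ w ∈ c.critValues, D w) c c := by
  obtain ⟨D, hD, h⟩ := c.exists_isDiskFamily O hO
  exact ⟨D, hD, h, (Covering.Collapse.refl hD).isPerturbation hD⟩

lemma coveringClasses_subset : coveringClasses S n ⊆ completedClasses S n := by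
  intro q hq
  obtain ⟨f, hf, hn, rfl⟩ := hq
  obtain ⟨D, -, -, h⟩ := exists_isPerturbation_self ⟨S, f, hf⟩ (fun _ => univ)
    fun _ _ => ⟨isOpen_univ, mem_univ _⟩
  exact ⟨_, _, _, rfl, ⟨f, hf, hn, rfl⟩, h⟩

/-- Near a perturbation, basic neighbourhoods of it are contained in the given one. -/
lemma exists_collapse_of_mem_basicNbhd {p : CoveringClass} {V : Set Sphere2}
    {q : completedClasses S n} (hq : q ∈ basicNbhd S n p V) {c : Covering} (hc : ⟦c⟧ = q.1) :
    ∃ (c₀ : Covering) (D : Sphere2 → Set Sphere2) (π : C(c.surf, c₀.surf)), ⟦c₀⟧ = p ∧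
      c₀.IsDiskFamily D ∧ V = (⋃ w ∈ c₀.critValues, D w) ∧ Covering.Collapse c₀ c D π := by
  obtain ⟨c₀, c₁, h0, h1, D, hD, hV, A, j, T, hP⟩ := hq
  obtain ⟨π, h⟩ := hP.exists_collapse hD
  obtain ⟨π', h'⟩ := h.congr_right (c₂ := c) (Quotient.exact (h1.trans hc.symm))
  exact ⟨c₀, D, π', h0, hD, hV, h'⟩

/-- Composition of perturbations. The given perturbation may start from an isomorphic covering and
another disk family with the same union, but the union determines the disks. -/
lemma basicNbhd_subset {c c₀ : Covering} {D E : Sphere2 → Set Sphere2} {π : C(c.surf, c₀.surf)}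
    (h : Covering.Collapse c₀ c D π) (hD : c₀.IsDiskFamily D) (hE : c.IsDiskFamily E)
    (hsub : ∀ w' ∈ c.critValues, ∃ w ∈ c₀.critValues, E w' ⊆ interior (D w)) :
    basicNbhd S n ⟦c⟧ (⋃ w ∈ c.critValues, E w) ⊆
      basicNbhd S n ⟦c₀⟧ (⋃ w ∈ c₀.critValues, D w) := by
  rintro q ⟨c', c'', h0, h1, E', hE', hV, A, j, T, hP⟩
  have hiso : Covering.Iso c c' := Quotient.exact h0.symm
  have hcv : c'.critValues = c.critValues := hiso.critValues_eq
  obtain ⟨π₁, h₁⟩ := h.congr_right hiso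
  obtain ⟨π₂, h₂⟩ := hP.exists_collapse hE'
  have h₃ := h₁.trans h₂ hD hE' fun w' hw' => by
    obtain ⟨w, hw, hs⟩ := hsub w' (hcv ▸ hw')
    exact ⟨w, hw, (hE.subset_of_iUnion_eq hE' hcv hV.symm hw').trans hs⟩
  exact ⟨c₀, c'', rfl, h1, h₃.isPerturbation hD⟩

/-- Each critical value of a representative of q is interior to a disk of either domain; disks
inside both interiors give a smaller basic set. -/
lemma exists_basicNbhd_subset {U₁ U₂ : Set (completedClasses S n)} (hU₁ : U₁ ∈ basicNbhds S n)
    (hU₂ : U₂ ∈ basicNbhds S n) {q : completedClasses S n} (h₁ : q ∈ U₁) (h₂ : q ∈ U₂) :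
    ∃ U ∈ basicNbhds S n, q ∈ U ∧ U ⊆ U₁ ∩ U₂ := by
  obtain ⟨p₁, V₁, -, -, rfl⟩ := hU₁
  obtain ⟨p₂, V₂, -, -, rfl⟩ := hU₂
  obtain ⟨c, hc⟩ := Quotient.exists_rep q.1
  obtain ⟨c₁, D₁, π₁, e₁, hD₁, rfl, k₁⟩ := exists_collapse_of_mem_basicNbhd h₁ hc
  obtain ⟨c₂, D₂, π₂, e₂, hD₂, rfl, k₂⟩ := exists_collapse_of_mem_basicNbhd h₂ hc
  have ho : ∀ w, ∃ O : Set Sphere2, w ∈ c.critValues → IsOpen O ∧ w ∈ O ∧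
      (∃ w₁ ∈ c₁.critValues, O ⊆ interior (D₁ w₁)) ∧
      ∃ w₂ ∈ c₂.critValues, O ⊆ interior (D₂ w₂) := by
    intro w
    by_cases hw : w ∈ c.critValues
    · obtain ⟨w₁, hw₁, m₁⟩ := k₁.exists_mem_interior hD₁ hw
      obtain ⟨w₂, hw₂, m₂⟩ := k₂.exists_mem_interior hD₂ hw
      exact ⟨interior (D₁ w₁) ∩ interior (D₂ w₂), fun _ => ⟨isOpen_interior.inter isOpen_interior,
        ⟨m₁, m₂⟩, ⟨w₁, hw₁, inter_subset_left⟩, w₂, hw₂, inter_subset_right⟩⟩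
    · exact ⟨∅, fun h => absurd h hw⟩
  choose O hO using ho
  obtain ⟨E, hE, hEO, hself⟩ := exists_isPerturbation_self c O fun w hw =>
    ⟨(hO w hw).1, (hO w hw).2.1⟩
  refine ⟨basicNbhd S n ⟦c⟧ (⋃ w ∈ c.critValues, E w), ⟨c, _, hc ▸ q.2, ⟨E, hE, rfl⟩, rfl⟩,
    ⟨c, c, rfl, hc, hself⟩, subset_inter ?_ ?_⟩
  · rw [← e₁]
    refine basicNbhd_subset k₁ hD₁ hE fun w hw => ?_
    obtain ⟨w₁, hw₁, hs⟩ := (hO w hw).2.2.1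
    exact ⟨w₁, hw₁, (hEO w hw).trans hs⟩
  · rw [← e₂]
    refine basicNbhd_subset k₂ hD₂ hE fun w hw => ?_
    obtain ⟨w₂, hw₂, hs⟩ := (hO w hw).2.2.2
    exact ⟨w₂, hw₂, (hEO w hw).trans hs⟩

lemma sUnion_basicNbhds : ⋃₀ basicNbhds S n = univ := by
  refine eq_univ_of_forall fun q => ?_
  obtain ⟨c, hc⟩ := Quotient.exists_rep q.1
  obtain ⟨D, hD, -, h⟩ := exists_isPerturbation_self c (fun _ => univ)
    fun _ _ => ⟨isOpen_univ, mem_univ _⟩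
  exact ⟨_, ⟨c, _, hc ▸ q.2, ⟨D, hD, rfl⟩, rfl⟩, c, c, rfl, hc, h⟩

/-- Every basic neighbourhood contains the class of a covering of the given type. -/
lemma exists_mem_basicNbhd {U : Set (completedClasses S n)} (hU : U ∈ basicNbhds S n) :
    ∃ q ∈ U, q.1 ∈ coveringClasses S n := by
  obtain ⟨c, V, ⟨c₀, c₁, V', h0, ⟨f, hf, hn, h1⟩, D', hD', -, A, j, T, hP⟩, ⟨D, hD, rfl⟩, rfl⟩ := hU
  have hcv : c₀.critValues = c.critValues := Covering.Iso.critValues_eq (Quotient.exact h0)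
  obtain ⟨π, h⟩ := hP.exists_collapse hD'
  obtain ⟨π', h'⟩ := h.congr_right (c₂ := ⟨S, f, hf⟩) (Quotient.exact h1)
  -- The property carried through the pushes is to be an n-sheeted covering by S itself; a push
  -- changes the map and not the surface.
  obtain ⟨c₂, ⟨f', hf', rfl, hn'⟩, h₂⟩ := Covering.exists_isPerturbation
    (P := fun c => ∃ f hf, c = ⟨S, f, hf⟩ ∧ c.IsSheeted n) (by
      rintro _ ⟨f, hf, rfl, hn⟩ D w C m
      exact ⟨_, _, rfl, Covering.IsSheeted.pushed _ C m hn⟩) h' ⟨f, hf, rfl, hn⟩ hD' (hD.of_critValues_eq hcv)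
  have hmem : (⟦⟨S, f', hf'⟩⟧ : CoveringClass) ∈ coveringClasses S n := ⟨f', hf', hn', rfl⟩
  rw [hcv] at h₂
  exact ⟨⟨_, coveringClasses_subset hmem⟩, ⟨c₀, _, h0.symm, rfl, h₂⟩, hmem⟩

end Completion

end

theorem proposition5 (S : ClosedSurface) (hS : S.Nonsingular) (n : ℕ) :
    coveringClasses S n ⊆ completedClasses S n ∧
    ∃ t : TopologicalSpace (completedClasses S n),
      @TopologicalSpace.IsTopologicalBasis _ t (basicNbhds S n) ∧
      @Dense _ t {q : completedClasses S n | q.1 ∈ coveringClasses S n} := by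
  let t := TopologicalSpace.generateFrom (basicNbhds S n)
  have hb : TopologicalSpace.IsTopologicalBasis (basicNbhds S n) :=
    ⟨fun _ h₁ _ h₂ _ hq => exists_basicNbhd_subset h₁ h₂ hq.1 hq.2, sUnion_basicNbhds, rfl⟩
  refine ⟨coveringClasses_subset, t, hb, hb.dense_iff.2 fun U hU _ => ?_⟩
  obtain ⟨q, hq, hqc⟩ := exists_mem_basicNbhd hU
  exact ⟨q, hq, hqc⟩
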